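/- Let $a\in\mathbb C\setminus\{0,-1\}$ and let $\mathfrak g=D(2,1;a)=\mathfrak g_{\bar 0}\oplus\mathfrak g_{\bar 1}$, where $\mathfrak g_{\bar 0}=\mathfrak{sl}_2\oplus\mathfrak{sl}_2\oplus\mathfrak{sl}_2$, $\mathfrak g_{\bar 1}=\mathbb C^2\boxtimes\mathbb C^2\boxtimes\mathbb C^2$, and $$[v_1\otimes v_2\otimes v_3,\,w_1\otimes w_2\otimes w_3]=\sum_{i=1}^3 s_i\Big(\prod_{j\ne i}\eta(v_j,w_j)\Big)\varphi_i(v_iw_i),\qquad (s_1,s_2,s_3)=(-1-a,1,a).$$ Here $\eta$ is the symplectic form on $\mathbb C^2$ with $\eta(x,y)=1$, and $\varphi_i:S^2\mathbb C^2\to\mathfrak{sl}_2$ (the $i$-th copy) sends $x^2\mapsto X_i$, $-2xy\mapsto H_i$, $-y^2\mapsto Y_i$. Let $\mathfrak h=\langle H_1,H_2,H_3\rangle$ with dual basis $\varepsilon_1,\varepsilon_2,\varepsilon_3$ of $\mathfrak h^*$, and $\langle\varepsilon_i,\varepsilon_j\rangle=s_i\delta_{ij}$. A simple root system is a basis $\Pi=\{\alpha_1,\alpha_2,\alpha_3\}$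 of $\mathfrak h^*$ consisting of roots such that every root is a nonnegative or a nonpositive integer combination of $\Pi$. A parabolic subalgebra is a proper subalgebra of $\mathfrak g$ that contains the Borel subalgebra $\mathfrak h\oplus\bigoplus_{\alpha>0}\mathfrak g_\alpha$ of some simple root system. For $\emptyset\ne\chi\subset\{1,2,3\}$ let $Z\in\mathfrak h$ be given by $\alpha_j(Z)=1$ for $j\in\chi$ and $\alpha_j(Z)=0$ for $j\notin\chi$; then $\mathfrak g_k=\bigoplus_{\alpha(Z)=k}\mathfrak g_\alpha$ (with $\mathfrak h\subset\mathfrak g_0$), $\mathfrak m=\mathfrak g_{<0}$ and $\mathfrak p_\chi=\mathfrak g_{\ge0}$. Consider the four simple root systems - I: $\varepsilon_1-\varepsilon_2-\varepsilon_3,\ 2\varepsilon_2,\ 2\varepsilon_3$; - II: $2\varepsilon_2,\ -\varepsilon_1-\varepsilon_2+\varepsilon_3,\ 2\varepsilon_1$; - III: $2\varepsilon_3,\ 2\varepsilon_1,\ -\varepsilon_1+\varepsilon_2-\varepsilon_3$; - IV: $-\varepsilon_1+\varepsilon_2+\varepsilon_3,\ \varepsilon_1+\varepsilon_2-\varepsilon_3,\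 \varepsilon_1-\varepsilon_2+\varepsilon_3$, and write $\mathfrak p^\Xi_\chi$ for the resulting 28 parabolic subalgebras. For $k\ge-1$, $\mathrm{pr}(\mathfrak g_{\le k})$ denotes the maximal graded Lie superalgebra that agrees with $\mathfrak g_{\le k}$ in degrees $\le k$ (including the brackets $[\mathfrak g_i,\mathfrak g_j]\subset\mathfrak g_{i+j}$ with $i,j,i+j\le k$) and is effective, that is, $[X,\mathfrak g_{-1}]\ne0$ for all $X\ne0$ of nonnegative degree; maximal means that every other such algebra embeds into it over $\mathfrak g_{\le k}$. Put $\mathrm{pr}(\mathfrak m)=\mathrm{pr}(\mathfrak g_{\le-1})$ and $\mathrm{pr}(\mathfrak m,\mathfrak g_0)=\mathrm{pr}(\mathfrak g_{\le0})$. **Theorem.** (a) Up to isomorphism and change of the parameter there are exactly 6 parabolic subalgebras, represented by $\mathfrak p_1^{\rm I},\mathfrak p_2^{\rm I},\mathfrak p_{12}^{\rm I},\mathfrak p_{23}^{\rm I},\mathfrak p_{123}^{\rm I},\mathfrak p_{123}^{\rm IV}$. That is, every parabolic subalgebra of $D(2,1;a)$ is mapped onto one of these six in $D(2,1;a')$ by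 an isomorphism $D(2,1;a)\cong D(2,1;a')$ for some $a'\in\{a,\ a^{-1},\ -1-a,\ -(1+a)^{-1},\ -a/(1+a),\ -(1+a)/a\}$; and parabolic subalgebras of different types among the six are not isomorphic as Lie superalgebras, for any two parameter values in $\mathbb C\setminus\{0,-1\}$. (b) I, II, III, IV are simple root systems and the 28 algebras $\mathfrak p^\Xi_\chi$ are parabolic. The odd reflection of I, II, III in its odd simple root $\alpha_j$ ($j=1,2,3$, respectively) is IV, with the same numbering, and if $j\notin\chi$ then the two gradings defined by $\chi$ coincide. Each of the 28 marked diagrams occurs in exactly one row of the table below, and an isomorphism $D(2,1;a)\cong D(2,1;a')$, with $a'$ as in (a), carries its grading to that of the first entry of the row. (c) The spaces $\mathfrak g_k$ form a grading of $\mathfrak g$ of depth $\nu$ (that is, $\mathfrak g_{-\nu}\neq0$ and $\mathfrak g_k=0$ for $|k|>\nu$). The depth, the superdimensions, the Lie superalgebra $\mathfrak g_0$ up to isomorphism, and the prolongations are as follows, where each prolongation stated to differ from $\mathfrak g$ is infinite-dimensional. | Parabolics | $\nu$ | $\dim\mathfrak g_0,\dots,\dim\mathfrak g_{-\nu}$ |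 $\mathfrak g_0$ | Prolongations | |---|---|---|---|---| | $\mathfrak p_1^{\rm I},\mathfrak p_2^{\rm II},\mathfrak p_3^{\rm III}$ | 2 | $(7\vert0,0\vert4,1\vert0)$ | $\mathfrak{co}(4)$ | $\mathrm{pr}(\mathfrak m,\mathfrak g_0)\ne\mathfrak g$, $\mathrm{pr}(\mathfrak g_{\le1})=\mathfrak g$ | | $\mathfrak p_2^{\rm I},\mathfrak p_3^{\rm I},\mathfrak p_1^{\rm II},\mathfrak p_3^{\rm II},\mathfrak p_1^{\rm III},\mathfrak p_2^{\rm III},\mathfrak p_1^{\rm IV},\mathfrak p_2^{\rm IV},\mathfrak p_3^{\rm IV}$ | 1 | $(5\vert4,2\vert2)$ | $\mathfrak{gl}(2\vert1)$ | $\mathrm{pr}(\mathfrak m)\ne\mathfrak g$, $\mathrm{pr}(\mathfrak m,\mathfrak g_0)=\mathfrak g$ | | $\mathfrak p_{12}^{\rm I},\mathfrak p_{13}^{\rm I},\mathfrak p_{12}^{\rm II},\mathfrak p_{23}^{\rm II},\mathfrak p_{13}^{\rm III},\mathfrak p_{23}^{\rm III}$ | 3 | $(5\vert0,1\vert2,0\vert2,1\vert0)$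 | $\mathfrak{gl}(2)\oplus\mathbb C$ | $\mathrm{pr}(\mathfrak m,\mathfrak g_0)\ne\mathfrak g$, $\mathrm{pr}(\mathfrak g_{\le1})=\mathfrak g$ | | $\mathfrak p_{23}^{\rm I},\mathfrak p_{13}^{\rm II},\mathfrak p_{12}^{\rm III},\mathfrak p_{12}^{\rm IV},\mathfrak p_{13}^{\rm IV},\mathfrak p_{23}^{\rm IV}$ | 2 | $(3\vert2,2\vert2,1\vert1)$ | $\mathfrak{gl}(1\vert1)\oplus\mathbb C$ | $\mathrm{pr}(\mathfrak m)\ne\mathfrak g$, $\mathrm{pr}(\mathfrak m,\mathfrak g_0)=\mathfrak g$ | | $\mathfrak p_{123}^{\rm I},\mathfrak p_{123}^{\rm II},\mathfrak p_{123}^{\rm III}$ | 4 | $(3\vert0,2\vert1,0\vert2,0\vert1,1\vert0)$ | $\mathbb C^{3\vert0}$ | $\mathrm{pr}(\mathfrak m,\mathfrak g_0)\ne\mathfrak g$, $\mathrm{pr}(\mathfrak g_{\le1})=\mathfrak g$ | | $\mathfrak p_{123}^{\rm IV}$ | 3 | $(3\vert0,0\vert3,3\vert0,0\vert1)$ | $\mathbb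 C^{3\vert0}$ | $\mathrm{pr}(\mathfrak m)=\mathfrak g$ | -/

import Mathlib

open scoped BigOperators

universe u v w

/-! ### Lie superalgebras over the complex numbers -/

/-- The Koszul sign `(-1)^{ij}`. -/
def koszulSign (i j : ZMod 2) : ℂ := if i = 1 ∧ j = 1 then -1 else 1

/-- A complex Lie superalgebra: a super vector space `L = L₀ ⊕ L₁` with an even bilinear bracket
that is super skew-symmetric and satisfies the super Jacobi identity. -/
class LieSuperalgebra (L : Type u) [AddCommGroup L] [Module ℂ L] where
  bracket : L →ₗ[ℂ] L →ₗ[ℂ] L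
  parity : ZMod 2 → Submodule ℂ L
  isCompl_parity : IsCompl (parity 0) (parity 1)
  bracket_mem : ∀ {i j : ZMod 2} {x y : L}, x ∈ parity i → y ∈ parity j →
    bracket x y ∈ parity (i + j)
  skew : ∀ {i j : ZMod 2} {x y : L}, x ∈ parity i → y ∈ parity j →
    bracket x y = -(koszulSign i j • bracket y x)
  jacobi : ∀ {i j : ZMod 2} {x y : L} (z : L), x ∈ parity i → y ∈ parity j →
    bracket x (bracket y z) = bracket (bracket x y) z + koszulSign i j • bracket y (bracket x z)

namespace LieSuperalgebra

section
variable {L : Type u} [AddCommGroup L] [Module ℂ L] [LieSuperalgebra L]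
variable {L' : Type v} [AddCommGroup L'] [Module ℂ L'] [LieSuperalgebra L']

/-- The subspace `p` is closed under the bracket. -/
def IsSubalgebra (p : Submodule ℂ L) : Prop :=
  ∀ x ∈ p, ∀ y ∈ p, bracket x y ∈ p

/-- The linear map `f` is a homomorphism of Lie superalgebras (even and bracket-preserving). -/
structure IsHom (f : L →ₗ[ℂ] L') : Prop where
  map_bracket : ∀ x y, f (bracket x y) = bracket (f x) (f y)
  map_parity : ∀ i, ∀ x ∈ parity (L := L) i, f x ∈ parity (L := L') i

/-- The subalgebras `p ⊆ L` and `q ⊆ L'` are isomorphic as Lie superalgebras: there is an even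
linear bijection `p → q` that preserves brackets. -/
def SubalgebraIso (p : Submodule ℂ L) (q : Submodule ℂ L') : Prop :=
  IsSubalgebra p ∧ IsSubalgebra q ∧ ∃ e : p ≃ₗ[ℂ] q,
    (∀ x y z : p, bracket (x : L) (y : L) = z → bracket (e x : L') (e y : L') = e z) ∧
    ∀ (i : ZMod 2) (x : p), (x : L) ∈ parity i → (e x : L') ∈ parity i

/-! ### Gradings and prolongations -/

/-- `G` is a `ℤ`-grading of the Lie superalgebra `L`. -/
structure IsGrading (G : ℤ → Submodule ℂ L) : Prop where
  isInternal : DirectSum.IsInternal G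
  homogeneous : ∀ k, G k = (G k ⊓ parity 0) ⊔ (G k ⊓ parity 1)
  bracket_mem : ∀ i j, ∀ x ∈ G i, ∀ y ∈ G j, bracket x y ∈ G (i + j)

/-- Effectivity: `[X, G₋₁] ≠ 0` for every nonzero `X` of nonnegative degree. -/
def IsEffective (G : ℤ → Submodule ℂ L) : Prop :=
  ∀ k, 0 ≤ k → ∀ x ∈ G k, (∀ y ∈ G (-1), bracket x y = 0) → x = 0

/-- The truncation `G_{≤ k} = ⨁_{i ≤ k} G i`. -/
def truncation (G : ℤ → Submodule ℂ L) (k : ℤ) : Submodule ℂ L :=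
  ⨆ i : ℤ, ⨆ _ : i ≤ k, G i

/-- `(L', G')` with the map `ι : G_{≤ k} → L'` is an effective graded Lie superalgebra that extends
the truncation `G_{≤ k}`: `ι` identifies `G i` with `G' i` for all `i ≤ k`, respecting the parity
and those brackets `[G i, G j] ⊆ G (i + j)` that are defined on the truncation, that is, with
`i`, `j` and `i + j` all at most `k`. -/
structure IsEffectiveExtension (G : ℤ → Submodule ℂ L) (k : ℤ) (G' : ℤ → Submodule ℂ L')
    (ι : truncation G k →ₗ[ℂ] L') : Prop where
  isGrading : IsGrading G'
  isEffective : IsEffective G'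
  injective : Function.Injective ι
  map_comp : ∀ i, i ≤ k → ((G i).comap (truncation G k).subtype).map ι = G' i
  map_parity : ∀ (i : ZMod 2) (x : truncation G k), (x : L) ∈ parity i → ι x ∈ parity i
  map_bracket : ∀ i j, i ≤ k → j ≤ k → i + j ≤ k → ∀ x y z : truncation G k,
    (x : L) ∈ G i → (y : L) ∈ G j → bracket (x : L) (y : L) = z → bracket (ι x) (ι y) = ι z

/-- `(L', G')` with the map `ι` is the maximal (Tanaka--Weisfeiler) prolongation of `G_{≤ k}`: it is
an effective extension of `G_{≤ k}`, and every effective extension of `G_{≤ k}` embeds into it by an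
injective graded homomorphism that is the identity on `G_{≤ k}`. The case `k = -1` is `pr(𝔪)`, the
case `k = 0` is `pr(𝔪, 𝔤₀)`. -/
def IsMaximalProlongation (G : ℤ → Submodule ℂ L) (k : ℤ) (G' : ℤ → Submodule ℂ L')
    (ι : truncation G k →ₗ[ℂ] L') : Prop :=
  IsEffectiveExtension G k G' ι ∧
  ∀ (Q : Type w) [AddCommGroup Q] [Module ℂ Q] [LieSuperalgebra Q] (GQ : ℤ → Submodule ℂ Q)
    (κ : truncation G k →ₗ[ℂ] Q), IsEffectiveExtension G k GQ κ →
    ∃ f : Q →ₗ[ℂ] L', IsHom f ∧ Function.Injective f ∧ (∀ i, (GQ i).map f ≤ G' i) ∧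
      ∀ x, f (κ x) = ι x

/-- `pr(G_{≤ k}) = L`, for a Lie superalgebra `L` with grading `G`. -/
def ProlongationIsSelf (G : ℤ → Submodule ℂ L) (k : ℤ) : Prop :=
  IsMaximalProlongation.{u, u, w} G k G (truncation G k).subtype

/-- `pr(G_{≤ k})` is infinite-dimensional (in particular, it exists). -/
def ProlongationIsInfinite (G : ℤ → Submodule ℂ L) (k : ℤ) : Prop :=
  ∃ (P : Type) (_ : AddCommGroup P) (_ : Module ℂ P) (_ : LieSuperalgebra P)
    (GP : ℤ → Submodule ℂ P) (ι : truncation G k →ₗ[ℂ] P),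
    IsMaximalProlongation.{u, 0, w} G k GP ι ∧ ¬ FiniteDimensional ℂ P

end

/-- Isomorphism of Lie superalgebras. -/
structure Iso (L : Type u) [AddCommGroup L] [Module ℂ L] [LieSuperalgebra L]
    (L' : Type v) [AddCommGroup L'] [Module ℂ L'] [LieSuperalgebra L'] where
  toLinearEquiv : L ≃ₗ[ℂ] L'
  isHom : IsHom toLinearEquiv.toLinearMap

/-! ### Standard examples: even abelian algebras, direct sums and `𝔤𝔩(m|n)` -/

/-- The even abelian Lie superalgebra `ℂ^{n|0}`. -/
def EvenAbelian (n : ℕ) : Type := Fin n → ℂ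

noncomputable instance (n : ℕ) : AddCommGroup (EvenAbelian n) :=
  inferInstanceAs (AddCommGroup (Fin n → ℂ))

noncomputable instance (n : ℕ) : Module ℂ (EvenAbelian n) :=
  inferInstanceAs (Module ℂ (Fin n → ℂ))

noncomputable instance (n : ℕ) : LieSuperalgebra (EvenAbelian n) where
  bracket := 0
  parity i := if i = 0 then ⊤ else ⊥
  isCompl_parity := by simpa using isCompl_top_bot
  bracket_mem _ _ := by simp
  skew _ _ := by simp
  jacobi _ _ _ := by simp

/-- The direct sum of two Lie superalgebras. -/
noncomputable instance (L : Type u) [AddCommGroup L] [Module ℂ L] [LieSuperalgebra L]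
    (L' : Type v) [AddCommGroup L'] [Module ℂ L'] [LieSuperalgebra L'] :
    LieSuperalgebra (L × L') where
  bracket := LinearMap.mk₂ ℂ (fun x y => (bracket x.1 y.1, bracket x.2 y.2))
    (by intros; ext <;> simp) (by intros; ext <;> simp)
    (by intros; ext <;> simp) (by intros; ext <;> simp)
  parity i := (parity i).prod (parity i)
  isCompl_parity := by
    have h1 := isCompl_parity (L := L)
    have h2 := isCompl_parity (L := L')
    constructor
    · rw [disjoint_iff, Submodule.prod_inf_prod, h1.inf_eq_bot, h2.inf_eq_bot, Submodule.prod_bot]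
    · rw [codisjoint_iff, Submodule.prod_sup_prod, h1.sup_eq_top, h2.sup_eq_top,
        Submodule.prod_top]
  bracket_mem hx hy := ⟨bracket_mem hx.1 hy.1, bracket_mem hx.2 hy.2⟩
  skew hx hy := Prod.ext (skew hx.1 hy.1) (skew hx.2 hy.2)
  jacobi z hx hy := Prod.ext (jacobi z.1 hx.1 hy.1) (jacobi z.2 hx.2 hy.2)

/-- The space of the general linear Lie superalgebra `𝔤𝔩(m|n)`. -/
def GeneralLinear (m n : ℕ) : Type := Matrix (Fin m ⊕ Fin n) (Fin m ⊕ Fin n) ℂ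

namespace GeneralLinear

noncomputable instance (m n : ℕ) : Ring (GeneralLinear m n) :=
  inferInstanceAs (Ring (Matrix (Fin m ⊕ Fin n) (Fin m ⊕ Fin n) ℂ))

noncomputable instance (m n : ℕ) : Algebra ℂ (GeneralLinear m n) :=
  inferInstanceAs (Algebra ℂ (Matrix (Fin m ⊕ Fin n) (Fin m ⊕ Fin n) ℂ))

/-- The diagonal-block part of a matrix. -/
def evenPart (m n : ℕ) : GeneralLinear m n →ₗ[ℂ] GeneralLinear m n where
  toFun X := Matrix.fromBlocks (Matrix.toBlocks₁₁ X) 0 0 (Matrix.toBlocks₂₂ X)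
  map_add' X Y := by
    apply Matrix.ext; rintro (i | i) (j | j) <;> first | rfl | exact (add_zero (0 : ℂ)).symm
  map_smul' c X := by
    apply Matrix.ext; rintro (i | i) (j | j) <;> first | rfl | exact (mul_zero c).symm

/-- The off-diagonal-block part of a matrix. -/
def oddPart (m n : ℕ) : GeneralLinear m n →ₗ[ℂ] GeneralLinear m n where
  toFun X := Matrix.fromBlocks 0 (Matrix.toBlocks₁₂ X) (Matrix.toBlocks₂₁ X) 0
  map_add' X Y := by
    apply Matrix.ext; rintro (i | i) (j | j) <;> first | rfl | exact (add_zero (0 : ℂ)).symm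
  map_smul' c X := by
    apply Matrix.ext; rintro (i | i) (j | j) <;> first | rfl | exact (mul_zero c).symm

theorem evenPart_add_oddPart {m n : ℕ} (X : GeneralLinear m n) :
    evenPart m n X + oddPart m n X = X := by
  apply Matrix.ext
  rintro (i | i) (j | j)
  · exact add_zero _
  · exact zero_add _
  · exact zero_add _
  · exact add_zero _

theorem evenPart_oddPart {m n : ℕ} (X : GeneralLinear m n) :
    evenPart m n (oddPart m n X) = 0 := by
  apply Matrix.ext
  rintro (i | i) (j | j) <;> rfl

theorem oddPart_evenPart {m n : ℕ} (X : GeneralLinear m n) :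
    oddPart m n (evenPart m n X) = 0 := by
  apply Matrix.ext
  rintro (i | i) (j | j) <;> rfl

theorem oddPart_mul {m n : ℕ} (X Y : GeneralLinear m n) :
    oddPart m n (X * Y) = evenPart m n X * oddPart m n Y + oddPart m n X * evenPart m n Y := by
  apply Matrix.ext
  have key : ∀ (A A' : Matrix (Fin m) (Fin m) ℂ) (B B' : Matrix (Fin m) (Fin n) ℂ)
      (C C' : Matrix (Fin n) (Fin m) ℂ) (D D' : Matrix (Fin n) (Fin n) ℂ),
      Matrix.fromBlocks 0 (A * B' + B * D') (C * A' + D * C') 0 =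
      Matrix.fromBlocks A 0 0 D * Matrix.fromBlocks 0 B' C' 0 +
      Matrix.fromBlocks 0 B C 0 * (Matrix.fromBlocks A' 0 0 D' :
        Matrix (Fin m ⊕ Fin n) (Fin m ⊕ Fin n) ℂ) := by
    intros
    simp [Matrix.fromBlocks_multiply, Matrix.fromBlocks_add, add_comm]
  have h := key (Matrix.toBlocks₁₁ X) (Matrix.toBlocks₁₁ Y) (Matrix.toBlocks₁₂ X)
    (Matrix.toBlocks₁₂ Y) (Matrix.toBlocks₂₁ X) (Matrix.toBlocks₂₁ Y) (Matrix.toBlocks₂₂ X)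
    (Matrix.toBlocks₂₂ Y)
  have h2 : oddPart m n (X * Y) = Matrix.fromBlocks 0
      (Matrix.toBlocks₁₁ X * Matrix.toBlocks₁₂ Y + Matrix.toBlocks₁₂ X * Matrix.toBlocks₂₂ Y)
      (Matrix.toBlocks₂₁ X * Matrix.toBlocks₁₁ Y + Matrix.toBlocks₂₂ X * Matrix.toBlocks₂₁ Y) 0 := by
    apply Matrix.ext
    rintro (i | i) (j | j)
    · rfl
    · exact Fintype.sum_sum_type (fun k => (X : Matrix _ _ ℂ) (Sum.inl i) k *
        (Y : Matrix _ _ ℂ) k (Sum.inr j))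
    · exact Fintype.sum_sum_type (fun k => (X : Matrix _ _ ℂ) (Sum.inr i) k *
        (Y : Matrix _ _ ℂ) k (Sum.inl j))
    · rfl
  intro i j
  rw [h2]
  exact congrFun (congrFun h i) j

theorem evenPart_mul {m n : ℕ} (X Y : GeneralLinear m n) :
    evenPart m n (X * Y) = evenPart m n X * evenPart m n Y + oddPart m n X * oddPart m n Y := by
  have h1 := evenPart_add_oddPart (X * Y)
  have h2 := oddPart_mul X Y
  have h3 : X * Y = (evenPart m n X + oddPart m n X) * (evenPart m n Y + oddPart m n Y) := by
    rw [evenPart_add_oddPart, evenPart_add_oddPart]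
  rw [h2] at h1
  have h4 : evenPart m n (X * Y) = X * Y -
      (evenPart m n X * oddPart m n Y + oddPart m n X * evenPart m n Y) := eq_sub_of_add_eq h1
  rw [h4, h3]
  noncomm_ring

/-- The parity decomposition of `𝔤𝔩(m|n)` into diagonal-block and off-diagonal-block matrices. -/
noncomputable def parityPart (m n : ℕ) (i : ZMod 2) : Submodule ℂ (GeneralLinear m n) :=
  if i = 0 then LinearMap.ker (oddPart m n) else LinearMap.ker (evenPart m n)

theorem mem_parity_zero {m n : ℕ} {X : GeneralLinear m n} :
    X ∈ parityPart m n 0 ↔ oddPart m n X = 0 := by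
  simp [parityPart]

theorem mem_parity_one {m n : ℕ} {X : GeneralLinear m n} :
    X ∈ parityPart m n 1 ↔ evenPart m n X = 0 := by
  simp [parityPart]

theorem evenPart_of_even {m n : ℕ} {X : GeneralLinear m n} (h : oddPart m n X = 0) :
    evenPart m n X = X := by
  have := evenPart_add_oddPart X
  rwa [h, add_zero] at this

theorem oddPart_of_odd {m n : ℕ} {X : GeneralLinear m n} (h : evenPart m n X = 0) :
    oddPart m n X = X := by
  have := evenPart_add_oddPart X
  rwa [h, zero_add] at this

/-- The supercommutator: `XY - YX` if `X` or `Y` is even, and `XY + YX` if both are odd. -/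
noncomputable def superCommutator (m n : ℕ) :
    GeneralLinear m n →ₗ[ℂ] GeneralLinear m n →ₗ[ℂ] GeneralLinear m n :=
  LinearMap.mk₂ ℂ (fun X Y => X * Y - Y * X + (2 : ℂ) • (oddPart m n Y * oddPart m n X))
    (by intros; simp only [map_add, mul_add, add_mul, smul_add]; abel)
    (by
      intros
      simp only [map_smul, smul_mul_assoc, mul_smul_comm, smul_add, smul_sub]
      rw [smul_comm])
    (by intros; simp only [map_add, mul_add, add_mul, smul_add]; abel)
    (by
      intros
      simp only [map_smul, smul_mul_assoc, mul_smul_comm, smul_add, smul_sub]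
      rw [smul_comm])

theorem superCommutator_apply {m n : ℕ} (X Y : GeneralLinear m n) :
    superCommutator m n X Y = X * Y - Y * X + (2 : ℂ) • (oddPart m n Y * oddPart m n X) := rfl

/-- `𝔤𝔩(m|n)` with the supercommutator. -/
noncomputable instance (m n : ℕ) : LieSuperalgebra (GeneralLinear m n) where
  bracket := superCommutator m n
  parity := parityPart m n
  isCompl_parity := by
    constructor
    · rw [Submodule.disjoint_def]
      intro X h0 h1
      rw [mem_parity_zero] at h0
      rw [mem_parity_one] at h1
      rw [← evenPart_of_even h0, h1]
    · rw [codisjoint_iff, eq_top_iff]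
      intro X _
      rw [← evenPart_add_oddPart X]
      exact Submodule.add_mem_sup (mem_parity_zero.2 (oddPart_evenPart X))
        (mem_parity_one.2 (evenPart_oddPart X))
  bracket_mem {i j X Y} hX hY := by
    have h01 : ∀ i : ZMod 2, i = 0 ∨ i = 1 := by decide
    have h11 : (1 : ZMod 2) + 1 = 0 := by decide
    rcases h01 i with rfl | rfl <;> rcases h01 j with rfl | rfl <;>
      simp only [add_zero, zero_add, h11, mem_parity_zero, mem_parity_one] at hX hY ⊢ <;>
      simp [superCommutator_apply, oddPart_mul, evenPart_mul, evenPart_oddPart, hX, hY]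
  skew {i j X Y} hX hY := by
    have h01 : ∀ i : ZMod 2, i = 0 ∨ i = 1 := by decide
    rcases h01 i with rfl | rfl <;> rcases h01 j with rfl | rfl <;>
      simp only [mem_parity_zero, mem_parity_one] at hX hY <;>
      simp [superCommutator_apply, koszulSign, hX, hY]
    rw [oddPart_of_odd hX, oddPart_of_odd hY, two_smul, two_smul]
    abel
  jacobi {i j X Y} Z hX hY := by
    have h01 : ∀ i : ZMod 2, i = 0 ∨ i = 1 := by decide
    obtain ⟨A, B, hA, hB, rfl⟩ : ∃ A B, oddPart m n A = 0 ∧ evenPart m n B = 0 ∧ Z = A + B :=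
      ⟨_, _, oddPart_evenPart Z, evenPart_oddPart Z, (evenPart_add_oddPart Z).symm⟩
    have eA := evenPart_of_even hA
    have oB := oddPart_of_odd hB
    rcases h01 i with rfl | rfl <;> rcases h01 j with rfl | rfl <;>
      simp only [mem_parity_zero, mem_parity_one] at hX hY <;>
      first
      | (have eX := evenPart_of_even hX
         have eY := evenPart_of_even hY
         simp [superCommutator_apply, koszulSign, oddPart_mul, hX, hY, hA, hB, eA, oB,
           eX, eY]
         noncomm_ring)
      | (have eX := evenPart_of_even hX
         have eY := oddPart_of_odd hY
         simp [superCommutator_apply, koszulSign, oddPart_mul, two_smul, hX, hY, hA, hB, eA, oB,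
           eX, eY]
         noncomm_ring)
      | (have eX := oddPart_of_odd hX
         have eY := evenPart_of_even hY
         simp [superCommutator_apply, koszulSign, oddPart_mul, two_smul, hX, hY, hA, hB, eA, oB,
           eX, eY]
         noncomm_ring)
      | (have eX := oddPart_of_odd hX
         have eY := oddPart_of_odd hY
         simp [superCommutator_apply, koszulSign, oddPart_mul, two_smul, hX, hY, hA, hB, eA, oB,
           eX, eY]
         noncomm_ring)

/-- The matrices `A` for which `A + Aᵀ` is a scalar matrix. -/
def conformalMatrices (ι : Type) [Fintype ι] [DecidableEq ι] : Submodule ℂ (Matrix ι ι ℂ) where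
  carrier := {A | ∃ c : ℂ, A + A.transpose = c • (1 : Matrix ι ι ℂ)}
  add_mem' := by
    rintro A B ⟨c, hc⟩ ⟨d, hd⟩
    refine ⟨c + d, ?_⟩
    rw [add_smul, ← hc, ← hd, Matrix.transpose_add]
    abel
  zero_mem' := ⟨0, by simp⟩
  smul_mem' := by
    rintro k A ⟨c, hc⟩
    refine ⟨k * c, ?_⟩
    rw [mul_smul, ← hc, smul_add, Matrix.transpose_smul]

/-- The conformal orthogonal Lie algebra `𝔠𝔬(n)`, as a subalgebra of `𝔤𝔩(n|0)`. -/
def conformalOrthogonal (n : ℕ) : Submodule ℂ (GeneralLinear n 0) :=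
  conformalMatrices (Fin n ⊕ Fin 0)

end GeneralLinear

end LieSuperalgebra

/-! ### The Lie superalgebra `D(2,1;a)` -/

namespace D21

open LieAlgebra.SpecialLinear

/-- The symplectic form on `ℂ²` with `η(x, y) = 1`, where `x = (1, 0)` and `y = (0, 1)`. -/
noncomputable def eta (v w : Fin 2 → ℂ) : ℂ := v 0 * w 1 - v 1 * w 0

/-- The standard basis `e 0 = x`, `e 1 = y` of `ℂ²`. -/
noncomputable def e (i : Fin 2) : Fin 2 → ℂ := Pi.single i 1

/-- The isomorphism `φ : S²ℂ² → 𝔰𝔩₂`, `x² ↦ X`, `-2xy ↦ H`, `-y² ↦ Y`; equivalently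
`φ(vw)u = (v η(w, u) + w η(v, u)) / 2`. -/
noncomputable def phi (v w : Fin 2 → ℂ) : sl (Fin 2) ℂ :=
  ⟨Matrix.of fun i j => (v i * eta w (e j) + w i * eta v (e j)) / 2, by
    change Matrix.trace (_ : Matrix (Fin 2) (Fin 2) ℂ) = 0
    rw [Matrix.trace_fin_two]
    simp [eta, e]
    ring⟩

/-- The basis element `X` of `𝔰𝔩₂`. -/
noncomputable def slX : sl (Fin 2) ℂ :=
  ⟨!![0, 1; 0, 0], by
    change Matrix.trace (_ : Matrix (Fin 2) (Fin 2) ℂ) = 0; simp [Matrix.trace_fin_two]⟩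

/-- The basis element `H` of `𝔰𝔩₂`. -/
noncomputable def slH : sl (Fin 2) ℂ :=
  ⟨!![1, 0; 0, -1], by
    change Matrix.trace (_ : Matrix (Fin 2) (Fin 2) ℂ) = 0; simp [Matrix.trace_fin_two]⟩

/-- The basis element `Y` of `𝔰𝔩₂`. -/
noncomputable def slY : sl (Fin 2) ℂ :=
  ⟨!![0, 0; 1, 0], by
    change Matrix.trace (_ : Matrix (Fin 2) (Fin 2) ℂ) = 0; simp [Matrix.trace_fin_two]⟩

theorem phi_x_x : phi (e 0) (e 0) = slX := by
  apply Subtype.ext; ext i j; fin_cases i <;> fin_cases j <;> simp [phi, slX, eta, e]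

theorem phi_x_y : (-2 : ℂ) • phi (e 0) (e 1) = slH := by
  apply Subtype.ext; ext i j; fin_cases i <;> fin_cases j <;> norm_num [phi, slH, eta, e]

theorem phi_y_y : -phi (e 1) (e 1) = slY := by
  apply Subtype.ext; ext i j; fin_cases i <;> fin_cases j <;> simp [phi, slY, eta, e]

/-- `ℂ² ⊠ ℂ² ⊠ ℂ²`: the value at `p` is the coefficient of `e (p 0) ⊗ e (p 1) ⊗ e (p 2)`. -/
abbrev Odd : Type := (Fin 3 → Fin 2) → ℂ

/-- `𝔰𝔩₂ ⊕ 𝔰𝔩₂ ⊕ 𝔰𝔩₂`. -/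
abbrev Even : Type := Fin 3 → sl (Fin 2) ℂ

/-- The action of `𝔰𝔩₂ ⊕ 𝔰𝔩₂ ⊕ 𝔰𝔩₂` on `ℂ² ⊠ ℂ² ⊠ ℂ²`, the `i`-th copy acting on the `i`-th
factor. -/
noncomputable def act : Even →ₗ[ℂ] Odd →ₗ[ℂ] Odd :=
  LinearMap.mk₂ ℂ
    (fun A u p => ∑ i : Fin 3, ∑ c : Fin 2, (A i).1 (p i) c * u (Function.update p i c))
    (by intros; ext; simp [add_mul, Finset.sum_add_distrib])
    (by intros; ext; simp [mul_assoc, Finset.mul_sum, mul_add])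
    (by intros; ext; simp [mul_add, Finset.sum_add_distrib])
    (by intros; ext; simp [mul_left_comm, Finset.mul_sum, mul_add])

/-- The bracket of two odd elements: bilinear, with `i`-th component on decomposable tensors
`[v₀ ⊗ v₁ ⊗ v₂, w₀ ⊗ w₁ ⊗ w₂]ᵢ = sᵢ (∏_{j ≠ i} η(vⱼ, wⱼ)) φ(vᵢ wᵢ)`. -/
noncomputable def oddBracket (s : Fin 3 → ℂ) : Odd →ₗ[ℂ] Odd →ₗ[ℂ] Even :=
  LinearMap.mk₂ ℂ
    (fun u v i => ∑ p : Fin 3 → Fin 2, ∑ q : Fin 3 → Fin 2,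
      (u p * v q * (s i * ∏ j ∈ Finset.univ.erase i, eta (e (p j)) (e (q j)))) •
        phi (e (p i)) (e (q i)))
    (by intros; ext1; simp only [Pi.add_apply, add_mul, add_smul, Finset.sum_add_distrib])
    (by
      intros; ext1
      simp only [Pi.smul_apply, smul_eq_mul, Finset.smul_sum, smul_smul, mul_assoc])
    (by intros; ext1; simp only [Pi.add_apply, mul_add, add_mul, add_smul, Finset.sum_add_distrib])
    (by
      intros; ext1
      simp only [Pi.smul_apply, smul_eq_mul, Finset.smul_sum, smul_smul, mul_assoc,
        mul_left_comm])

/-- The bracket of `Γ(s₀, s₁, s₂)` on `(𝔰𝔩₂)³ ⊕ ℂ² ⊠ ℂ² ⊠ ℂ²`. -/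
noncomputable def gammaBracket (s : Fin 3 → ℂ) : Even × Odd →ₗ[ℂ] Even × Odd →ₗ[ℂ] Even × Odd :=
  LinearMap.mk₂ ℂ
    (fun x y => ((fun i => ⁅x.1 i, y.1 i⁆) + oddBracket s x.2 y.2, act x.1 y.2 - act y.1 x.2))
    (by
      intros; refine Prod.ext (funext fun i => ?_) ?_
      · simp only [Prod.fst_add, Prod.snd_add, map_add, LinearMap.add_apply, Pi.add_apply, add_lie]
        abel
      · simp only [Prod.fst_add, Prod.snd_add, map_add, LinearMap.add_apply]
        abel)
    (by
      intros; refine Prod.ext (funext fun i => ?_) ?_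
      · simp only [Prod.smul_fst, Prod.smul_snd, map_smul, LinearMap.smul_apply, Pi.smul_apply,
          Pi.add_apply, smul_lie, smul_add]
      · simp only [Prod.smul_fst, Prod.smul_snd, map_smul, LinearMap.smul_apply, smul_sub])
    (by
      intros; refine Prod.ext (funext fun i => ?_) ?_
      · simp only [Prod.fst_add, Prod.snd_add, map_add, Pi.add_apply, lie_add]
        abel
      · simp only [Prod.fst_add, Prod.snd_add, map_add, LinearMap.add_apply]
        abel)
    (by
      intros; refine Prod.ext (funext fun i => ?_) ?_
      · simp only [Prod.smul_fst, Prod.smul_snd, map_smul, Pi.smul_apply,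
          Pi.add_apply, lie_smul, smul_add]
      · simp only [Prod.smul_fst, Prod.smul_snd, map_smul, LinearMap.smul_apply, smul_sub])

theorem gammaBracket_apply (s : Fin 3 → ℂ) (x y : Even × Odd) :
    gammaBracket s x y =
      ((fun i => ⁅x.1 i, y.1 i⁆) + oddBracket s x.2 y.2, act x.1 y.2 - act y.1 x.2) := rfl

theorem univ_eq : (Finset.univ : Finset (Fin 3 → Fin 2)) =
    {![0, 0, 0], ![0, 0, 1], ![0, 1, 0], ![0, 1, 1], ![1, 0, 0], ![1, 0, 1], ![1, 1, 0],
      ![1, 1, 1]} := by decide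

theorem sum_odd {M : Type} [AddCommMonoid M] (f : (Fin 3 → Fin 2) → M) :
    ∑ p, f p = f ![0, 0, 0] + (f ![0, 0, 1] + (f ![0, 1, 0] + (f ![0, 1, 1] + (f ![1, 0, 0] +
      (f ![1, 0, 1] + (f ![1, 1, 0] + f ![1, 1, 1])))))) := by
  rw [univ_eq, Finset.sum_insert (by decide), Finset.sum_insert (by decide),
    Finset.sum_insert (by decide), Finset.sum_insert (by decide), Finset.sum_insert (by decide),
    Finset.sum_insert (by decide), Finset.sum_insert (by decide), Finset.sum_singleton]

/-- Contraction of two odd elements in the factors other than the one with index `0`. -/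
def contr0 (u v : Odd) (x y : Fin 2) : ℂ :=
  u ![x, 0, 0] * v ![y, 1, 1]
    - u ![x, 0, 1] * v ![y, 1, 0] - u ![x, 1, 0] * v ![y, 0, 1] + u ![x, 1, 1] * v ![y, 0, 0]

/-- Contraction of two odd elements in the factors other than the one with index `1`. -/
def contr1 (u v : Odd) (x y : Fin 2) : ℂ :=
  u ![0, x, 0] * v ![1, y, 1]
    - u ![0, x, 1] * v ![1, y, 0] - u ![1, x, 0] * v ![0, y, 1] + u ![1, x, 1] * v ![0, y, 0]

/-- Contraction of two odd elements in the factors other than the one with index `2`. -/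
def contr2 (u v : Odd) (x y : Fin 2) : ℂ :=
  u ![0, 0, x] * v ![1, 1, y]
    - u ![0, 1, x] * v ![1, 0, y] - u ![1, 0, x] * v ![0, 1, y] + u ![1, 1, x] * v ![0, 0, y]

theorem eta_e : eta (e 0) (e 0) = 0 ∧ eta (e 0) (e 1) = 1 ∧ eta (e 1) (e 0) = -1 ∧
    eta (e 1) (e 1) = 0 := by
  simp [eta, e]

theorem phi_e (i j a b : Fin 2) : (phi (e i) (e j)).1 a b =
    (e i a * eta (e j) (e b) + e j a * eta (e i) (e b)) / 2 := rfl

theorem oddBracket_entries0 (s : Fin 3 → ℂ) (u v : Odd) :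
    (oddBracket s u v 0).1 0 0 = -(s 0 * (contr0 u v 0 1 + contr0 u v 1 0) / 2) ∧
    (oddBracket s u v 0).1 0 1 = s 0 * contr0 u v 0 0 ∧
    (oddBracket s u v 0).1 1 0 = -(s 0 * contr0 u v 1 1) ∧
    (oddBracket s u v 0).1 1 1 = s 0 * (contr0 u v 0 1 + contr0 u v 1 0) / 2 := by
  have h0 : (Finset.univ.erase 0 : Finset (Fin 3)) = {1, 2} := by decide
  simp only [oddBracket, LinearMap.mk₂_apply, sum_odd, h0]
  obtain ⟨h1, h2, h3, h4⟩ := eta_e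
  have hne : (1 : Fin 3) ≠ 2 := by decide
  simp only [Finset.prod_pair hne, Matrix.cons_val, h1, h2, h3, h4, mul_zero, zero_smul,
    zero_add, add_zero, mul_one, mul_neg, neg_neg]
  refine ⟨?_, ?_, ?_, ?_⟩ <;> simp [phi_e, eta_e, contr0] <;> simp [e] <;> ring

theorem oddBracket_entries1 (s : Fin 3 → ℂ) (u v : Odd) :
    (oddBracket s u v 1).1 0 0 = -(s 1 * (contr1 u v 0 1 + contr1 u v 1 0) / 2) ∧
    (oddBracket s u v 1).1 0 1 = s 1 * contr1 u v 0 0 ∧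
    (oddBracket s u v 1).1 1 0 = -(s 1 * contr1 u v 1 1) ∧
    (oddBracket s u v 1).1 1 1 = s 1 * (contr1 u v 0 1 + contr1 u v 1 0) / 2 := by
  have h0 : (Finset.univ.erase 1 : Finset (Fin 3)) = {0, 2} := by decide
  simp only [oddBracket, LinearMap.mk₂_apply, sum_odd, h0]
  obtain ⟨h1, h2, h3, h4⟩ := eta_e
  have hne : (0 : Fin 3) ≠ 2 := by decide
  simp only [Finset.prod_pair hne, Matrix.cons_val, h1, h2, h3, h4, mul_zero, zero_smul,
    zero_add, add_zero, mul_one, mul_neg, neg_neg]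
  refine ⟨?_, ?_, ?_, ?_⟩ <;> simp [phi_e, eta_e, contr1] <;> simp [e] <;> ring

theorem oddBracket_entries2 (s : Fin 3 → ℂ) (u v : Odd) :
    (oddBracket s u v 2).1 0 0 = -(s 2 * (contr2 u v 0 1 + contr2 u v 1 0) / 2) ∧
    (oddBracket s u v 2).1 0 1 = s 2 * contr2 u v 0 0 ∧
    (oddBracket s u v 2).1 1 0 = -(s 2 * contr2 u v 1 1) ∧
    (oddBracket s u v 2).1 1 1 = s 2 * (contr2 u v 0 1 + contr2 u v 1 0) / 2 := by
  have h0 : (Finset.univ.erase 2 : Finset (Fin 3)) = {0, 1} := by decide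
  simp only [oddBracket, LinearMap.mk₂_apply, sum_odd, h0]
  obtain ⟨h1, h2, h3, h4⟩ := eta_e
  have hne : (0 : Fin 3) ≠ 1 := by decide
  simp only [Finset.prod_pair hne, Matrix.cons_val, h1, h2, h3, h4, mul_zero, zero_smul,
    zero_add, add_zero, mul_one, mul_neg, neg_neg]
  refine ⟨?_, ?_, ?_, ?_⟩ <;> simp [phi_e, eta_e, contr2] <;> simp [e] <;> ring

theorem act_apply (A : Even) (u : Odd) (p : Fin 3 → Fin 2) :
    act A u p = ∑ i : Fin 3, ∑ c : Fin 2, (A i).1 (p i) c * u (Function.update p i c) := rfl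

theorem act_cons (A : Even) (u : Odd) (x y z : Fin 2) :
    act A u ![x, y, z] =
      (A 0).1 x 0 * u ![0, y, z] + (A 0).1 x 1 * u ![1, y, z] +
      ((A 1).1 y 0 * u ![x, 0, z] + (A 1).1 y 1 * u ![x, 1, z]) +
      ((A 2).1 z 0 * u ![x, y, 0] + (A 2).1 z 1 * u ![x, y, 1]) := by
  have h0 : ∀ c, Function.update ![x, y, z] 0 c = ![c, y, z] := by
    intro c; ext i; fin_cases i <;> rfl
  have h1 : ∀ c, Function.update ![x, y, z] 1 c = ![x, c, z] := by
    intro c; ext i; fin_cases i <;> rfl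
  have h2 : ∀ c, Function.update ![x, y, z] 2 c = ![x, y, c] := by
    intro c; ext i; fin_cases i <;> rfl
  simp [act_apply, Fin.sum_univ_three, h0, h1, h2]

theorem odd_ext {u v : Odd} (h : ∀ x y z, u ![x, y, z] = v ![x, y, z]) : u = v := by
  ext p
  have : p = ![p 0, p 1, p 2] := by ext i; fin_cases i <;> rfl
  rw [this]
  exact h _ _ _

theorem sl_entry (A : sl (Fin 2) ℂ) : A.1 1 1 = -A.1 0 0 := by
  have h : Matrix.trace A.1 = 0 := A.2
  rw [Matrix.trace_fin_two] at h
  linear_combination h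

theorem lie_entry (A B : sl (Fin 2) ℂ) (i j : Fin 2) :
    (⁅A, B⁆ : sl (Fin 2) ℂ).1 i j =
      A.1 i 0 * B.1 0 j + A.1 i 1 * B.1 1 j - (B.1 i 0 * A.1 0 j + B.1 i 1 * A.1 1 j) := by
  rw [sl_bracket, Matrix.sub_apply, Matrix.mul_apply, Matrix.mul_apply, Fin.sum_univ_two,
    Fin.sum_univ_two]

theorem coe_add_entry (A B : sl (Fin 2) ℂ) (i j : Fin 2) :
    (A + B).1 i j = A.1 i j + B.1 i j := rfl

theorem sl_ext {A B : sl (Fin 2) ℂ} (h00 : A.1 0 0 = B.1 0 0) (h01 : A.1 0 1 = B.1 0 1)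
    (h10 : A.1 1 0 = B.1 1 0) : A = B := by
  apply Subtype.ext
  ext i j
  fin_cases i <;> fin_cases j
  · exact h00
  · exact h01
  · exact h10
  · change A.1 1 1 = B.1 1 1
    rw [sl_entry, sl_entry, h00]

theorem oddBracket_symm (s : Fin 3 → ℂ) (u v : Odd) : oddBracket s u v = oddBracket s v u := by
  funext i
  obtain ⟨h1, h2, h3, -⟩ := oddBracket_entries0 s u v
  obtain ⟨h4, h5, h6, -⟩ := oddBracket_entries1 s u v
  obtain ⟨h7, h8, h9, -⟩ := oddBracket_entries2 s u v
  obtain ⟨k1, k2, k3, -⟩ := oddBracket_entries0 s v u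
  obtain ⟨k4, k5, k6, -⟩ := oddBracket_entries1 s v u
  obtain ⟨k7, k8, k9, -⟩ := oddBracket_entries2 s v u
  fin_cases i <;> apply sl_ext <;>
    simp only [Fin.zero_eta, Fin.mk_one, Fin.reduceFinMk, h1, h2, h3, h4, h5, h6, h7, h8, h9, k1,
      k2, k3, k4, k5, k6, k7, k8, k9, contr0, contr1, contr2] <;> ring

theorem act_lie (A B : Even) (u : Odd) :
    act (fun i => ⁅A i, B i⁆) u = act A (act B u) - act B (act A u) := by
  apply odd_ext
  intro x y z
  simp only [Pi.sub_apply, act_cons, lie_entry]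
  ring

theorem lie_oddBracket (s : Fin 3 → ℂ) (A : Even) (u v : Odd) (i : Fin 3) :
    ⁅A i, oddBracket s u v i⁆ = oddBracket s (act A u) v i + oddBracket s u (act A v) i := by
  have t0 := sl_entry (A 0)
  have t1 := sl_entry (A 1)
  have t2 := sl_entry (A 2)
  fin_cases i
  · obtain ⟨h1, h2, h3, h4⟩ := oddBracket_entries0 s u v
    obtain ⟨k1, k2, k3, -⟩ := oddBracket_entries0 s (act A u) v
    obtain ⟨l1, l2, l3, -⟩ := oddBracket_entries0 s u (act A v)
    apply sl_ext <;>
      simp only [Fin.zero_eta, lie_entry, coe_add_entry, h1, h2, h3, h4,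
        k1, k2, k3, l1, l2, l3, contr0, act_cons, t0, t1, t2] <;> ring
  · obtain ⟨h1, h2, h3, h4⟩ := oddBracket_entries1 s u v
    obtain ⟨k1, k2, k3, -⟩ := oddBracket_entries1 s (act A u) v
    obtain ⟨l1, l2, l3, -⟩ := oddBracket_entries1 s u (act A v)
    apply sl_ext <;>
      simp only [Fin.mk_one, lie_entry, coe_add_entry, h1, h2, h3, h4,
        k1, k2, k3, l1, l2, l3, contr1, act_cons, t0, t1, t2] <;> ring
  · obtain ⟨h1, h2, h3, h4⟩ := oddBracket_entries2 s u v
    obtain ⟨k1, k2, k3, -⟩ := oddBracket_entries2 s (act A u) v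
    obtain ⟨l1, l2, l3, -⟩ := oddBracket_entries2 s u (act A v)
    apply sl_ext <;>
      simp only [Fin.reduceFinMk, lie_entry, coe_add_entry, h1, h2, h3,
        h4, k1, k2, k3, l1, l2, l3, contr2, act_cons, t0, t1, t2] <;> ring

theorem act_oddBracket (s : Fin 3 → ℂ) (hs : s 0 + s 1 + s 2 = 0) (u v w : Odd) :
    act (oddBracket s u v) w + act (oddBracket s v w) u + act (oddBracket s w u) v = 0 := by
  have hs' : s 0 = -s 1 - s 2 := by linear_combination hs
  obtain ⟨a1, a2, a3, a4⟩ := oddBracket_entries0 s u v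
  obtain ⟨a5, a6, a7, a8⟩ := oddBracket_entries1 s u v
  obtain ⟨a9, a10, a11, a12⟩ := oddBracket_entries2 s u v
  obtain ⟨b1, b2, b3, b4⟩ := oddBracket_entries0 s v w
  obtain ⟨b5, b6, b7, b8⟩ := oddBracket_entries1 s v w
  obtain ⟨b9, b10, b11, b12⟩ := oddBracket_entries2 s v w
  obtain ⟨c1, c2, c3, c4⟩ := oddBracket_entries0 s w u
  obtain ⟨c5, c6, c7, c8⟩ := oddBracket_entries1 s w u
  obtain ⟨c9, c10, c11, c12⟩ := oddBracket_entries2 s w u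
  apply odd_ext
  intro x y z
  fin_cases x <;> fin_cases y <;> fin_cases z <;>
    simp only [Fin.zero_eta, Fin.mk_one, Pi.add_apply, Pi.zero_apply, act_cons, a1, a2, a3, a4, a5,
      a6, a7, a8, a9, a10, a11, a12, b1, b2, b3, b4, b5, b6, b7, b8, b9, b10, b11, b12, c1, c2, c3,
      c4, c5, c6, c7, c8, c9, c10, c11, c12, contr0, contr1, contr2, hs'] <;> ring

/-- The parity decomposition `Even ⊕ Odd`. -/
noncomputable def parityPart (i : ZMod 2) : Submodule ℂ (Even × Odd) :=
  if i = 0 then LinearMap.ker (LinearMap.snd ℂ Even Odd)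
  else LinearMap.ker (LinearMap.fst ℂ Even Odd)

theorem mem_parity_zero {x : Even × Odd} : x ∈ parityPart 0 ↔ ∃ A, x = (A, 0) := by
  obtain ⟨A, u⟩ := x
  simp [parityPart]

theorem mem_parity_one {x : Even × Odd} : x ∈ parityPart 1 ↔ ∃ u, x = (0, u) := by
  obtain ⟨A, u⟩ := x
  simp [parityPart]

theorem isCompl_parityPart : IsCompl (parityPart 0) (parityPart 1) := by
  constructor
  · rw [Submodule.disjoint_def]
    intro x h0 h1
    obtain ⟨A, rfl⟩ := mem_parity_zero.1 h0
    obtain ⟨u, hu⟩ := mem_parity_one.1 h1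
    rw [Prod.mk.injEq] at hu
    rw [hu.1, Prod.mk_zero_zero]
  · rw [codisjoint_iff, eq_top_iff]
    rintro ⟨A, u⟩ _
    have hx : ((A, u) : Even × Odd) = (A, 0) + (0, u) := by simp
    rw [hx]
    exact Submodule.add_mem_sup (mem_parity_zero.2 ⟨A, rfl⟩) (mem_parity_one.2 ⟨u, rfl⟩)

theorem bracket_even_even (s : Fin 3 → ℂ) (A B : Even) :
    gammaBracket s (A, 0) (B, 0) = (fun i => ⁅A i, B i⁆, 0) := by
  refine Prod.ext ?_ ?_ <;> simp [gammaBracket_apply]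

theorem bracket_even_odd (s : Fin 3 → ℂ) (A : Even) (u : Odd) :
    gammaBracket s (A, 0) (0, u) = (0, act A u) := by
  refine Prod.ext (funext fun i => ?_) ?_ <;> simp [gammaBracket_apply]

theorem bracket_odd_even (s : Fin 3 → ℂ) (A : Even) (u : Odd) :
    gammaBracket s (0, u) (A, 0) = (0, -act A u) := by
  refine Prod.ext (funext fun i => ?_) ?_ <;> simp [gammaBracket_apply]

theorem bracket_odd_odd (s : Fin 3 → ℂ) (u v : Odd) :
    gammaBracket s (0, u) (0, v) = (oddBracket s u v, 0) := by
  refine Prod.ext (funext fun i => ?_) ?_ <;> simp [gammaBracket_apply]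

theorem zmod_two_cases (i : ZMod 2) : i = 0 ∨ i = 1 := by
  revert i; decide

theorem gammaBracket_mem (s : Fin 3 → ℂ) {i j : ZMod 2} {x y : Even × Odd}
    (hx : x ∈ parityPart i) (hy : y ∈ parityPart j) :
    gammaBracket s x y ∈ parityPart (i + j) := by
  have h11 : (1 : ZMod 2) + 1 = 0 := by decide
  rcases zmod_two_cases i with rfl | rfl <;> rcases zmod_two_cases j with rfl | rfl <;>
    simp only [add_zero, zero_add, h11, mem_parity_zero, mem_parity_one] at hx hy ⊢ <;>
    obtain ⟨x, rfl⟩ := hx <;> obtain ⟨y, rfl⟩ := hy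
  · exact ⟨_, bracket_even_even s x y⟩
  · exact ⟨_, bracket_even_odd s x y⟩
  · exact ⟨_, bracket_odd_even s y x⟩
  · exact ⟨_, bracket_odd_odd s x y⟩

theorem gammaBracket_skew (s : Fin 3 → ℂ) {i j : ZMod 2} {x y : Even × Odd}
    (hx : x ∈ parityPart i) (hy : y ∈ parityPart j) :
    gammaBracket s x y = -(koszulSign i j • gammaBracket s y x) := by
  rcases zmod_two_cases i with rfl | rfl <;> rcases zmod_two_cases j with rfl | rfl <;>
    simp only [mem_parity_zero, mem_parity_one] at hx hy <;>
    obtain ⟨x, rfl⟩ := hx <;> obtain ⟨y, rfl⟩ := hy <;>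
    simp only [bracket_even_even, bracket_even_odd, bracket_odd_even, bracket_odd_odd, koszulSign]
  · refine Prod.ext (funext fun i => ?_) ?_
    · simp
    · simp
  · simp
  · simp
  · simp [oddBracket_symm s x y]

theorem gammaBracket_jacobi (s : Fin 3 → ℂ) (hs : s 0 + s 1 + s 2 = 0) {i j : ZMod 2}
    {x y : Even × Odd} (z : Even × Odd) (hx : x ∈ parityPart i) (hy : y ∈ parityPart j) :
    gammaBracket s x (gammaBracket s y z) =
      gammaBracket s (gammaBracket s x y) z +
        koszulSign i j • gammaBracket s y (gammaBracket s x z) := by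
  obtain ⟨C, w⟩ := z
  have hz : ((C, w) : Even × Odd) = (C, 0) + (0, w) := by simp
  rw [hz]
  simp only [map_add]
  have key : ∀ a b c a' b' c' : Even × Odd, a = b + koszulSign i j • c →
      a' = b' + koszulSign i j • c' → a + a' = b + b' + koszulSign i j • (c + c') := by
    rintro a b c a' b' c' rfl rfl
    rw [smul_add]; abel
  rcases zmod_two_cases i with rfl | rfl <;> rcases zmod_two_cases j with rfl | rfl <;>
    simp only [mem_parity_zero, mem_parity_one] at hx hy <;>
    obtain ⟨x, rfl⟩ := hx <;> obtain ⟨y, rfl⟩ := hy <;>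
    apply key <;>
    simp only [bracket_even_even, bracket_even_odd, bracket_odd_even, bracket_odd_odd, koszulSign,
      zero_ne_one, and_self, and_true, and_false, if_true, if_false, one_smul,
      neg_smul, Prod.mk_add_mk, Prod.neg_mk, add_zero, Prod.mk.injEq,
      true_and, neg_zero, map_neg]
  · funext i
    exact leibniz_lie _ _ _
  · rw [act_lie]; abel
  · rw [act_lie]; abel
  · funext i
    exact lie_oddBracket s x y w i
  · rw [act_lie]; abel
  · funext i
    have h := lie_oddBracket s y x w i
    simp only [Pi.add_apply, LinearMap.neg_apply, Pi.neg_apply]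
    rw [h]
    abel
  · funext i
    have h := lie_oddBracket s C x y i
    simp only [Pi.add_apply, Pi.neg_apply]
    rw [← lie_skew, h, oddBracket_symm s y]
    abel
  · have h := act_oddBracket s hs x y w
    rw [oddBracket_symm s w x] at h
    rw [neg_neg, neg_eq_iff_add_eq_zero, ← h]
    abel

end D21

/-- The structure constants `s₁ = -1-a`, `s₂ = 1`, `s₃ = a`. -/
def D21.s (a : ℂ) : Fin 3 → ℂ := ![-1 - a, 1, a]

theorem D21.s_sum (a : ℂ) : D21.s a 0 + D21.s a 1 + D21.s a 2 = 0 := by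
  simp [D21.s]; ring

/-- The space of the Lie superalgebra `D(2,1;a)`. -/
def D21 (_a : ℂ) : Type := D21.Even × D21.Odd

namespace D21

noncomputable instance (a : ℂ) : AddCommGroup (D21 a) := inferInstanceAs (AddCommGroup (Even × Odd))

noncomputable instance (a : ℂ) : Module ℂ (D21 a) := inferInstanceAs (Module ℂ (Even × Odd))

/-- The Lie superalgebra `D(2,1;a) = Γ(-1-a, 1, a)` (which is simple for `a ≠ 0, -1`). -/
noncomputable instance (a : ℂ) : LieSuperalgebra (D21 a) where
  bracket := gammaBracket (s a)
  parity := parityPart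
  isCompl_parity := isCompl_parityPart
  bracket_mem hx hy := gammaBracket_mem (s a) hx hy
  skew hx hy := gammaBracket_skew (s a) hx hy
  jacobi z hx hy := gammaBracket_jacobi (s a) (s_sum a) z hx hy

end D21

namespace D21

open LieSuperalgebra

/-! ### Roots, Borel and parabolic subalgebras

The Cartan subalgebra is `𝔥 = ⟨H₁, H₂, H₃⟩`. Elements `∑ hᵢ Hᵢ` of `𝔥` and functionals `∑ αᵢ εᵢ` on
it are given by their coordinates, where `εᵢ(∑ hⱼ Hⱼ) = hᵢ`. All indices run from `0` to `2` in place
of `1` to `3`. -/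

/-- The inclusion `h ↦ ∑ hᵢ Hᵢ` of the Cartan subalgebra. -/
noncomputable def cartan (a : ℂ) : (Fin 3 → ℂ) →ₗ[ℂ] D21 a where
  toFun h := ((fun i => h i • slH, 0) : Even × Odd)
  map_add' h h' := by
    refine Prod.ext (funext fun i => ?_) ?_
    · exact add_smul _ _ _
    · exact (add_zero (0 : Odd)).symm
  map_smul' c h := by
    refine Prod.ext (funext fun i => ?_) ?_
    · exact mul_smul _ _ _
    · exact (smul_zero (A := Odd) c).symm

/-- The space `𝔤_α = {x | [h, x] = α(h) x for all h ∈ 𝔥}`. -/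
def rootSpace (a : ℂ) (α : Fin 3 → ℂ) : Submodule ℂ (D21 a) where
  carrier := {x | ∀ h : Fin 3 → ℂ, bracket (cartan a h) x = (∑ i, α i * h i) • x}
  add_mem' hx hy h := by rw [map_add, hx h, hy h, smul_add]
  zero_mem' h := by rw [map_zero, smul_zero]
  smul_mem' c x hx h := by rw [map_smul, hx h, smul_comm]

/-- The roots are the nonzero `α` with `𝔤_α ≠ 0`. -/
def IsRoot (a : ℂ) (α : Fin 3 → ℂ) : Prop := α ≠ 0 ∧ rootSpace a α ≠ ⊥

/-- `α` is a combination of `S` with nonnegative integer coefficients. -/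
def IsNonnegCombination (S : Fin 3 → Fin 3 → ℂ) (α : Fin 3 → ℂ) : Prop :=
  ∃ n : Fin 3 → ℕ, α = ∑ j, (n j : ℂ) • S j

/-- `S` is a simple root system: a basis of `𝔥*` consisting of roots, such that every root is
a nonnegative or a nonpositive integer combination of `S`. -/
structure IsSimpleRootSystem (a : ℂ) (S : Fin 3 → Fin 3 → ℂ) : Prop where
  linearIndependent : LinearIndependent ℂ S
  isRoot : ∀ j, IsRoot a (S j)
  pos_or_neg : ∀ α, IsRoot a α → IsNonnegCombination S α ∨ IsNonnegCombination S (-α)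

/-- The Borel subalgebra `𝔥 ⊕ ⨁_{α > 0} 𝔤_α`. -/
noncomputable def borel (a : ℂ) (S : Fin 3 → Fin 3 → ℂ) : Submodule ℂ (D21 a) :=
  LinearMap.range (cartan a) ⊔
    ⨆ α : Fin 3 → ℂ, ⨆ _ : IsRoot a α ∧ IsNonnegCombination S α, rootSpace a α

/-- A (proper) parabolic subalgebra: a proper subalgebra that contains a Borel subalgebra. -/
def IsParabolic (a : ℂ) (p : Submodule ℂ (D21 a)) : Prop :=
  p ≠ ⊤ ∧ IsSubalgebra p ∧ ∃ S, IsSimpleRootSystem a S ∧ borel a S ≤ p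

/-- The degree `k` component of the grading defined by the simple root system `S` and the set `χ` of
crossed nodes: the sum of all `𝔤_α` with `α = ∑ nⱼ S j` and `Z(α) = ∑_{j ∈ χ} nⱼ = k`. -/
noncomputable def gradedPiece (a : ℂ) (S : Fin 3 → Fin 3 → ℂ) (χ : Finset (Fin 3)) (k : ℤ) :
    Submodule ℂ (D21 a) :=
  ⨆ n : Fin 3 → ℤ, ⨆ _ : ∑ j ∈ χ, n j = k, rootSpace a (∑ j, (n j : ℂ) • S j)

/-- The parabolic subalgebra `𝔭_χ = 𝔤_{≥ 0}`. -/
noncomputable def parabolic (a : ℂ) (S : Fin 3 → Fin 3 → ℂ) (χ : Finset (Fin 3)) :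
    Submodule ℂ (D21 a) :=
  ⨆ k : ℤ, ⨆ _ : 0 ≤ k, gradedPiece a S χ k

/-- The scalar product `⟨α, β⟩ = ∑ sᵢ αᵢ βᵢ` on `𝔥*`. -/
def scalarProduct (a : ℂ) (α β : Fin 3 → ℂ) : ℂ := ∑ i, s a i * α i * β i

open Classical in
/-- The odd reflection of `S` in the odd isotropic simple root `S j`. -/
noncomputable def oddReflection (a : ℂ) (S : Fin 3 → Fin 3 → ℂ) (j : Fin 3) :
    Fin 3 → Fin 3 → ℂ := fun i =>
  if i = j then -S j
  else if scalarProduct a (S j) (S i) ≠ 0 then S i + S j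
  else S i

/-! ### The four Dynkin diagrams and the classification table -/

/-- The four Dynkin diagrams. -/
inductive Diagram
  | I | II | III | IV

/-- The simple roots of the four Dynkin diagrams. -/
def simpleRoots : Diagram → Fin 3 → Fin 3 → ℂ
  | .I => ![![1, -1, -1], ![0, 2, 0], ![0, 0, 2]]
  | .II => ![![0, 2, 0], ![-1, -1, 1], ![2, 0, 0]]
  | .III => ![![0, 0, 2], ![2, 0, 0], ![-1, 1, -1]]
  | .IV => ![![-1, 1, 1], ![1, 1, -1], ![1, -1, 1]]

/-- The parameters obtained from `a` by permuting `s₁, s₂, s₃` and rescaling. -/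
def paramOrbit (a : ℂ) : Set ℂ :=
  {a, 1 / a, -1 - a, -1 / (1 + a), -a / (1 + a), -(1 + a) / a}

/-- The six types of parabolic subalgebras, named by a representative. -/
inductive ParabolicType
  | I1 | I2 | I12 | I23 | I123 | IV123

namespace ParabolicType

open Diagram

/-- The representative (diagram, crossed nodes) of each type. -/
def rep : ParabolicType → Diagram × Finset (Fin 3)
  | I1 => (I, {0})
  | I2 => (I, {1})
  | I12 => (I, {0, 1})
  | I23 => (I, {1, 2})
  | I123 => (I, {0, 1, 2})
  | IV123 => (IV, {0, 1, 2})

/-- The marked Dynkin diagrams of each type. -/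
def marked : ParabolicType → List (Diagram × Finset (Fin 3))
  | I1 => [(I, {0}), (II, {1}), (III, {2})]
  | I2 => [(I, {1}), (I, {2}), (II, {0}), (II, {2}), (III, {0}), (III, {1}),
      (IV, {0}), (IV, {1}), (IV, {2})]
  | I12 => [(I, {0, 1}), (I, {0, 2}), (II, {0, 1}), (II, {1, 2}), (III, {0, 2}), (III, {1, 2})]
  | I23 => [(I, {1, 2}), (II, {0, 2}), (III, {0, 1}), (IV, {0, 1}), (IV, {0, 2}), (IV, {1, 2})]
  | I123 => [(I, {0, 1, 2}), (II, {0, 1, 2}), (III, {0, 1, 2})]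
  | IV123 => [(IV, {0, 1, 2})]

/-- The depth `ν` of the grading. -/
def depth : ParabolicType → ℕ
  | I1 => 2
  | I2 => 1
  | I12 => 3
  | I23 => 2
  | I123 => 4
  | IV123 => 3

/-- The list of the superdimensions (even, odd) of `𝔤₀, 𝔤₋₁, …, 𝔤_{-ν}`. -/
def dims : ParabolicType → List (ℕ × ℕ)
  | I1 => [(7, 0), (0, 4), (1, 0)]
  | I2 => [(5, 4), (2, 2)]
  | I12 => [(5, 0), (1, 2), (0, 2), (1, 0)]
  | I23 => [(3, 2), (2, 2), (1, 1)]
  | I123 => [(3, 0), (2, 1), (0, 2), (0, 1), (1, 0)]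
  | IV123 => [(3, 0), (0, 3), (3, 0), (0, 1)]

/-- The degree zero component `g` of the grading is isomorphic to `𝔠𝔬(4)`, `𝔤𝔩(2|1)`, `𝔤𝔩(2) ⊕ ℂ`,
`𝔤𝔩(1|1) ⊕ ℂ`, `ℂ^{3|0}`, `ℂ^{3|0}`, respectively. -/
def DegreeZeroData {a : ℂ} (g : Submodule ℂ (D21 a)) : ParabolicType → Prop
  | I1 => SubalgebraIso g (GeneralLinear.conformalOrthogonal 4)
  | I2 => SubalgebraIso g (⊤ : Submodule ℂ (GeneralLinear 2 1))
  | I12 => SubalgebraIso g (⊤ : Submodule ℂ (GeneralLinear 2 0 × EvenAbelian 1))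
  | I23 => SubalgebraIso g (⊤ : Submodule ℂ (GeneralLinear 1 1 × EvenAbelian 1))
  | I123 | IV123 => SubalgebraIso g (⊤ : Submodule ℂ (EvenAbelian 3))

/-- The prolongation data of the grading `G`, in terms of `pr(𝔪)`, `pr(𝔪, 𝔤₀)` and `pr(𝔤_{≤ 1})`,
which are the prolongations of the truncations at `-1`, `0` and `1`. -/
def ProlongationData {a : ℂ} (G : ℤ → Submodule ℂ (D21 a)) : ParabolicType → Prop
  | I1 | I12 | I123 =>
    ¬ ProlongationIsSelf.{0, w} G 0 ∧ ProlongationIsInfinite.{0, w} G 0 ∧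
      ProlongationIsSelf.{0, w} G 1
  | I2 | I23 =>
    ¬ ProlongationIsSelf.{0, w} G (-1) ∧ ProlongationIsInfinite.{0, w} G (-1) ∧
      ProlongationIsSelf.{0, w} G 0
  | IV123 => ProlongationIsSelf.{0, w} G (-1)

end ParabolicType

end D21

namespace LieSuperalgebra

/-! ### Signs and the parity involution -/

/-! Write 𝔪 for the negative part of a grading, U(𝔪) for its enveloping algebra (`Env`), and L_y for
left multiplication by y.

Prolongations. An effective extension Q of G_{≤ k} acts on the module induced from the trivial
representation of Q_{≥ 0}. As a vector space this module is U(𝔪), the same for all Q. The operator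
T_x of x ∈ Q is determined by two rules: T_x 1 is the negative part of x, and [T_x, L_y] = T_{[x,y]}
for y ∈ 𝔪 (`coindRep`, `extRep`). An operator that kills 1 and supercommutes with G₋₁ is zero
(`eq_zero_of_commutes`), and with effectivity this makes the action faithful (`extRep_injective`).
Hence every extension embeds into End U(𝔪), and the maximal one can be described there: above degree
k, its pieces consist of the operators that kill 1 and whose commutators with 𝔪 lie in the pieces of
lower degree (`piece`). The Poincaré–Birkhoff–Witt theorem is not needed. It suffices that 𝔪 → U(𝔪)
is injective, which the faithful adjoint action of 𝔪 provides (`eq_zero_of_envι_eq_zero`). Two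
criteria follow. If every derivation 𝔪 → 𝔤 of degree above k agrees with an inner one on G₋₁, then
the prolongation is 𝔤 (`prolongationIsSelf_of_innerDerivations`). If infinitely many pieces are
nonzero, then the maximal prolongation exists and is infinite-dimensional
(`prolongationIsInfinite_of_ne_bot`).

Reduction to weights. D(2,1;a) has a basis of 17 weight vectors. Nonzero weights have multiplicity
one, and for a ≠ 0, -1 the bracket of two root vectors is nonzero whenever the sum of their weights
is a weight (`exists_coord_bracket_ne_zero`). So gradings, effectivity, generation and closure of
index sets become finite questions about weights in ℤ³ that do not involve a, and they are settled
by evaluation. Weyl reflections and permutations of the three factors are isomorphisms that permute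
the basis up to scalars; the permutations change the parameter within its orbit.

Classification. A parabolic subalgebra contains the Cartan subalgebra, so it is spanned by basis
vectors. Weyl reflections bring all Xᵢ into it, and the closed index sets that remain form six
classes under permutation of the factors (`exists_type_of_indicator`). Superdimensions separate the
six types except for two of dimension (6|4), which are told apart by their brackets of odd elements.

The table. The degree zero parts are given by explicit matrices. A derivation of 𝔪 splits into
weight components; after subtraction of an inner derivation, the Leibniz rule propagates zeros over
all of G₋₁, and a verified search checks this for each weight (`propagates_negCodes`,
`vanishes_of_propagate`). One degree lower, the polynomials in a variable u with values in a
(2|2)-dimensional abelian subalgebra form an infinite-dimensional graded 𝔪-module that maps into the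
prolongation, and the powers of u give infinitely many nonzero pieces (`isTruncatedModule_prolong`).
Both results are proved for one representative of each type and carried along isomorphisms to the
other marked diagrams. -/

theorem zmod_two_cases (i : ZMod 2) : i = 0 ∨ i = 1 := by
  revert i; decide

theorem zmod_two_one_add_one : (1 : ZMod 2) + 1 = 0 := by decide

@[simp] theorem koszulSign_zero_left (j : ZMod 2) : koszulSign 0 j = 1 := by simp [koszulSign]
@[simp] theorem koszulSign_zero_right (j : ZMod 2) : koszulSign j 0 = 1 := by simp [koszulSign]
@[simp] theorem koszulSign_one_one : koszulSign 1 1 = -1 := by simp [koszulSign]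

theorem koszulSign_comm (i j : ZMod 2) : koszulSign i j = koszulSign j i := by
  simp [koszulSign, and_comm]

theorem koszulSign_mul_self (i j : ZMod 2) : koszulSign i j * koszulSign i j = 1 := by
  rcases zmod_two_cases i with rfl | rfl <;> rcases zmod_two_cases j with rfl | rfl <;> simp

theorem koszulSign_add_left (i j l : ZMod 2) :
    koszulSign (i + j) l = koszulSign i l * koszulSign j l := by
  rcases zmod_two_cases i with rfl | rfl <;> rcases zmod_two_cases j with rfl | rfl <;>
    rcases zmod_two_cases l with rfl | rfl <;> simp [zmod_two_one_add_one]

theorem koszulSign_add_right (i j l : ZMod 2) :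
    koszulSign l (i + j) = koszulSign l i * koszulSign l j := by
  rw [koszulSign_comm, koszulSign_add_left, koszulSign_comm i, koszulSign_comm j]

section Involution

variable (L : Type u) [AddCommGroup L] [Module ℂ L] [LieSuperalgebra L]

/-- The parity involution: `1` on the even part and `-1` on the odd part. -/
noncomputable def sigma : L →ₗ[ℂ] L :=
  (2 : ℂ) • Submodule.projection (parity 0) (parity 1) isCompl_parity - LinearMap.id

variable {L}

theorem sigma_even {x : L} (hx : x ∈ parity (L := L) 0) : sigma L x = x := by
  have h : Submodule.projection (parity 0) (parity 1) (isCompl_parity (L := L)) x = x := by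
    simpa using hx
  simp only [sigma, LinearMap.sub_apply, LinearMap.smul_apply, h, LinearMap.id_apply]
  module

theorem sigma_odd {x : L} (hx : x ∈ parity (L := L) 1) : sigma L x = -x := by
  have h : Submodule.projection (parity 0) (parity 1) (isCompl_parity (L := L)) x = 0 := by
    simpa using hx
  simp only [sigma, LinearMap.sub_apply, LinearMap.smul_apply, h, LinearMap.id_apply]
  module

theorem sigma_of_mem {i : ZMod 2} {x : L} (hx : x ∈ parity (L := L) i) :
    sigma L x = koszulSign i 1 • x := by
  rcases zmod_two_cases i with rfl | rfl
  · simpa using sigma_even hx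
  · simpa using sigma_odd hx

theorem exists_even_add_odd (x : L) :
    ∃ y ∈ parity (L := L) 0, ∃ z ∈ parity (L := L) 1, x = y + z := by
  have h : x ∈ parity (L := L) 0 ⊔ parity (L := L) 1 := by
    rw [isCompl_parity.sup_eq_top]; trivial
  obtain ⟨y, hy, z, hz, rfl⟩ := Submodule.mem_sup.1 h
  exact ⟨y, hy, z, hz, rfl⟩

theorem sigma_sigma (x : L) : sigma L (sigma L x) = x := by
  obtain ⟨y, hy, z, hz, rfl⟩ := exists_even_add_odd x
  simp [sigma_even hy, sigma_odd hz]

/-- Parity as an eigenvalue equation can be tested after any injective linear map that intertwines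
the involutions. -/
theorem mem_parity_iff {i : ZMod 2} {x : L} :
    x ∈ parity (L := L) i ↔ sigma L x = koszulSign i 1 • x := by
  refine ⟨sigma_of_mem, fun h => ?_⟩
  obtain ⟨y, hy, z, hz, rfl⟩ := exists_even_add_odd x
  rw [map_add, sigma_even hy, sigma_odd hz] at h
  rcases zmod_two_cases i with rfl | rfl
  · have : z = 0 := by
      have h2 : (2 : ℂ) • z = 0 := by
        rw [koszulSign_zero_left, one_smul] at h
        rw [two_smul]; nth_rewrite 1 [← add_left_cancel h]; simp
      simpa using h2
    simpa [this] using hy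
  · have : y = 0 := by
      have h2 : (2 : ℂ) • y = 0 := by
        rw [koszulSign_one_one, neg_smul, one_smul] at h
        rw [neg_add] at h
        rw [two_smul]; nth_rewrite 1 [add_right_cancel h]; simp
      simpa using h2
    simpa [this] using hz

theorem sigma_bracket (x y : L) :
    sigma L (bracket x y) = bracket (sigma L x) (sigma L y) := by
  obtain ⟨x0, hx0, x1, hx1, rfl⟩ := exists_even_add_odd x
  obtain ⟨y0, hy0, y1, hy1, rfl⟩ := exists_even_add_odd y
  have key : ∀ {i j : ZMod 2} {x y : L}, x ∈ parity (L := L) i → y ∈ parity (L := L) j →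
      sigma L (bracket x y) = bracket (sigma L x) (sigma L y) := by
    intro i j x y hx hy
    rw [sigma_of_mem (bracket_mem hx hy), sigma_of_mem hx, sigma_of_mem hy, koszulSign_add_left]
    simp [smul_smul, mul_comm]
  simp only [map_add, LinearMap.add_apply, key hx0 hy0, key hx0 hy1, key hx1 hy0, key hx1 hy1]

/-- The even part (`i = 0`) and the odd part (`i = 1`) of an element. -/
noncomputable def parityComponent (i : ZMod 2) : L →ₗ[ℂ] L :=
  (2⁻¹ : ℂ) • (LinearMap.id + koszulSign i 1 • sigma L)

theorem parityComponent_apply (i : ZMod 2) (x : L) :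
    parityComponent i x = (2⁻¹ : ℂ) • (x + koszulSign i 1 • sigma L x) := rfl

theorem parityComponent_mem (i : ZMod 2) (x : L) : parityComponent i x ∈ parity (L := L) i := by
  rw [mem_parity_iff, parityComponent_apply]
  simp only [map_smul, map_add, sigma_sigma]
  rw [smul_comm, smul_add (koszulSign i 1), smul_smul (koszulSign i 1), koszulSign_mul_self,
    one_smul, add_comm]

theorem parityComponent_add (x : L) : parityComponent 0 x + parityComponent 1 x = x := by
  simp only [parityComponent_apply, koszulSign_zero_left, koszulSign_one_one]
  module

theorem parityComponent_self {i : ZMod 2} {x : L} (hx : x ∈ parity (L := L) i) :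
    parityComponent i x = x := by
  rw [parityComponent_apply, sigma_of_mem hx, smul_smul, koszulSign_mul_self]
  module

theorem parityComponent_zero_of_odd {x : L} (hx : x ∈ parity (L := L) 1) :
    parityComponent 0 x = 0 := by
  rw [parityComponent_apply, sigma_odd hx]; simp

theorem parityComponent_one_of_even {x : L} (hx : x ∈ parity (L := L) 0) :
    parityComponent 1 x = 0 := by
  rw [parityComponent_apply, sigma_even hx]; simp

/-- The sigma-twisted form of the Jacobi identity for right multiplications. -/
theorem bracket_bracket_right {i j : ZMod 2} (x : L) {y z : L} (hy : y ∈ parity (L := L) i)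
    (hz : z ∈ parity (L := L) j) :
    bracket x (bracket y z) =
      bracket (bracket x y) z - koszulSign i j • bracket (bracket x z) y := by
  have key : ∀ {p : ZMod 2} {x : L}, x ∈ parity (L := L) p → bracket x (bracket y z) =
      bracket (bracket x y) z - koszulSign i j • bracket (bracket x z) y := by
    intro p x hx
    rw [jacobi z hx hy, skew hy (bracket_mem hx hz), koszulSign_add_right, smul_neg, smul_smul,
      koszulSign_comm i p, ← mul_assoc, koszulSign_mul_self, one_mul, sub_eq_add_neg]
  obtain ⟨x0, hx0, x1, hx1, rfl⟩ := exists_even_add_odd x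
  simp only [map_add, LinearMap.add_apply, key hx0, key hx1, smul_add]
  abel

end Involution

/-! ### Linear maps out of a graded space -/

section Graded

variable {L : Type u} [AddCommGroup L] [Module ℂ L]
variable {N : Type v} [AddCommGroup N] [Module ℂ N]

/-- The linear map with given restrictions to the graded pieces. -/
noncomputable def gradedLift {G : ℤ → Submodule ℂ L} (hG : DirectSum.IsInternal G)
    (f : ∀ j, G j →ₗ[ℂ] N) : L →ₗ[ℂ] N :=
  (DirectSum.toModule ℂ ℤ N f).comp
    (LinearEquiv.ofBijective (DirectSum.coeLinearMap G) hG).symm.toLinearMap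

theorem gradedLift_apply {G : ℤ → Submodule ℂ L} (hG : DirectSum.IsInternal G)
    (f : ∀ j, G j →ₗ[ℂ] N) {j : ℤ} {x : L} (hx : x ∈ G j) :
    gradedLift hG f x = f j ⟨x, hx⟩ := by
  have : (LinearEquiv.ofBijective (DirectSum.coeLinearMap G) hG).symm x =
      DirectSum.lof ℂ ℤ (fun j => G j) j ⟨x, hx⟩ := by
    rw [LinearEquiv.symm_apply_eq]
    change x = DirectSum.coeLinearMap G _
    rw [DirectSum.coeLinearMap_lof]
  simp only [gradedLift, LinearMap.comp_apply, LinearEquiv.coe_coe, this, DirectSum.toModule_lof]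

theorem graded_induction {G : ℤ → Submodule ℂ L} (hG : DirectSum.IsInternal G)
    {p : Submodule ℂ L} (h : ∀ j, G j ≤ p) (x : L) : x ∈ p := by
  have : (⨆ j, G j) ≤ p := iSup_le h
  rw [hG.submodule_iSup_eq_top] at this
  exact this trivial

/-- The projection onto the part of negative degree. -/
noncomputable def negPart {G : ℤ → Submodule ℂ L} (hG : DirectSum.IsInternal G) : L →ₗ[ℂ] L :=
  gradedLift hG fun j => if j < 0 then (G j).subtype else 0

theorem negPart_of_neg {G : ℤ → Submodule ℂ L} (hG : DirectSum.IsInternal G) {j : ℤ} (hj : j < 0)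
    {x : L} (hx : x ∈ G j) : negPart hG x = x := by
  simp [negPart, gradedLift_apply hG _ hx, hj]

theorem negPart_of_nonneg {G : ℤ → Submodule ℂ L} (hG : DirectSum.IsInternal G) {j : ℤ}
    (hj : 0 ≤ j) {x : L} (hx : x ∈ G j) : negPart hG x = 0 := by
  simp [negPart, gradedLift_apply hG _ hx, not_lt.2 hj]

theorem mem_truncation {G : ℤ → Submodule ℂ L} {j k : ℤ} (hj : j ≤ k) {x : L} (hx : x ∈ G j) :
    x ∈ truncation G k :=
  Submodule.mem_iSup_of_mem j (Submodule.mem_iSup_of_mem hj hx)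

theorem truncation_induction {G : ℤ → Submodule ℂ L} {k : ℤ} {p : Submodule ℂ L}
    (h : ∀ j ≤ k, G j ≤ p) {x : L} (hx : x ∈ truncation G k) : x ∈ p := by
  have : truncation G k ≤ p := iSup_le fun j => iSup_le fun hj => h j hj
  exact this hx

/-- The projection onto the truncation. -/
noncomputable def truncationProj {G : ℤ → Submodule ℂ L} (hG : DirectSum.IsInternal G) (k : ℤ) :
    L →ₗ[ℂ] truncation G k :=
  gradedLift hG fun j => if hj : j ≤ k then
    Submodule.inclusion (fun _ hx => mem_truncation hj hx) else 0

theorem truncationProj_apply {G : ℤ → Submodule ℂ L} (hG : DirectSum.IsInternal G) {j k : ℤ}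
    (hj : j ≤ k) {x : L} (hx : x ∈ G j) :
    truncationProj hG k x = ⟨x, mem_truncation hj hx⟩ := by
  rw [truncationProj, gradedLift_apply hG _ hx, dif_pos hj]; rfl

end Graded

section Homogeneous

variable {L : Type u} [AddCommGroup L] [Module ℂ L] [LieSuperalgebra L]
variable {G : ℤ → Submodule ℂ L}

theorem IsGrading.sigma_mem (hG : IsGrading G) {j : ℤ} {x : L} (hx : x ∈ G j) : sigma L x ∈ G j := by
  rw [hG.homogeneous j] at hx
  obtain ⟨y, hy, z, hz, rfl⟩ := Submodule.mem_sup.1 hx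
  rw [map_add, sigma_even hy.2, sigma_odd hz.2]
  exact add_mem hy.1 (neg_mem hz.1)

theorem IsGrading.parityComponent_mem (hG : IsGrading G) (i : ZMod 2) {j : ℤ} {x : L} (hx : x ∈ G j) :
    parityComponent i x ∈ G j := by
  rw [parityComponent_apply]
  exact Submodule.smul_mem _ _ (add_mem hx (Submodule.smul_mem _ _ (hG.sigma_mem hx)))

end Homogeneous

end LieSuperalgebra

namespace LieSuperalgebra

/-! ### The supercommutator of an associative algebra with an involutive automorphism -/

section SuperBracket

variable {R : Type u} [Ring R] [Algebra ℂ R]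

/-- The supercommutator of an associative superalgebra, the parity being given by the involutive
automorphism `τ`. -/
noncomputable def superBracket (τ : R →ₐ[ℂ] R) : R →ₗ[ℂ] R →ₗ[ℂ] R :=
  LinearMap.mk₂ ℂ (fun r s => r * s - s * r + (2⁻¹ : ℂ) • ((s - τ s) * (r - τ r)))
    (by intros; simp only [map_add, mul_add, add_mul, mul_sub, sub_mul, smul_add, smul_sub]; abel)
    (by
      intros
      simp only [map_smul, smul_mul_assoc, mul_smul_comm, smul_add, smul_sub, mul_sub, sub_mul]
      module)
    (by intros; simp only [map_add, mul_add, add_mul, mul_sub, sub_mul, smul_add, smul_sub]; abel)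
    (by
      intros
      simp only [map_smul, smul_mul_assoc, mul_smul_comm, smul_add, smul_sub, mul_sub, sub_mul]
      module)

variable {τ : R →ₐ[ℂ] R}

theorem superBracket_apply (r s : R) :
    superBracket τ r s = r * s - s * r + (2⁻¹ : ℂ) • ((s - τ s) * (r - τ r)) := rfl

/-- Since `r - τ r` is twice the odd part of `r`, the correction term in `superBracket` is twice the
product of the odd parts. It turns `-sr` into `+sr` exactly when both factors are odd. -/
theorem superBracket_of_homogeneous {i j : ZMod 2} {r s : R} (hr : τ r = koszulSign i 1 • r)
    (hs : τ s = koszulSign j 1 • s) :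
    superBracket τ r s = r * s - koszulSign i j • (s * r) := by
  rw [superBracket_apply, hr, hs]
  rcases zmod_two_cases i with rfl | rfl <;> rcases zmod_two_cases j with rfl | rfl <;>
    simp only [koszulSign_zero_left, koszulSign_zero_right, koszulSign_one_one, one_smul, sub_self,
      zero_mul, mul_zero, smul_zero, add_zero, neg_smul, sub_neg_eq_add, ← two_smul ℂ r,
      ← two_smul ℂ s, smul_mul_assoc, mul_smul_comm]
  module

theorem map_superBracket (r s : R) :
    τ (superBracket τ r s) = superBracket τ (τ r) (τ s) := by
  simp only [superBracket_apply, map_add, map_sub, map_mul, map_smul]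

theorem superBracket_mem {i j : ZMod 2} {r s : R} (hr : τ r = koszulSign i 1 • r)
    (hs : τ s = koszulSign j 1 • s) :
    τ (superBracket τ r s) = koszulSign (i + j) 1 • superBracket τ r s := by
  rw [superBracket_of_homogeneous hr hs, koszulSign_add_left]
  simp only [map_sub, map_smul, map_mul, hr, hs, smul_mul_assoc, mul_smul_comm, smul_sub]
  module

theorem superBracket_skew {i j : ZMod 2} {r s : R} (hr : τ r = koszulSign i 1 • r)
    (hs : τ s = koszulSign j 1 • s) :
    superBracket τ r s = -(koszulSign i j • superBracket τ s r) := by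
  rw [superBracket_of_homogeneous hr hs, superBracket_of_homogeneous hs hr, smul_sub, smul_smul,
    koszulSign_comm j i, koszulSign_mul_self]
  module

theorem exists_homogeneous_add (hτ : ∀ r, τ (τ r) = r) (t : R) :
    ∃ t0 t1, τ t0 = koszulSign 0 1 • t0 ∧ τ t1 = koszulSign 1 1 • t1 ∧ t = t0 + t1 := by
  refine ⟨(2⁻¹ : ℂ) • (t + τ t), (2⁻¹ : ℂ) • (t - τ t), ?_, ?_, ?_⟩
  · simp only [map_smul, map_add, hτ, koszulSign_zero_left]; module
  · simp only [map_smul, map_sub, hτ, koszulSign_one_one]; module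
  · module

theorem superBracket_jacobi (hτ : ∀ r, τ (τ r) = r) {i j : ZMod 2} {r s : R} (t : R)
    (hr : τ r = koszulSign i 1 • r) (hs : τ s = koszulSign j 1 • s) :
    superBracket τ r (superBracket τ s t) = superBracket τ (superBracket τ r s) t +
      koszulSign i j • superBracket τ s (superBracket τ r t) := by
  have key : ∀ {l : ZMod 2} {t : R}, τ t = koszulSign l 1 • t →
      superBracket τ r (superBracket τ s t) = superBracket τ (superBracket τ r s) t +
      koszulSign i j • superBracket τ s (superBracket τ r t) := by
    intro l t ht
    rw [superBracket_of_homogeneous hr (superBracket_mem hs ht),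
      superBracket_of_homogeneous (superBracket_mem hr hs) ht,
      superBracket_of_homogeneous hs (superBracket_mem hr ht),
      superBracket_of_homogeneous hr hs, superBracket_of_homogeneous hr ht,
      superBracket_of_homogeneous hs ht, koszulSign_add_right, koszulSign_add_right,
      koszulSign_add_left, koszulSign_comm j i]
    simp only [mul_sub, sub_mul, smul_sub, mul_smul_comm, smul_mul_assoc, smul_smul, mul_assoc]
    rcases zmod_two_cases i with rfl | rfl <;> rcases zmod_two_cases j with rfl | rfl <;>
      simp only [koszulSign_zero_left, koszulSign_zero_right, koszulSign_one_one] <;> module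
  obtain ⟨t0, t1, h0, h1, rfl⟩ := exists_homogeneous_add hτ t
  simp only [map_add, key h0, key h1, smul_add]
  abel

/-- The Jacobi identity solved so that no parity of the leftmost entry appears; it therefore applies
to arbitrary operators in that slot. -/
theorem superBracket_bracket_right (hτ : ∀ r, τ (τ r) = r) {i j : ZMod 2} (r : R) {s t : R}
    (hs : τ s = koszulSign i 1 • s) (ht : τ t = koszulSign j 1 • t) :
    superBracket τ r (superBracket τ s t) = superBracket τ (superBracket τ r s) t -
      koszulSign i j • superBracket τ (superBracket τ r t) s := by
  have key : ∀ {l : ZMod 2} {r : R}, τ r = koszulSign l 1 • r →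
      superBracket τ r (superBracket τ s t) = superBracket τ (superBracket τ r s) t -
      koszulSign i j • superBracket τ (superBracket τ r t) s := by
    intro l r hr
    rw [superBracket_jacobi hτ t hr hs, superBracket_skew hs (superBracket_mem hr ht),
      koszulSign_add_right, smul_neg, smul_smul, koszulSign_comm i l, ← mul_assoc,
      koszulSign_mul_self, one_mul, sub_eq_add_neg]
  obtain ⟨t0, t1, h0, h1, rfl⟩ := exists_homogeneous_add hτ r
  simp only [map_add, LinearMap.add_apply, key h0, key h1, smul_add]
  abel

/-- The Lie superalgebra structure on a subspace that is stable under the supercommutator and the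
parity automorphism. -/
@[reducible]
noncomputable def ofSuperBracket (hτ : ∀ r, τ (τ r) = r) (p : Submodule ℂ R)
    (hp : ∀ r ∈ p, ∀ s ∈ p, superBracket τ r s ∈ p) (hpτ : ∀ r ∈ p, τ r ∈ p) :
    LieSuperalgebra p where
  bracket := LinearMap.mk₂ ℂ (fun x y => ⟨superBracket τ x y, hp _ x.2 _ y.2⟩)
    (by intros; ext; simp) (by intros; ext; simp) (by intros; ext; simp) (by intros; ext; simp)
  parity i :=
    { carrier := {x | τ x = koszulSign i 1 • (x : R)}
      add_mem' := fun {x y} hx hy => by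
        change τ ((x : R) + y) = koszulSign i 1 • ((x : R) + y)
        rw [map_add, show τ (x : R) = _ from hx, show τ (y : R) = _ from hy, smul_add]
      zero_mem' := by simp
      smul_mem' := fun c x hx => by
        change τ (c • (x : R)) = koszulSign i 1 • (c • (x : R))
        rw [map_smul, show τ (x : R) = _ from hx, smul_comm] }
  isCompl_parity := by
    constructor
    · rw [Submodule.disjoint_def]
      intro x h0 h1
      have h0' : τ (x : R) = koszulSign 0 1 • (x : R) := h0
      have h1' : τ (x : R) = koszulSign 1 1 • (x : R) := h1
      rw [h0', koszulSign_zero_left, koszulSign_one_one, one_smul, neg_smul, one_smul] at h1'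
      have : (2 : ℂ) • (x : R) = 0 := by
        rw [two_smul]; nth_rewrite 1 [h1']; simp
      exact Subtype.ext (by simpa using this)
    · rw [codisjoint_iff, eq_top_iff]
      rintro ⟨x, hx⟩ -
      have : (⟨x, hx⟩ : p) = ⟨(2⁻¹ : ℂ) • (x + τ x), p.smul_mem _ (p.add_mem hx (hpτ _ hx))⟩ +
          ⟨(2⁻¹ : ℂ) • (x - τ x), p.smul_mem _ (p.sub_mem hx (hpτ _ hx))⟩ := by
        ext; change x = (2⁻¹ : ℂ) • (x + τ x) + (2⁻¹ : ℂ) • (x - τ x); module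
      rw [this]
      refine Submodule.add_mem_sup ?_ ?_
      · change τ ((2⁻¹ : ℂ) • (x + τ x)) = koszulSign 0 1 • ((2⁻¹ : ℂ) • (x + τ x))
        simp only [map_smul, map_add, hτ, koszulSign_zero_left]; module
      · change τ ((2⁻¹ : ℂ) • (x - τ x)) = koszulSign 1 1 • ((2⁻¹ : ℂ) • (x - τ x))
        simp only [map_smul, map_sub, hτ, koszulSign_one_one]; module
  bracket_mem {_ _ _ _} hx hy := superBracket_mem hx hy
  skew {_ _ _ _} hx hy := Subtype.ext (superBracket_skew hx hy)
  jacobi {_ _ _ _} z hx hy := Subtype.ext (superBracket_jacobi hτ _ hx hy)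

end SuperBracket

/-! ### The enveloping algebra of the negative part -/

section Env

variable {L : Type u} [AddCommGroup L] [Module ℂ L] [LieSuperalgebra L]

/-- The defining relations of the enveloping algebra of the negative part. -/
inductive EnvRel (G : ℤ → Submodule ℂ L) : TensorAlgebra ℂ L → TensorAlgebra ℂ L → Prop
  | nonneg {a : ℤ} {x : L} (ha : 0 ≤ a) (hx : x ∈ G a) : EnvRel G (TensorAlgebra.ι ℂ x) 0
  | comm {a b : ℤ} {i j : ZMod 2} {x y : L} (ha : a < 0) (hb : b < 0) (hxa : x ∈ G a)
      (hyb : y ∈ G b) (hxi : x ∈ parity i) (hyj : y ∈ parity j) :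
      EnvRel G (TensorAlgebra.ι ℂ x * TensorAlgebra.ι ℂ y)
        (koszulSign i j • (TensorAlgebra.ι ℂ y * TensorAlgebra.ι ℂ x) +
          TensorAlgebra.ι ℂ (bracket x y))

/-- The universal enveloping algebra of the negative part of a graded Lie superalgebra. -/
def Env (G : ℤ → Submodule ℂ L) : Type u := RingQuot (EnvRel G)

noncomputable instance (G : ℤ → Submodule ℂ L) : Ring (Env G) :=
  inferInstanceAs (Ring (RingQuot (EnvRel G)))

noncomputable instance (G : ℤ → Submodule ℂ L) : Algebra ℂ (Env G) :=
  inferInstanceAs (Algebra ℂ (RingQuot (EnvRel G)))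

/-- The quotient map from the tensor algebra. -/
noncomputable def envMk (G : ℤ → Submodule ℂ L) : TensorAlgebra ℂ L →ₐ[ℂ] Env G :=
  RingQuot.mkAlgHom ℂ (EnvRel G)

theorem envMk_rel {G : ℤ → Submodule ℂ L} {s t : TensorAlgebra ℂ L} (h : EnvRel G s t) :
    envMk G s = envMk G t :=
  RingQuot.mkAlgHom_rel ℂ h

/-- The canonical map to the enveloping algebra (which kills the nonnegative part). -/
noncomputable def envι (G : ℤ → Submodule ℂ L) : L →ₗ[ℂ] Env G :=
  (envMk G).toLinearMap ∘ₗ TensorAlgebra.ι ℂ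

variable {G : ℤ → Submodule ℂ L}

theorem envι_nonneg {a : ℤ} {x : L} (ha : 0 ≤ a) (hx : x ∈ G a) : envι G x = 0 := by
  have := envMk_rel (EnvRel.nonneg (G := G) ha hx)
  rw [map_zero] at this
  exact this

theorem envι_mul_envι {a b : ℤ} {i j : ZMod 2} {x y : L} (ha : a < 0) (hb : b < 0)
    (hxa : x ∈ G a) (hyb : y ∈ G b) (hxi : x ∈ parity i) (hyj : y ∈ parity j) :
    envι G x * envι G y = koszulSign i j • (envι G y * envι G x) + envι G (bracket x y) := by
  have := envMk_rel (EnvRel.comm (G := G) ha hb hxa hyb hxi hyj)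
  simp only [map_mul, map_add, map_smul] at this
  exact this

/-- The universal property of the enveloping algebra. -/
noncomputable def envLift {A : Type v} [Ring A] [Algebra ℂ A] (f : L →ₗ[ℂ] A)
    (h0 : ∀ a x, 0 ≤ a → x ∈ G a → f x = 0)
    (hc : ∀ a b i j x y, a < 0 → b < 0 → x ∈ G a → y ∈ G b → x ∈ parity i → y ∈ parity j →
      f x * f y = koszulSign i j • (f y * f x) + f (bracket x y)) : Env G →ₐ[ℂ] A :=
  RingQuot.liftAlgHom ℂ ⟨TensorAlgebra.lift ℂ f, by
    intro x y hxy
    induction hxy with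
    | nonneg ha hx => simp [h0 _ _ ha hx]
    | comm ha hb hxa hyb hxi hyj =>
      simp [hc _ _ _ _ _ _ ha hb hxa hyb hxi hyj]⟩

theorem envLift_envι {A : Type v} [Ring A] [Algebra ℂ A] (f : L →ₗ[ℂ] A)
    (h0 : ∀ a x, 0 ≤ a → x ∈ G a → f x = 0)
    (hc : ∀ a b i j x y, a < 0 → b < 0 → x ∈ G a → y ∈ G b → x ∈ parity i → y ∈ parity j →
      f x * f y = koszulSign i j • (f y * f x) + f (bracket x y)) (x : L) :
    envLift f h0 hc (envι G x) = f x :=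
  (RingQuot.liftAlgHom_mkAlgHom_apply ℂ _ _ _).trans (TensorAlgebra.lift_ι_apply f x)

theorem env_hom_ext {A : Type v} [Ring A] [Algebra ℂ A] {f g : Env G →ₐ[ℂ] A}
    (h : ∀ x, f (envι G x) = g (envι G x)) : f = g :=
  RingQuot.ringQuot_ext' ℂ f g (TensorAlgebra.hom_ext (LinearMap.ext h))

/-- Induction on words in homogeneous elements of the negative part. -/
theorem env_induction (hG : IsGrading G) {p : Submodule ℂ (Env G)} (h1 : 1 ∈ p)
    (h : ∀ a i y u, a < 0 → y ∈ G a → y ∈ parity i → u ∈ p → envι G y * u ∈ p) (u : Env G) :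
    u ∈ p := by
  -- An arbitrary `y` splits into homogeneous components; those of nonnegative degree are killed by
  -- `envι`.
  have hι : ∀ y, ∀ u ∈ p, envι G y * u ∈ p := by
    intro y u hu
    have : y ∈ p.comap ((LinearMap.mul ℂ (Env G)).flip u ∘ₗ envι G) := by
      refine graded_induction hG.isInternal (fun a y hy => ?_) y
      change envι G y * u ∈ p
      rcases lt_or_ge a 0 with ha | ha
      · rw [← parityComponent_add y, map_add, add_mul]
        exact p.add_mem (h a 0 _ u ha (hG.parityComponent_mem 0 hy) (parityComponent_mem 0 y) hu)
          (h a 1 _ u ha (hG.parityComponent_mem 1 hy) (parityComponent_mem 1 y) hu)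
      · rw [envι_nonneg ha hy, zero_mul]; exact p.zero_mem
    exact this
  -- Stability under the generators gives stability under the whole tensor algebra, which maps onto
  -- `Env G`; the result is applied to `u = 1`.
  have hall : ∀ t : TensorAlgebra ℂ L, ∀ u ∈ p, envMk G t * u ∈ p := by
    intro t
    induction t using TensorAlgebra.induction with
    | algebraMap r =>
      intro u hu
      rw [AlgHom.commutes, ← Algebra.smul_def]
      exact p.smul_mem r hu
    | ι x => exact hι x
    | mul a b ha hb =>
      intro u hu
      rw [map_mul, mul_assoc]
      exact ha _ (hb _ hu)
    | add a b ha hb =>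
      intro u hu
      rw [map_add, add_mul]
      exact p.add_mem (ha _ hu) (hb _ hu)
  obtain ⟨t, rfl⟩ := RingQuot.mkAlgHom_surjective ℂ (EnvRel G) u
  have := hall t 1 h1
  rwa [mul_one] at this

/-- The parity automorphism of the enveloping algebra. -/
noncomputable def envSigma (hG : IsGrading G) : Env G →ₐ[ℂ] Env G :=
  envLift (envι G ∘ₗ sigma L)
    (fun a x ha hx => envι_nonneg ha (hG.sigma_mem hx))
    (fun a b i j x y ha hb hxa hyb hxi hyj => by
      simp only [LinearMap.comp_apply, sigma_bracket, sigma_of_mem hxi, sigma_of_mem hyj, map_smul,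
        LinearMap.smul_apply, smul_mul_assoc, mul_smul_comm,
        envι_mul_envι ha hb hxa hyb hxi hyj, smul_add]
      module)

theorem envSigma_envι (hG : IsGrading G) (x : L) :
    envSigma hG (envι G x) = envι G (sigma L x) := envLift_envι _ _ _ x

theorem envSigma_envSigma (hG : IsGrading G) (u : Env G) : envSigma hG (envSigma hG u) = u := by
  have : (envSigma hG).comp (envSigma hG) = AlgHom.id ℂ _ := by
    apply env_hom_ext
    intro x
    simp [envSigma_envι, sigma_sigma]
  exact DFunLike.congr_fun this u

/-- The parity automorphism of the endomorphism algebra of the enveloping algebra. -/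
noncomputable def endSigma (hG : IsGrading G) :
    Module.End ℂ (Env G) →ₐ[ℂ] Module.End ℂ (Env G) :=
  AlgHom.ofLinearMap
    { toFun := fun T => (envSigma hG).toLinearMap ∘ₗ T ∘ₗ (envSigma hG).toLinearMap
      map_add' := fun S T => by ext u; simp
      map_smul' := fun c T => by ext u; simp }
    (by ext u; simp [envSigma_envSigma])
    (fun S T => by ext u; simp [envSigma_envSigma])

theorem endSigma_apply (hG : IsGrading G) (T : Module.End ℂ (Env G)) (u : Env G) :
    endSigma hG T u = envSigma hG (T (envSigma hG u)) := rfl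

theorem endSigma_endSigma (hG : IsGrading G) (T : Module.End ℂ (Env G)) :
    endSigma hG (endSigma hG T) = T := by
  ext u; simp [endSigma_apply, envSigma_envSigma]

/-- Left multiplication by an element of the negative part. -/
noncomputable def envL (G : ℤ → Submodule ℂ L) : L →ₗ[ℂ] Module.End ℂ (Env G) :=
  LinearMap.mul ℂ (Env G) ∘ₗ envι G

theorem envL_apply (y : L) (u : Env G) : envL G y u = envι G y * u := rfl

theorem endSigma_envL (hG : IsGrading G) (y : L) : endSigma hG (envL G y) = envL G (sigma L y) := by
  ext u; simp [endSigma_apply, envL_apply, envSigma_envSigma, envSigma_envι]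

theorem endSigma_envL_of_mem (hG : IsGrading G) {i : ZMod 2} {y : L} (hy : y ∈ parity i) :
    endSigma hG (envL G y) = koszulSign i 1 • envL G y := by
  rw [endSigma_envL, sigma_of_mem hy, map_smul]

/-- The defining relation of the enveloping algebra, read as an identity of left multiplications. -/
theorem superBracket_envL (hG : IsGrading G) {a b : ℤ} (ha : a < 0) (hb : b < 0) {x y : L}
    (hx : x ∈ G a) (hy : y ∈ G b) :
    superBracket (endSigma hG) (envL G x) (envL G y) = envL G (bracket x y) := by
  have key : ∀ {i j : ZMod 2} {x y : L}, x ∈ parity i → y ∈ parity j → x ∈ G a → y ∈ G b →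
      superBracket (endSigma hG) (envL G x) (envL G y) = envL G (bracket x y) := by
    intro i j x y hxi hyj hx hy
    rw [superBracket_of_homogeneous (endSigma_envL_of_mem hG hxi) (endSigma_envL_of_mem hG hyj)]
    ext u
    change envι G x * (envι G y * u) - koszulSign i j • (envι G y * (envι G x * u)) = _
    rw [← mul_assoc, envι_mul_envι ha hb hx hy hxi hyj, envL_apply, add_mul, smul_mul_assoc,
      mul_assoc, add_sub_cancel_left]
  rw [← parityComponent_add x, ← parityComponent_add y]
  have hx' := fun i => hG.parityComponent_mem i hx
  have hy' := fun i => hG.parityComponent_mem i hy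
  have px := fun i => parityComponent_mem i x
  have py := fun i => parityComponent_mem i y
  simp only [map_add, LinearMap.add_apply, key (px _) (py _) (hx' _) (hy' _)]

end Env

end LieSuperalgebra

namespace LieSuperalgebra

/-! ### Modules over the negative part -/

section NegativeAction

variable {L : Type u} [AddCommGroup L] [Module ℂ L] [LieSuperalgebra L]
variable {G : ℤ → Submodule ℂ L}
variable {M : Type v} [AddCommGroup M] [Module ℂ M]

/-- `act` is a right action of the negative part on the super vector space `M`, whose parity is
given by the involution `σ`. -/
structure IsNegativeAction (G : ℤ → Submodule ℂ L) (σ : M →ₗ[ℂ] M) (act : L →ₗ[ℂ] M →ₗ[ℂ] M) :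
    Prop where
  sigma_sigma : ∀ x, σ (σ x) = x
  sigma_act : ∀ {a : ℤ} {i : ZMod 2} {y : L}, a < 0 → y ∈ G a → y ∈ parity i →
    ∀ x, σ (act y x) = koszulSign i 1 • act y (σ x)
  act_bracket : ∀ {a b : ℤ} {i j : ZMod 2} {y z : L}, a < 0 → b < 0 → y ∈ G a → z ∈ G b →
    y ∈ parity i → z ∈ parity j →
    ∀ x, act (bracket y z) x = act z (act y x) - koszulSign i j • act y (act z x)

/-- The `i`-th power of the involution `σ`. -/
def twist (σ : M →ₗ[ℂ] M) (i : ZMod 2) : M →ₗ[ℂ] M := if i = 0 then LinearMap.id else σ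

@[simp] theorem twist_zero (σ : M →ₗ[ℂ] M) : twist σ 0 = LinearMap.id := by simp [twist]
@[simp] theorem twist_one (σ : M →ₗ[ℂ] M) : twist σ 1 = σ := by simp [twist]

/-- The action of the negative part on linear maps to the enveloping algebra that governs the
extension of `M → Env G` to `M → End (Env G)`. -/
noncomputable def coindAction (hG : IsGrading G) (σ : M →ₗ[ℂ] M) (act : L →ₗ[ℂ] M →ₗ[ℂ] M) :
    L →ₗ[ℂ] Module.End ℂ (M →ₗ[ℂ] Env G) :=
  LinearMap.mk₂ ℂ (fun y F => F ∘ₗ act (negPart hG.isInternal y) +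
      LinearMap.mulLeft ℂ (envι G (parityComponent 0 (negPart hG.isInternal y))) ∘ₗ F +
      LinearMap.mulLeft ℂ (envι G (parityComponent 1 (negPart hG.isInternal y))) ∘ₗ F ∘ₗ σ)
    (by intros; ext; simp [add_mul]; abel)
    (by intros; ext; simp)
    (by intros; ext; simp [mul_add]; abel)
    (by intros; ext; simp)

/-- The formula is what the rule T_x L_y = T_{x·y} ± L_y T_x demands of `F = (x ↦ T_x u)`. The power
of the involution carries the Koszul sign, so `x` need not be homogeneous. -/
theorem coindAction_apply (hG : IsGrading G) (σ : M →ₗ[ℂ] M) (act : L →ₗ[ℂ] M →ₗ[ℂ] M) {a : ℤ}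
    {i : ZMod 2} {y : L} (ha : a < 0) (hy : y ∈ G a) (hyi : y ∈ parity i) (F : M →ₗ[ℂ] Env G)
    (x : M) : coindAction hG σ act y F x = F (act y x) + envι G y * F (twist σ i x) := by
  simp only [coindAction, LinearMap.mk₂_apply, negPart_of_neg hG.isInternal ha hy]
  rcases zmod_two_cases i with rfl | rfl
  · simp [parityComponent_self hyi, parityComponent_one_of_even hyi]
  · simp [parityComponent_self hyi, parityComponent_zero_of_odd hyi]

theorem IsNegativeAction.twist_act {σ : M →ₗ[ℂ] M} {act : L →ₗ[ℂ] M →ₗ[ℂ] M}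
    (h : IsNegativeAction G σ act) {a : ℤ} {i : ZMod 2} {y : L} (ha : a < 0) (hy : y ∈ G a)
    (hyi : y ∈ parity i) (j : ZMod 2) (x : M) :
    twist σ j (act y x) = koszulSign i j • act y (twist σ j x) := by
  rcases zmod_two_cases j with rfl | rfl
  · simp
  · simpa using h.sigma_act ha hy hyi x

theorem IsNegativeAction.twist_twist {σ : M →ₗ[ℂ] M} {act : L →ₗ[ℂ] M →ₗ[ℂ] M}
    (h : IsNegativeAction G σ act) (i j : ZMod 2) (x : M) :
    twist σ i (twist σ j x) = twist σ (i + j) x := by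
  rcases zmod_two_cases i with rfl | rfl <;> rcases zmod_two_cases j with rfl | rfl <;>
    simp [zmod_two_one_add_one, h.sigma_sigma]

/-- The operators on the enveloping algebra defined by a module over the negative part and a linear
map `c : M → Env G`. -/
noncomputable def coindRep (hG : IsGrading G) {σ : M →ₗ[ℂ] M} {act : L →ₗ[ℂ] M →ₗ[ℂ] M}
    (h : IsNegativeAction G σ act) (c : M →ₗ[ℂ] Env G) : M →ₗ[ℂ] Module.End ℂ (Env G) :=
  -- The action of 𝔪 on `M →ₗ[ℂ] Env G` extends to `Env G`. The operator attached to `x` sends `u`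
  -- to the value at `x` of `u` applied to `c`.
  ((envLift (G := G) (A := Module.End ℂ (M →ₗ[ℂ] Env G)) (coindAction hG σ act)
    (fun a x ha hx => by
      ext F z
      simp [coindAction, negPart_of_nonneg hG.isInternal ha hx])
    (fun a b i j y z ha hb hya hzb hyi hzj => by
      ext F x
      have hyz := hG.bracket_mem a b y hya z hzb
      simp only [Module.End.mul_apply, LinearMap.add_apply, LinearMap.smul_apply,
        coindAction_apply hG σ act ha hya hyi, coindAction_apply hG σ act hb hzb hzj,
        coindAction_apply hG σ act (add_neg ha hb) hyz (bracket_mem hyi hzj),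
        h.twist_act ha hya hyi, h.twist_act hb hzb hzj, h.twist_twist,
        h.act_bracket ha hb hya hzb hyi hzj, map_sub, map_smul, mul_add, smul_add, mul_smul_comm,
        ← mul_assoc, envι_mul_envι ha hb hya hzb hyi hzj, add_mul, smul_mul_assoc, smul_smul,
        koszulSign_comm j i, koszulSign_mul_self, add_comm j i]
      module)).toLinearMap.flip c).flip

theorem coindRep_one (hG : IsGrading G) {σ : M →ₗ[ℂ] M} {act : L →ₗ[ℂ] M →ₗ[ℂ] M}
    (h : IsNegativeAction G σ act) (c : M →ₗ[ℂ] Env G) (x : M) : coindRep hG h c x 1 = c x := by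
  simp [coindRep]

/-- With `coindRep_one` this is a recursion on the length of words in 𝔪, so it determines the
operators. It expresses [T_x, L_y] = T_{x·y}. -/
theorem coindRep_mul (hG : IsGrading G) {σ : M →ₗ[ℂ] M} {act : L →ₗ[ℂ] M →ₗ[ℂ] M}
    (h : IsNegativeAction G σ act) (c : M →ₗ[ℂ] Env G) {a : ℤ} {i : ZMod 2} {y : L} (ha : a < 0)
    (hy : y ∈ G a) (hyi : y ∈ parity i) (x : M) (u : Env G) :
    coindRep hG h c x (envι G y * u) =
      coindRep hG h c (act y x) u + envι G y * coindRep hG h c (twist σ i x) u := by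
  simp [coindRep, envLift_envι, coindAction_apply hG σ act ha hy hyi]

/-- A family of operators on the enveloping algebra that kills `1` and is closed under commutators
with the negative part vanishes. -/
theorem env_operators_eq_zero (hG : IsGrading G) {ι : Type w} (T : ι → Module.End ℂ (Env G))
    (h1 : ∀ i, T i 1 = 0)
    (h : ∀ i a q y, a < 0 → y ∈ G a → y ∈ parity q →
      ∃ A ∈ Submodule.span ℂ (Set.range T), ∃ B ∈ Submodule.span ℂ (Set.range T),
        ∀ u, T i (envι G y * u) = A u + envι G y * B u) (i : ι) : T i = 0 := by
  ext u
  -- The joint kernel of the family contains 1 and is stable under left multiplication by 𝔪.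
  have hu : u ∈ ⨅ i, LinearMap.ker (T i) := by
    refine env_induction hG ?_ ?_ u
    · simpa [Submodule.mem_iInf] using h1
    · intro a q y u ha hy hyq hu
      rw [Submodule.mem_iInf] at hu ⊢
      intro i
      obtain ⟨A, hA, B, hB, hAB⟩ := h i a q y ha hy hyq
      have hspan : ∀ A ∈ Submodule.span ℂ (Set.range T), A u = 0 := by
        intro A hA
        have : Submodule.span ℂ (Set.range T) ≤ LinearMap.ker (LinearMap.applyₗ (R := ℂ) u) := by
          rw [Submodule.span_le]
          rintro _ ⟨j, rfl⟩
          exact hu j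
        exact this hA
      rw [LinearMap.mem_ker, hAB, hspan A hA, hspan B hB, mul_zero, add_zero]
  rw [Submodule.mem_iInf] at hu
  exact hu i

/-- The supercommutator with a left multiplication. -/
theorem mul_envL (hG : IsGrading G) {i : ZMod 2} {y : L} (hy : y ∈ parity i)
    (T : Module.End ℂ (Env G)) (u : Env G) :
    T (envι G y * u) = superBracket (endSigma hG) T (envL G y) u +
      envι G y * twist (endSigma hG).toLinearMap i T u := by
  have key : ∀ {j : ZMod 2} {T : Module.End ℂ (Env G)}, endSigma hG T = koszulSign j 1 • T →
      T (envι G y * u) = superBracket (endSigma hG) T (envL G y) u +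
      envι G y * twist (endSigma hG).toLinearMap i T u := by
    intro j T hT
    rw [superBracket_of_homogeneous hT (endSigma_envL_of_mem hG hy)]
    have : twist (endSigma hG).toLinearMap i T = koszulSign j i • T := by
      rcases zmod_two_cases i with rfl | rfl <;> simp [hT]
    rw [this]
    simp [envL_apply]
  obtain ⟨t0, t1, h0, h1, rfl⟩ := exists_homogeneous_add (endSigma_endSigma hG) T
  simp only [map_add, LinearMap.add_apply, key h0, key h1, mul_add]
  abel

/-- Both sides obey the same recursion and agree at 1. Hence their differences, for all `x` at once,
form a family covered by `env_operators_eq_zero`. -/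
theorem endSigma_coindRep (hG : IsGrading G) {σ : M →ₗ[ℂ] M} {act : L →ₗ[ℂ] M →ₗ[ℂ] M}
    (h : IsNegativeAction G σ act) {c : M →ₗ[ℂ] Env G} (hc : ∀ x, c (σ x) = envSigma hG (c x))
    (x : M) : endSigma hG (coindRep hG h c x) = coindRep hG h c (σ x) := by
  refine sub_eq_zero.1 (env_operators_eq_zero hG
    (fun x : M => endSigma hG (coindRep hG h c x) - coindRep hG h c (σ x)) ?_ ?_ x)
  · intro x
    simp only [LinearMap.sub_apply, endSigma_apply, map_one, coindRep_one, hc, sub_self]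
  · intro x a q y ha hy hyq
    have hm : ∀ x : M, endSigma hG (coindRep hG h c x) - coindRep hG h c (σ x) ∈
        Submodule.span ℂ (Set.range fun x : M =>
          endSigma hG (coindRep hG h c x) - coindRep hG h c (σ x)) :=
      fun x => Submodule.subset_span ⟨x, rfl⟩
    refine ⟨_, Submodule.smul_mem _ (koszulSign q 1) (hm (act y x)), _,
      hm (twist σ q x), fun u => ?_⟩
    have ht : twist σ q (σ x) = σ (twist σ q x) := by
      rcases zmod_two_cases q with rfl | rfl <;> simp
    simp only [LinearMap.sub_apply, LinearMap.smul_apply, endSigma_apply, map_mul, envSigma_envι,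
      sigma_of_mem hyq, map_smul, smul_mul_assoc, coindRep_mul hG h c ha hy hyq, map_add,
      smul_add, smul_smul, koszulSign_mul_self, h.sigma_act ha hy hyq, ht, mul_sub,
      smul_sub, one_smul]
    abel

/-- Two expressions for T_x(yu), from `mul_envL` and from `coindRep_mul`, share the term with `y` on
the left; cancelling it leaves the commutator. -/
theorem superBracket_coindRep_envL (hG : IsGrading G) {σ : M →ₗ[ℂ] M} {act : L →ₗ[ℂ] M →ₗ[ℂ] M}
    (h : IsNegativeAction G σ act) {c : M →ₗ[ℂ] Env G} (hc : ∀ x, c (σ x) = envSigma hG (c x))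
    {a : ℤ} (ha : a < 0) {y : L} (hy : y ∈ G a) (x : M) :
    superBracket (endSigma hG) (coindRep hG h c x) (envL G y) = coindRep hG h c (act y x) := by
  have key : ∀ {i : ZMod 2} {y : L}, y ∈ parity i → y ∈ G a →
      superBracket (endSigma hG) (coindRep hG h c x) (envL G y) = coindRep hG h c (act y x) := by
    intro i y hyi hy
    ext u
    have h1 := mul_envL hG hyi (coindRep hG h c x) u
    rw [coindRep_mul hG h c ha hy hyi] at h1
    have h2 : twist (endSigma hG).toLinearMap i (coindRep hG h c x) =
        coindRep hG h c (twist σ i x) := by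
      rcases zmod_two_cases i with rfl | rfl
      · simp
      · simpa using endSigma_coindRep hG h hc x
    rw [h2] at h1
    exact (add_right_cancel h1).symm
  rw [← parityComponent_add y]
  simp only [map_add, LinearMap.add_apply,
    key (parityComponent_mem _ y) (hG.parityComponent_mem _ hy)]

end NegativeAction

/-! ### The representation of an effective extension -/

section Extension

variable {L : Type u} [AddCommGroup L] [Module ℂ L] [LieSuperalgebra L]
variable {G : ℤ → Submodule ℂ L} {k : ℤ}
variable {Q : Type v} [AddCommGroup Q] [Module ℂ Q]
variable {GQ : ℤ → Submodule ℂ Q} {κ : truncation G k →ₗ[ℂ] Q}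

/-- The algebra itself is the reference extension with which all others are compared. -/
theorem self_isEffectiveExtension (hG : IsGrading G) (hE : IsEffective G) (k : ℤ) :
    IsEffectiveExtension G k G (truncation G k).subtype where
  isGrading := hG
  isEffective := hE
  injective := Subtype.val_injective
  map_comp i hi := by
    rw [Submodule.map_comap_subtype, inf_eq_right]
    exact fun x hx => mem_truncation hi hx
  map_parity _ _ hx := hx
  map_bracket _ _ _ _ _ _ _ _ _ _ h := h

/-- The map `κ`, extended by zero. -/
noncomputable def extMap (hG : IsGrading G) (κ : truncation G k →ₗ[ℂ] Q) : L →ₗ[ℂ] Q :=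
  κ ∘ₗ truncationProj hG.isInternal k

theorem extMap_apply (hG : IsGrading G) (κ : truncation G k →ₗ[ℂ] Q) {j : ℤ} (hj : j ≤ k) {x : L}
    (hx : x ∈ G j) : extMap hG κ x = κ ⟨x, mem_truncation hj hx⟩ := by
  rw [extMap, LinearMap.comp_apply, truncationProj_apply hG.isInternal hj hx]

theorem extMap_coe (hG : IsGrading G) (κ : truncation G k →ₗ[ℂ] Q) (x : truncation G k) :
    extMap hG κ x = κ x := by
  have : (x : L) ∈ (LinearMap.ker ((truncation G k).subtype ∘ₗ truncationProj hG.isInternal k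
      - LinearMap.id)) := by
    refine truncation_induction (fun j hj y hy => ?_) x.2
    rw [LinearMap.mem_ker, LinearMap.sub_apply, LinearMap.comp_apply,
      truncationProj_apply hG.isInternal hj hy]
    simp
  rw [extMap, LinearMap.comp_apply]
  congr 1
  ext
  exact sub_eq_zero.1 this

variable [LieSuperalgebra Q]

theorem extMap_mem (hG : IsGrading G) (hQ : IsEffectiveExtension G k GQ κ) {j : ℤ} (hj : j ≤ k)
    {x : L} (hx : x ∈ G j) : extMap hG κ x ∈ GQ j := by
  rw [extMap_apply hG κ hj hx, ← hQ.map_comp j hj]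
  exact Submodule.mem_map_of_mem hx

theorem exists_extMap_eq (hG : IsGrading G) (hQ : IsEffectiveExtension G k GQ κ) {j : ℤ}
    (hj : j ≤ k) {x : Q} (hx : x ∈ GQ j) : ∃ y ∈ G j, extMap hG κ y = x := by
  rw [← hQ.map_comp j hj] at hx
  obtain ⟨y, hy, rfl⟩ := hx
  exact ⟨y, hy, extMap_coe hG κ y⟩

theorem extMap_parity (hG : IsGrading G) (hQ : IsEffectiveExtension G k GQ κ) {j : ℤ} (hj : j ≤ k)
    {x : L} (hx : x ∈ G j) {i : ZMod 2} (hxi : x ∈ parity i) : extMap hG κ x ∈ parity i := by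
  rw [extMap_apply hG κ hj hx]
  exact hQ.map_parity i _ hxi

theorem extMap_sigma (hG : IsGrading G) (hQ : IsEffectiveExtension G k GQ κ) {j : ℤ} (hj : j ≤ k)
    {x : L} (hx : x ∈ G j) : extMap hG κ (sigma L x) = sigma Q (extMap hG κ x) := by
  have h : ∀ i, extMap hG κ (sigma L (parityComponent i x)) =
      sigma Q (extMap hG κ (parityComponent i x)) := fun i => by
    rw [sigma_of_mem (parityComponent_mem i x), map_smul, sigma_of_mem (extMap_parity hG hQ hj
      (hG.parityComponent_mem i hx) (parityComponent_mem i x))]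
  rw [← parityComponent_add x]
  simp only [map_add, h]

theorem extMap_bracket (hG : IsGrading G) (hQ : IsEffectiveExtension G k GQ κ) {i j : ℤ}
    (hi : i ≤ k) (hj : j ≤ k) (hij : i + j ≤ k) {x y : L} (hx : x ∈ G i) (hy : y ∈ G j) :
    bracket (extMap hG κ x) (extMap hG κ y) = extMap hG κ (bracket x y) := by
  rw [extMap_apply hG κ hi hx, extMap_apply hG κ hj hy,
    extMap_apply hG κ hij (hG.bracket_mem i j x hx y hy)]
  exact hQ.map_bracket i j hi hj hij _ _ _ hx hy rfl

/-- The inverse of `κ`, extended by zero. -/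
noncomputable def extRetract (hQ : IsEffectiveExtension G k GQ κ) : Q →ₗ[ℂ] L :=
  gradedLift hQ.isGrading.isInternal fun j => if hj : j ≤ k then
    (truncation G k).subtype ∘ₗ (LinearEquiv.ofInjective κ hQ.injective).symm.toLinearMap ∘ₗ
      Submodule.inclusion (fun x hx => by
        rw [← hQ.map_comp j hj] at hx
        obtain ⟨y, -, rfl⟩ := hx
        exact LinearMap.mem_range_self κ y)
    else 0

theorem extRetract_extMap (hG : IsGrading G) (hQ : IsEffectiveExtension G k GQ κ) {j : ℤ}
    (hj : j ≤ k) {x : L} (hx : x ∈ G j) : extRetract hQ (extMap hG κ x) = x := by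
  rw [extRetract, gradedLift_apply _ _ (extMap_mem hG hQ hj hx), dif_pos hj]
  have : (LinearEquiv.ofInjective κ hQ.injective).symm
      ⟨extMap hG κ x, ⟨⟨x, mem_truncation hj hx⟩, (extMap_apply hG κ hj hx).symm⟩⟩ =
      ⟨x, mem_truncation hj hx⟩ := by
    rw [LinearEquiv.symm_apply_eq]
    ext
    exact extMap_apply hG κ hj hx
  exact congrArg Subtype.val this

theorem extRetract_of_gt (hQ : IsEffectiveExtension G k GQ κ) {j : ℤ} (hj : k < j) {x : Q}
    (hx : x ∈ GQ j) : extRetract hQ x = 0 := by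
  rw [extRetract, gradedLift_apply _ _ hx, dif_neg (not_le.2 hj)]
  rfl

theorem extRetract_mem (hG : IsGrading G) (hQ : IsEffectiveExtension G k GQ κ) {j : ℤ} {x : Q}
    (hx : x ∈ GQ j) : extRetract hQ x ∈ G j := by
  rcases le_or_gt j k with hj | hj
  · obtain ⟨y, hy, rfl⟩ := exists_extMap_eq hG hQ hj hx
    rwa [extRetract_extMap hG hQ hj hy]
  · rw [extRetract_of_gt hQ hj hx]; exact zero_mem _

/-- The right adjoint action of 𝔪 on an extension. The bound `-1 ≤ k` ensures that the truncation
contains 𝔪 with all its brackets. -/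
theorem ext_isNegativeAction (hG : IsGrading G) (hQ : IsEffectiveExtension G k GQ κ)
    (hk : -1 ≤ k) : IsNegativeAction G (sigma Q) (bracket.flip ∘ₗ extMap hG κ) where
  sigma_sigma := sigma_sigma
  sigma_act {a i y} ha hy hyi x := by
    have := extMap_parity hG hQ (by omega : a ≤ k) hy hyi
    simp [sigma_bracket, sigma_of_mem this]
  act_bracket {a b i j y z} ha hb hy hz hyi hzj x := by
    have h1 := extMap_parity hG hQ (by omega : a ≤ k) hy hyi
    have h2 := extMap_parity hG hQ (by omega : b ≤ k) hz hzj
    simp only [LinearMap.comp_apply, LinearMap.flip_apply]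
    rw [← extMap_bracket hG hQ (by omega : a ≤ k) (by omega : b ≤ k) (by omega) hy hz,
      bracket_bracket_right x h1 h2]

/-- The action of an effective extension on the enveloping algebra of the negative part. -/
noncomputable def extRep (hG : IsGrading G) (hQ : IsEffectiveExtension G k GQ κ) (hk : -1 ≤ k) :
    Q →ₗ[ℂ] Module.End ℂ (Env G) :=
  coindRep hG (ext_isNegativeAction hG hQ hk) (envι G ∘ₗ extRetract hQ)

/-- `extRetract` inverts `κ` and vanishes above degree `k`, and `envι` kills nonnegative degrees, so
1 is sent to the negative part of `x`: nonnegative elements annihilate the cyclic vector of the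
induced module. -/
theorem extRep_one (hG : IsGrading G) (hQ : IsEffectiveExtension G k GQ κ) (hk : -1 ≤ k) (x : Q) :
    extRep hG hQ hk x 1 = envι G (extRetract hQ x) := by
  rw [extRep, coindRep_one]; rfl

theorem extRep_one_of_nonneg (hG : IsGrading G) (hQ : IsEffectiveExtension G k GQ κ) (hk : -1 ≤ k)
    {j : ℤ} (hj : 0 ≤ j) {x : Q} (hx : x ∈ GQ j) : extRep hG hQ hk x 1 = 0 := by
  rw [extRep_one, envι_nonneg hj (extRetract_mem hG hQ hx)]

theorem extRep_mul (hG : IsGrading G) (hQ : IsEffectiveExtension G k GQ κ) (hk : -1 ≤ k) {a : ℤ}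
    {i : ZMod 2} {y : L} (ha : a < 0) (hy : y ∈ G a) (hyi : y ∈ parity i) (x : Q) (u : Env G) :
    extRep hG hQ hk x (envι G y * u) = extRep hG hQ hk (bracket x (extMap hG κ y)) u +
      envι G y * extRep hG hQ hk (twist (sigma Q) i x) u := by
  rw [extRep, coindRep_mul hG _ _ ha hy hyi]; rfl

theorem extRetract_sigma (hG : IsGrading G) (hQ : IsEffectiveExtension G k GQ κ) (x : Q) :
    extRetract hQ (sigma Q x) = sigma L (extRetract hQ x) := by
  have : x ∈ LinearMap.ker (extRetract hQ ∘ₗ sigma Q - sigma L ∘ₗ extRetract hQ) := by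
    refine graded_induction hQ.isGrading.isInternal (fun j x hx => ?_) x
    change extRetract hQ (sigma Q x) - sigma L (extRetract hQ x) = 0
    rcases le_or_gt j k with hj | hj
    · obtain ⟨y, hy, rfl⟩ := exists_extMap_eq hG hQ hj hx
      rw [← extMap_sigma hG hQ hj hy, extRetract_extMap hG hQ hj hy,
        extRetract_extMap hG hQ hj (hG.sigma_mem hy), sub_self]
    · rw [extRetract_of_gt hQ hj hx, extRetract_of_gt hQ hj (hQ.isGrading.sigma_mem hx), map_zero,
        sub_self]
  exact sub_eq_zero.1 this

theorem endSigma_extRep (hG : IsGrading G) (hQ : IsEffectiveExtension G k GQ κ) (hk : -1 ≤ k)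
    (x : Q) : endSigma hG (extRep hG hQ hk x) = extRep hG hQ hk (sigma Q x) :=
  endSigma_coindRep hG (ext_isNegativeAction hG hQ hk)
    (fun x => by simp [extRetract_sigma hG hQ, envSigma_envι]) x

theorem superBracket_extRep_envL (hG : IsGrading G) (hQ : IsEffectiveExtension G k GQ κ)
    (hk : -1 ≤ k) {a : ℤ} (ha : a < 0) {y : L} (hy : y ∈ G a) (x : Q) :
    superBracket (endSigma hG) (extRep hG hQ hk x) (envL G y) =
      extRep hG hQ hk (bracket x (extMap hG κ y)) :=
  superBracket_coindRep_envL hG (ext_isNegativeAction hG hQ hk)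
    (fun x => by simp [extRetract_sigma hG hQ, envSigma_envι]) ha hy x

/-- The representations of two effective extensions agree on the truncation. -/
theorem extRep_extMap (hG : IsGrading G) (hQ : IsEffectiveExtension G k GQ κ) (hk : -1 ≤ k)
    {Q' : Type w} [AddCommGroup Q'] [Module ℂ Q'] [LieSuperalgebra Q']
    {GQ' : ℤ → Submodule ℂ Q'} {κ' : truncation G k →ₗ[ℂ] Q'}
    (hQ' : IsEffectiveExtension G k GQ' κ') {j : ℤ} (hj : j ≤ k) {x : L} (hx : x ∈ G j) :
    extRep hG hQ hk (extMap hG κ x) = extRep hG hQ' hk (extMap hG κ' x) := by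
  -- The homogeneous elements of degree at most `k` are stable under bracketing with 𝔪 and under the
  -- involution, and only brackets inside the truncation occur.
  refine sub_eq_zero.1 (env_operators_eq_zero hG
    (fun x : {x : L // ∃ j ≤ k, x ∈ G j} => extRep hG hQ hk (extMap hG κ x) -
      extRep hG hQ' hk (extMap hG κ' x)) ?_ ?_ ⟨x, j, hj, hx⟩)
  · rintro ⟨x, j, hj, hx⟩
    rw [LinearMap.sub_apply, extRep_one, extRep_one, extRetract_extMap hG hQ hj hx,
      extRetract_extMap hG hQ' hj hx, sub_self]
  · rintro ⟨x, j, hj, hx⟩ a q y ha hy hyq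
    have ht : ∃ j ≤ k, twist (sigma L) q x ∈ G j := by
      refine ⟨j, hj, ?_⟩
      rcases zmod_two_cases q with rfl | rfl
      · simpa using hx
      · simpa using hG.sigma_mem hx
    have htw : twist (sigma Q) q (extMap hG κ x) = extMap hG κ (twist (sigma L) q x) := by
      rcases zmod_two_cases q with rfl | rfl
      · simp
      · simpa using (extMap_sigma hG hQ hj hx).symm
    refine ⟨_, Submodule.subset_span ⟨⟨bracket x y, j + a, by omega,
      hG.bracket_mem j a x hx y hy⟩, rfl⟩, _, Submodule.subset_span ⟨⟨_, ht⟩, rfl⟩, fun u => ?_⟩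
    have htw' : twist (sigma Q') q (extMap hG κ' x) = extMap hG κ' (twist (sigma L) q x) := by
      rcases zmod_two_cases q with rfl | rfl
      · simp
      · simpa using (extMap_sigma hG hQ' hj hx).symm
    simp only [LinearMap.sub_apply, extRep_mul hG hQ hk ha hy hyq, extRep_mul hG hQ' hk ha hy hyq,
      extMap_bracket hG hQ hj (by omega : a ≤ k) (by omega) hx hy,
      extMap_bracket hG hQ' hj (by omega : a ≤ k) (by omega) hx hy, htw, htw', mul_sub]
    abel

/-- Whatever the extension is, its negative part acts by left multiplication: the recursion and the
value at 1 are the same on both sides. -/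
theorem extRep_neg (hG : IsGrading G) (hQ : IsEffectiveExtension G k GQ κ) (hk : -1 ≤ k)
    {j : ℤ} (hj : j < 0) {x : L} (hx : x ∈ G j) :
    extRep hG hQ hk (extMap hG κ x) = envL G x := by
  refine sub_eq_zero.1 (env_operators_eq_zero hG
    (fun x : {x : L // ∃ j < 0, x ∈ G j} => extRep hG hQ hk (extMap hG κ x) - envL G x)
      ?_ ?_ ⟨x, j, hj, hx⟩)
  · rintro ⟨x, j, hj, hx⟩
    rw [LinearMap.sub_apply, extRep_one, extRetract_extMap hG hQ (by omega) hx, envL_apply,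
      mul_one, sub_self]
  · rintro ⟨x, j, hj, hx⟩ a q y ha hy hyq
    have ht : ∃ j < 0, twist (sigma L) q x ∈ G j := by
      refine ⟨j, hj, ?_⟩
      rcases zmod_two_cases q with rfl | rfl
      · simpa using hx
      · simpa using hG.sigma_mem hx
    have htw : twist (sigma Q) q (extMap hG κ x) = extMap hG κ (twist (sigma L) q x) := by
      rcases zmod_two_cases q with rfl | rfl
      · simp
      · simpa using (extMap_sigma hG hQ (by omega) hx).symm
    have htw' : twist (endSigma hG).toLinearMap q (envL G x) = envL G (twist (sigma L) q x) := by
      rcases zmod_two_cases q with rfl | rfl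
      · simp
      · simpa using endSigma_envL hG x
    refine ⟨_, Submodule.subset_span ⟨⟨bracket x y, j + a, by omega,
      hG.bracket_mem j a x hx y hy⟩, rfl⟩, _, Submodule.subset_span ⟨⟨_, ht⟩, rfl⟩, fun u => ?_⟩
    simp only [LinearMap.sub_apply, extRep_mul hG hQ hk ha hy hyq, mul_envL hG hyq (envL G x),
      extMap_bracket hG hQ (by omega : j ≤ k) (by omega : a ≤ k) (by omega) hx hy, htw, htw',
      superBracket_envL hG hj ha hx hy, mul_sub]
    abel

/-- The action of an effective extension is a homomorphism of Lie superalgebras. -/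
theorem extRep_bracket (hG : IsGrading G) (hQ : IsEffectiveExtension G k GQ κ) (hk : -1 ≤ k)
    (x x' : Q) : extRep hG hQ hk (bracket x x') =
      superBracket (endSigma hG) (extRep hG hQ hk x) (extRep hG hQ hk x') := by
  -- `D` is the failure of multiplicativity. It kills 1, and by the Jacobi identities its commutator
  -- with L_y is a combination of values of `D` at bracketed arguments, so the operator induction
  -- forces it to vanish.
  let D : Q → Q → Module.End ℂ (Env G) := fun x x' =>
    superBracket (endSigma hG) (extRep hG hQ hk x) (extRep hG hQ hk x') -
      extRep hG hQ hk (bracket x x')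
  have hDadd : ∀ x x' y', D x (x' + y') = D x x' + D x y' := by
    intro x x' y'; simp only [D, map_add]; abel
  have hDadd' : ∀ x y x', D (x + y) x' = D x x' + D y x' := by
    intro x y x'; simp only [D, map_add, LinearMap.add_apply]; abel
  have hσ : ∀ {i : ZMod 2} {x : Q}, x ∈ parity i →
      endSigma hG (extRep hG hQ hk x) = koszulSign i 1 • extRep hG hQ hk x := by
    intro i x hx
    rw [endSigma_extRep, sigma_of_mem hx, map_smul]
  have hneg : ∀ {j : ℤ}, j < 0 → ∀ x, ∀ x' ∈ GQ j, D x x' = 0 := by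
    intro j hj x x' hx'
    obtain ⟨y, hy, rfl⟩ := exists_extMap_eq hG hQ (by omega) hx'
    simp only [D]
    rw [extRep_neg hG hQ hk hj hy, superBracket_extRep_envL hG hQ hk hj hy, sub_self]
  have hskew : ∀ {i j : ZMod 2} {x x' : Q}, x ∈ parity i → x' ∈ parity j →
      D x x' = -(koszulSign i j • D x' x) := by
    intro i j x x' hx hx'
    simp only [D]
    rw [superBracket_skew (hσ hx) (hσ hx'), skew hx hx', map_neg, map_smul]
    module
  -- If both degrees are nonnegative, the two operators and the operator of the bracket all kill 1;
  -- if one degree is negative, `D` itself is zero.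
  have hD1 : ∀ x x', D x x' 1 = 0 := by
    have hlin : ∀ i j, ∀ x ∈ GQ i, ∀ x' ∈ GQ j, D x x' 1 = 0 := by
      intro i j x hx x' hx'
      rcases lt_or_ge j 0 with hj | hj
      · rw [hneg hj x x' hx']; rfl
      rcases lt_or_ge i 0 with hi | hi
      · have h0 : ∀ p q, D (parityComponent p x) (parityComponent q x') = 0 := by
          intro p q
          rw [hskew (parityComponent_mem p x) (parityComponent_mem q x'),
            hneg hi _ _ (hQ.isGrading.parityComponent_mem p hx), smul_zero, neg_zero]
        rw [← parityComponent_add x, ← parityComponent_add x']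
        simp only [hDadd, hDadd', h0, add_zero, LinearMap.zero_apply]
      · have h0 := extRep_one_of_nonneg hG hQ hk hi hx
        have h0' := extRep_one_of_nonneg hG hQ hk hj hx'
        have h1 := extRep_one_of_nonneg hG hQ hk hi (hQ.isGrading.sigma_mem hx)
        have h2 := extRep_one_of_nonneg hG hQ hk (add_nonneg hi hj)
          (hQ.isGrading.bracket_mem i j x hx x' hx')
        simp only [D]
        rw [superBracket_apply, endSigma_extRep, endSigma_extRep]
        simp [h0, h0', h1, h2]
    intro x x'
    let B : Q →ₗ[ℂ] Q →ₗ[ℂ] Env G := LinearMap.mk₂ ℂ (fun x x' => D x x' 1)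
      (by intros; simp only [hDadd', LinearMap.add_apply])
      (by intros; simp [D, smul_sub])
      (by intros; simp only [hDadd, LinearMap.add_apply])
      (by intros; simp [D, smul_sub])
    have h1 : ∀ j, ∀ x' ∈ GQ j, ∀ x, B x x' = 0 := by
      intro j x' hx' x
      have : x ∈ LinearMap.ker (B.flip x') :=
        graded_induction hQ.isGrading.isInternal (fun i x hx => hlin i j x hx x' hx') x
      exact this
    have : x' ∈ LinearMap.ker (B x) :=
      graded_induction hQ.isGrading.isInternal (fun j x' hx' => h1 j x' hx' x) x'
    exact this
  -- The second entry is kept homogeneous because its parity enters the sign of the right Jacobi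
  -- identity.
  have hD : ∀ z : {z : Q × Q // ∃ p, z.2 ∈ parity (L := Q) p}, D z.1.1 z.1.2 = 0 := by
    refine env_operators_eq_zero hG _ (fun z => hD1 _ _) ?_
    rintro ⟨⟨x, x'⟩, p, hp⟩ a q y ha hy hyq
    have hey := extMap_parity hG hQ (by omega : a ≤ k) hy hyq
    refine ⟨_, Submodule.add_mem _ (Submodule.subset_span ⟨⟨(x, bracket x' (extMap hG κ y)), _,
        bracket_mem hp hey⟩, rfl⟩) (Submodule.smul_mem _ (koszulSign p q)
          (Submodule.subset_span ⟨⟨(bracket x (extMap hG κ y), x'), _, hp⟩, rfl⟩)), _,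
      Submodule.subset_span ⟨⟨(twist (sigma Q) q x, twist (sigma Q) q x'), p, ?_⟩, rfl⟩,
      fun u => ?_⟩
    · rcases zmod_two_cases q with rfl | rfl
      · simpa using hp
      · simpa [sigma_of_mem hp] using Submodule.smul_mem _ _ hp
    · have ht : twist (endSigma hG).toLinearMap q (D x x') =
          D (twist (sigma Q) q x) (twist (sigma Q) q x') := by
        rcases zmod_two_cases q with rfl | rfl
        · simp
        · simp only [D, twist_one, map_sub, AlgHom.toLinearMap_apply, map_superBracket,
            endSigma_extRep, sigma_bracket]
      have hb : superBracket (endSigma hG) (D x x') (envL G y) =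
          D x (bracket x' (extMap hG κ y)) +
            koszulSign p q • D (bracket x (extMap hG κ y)) x' := by
        have e1 := superBracket_bracket_right (endSigma_endSigma hG) (extRep hG hQ hk x) (hσ hp)
          (endSigma_envL_of_mem hG hyq)
        rw [superBracket_extRep_envL hG hQ hk ha hy, superBracket_extRep_envL hG hQ hk ha hy] at e1
        have e2 := bracket_bracket_right x hp hey
        simp only [D, map_sub, LinearMap.sub_apply, superBracket_extRep_envL hG hQ hk ha hy]
        rw [e1, e2]
        simp only [map_sub, map_smul]
        module
      change D x x' _ = (D x _ + koszulSign p q • D _ x') u + envι G y * D _ _ u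
      rw [mul_envL hG hyq, ht, hb]
  rw [← parityComponent_add x']
  have h0 := hD ⟨(x, parityComponent 0 x'), 0, parityComponent_mem 0 x'⟩
  have h1 := hD ⟨(x, parityComponent 1 x'), 1, parityComponent_mem 1 x'⟩
  have h := hDadd x (parityComponent 0 x') (parityComponent 1 x')
  rw [h0, h1, add_zero] at h
  exact (sub_eq_zero.1 h).symm

end Extension

end LieSuperalgebra

/-! ### The maximal prolongation inside the operators on the enveloping algebra -/

namespace LieSuperalgebra

section Prolongation

variable {L : Type u} [AddCommGroup L] [Module ℂ L] [LieSuperalgebra L]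
variable {G : ℤ → Submodule ℂ L} {k : ℤ}

/-- The negative part is generated by `G₋₁` and acts faithfully on the whole algebra. -/
structure IsFundamental (G : ℤ → Submodule ℂ L) : Prop where
  generated : ∀ a < -1, ∀ z ∈ G a,
    z ∈ Submodule.span ℂ {z | ∃ x ∈ G (-1), ∃ y ∈ G (a + 1), bracket x y = z}
  faithful : ∀ x ∈ truncation G (-1), (∀ y, bracket x y = 0) → x = 0

theorem negPart_of_mem_truncation (hG : IsGrading G) {x : L} (hx : x ∈ truncation G (-1)) :
    negPart hG.isInternal x = x := by
  have : x ∈ LinearMap.ker (negPart hG.isInternal - LinearMap.id) := by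
    refine truncation_induction (fun j hj y hy => ?_) hx
    rw [LinearMap.mem_ker, LinearMap.sub_apply, negPart_of_neg hG.isInternal (by omega) hy]
    simp
  exact sub_eq_zero.1 this

/-- Replaces the Poincaré–Birkhoff–Witt theorem: the adjoint action of 𝔪 on the whole algebra
factors through the enveloping algebra, so an element that dies there acts by zero. -/
theorem eq_zero_of_envι_eq_zero (hG : IsGrading G) (hF : IsFundamental G) {x : L}
    (hx : x ∈ truncation G (-1)) (h : envι G x = 0) : x = 0 := by
  let f : L →ₗ[ℂ] Module.End ℂ L := bracket ∘ₗ negPart hG.isInternal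
  have hf := envLift_envι (G := G) f
    (fun a x ha hx => by simp [f, negPart_of_nonneg hG.isInternal ha hx])
    (fun a b i j x y ha hb hxa hyb hxi hyj => by
      ext z
      simp only [f, LinearMap.comp_apply, Module.End.mul_apply, LinearMap.add_apply,
        LinearMap.smul_apply, negPart_of_neg hG.isInternal ha hxa,
        negPart_of_neg hG.isInternal hb hyb,
        negPart_of_neg hG.isInternal (add_neg ha hb) (hG.bracket_mem a b x hxa y hyb)]
      rw [jacobi z hxi hyj, add_comm]) x
  rw [h, map_zero] at hf
  refine hF.faithful x hx fun y => ?_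
  have := DFunLike.congr_fun hf.symm y
  simpa [f, negPart_of_mem_truncation hG hx] using this

/-- Since G₋₁ generates 𝔪, the Jacobi identity spreads commutation with L_y from degree -1 to all
negative degrees. -/
theorem superBracket_envL_eq_zero (hG : IsGrading G) (hF : IsFundamental G)
    {T : Module.End ℂ (Env G)}
    (h : ∀ y ∈ G (-1), superBracket (endSigma hG) T (envL G y) = 0) {a : ℤ} (ha : a < 0) {y : L}
    (hy : y ∈ G a) : superBracket (endSigma hG) T (envL G y) = 0 := by
  have main : ∀ n : ℕ, ∀ y ∈ G (-1 - n), superBracket (endSigma hG) T (envL G y) = 0 := by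
    intro n
    induction n with
    | zero => simpa using h
    | succ n ih =>
      intro y hy
      have hmem := hF.generated _ (by push_cast; omega) y hy
      have hle : Submodule.span ℂ {z | ∃ x ∈ G (-1), ∃ y ∈ G (-1 - ((n + 1 : ℕ) : ℤ) + 1),
          bracket x y = z} ≤ LinearMap.ker (superBracket (endSigma hG) T ∘ₗ envL G) := by
        rw [Submodule.span_le]
        rintro _ ⟨x, hx, y, hy, rfl⟩
        rw [show (-1 - ((n + 1 : ℕ) : ℤ) + 1) = -1 - n by push_cast; ring] at hy
        have key : ∀ {i j : ZMod 2} {x y : L}, x ∈ parity i → y ∈ parity j → x ∈ G (-1) →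
            y ∈ G (-1 - n) → superBracket (endSigma hG) T (envL G (bracket x y)) = 0 := by
          intro i j x y hxi hyj hx hy
          rw [← superBracket_envL hG (by omega) (by omega) hx hy,
            superBracket_bracket_right (endSigma_endSigma hG) T (endSigma_envL_of_mem hG hxi)
              (endSigma_envL_of_mem hG hyj), h x hx, ih y hy]
          simp
        change superBracket (endSigma hG) T (envL G (bracket x y)) = 0
        rw [← parityComponent_add x, ← parityComponent_add y]
        simp only [map_add, LinearMap.add_apply, key (parityComponent_mem _ x)
          (parityComponent_mem _ y) (hG.parityComponent_mem _ hx) (hG.parityComponent_mem _ hy),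
          add_zero]
      exact hle hmem
  have := main (-1 - a).toNat
  rw [show -1 - (((-1 - a).toNat : ℕ) : ℤ) = a by omega] at this
  exact this y hy

/-- An operator that kills `1` and commutes with `G₋₁` vanishes. -/
theorem eq_zero_of_commutes (hG : IsGrading G) (hF : IsFundamental G) {T : Module.End ℂ (Env G)}
    (h1 : T 1 = 0) (h : ∀ y ∈ G (-1), superBracket (endSigma hG) T (envL G y) = 0) : T = 0 := by
  have hσ : ∀ y ∈ G (-1), superBracket (endSigma hG) (endSigma hG T) (envL G y) = 0 := by
    intro y hy
    have := congrArg (endSigma hG) (h (sigma L y) (hG.sigma_mem hy))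
    rwa [map_superBracket, endSigma_envL, sigma_sigma, map_zero] at this
  -- Moving `T` past an odd `y` replaces it by its parity conjugate, so `T` and its conjugate form
  -- the family to which the operator induction applies.
  have := env_operators_eq_zero hG (fun i : ZMod 2 => twist (endSigma hG).toLinearMap i T) ?_ ?_ 0
  · simpa using this
  · intro i
    rcases zmod_two_cases i with rfl | rfl
    · simpa using h1
    · simp [endSigma_apply, h1]
  · intro i a q y ha hy hyq
    refine ⟨0, Submodule.zero_mem _, _, Submodule.subset_span ⟨q + i, rfl⟩, fun u => ?_⟩
    have hz : superBracket (endSigma hG) (twist (endSigma hG).toLinearMap i T) (envL G y) = 0 := by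
      rcases zmod_two_cases i with rfl | rfl
      · simpa using superBracket_envL_eq_zero hG hF h ha hy
      · simpa using superBracket_envL_eq_zero hG hF hσ ha hy
    rw [mul_envL hG hyq, hz]
    congr 2
    rcases zmod_two_cases i with rfl | rfl <;> rcases zmod_two_cases q with rfl | rfl <;>
      simp [zmod_two_one_add_one, endSigma_endSigma]

/-! ### The pieces of the prolongation -/

section Pieces

variable (hG : IsGrading G) (hE : IsEffective G) (hk : -1 ≤ k)

/-- The action of the algebra itself on the enveloping algebra of its negative part. -/
noncomputable abbrev selfRep : L →ₗ[ℂ] Module.End ℂ (Env G) :=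
  extRep hG (self_isEffectiveExtension hG hE k) hk

/-- The piece of degree `k + 1 + n` of the prolongation of `G_{≤ k}`. -/
noncomputable def pieceAux (n : ℕ) : Submodule ℂ (Module.End ℂ (Env G)) :=
  -- Bracketing with degree `-1 - a` leads from degree `k + 1 + n` to `k + n - a`. For `a < n` this
  -- is the piece with index `n - 1 - a`; otherwise it is a degree at most `k`, where the piece is
  -- the image of `G`.
  { carrier := {T | T 1 = 0 ∧ ∀ a : ℕ, ∀ y ∈ G (-1 - a),
    superBracket (endSigma hG) T (envL G y) ∈
      if h : a < n then pieceAux (n - 1 - a) else (G (k + n - a)).map (selfRep hG hE hk)}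
    add_mem' {S T} hS hT := by
      refine ⟨by rw [LinearMap.add_apply, hS.1, hT.1, add_zero], fun a y hy => ?_⟩
      rw [map_add, LinearMap.add_apply]
      exact Submodule.add_mem _ (hS.2 a y hy) (hT.2 a y hy)
    zero_mem' := by
      refine ⟨rfl, fun a y hy => ?_⟩
      rw [map_zero, LinearMap.zero_apply]
      exact Submodule.zero_mem _
    smul_mem' c T hT := by
      refine ⟨by rw [LinearMap.smul_apply, hT.1, smul_zero], fun a y hy => ?_⟩
      rw [map_smul, LinearMap.smul_apply]
      exact Submodule.smul_mem _ _ (hT.2 a y hy) }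
termination_by n

/-- The piece of degree `j` of the prolongation of `G_{≤ k}`. -/
noncomputable def piece (j : ℤ) : Submodule ℂ (Module.End ℂ (Env G)) :=
  if j ≤ k then (G j).map (selfRep hG hE hk) else pieceAux hG hE hk (j - k - 1).toNat

theorem piece_of_le {j : ℤ} (hj : j ≤ k) :
    piece hG hE hk j = (G j).map (selfRep hG hE hk) := if_pos hj

/-- Frees the recursion from natural number indices; later arguments above degree `k` use only this
description. -/
theorem mem_piece_of_gt {j : ℤ} (hj : k < j) {T : Module.End ℂ (Env G)} :
    T ∈ piece hG hE hk j ↔ T 1 = 0 ∧ ∀ a < 0, ∀ y ∈ G a,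
      superBracket (endSigma hG) T (envL G y) ∈ piece hG hE hk (j + a) := by
  have h0 : T ∈ piece hG hE hk j ↔ T 1 = 0 ∧ ∀ a : ℕ, ∀ y ∈ G (-1 - a),
      superBracket (endSigma hG) T (envL G y) ∈ piece hG hE hk (j - 1 - a) := by
    rw [piece, if_neg (not_le.2 hj), pieceAux]
    refine and_congr Iff.rfl (forall_congr' fun a => forall_congr' fun y => forall_congr' fun _ => ?_)
    split_ifs with ha
    · rw [piece, if_neg (by omega)]
      rw [show (j - 1 - a - k - 1).toNat = (j - k - 1).toNat - 1 - a by omega]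
    · rw [piece, if_pos (by omega), show k + ((j - k - 1).toNat : ℤ) - a = j - 1 - a by omega]
  rw [h0]
  refine and_congr Iff.rfl ⟨fun h a ha y hy => ?_, fun h a y hy => ?_⟩
  · have := h (-1 - a).toNat y (by rwa [show -1 - (((-1 - a).toNat : ℕ) : ℤ) = a by omega])
    rwa [show j - 1 - (((-1 - a).toNat : ℕ) : ℤ) = j + a by omega] at this
  · have := h (-1 - a) (by omega) y hy
    rwa [show j + (-1 - (a : ℤ)) = j - 1 - a by ring] at this

theorem exists_envL_eq {j : ℤ} (hj : j < 0) {T : Module.End ℂ (Env G)}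
    (hT : T ∈ piece hG hE hk j) : ∃ y ∈ G j, T = envL G y := by
  rw [piece_of_le hG hE hk (by omega)] at hT
  obtain ⟨y, hy, rfl⟩ := hT
  refine ⟨y, hy, ?_⟩
  have h := extRep_neg hG (self_isEffectiveExtension hG hE k) hk hj hy
  rwa [extMap_apply hG _ (by omega) hy] at h

theorem selfRep_neg {j : ℤ} (hj : j < 0) {y : L} (hy : y ∈ G j) :
    selfRep hG hE hk y = envL G y := by
  have h := extRep_neg hG (self_isEffectiveExtension hG hE k) hk hj hy
  rwa [extMap_apply hG _ (by omega) hy] at h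

theorem envL_mem_piece {j : ℤ} (hj : j < 0) {y : L} (hy : y ∈ G j) :
    envL G y ∈ piece hG hE hk j := by
  rw [piece_of_le hG hE hk (by omega), ← selfRep_neg hG hE hk hj hy]
  exact Submodule.mem_map_of_mem hy

theorem piece_apply_one {j : ℤ} (hj : 0 ≤ j) {T : Module.End ℂ (Env G)}
    (hT : T ∈ piece hG hE hk j) : T 1 = 0 := by
  rcases le_or_gt j k with hjk | hjk
  · rw [piece_of_le hG hE hk hjk] at hT
    obtain ⟨x, hx, rfl⟩ := hT
    exact extRep_one_of_nonneg hG _ hk hj hx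
  · exact ((mem_piece_of_gt hG hE hk hjk).1 hT).1

theorem superBracket_envL_mem_piece {j : ℤ} {T : Module.End ℂ (Env G)}
    (hT : T ∈ piece hG hE hk j) {a : ℤ} (ha : a < 0) {y : L} (hy : y ∈ G a) :
    superBracket (endSigma hG) T (envL G y) ∈ piece hG hE hk (j + a) := by
  rcases le_or_gt j k with hjk | hjk
  · rw [piece_of_le hG hE hk hjk] at hT
    obtain ⟨x, hx, rfl⟩ := hT
    rw [selfRep, superBracket_extRep_envL hG _ hk ha hy, piece_of_le hG hE hk (by omega),
      extMap_apply hG _ (by omega) hy]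
    exact Submodule.mem_map_of_mem (hG.bracket_mem _ _ _ hx _ hy)
  · exact ((mem_piece_of_gt hG hE hk hjk).1 hT).2 a ha y hy

/-- A graded subspace of operators that is closed under commutators with the negative part lies in
the prolongation as soon as its part of degree at most `k` does. -/
theorem mem_piece_of_graded {N : Type w} [AddCommGroup N] [Module ℂ N]
    (Φ : N →ₗ[ℂ] Module.End ℂ (Env G)) (GN : ℤ → Set N)
    (hle : ∀ j ≤ k, ∀ x ∈ GN j, Φ x ∈ piece hG hE hk j)
    (h1 : ∀ j > k, ∀ x ∈ GN j, Φ x 1 = 0)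
    (hb : ∀ j > k, ∀ x ∈ GN j, ∀ a < 0, ∀ y ∈ G a, ∃ x' ∈ GN (j + a),
      superBracket (endSigma hG) (Φ x) (envL G y) = Φ x')
    {j : ℤ} {x : N} (hx : x ∈ GN j) : Φ x ∈ piece hG hE hk j := by
  have main : ∀ n : ℕ, ∀ j ≤ k + n, ∀ x ∈ GN j, Φ x ∈ piece hG hE hk j := by
    intro n
    induction n with
    | zero => intro j hj; exact hle j (by simpa using hj)
    | succ n ih =>
      intro j hj x hx
      rcases le_or_gt j k with hjk | hjk
      · exact hle j hjk x hx
      · refine (mem_piece_of_gt hG hE hk hjk).2 ⟨h1 j hjk x hx, fun a ha y hy => ?_⟩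
        obtain ⟨x', hx', h⟩ := hb j hjk x hx a ha y hy
        rw [h]
        exact ih _ (by push_cast at hj; omega) _ hx'
  exact main (j - k).toNat j (by omega) x hx

/-- Universality of the pieces: above degree `k` the operators of an extension kill 1, and their
commutators with 𝔪 come from elements of lower degree. -/
theorem extRep_mem_piece {Q : Type v} [AddCommGroup Q] [Module ℂ Q] [LieSuperalgebra Q]
    {GQ : ℤ → Submodule ℂ Q} {κ : truncation G k →ₗ[ℂ] Q}
    (hQ : IsEffectiveExtension G k GQ κ) {j : ℤ} {x : Q} (hx : x ∈ GQ j) :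
    extRep hG hQ hk x ∈ piece hG hE hk j := by
  refine mem_piece_of_graded hG hE hk (extRep hG hQ hk) (fun j => (GQ j : Set Q)) ?_ ?_ ?_ hx
  · intro j hj x hx
    obtain ⟨y, hy, rfl⟩ := exists_extMap_eq hG hQ hj hx
    rw [extRep_extMap hG hQ hk (self_isEffectiveExtension hG hE k) hj hy,
      extMap_apply hG _ hj hy, piece_of_le hG hE hk hj]
    exact Submodule.mem_map_of_mem hy
  · intro j hj x hx
    exact extRep_one_of_nonneg hG hQ hk (by omega) hx
  · intro j hj x hx a ha y hy
    exact ⟨_, hQ.isGrading.bracket_mem j a x hx _ (extMap_mem hG hQ (by omega) hy),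
      superBracket_extRep_envL hG hQ hk ha hy x⟩

theorem endSigma_mem_piece {j : ℤ} {T : Module.End ℂ (Env G)} (hT : T ∈ piece hG hE hk j) :
    endSigma hG T ∈ piece hG hE hk j := by
  refine mem_piece_of_graded hG hE hk (endSigma hG).toLinearMap
    (fun j => (piece hG hE hk j : Set _)) ?_ ?_ ?_ hT
  · intro j hj T hT
    rw [SetLike.mem_coe, piece_of_le hG hE hk hj] at hT
    obtain ⟨x, hx, rfl⟩ := hT
    rw [piece_of_le hG hE hk hj, AlgHom.toLinearMap_apply, endSigma_extRep]
    exact Submodule.mem_map_of_mem (hG.sigma_mem hx)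
  · intro j hj T hT
    simp [endSigma_apply, piece_apply_one hG hE hk (by omega) hT]
  · intro j hj T hT a ha y hy
    refine ⟨_, superBracket_envL_mem_piece hG hE hk hT ha (hG.sigma_mem hy), ?_⟩
    simp only [AlgHom.toLinearMap_apply]
    rw [map_superBracket, endSigma_envL, sigma_sigma]

theorem exists_homogeneous_add_piece {j : ℤ} {T : Module.End ℂ (Env G)}
    (hT : T ∈ piece hG hE hk j) : ∃ T0 ∈ piece hG hE hk j, ∃ T1 ∈ piece hG hE hk j,
      endSigma hG T0 = koszulSign 0 1 • T0 ∧ endSigma hG T1 = koszulSign 1 1 • T1 ∧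
      T = T0 + T1 := by
  have hσ := endSigma_mem_piece hG hE hk hT
  refine ⟨(2⁻¹ : ℂ) • (T + endSigma hG T), Submodule.smul_mem _ _ (add_mem hT hσ),
    (2⁻¹ : ℂ) • (T - endSigma hG T), Submodule.smul_mem _ _ (sub_mem hT hσ), ?_, ?_, ?_⟩
  · simp only [map_smul, map_add, endSigma_endSigma, koszulSign_zero_left]; module
  · simp only [map_smul, map_sub, endSigma_endSigma, koszulSign_one_one]; module
  · module

/-- Induction on the total degree. Above `k`, the Jacobi identity moves a commutator with 𝔪 into one
of the two entries, which lowers the sum of the degrees. Negative entries are left multiplications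
and are covered by the definition. -/
theorem superBracket_mem_piece {i j : ℤ} {S T : Module.End ℂ (Env G)}
    (hS : S ∈ piece hG hE hk i) (hT : T ∈ piece hG hE hk j) :
    superBracket (endSigma hG) S T ∈ piece hG hE hk (i + j) := by
  -- Each piece contains the parity components of its elements, so the order of the entries can be
  -- exchanged by skew-symmetry.
  have hskew : ∀ {i j : ℤ}, (∀ S ∈ piece hG hE hk i, ∀ T ∈ piece hG hE hk j,
      superBracket (endSigma hG) S T ∈ piece hG hE hk (i + j)) →
      ∀ T ∈ piece hG hE hk j, ∀ S ∈ piece hG hE hk i,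
      superBracket (endSigma hG) T S ∈ piece hG hE hk (j + i) := by
    intro i j h T hT S hS
    obtain ⟨S0, hS0, S1, hS1, p0, p1, rfl⟩ := exists_homogeneous_add_piece hG hE hk hS
    obtain ⟨T0, hT0, T1, hT1, q0, q1, rfl⟩ := exists_homogeneous_add_piece hG hE hk hT
    have key : ∀ {p q : ZMod 2} {S T : Module.End ℂ (Env G)}, S ∈ piece hG hE hk i →
        T ∈ piece hG hE hk j → endSigma hG S = koszulSign p 1 • S →
        endSigma hG T = koszulSign q 1 • T →
        superBracket (endSigma hG) T S ∈ piece hG hE hk (j + i) := by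
      intro p q S T hS hT hp hq
      rw [superBracket_skew hq hp, add_comm]
      exact neg_mem (Submodule.smul_mem _ _ (h S hS T hT))
    simp only [map_add, LinearMap.add_apply]
    exact add_mem (add_mem (key hS0 hT0 p0 q0) (key hS0 hT1 p0 q1))
      (add_mem (key hS1 hT0 p1 q0) (key hS1 hT1 p1 q1))
  have hneg : ∀ {i j : ℤ}, j < 0 → ∀ S ∈ piece hG hE hk i, ∀ T ∈ piece hG hE hk j,
      superBracket (endSigma hG) S T ∈ piece hG hE hk (i + j) := by
    intro i j hj S hS T hT
    obtain ⟨y, hy, rfl⟩ := exists_envL_eq hG hE hk hj hT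
    exact superBracket_envL_mem_piece hG hE hk hS hj hy
  have main : ∀ n : ℕ, ∀ i j, i + j ≤ k + n → ∀ S ∈ piece hG hE hk i, ∀ T ∈ piece hG hE hk j,
      superBracket (endSigma hG) S T ∈ piece hG hE hk (i + j) := by
    intro n
    induction n with
    | zero =>
      intro i j hij S hS T hT
      rcases lt_or_ge j 0 with hj | hj
      · exact hneg hj S hS T hT
      rcases lt_or_ge i 0 with hi | hi
      · exact hskew (hneg hi) S hS T hT
      -- Two nonnegative degrees with sum at most `k` are both at most `k`, so all three pieces are
      -- images of pieces of `G`.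
      rw [piece_of_le hG hE hk (by push_cast at hij; omega)] at hS hT ⊢
      obtain ⟨x, hx, rfl⟩ := hS
      obtain ⟨y, hy, rfl⟩ := hT
      rw [selfRep, ← extRep_bracket]
      exact Submodule.mem_map_of_mem (hG.bracket_mem _ _ _ hx _ hy)
    | succ n ih =>
      intro i j hij S hS T hT
      rcases lt_or_ge j 0 with hj | hj
      · exact hneg hj S hS T hT
      rcases lt_or_ge i 0 with hi | hi
      · exact hskew (hneg hi) S hS T hT
      rcases le_or_gt (i + j) k with hk' | hk'
      · exact ih i j (by omega) S hS T hT
      refine (mem_piece_of_gt hG hE hk hk').2 ⟨?_, fun a ha y hy => ?_⟩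
      · have h1 := piece_apply_one hG hE hk hi hS
        have h2 := piece_apply_one hG hE hk hj hT
        have h3 := piece_apply_one hG hE hk hi (endSigma_mem_piece hG hE hk hS)
        rw [superBracket_apply]
        simp [h1, h2, h3]
      · have key : ∀ {p q : ZMod 2} {T : Module.End ℂ (Env G)} {y : L}, T ∈ piece hG hE hk j →
            y ∈ G a → endSigma hG T = koszulSign p 1 • T → y ∈ parity q →
            superBracket (endSigma hG) (superBracket (endSigma hG) S T) (envL G y) ∈
              piece hG hE hk (i + j + a) := by
          intro p q T y hT hy hp hq
          have h := superBracket_bracket_right (endSigma_endSigma hG) S hp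
            (endSigma_envL_of_mem hG hq)
          rw [eq_sub_iff_add_eq] at h
          rw [← h]
          refine add_mem ?_ (Submodule.smul_mem _ _ ?_)
          · rw [add_assoc]
            exact ih _ _ (by push_cast at hij; omega) _ hS _
              (superBracket_envL_mem_piece hG hE hk hT ha hy)
          · rw [add_right_comm]
            exact ih _ _ (by push_cast at hij; omega) _
              (superBracket_envL_mem_piece hG hE hk hS ha hy) _ hT
        obtain ⟨T0, hT0, T1, hT1, q0, q1, rfl⟩ := exists_homogeneous_add_piece hG hE hk hT
        rw [← parityComponent_add y]
        have hy' := fun i => hG.parityComponent_mem i hy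
        have py := fun i => parityComponent_mem i y
        simp only [map_add, LinearMap.add_apply]
        exact add_mem (add_mem (key hT0 (hy' _) q0 (py 0)) (key hT1 (hy' _) q1 (py 0)))
          (add_mem (key hT0 (hy' _) q0 (py 1)) (key hT1 (hy' _) q1 (py 1)))
  exact main (i + j - k).toNat i j (by omega) S hS T hT

/-- Induction on an upper bound for the degrees in a relation. Commutators with G₋₁ lower all
degrees by one, so by induction every summand commutes with G₋₁, and the nonnegative ones vanish. A
relation in negative degrees is evaluated at 1 and read in 𝔪. -/
theorem piece_iSupIndep (hF : IsFundamental G) : iSupIndep (piece hG hE hk) := by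
  have main : ∀ n : ℕ, ∀ (s : Finset ℤ) (v : ℤ → Module.End ℂ (Env G)), (∀ i ∈ s, i < n) →
      (∀ i ∈ s, v i ∈ piece hG hE hk i) → ∑ i ∈ s, v i = 0 → ∀ i ∈ s, v i = 0 := by
    intro n
    induction n with
    | zero =>
      intro s v hs hv hsum
      have hy : ∀ i : s, ∃ y ∈ G i, v i = envL G y := fun i =>
        exists_envL_eq hG hE hk (by simpa using hs i i.2) (hv i i.2)
      choose y hyG hyv using hy
      have h1 : envι G (∑ i : s, y i) = 0 := by
        have := DFunLike.congr_fun hsum 1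
        rw [← Finset.sum_coe_sort] at this
        simp only [hyv, LinearMap.sum_apply, envL_apply, mul_one, LinearMap.zero_apply] at this
        rwa [map_sum]
      have h2 := eq_zero_of_envι_eq_zero hG hF (Submodule.sum_mem _ fun i _ =>
        mem_truncation (by have := hs i i.2; push_cast at this; omega) (hyG i)) h1
      have h3 := (iSupIndep_iff_finsetSum_eq_zero_imp_eq_zero _).1
        hG.isInternal.submodule_iSupIndep s (fun i => if h : i ∈ s then y ⟨i, h⟩ else 0)
        (fun i hi => by simpa [hi] using hyG ⟨i, hi⟩)
        (by rw [← Finset.sum_coe_sort, ← h2]; exact Finset.sum_congr rfl fun i _ => by simp)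
      intro i hi
      have := h3 i hi
      simp only [hi, dif_pos] at this
      rw [show v i = _ from hyv ⟨i, hi⟩, this, map_zero]
    | succ n ih =>
      intro s v hs hv hsum
      have hb : ∀ y ∈ G (-1), ∀ i ∈ s, superBracket (endSigma hG) (v i) (envL G y) = 0 := by
        intro y hy i hi
        have := ih (s.image (· - 1))
          (fun i => superBracket (endSigma hG) (v (i + 1)) (envL G y))
          (by
            intro i hi
            obtain ⟨j, hj, rfl⟩ := Finset.mem_image.1 hi
            have := hs j hj
            push_cast at this; omega)
          (by
            intro i hi
            obtain ⟨j, hj, rfl⟩ := Finset.mem_image.1 hi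
            have := superBracket_envL_mem_piece hG hE hk (hv j hj) (by omega) hy
            simpa [sub_eq_add_neg] using this)
          (by
            rw [Finset.sum_image (by intro a _ b _ h; simpa using h)]
            simp only [sub_add_cancel]
            rw [← LinearMap.sum_apply, ← map_sum, hsum, map_zero, LinearMap.zero_apply])
          (i - 1) (Finset.mem_image_of_mem _ hi)
        simpa using this
      have hnonneg : ∀ i ∈ s, 0 ≤ i → v i = 0 := fun i hi h0 =>
        eq_zero_of_commutes hG hF (piece_apply_one hG hE hk h0 (hv i hi)) fun y hy => hb y hy i hi
      rcases Nat.eq_zero_or_pos n with rfl | hn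
      · have hz := ih (s.filter (· < 0)) v (fun i hi => by simpa using (Finset.mem_filter.1 hi).2)
          (fun i hi => hv i (Finset.mem_filter.1 hi).1) (by
            rw [← hsum]
            refine Finset.sum_subset (Finset.filter_subset _ _) fun i hi hi' => hnonneg i hi ?_
            simpa [hi] using hi')
        intro i hi
        rcases lt_or_ge i 0 with h | h
        · exact hz i (Finset.mem_filter.2 ⟨hi, h⟩)
        · exact hnonneg i hi h
      · have hz := ih (s.filter (· < 0)) v
          (fun i hi => by have := (Finset.mem_filter.1 hi).2; omega)
          (fun i hi => hv i (Finset.mem_filter.1 hi).1) (by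
            rw [← hsum]
            refine Finset.sum_subset (Finset.filter_subset _ _) fun i hi hi' => hnonneg i hi ?_
            simpa [hi] using hi')
        intro i hi
        rcases lt_or_ge i 0 with h | h
        · exact hz i (Finset.mem_filter.2 ⟨hi, h⟩)
        · exact hnonneg i hi h
  rw [iSupIndep_iff_finsetSum_eq_zero_imp_eq_zero]
  intro s v hv hsum
  -- Any strict common upper bound for the degrees in `s` would do.
  refine main (∑ i ∈ s, (i.toNat + 1)) s v (fun i hi => ?_) hv hsum
  have := Finset.single_le_sum (f := fun i : ℤ => i.toNat + 1) (fun _ _ => Nat.zero_le _) hi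
  omega

end Pieces

/-- Independence of the pieces reduces injectivity to homogeneous elements. There it follows by
induction on the degree: if T_x = 0 then T_{[x,y]} = 0 for y in G₋₁, so [x, y] = 0, and effectivity
gives x = 0. -/
theorem extRep_injective (hG : IsGrading G) (hE : IsEffective G) (hk : -1 ≤ k) (hF : IsFundamental G) {Q : Type v} [AddCommGroup Q] [Module ℂ Q]
    [LieSuperalgebra Q] {GQ : ℤ → Submodule ℂ Q} {κ : truncation G k →ₗ[ℂ] Q}
    (hQ : IsEffectiveExtension G k GQ κ) : Function.Injective (extRep hG hQ hk) := by
  have hpiece : ∀ n : ℕ, ∀ j < (n : ℤ), ∀ x ∈ GQ j, extRep hG hQ hk x = 0 → x = 0 := by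
    intro n
    induction n with
    | zero =>
      intro j hj x hx h
      obtain ⟨y, hy, rfl⟩ := exists_extMap_eq hG hQ (by push_cast at hj; omega) hx
      have h1 := DFunLike.congr_fun h 1
      rw [extRep_one, extRetract_extMap hG hQ (by push_cast at hj; omega) hy] at h1
      rw [eq_zero_of_envι_eq_zero hG hF (mem_truncation (by push_cast at hj; omega) hy) h1,
        map_zero]
    | succ n ih =>
      intro j hj x hx h
      rcases lt_or_ge j n with hj' | hj'
      · exact ih j hj' x hx h
      refine hQ.isEffective j (by omega) x hx fun z hz => ?_
      obtain ⟨y, hy, rfl⟩ := exists_extMap_eq hG hQ hk hz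
      refine ih (j + -1) (by push_cast at hj; omega) _ (hQ.isGrading.bracket_mem _ _ _ hx _ hz) ?_
      rw [← superBracket_extRep_envL hG hQ hk (by omega) hy, h, map_zero, LinearMap.zero_apply]
  rw [injective_iff_map_eq_zero]
  intro x hx
  have hmem : x ∈ ⨆ j, GQ j := by rw [hQ.isGrading.isInternal.submodule_iSup_eq_top]; trivial
  obtain ⟨f, hf, rfl⟩ := (Submodule.mem_iSup_iff_exists_finsupp _ _).1 hmem
  rw [Finsupp.sum, map_sum] at hx
  have h0 := (iSupIndep_iff_finsetSum_eq_zero_imp_eq_zero _).1 (piece_iSupIndep hG hE hk hF)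
    f.support _ (fun i _ => extRep_mem_piece hG hE hk hQ (hf i)) hx
  refine Finset.sum_eq_zero fun i hi => ?_
  exact hpiece (i.toNat + 1) i (by push_cast; omega) _ (hf i) (h0 i hi)

end Prolongation

end LieSuperalgebra

namespace LieSuperalgebra

/-! ### Transport along isomorphisms -/

section Transport

variable {L : Type u} [AddCommGroup L] [Module ℂ L] [LieSuperalgebra L]
variable {L' : Type v} [AddCommGroup L'] [Module ℂ L'] [LieSuperalgebra L']

theorem Iso.map_bracket (e : Iso L L') (x y : L) :
    e.toLinearEquiv (bracket x y) = bracket (e.toLinearEquiv x) (e.toLinearEquiv y) :=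
  e.isHom.map_bracket x y

theorem Iso.map_mem_parity (e : Iso L L') {i : ZMod 2} {x : L} (hx : x ∈ parity i) :
    e.toLinearEquiv x ∈ parity i := e.isHom.map_parity i x hx

theorem Iso.map_sigma (e : Iso L L') (x : L) :
    e.toLinearEquiv (sigma L x) = sigma L' (e.toLinearEquiv x) := by
  have h : ∀ i, e.toLinearEquiv (sigma L (parityComponent i x)) =
      sigma L' (e.toLinearEquiv (parityComponent i x)) := fun i => by
    rw [sigma_of_mem (parityComponent_mem i x), map_smul,
      sigma_of_mem (e.map_mem_parity (parityComponent_mem i x))]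
  rw [← parityComponent_add x]
  simp only [map_add, h]

theorem Iso.mem_parity_iff (e : Iso L L') {i : ZMod 2} {x : L} :
    e.toLinearEquiv x ∈ parity i ↔ x ∈ parity i := by
  rw [LieSuperalgebra.mem_parity_iff, LieSuperalgebra.mem_parity_iff, ← e.map_sigma,
    ← map_smul, e.toLinearEquiv.injective.eq_iff]

/-- The inverse of an isomorphism. -/
def Iso.symm (e : Iso L L') : Iso L' L where
  toLinearEquiv := e.toLinearEquiv.symm
  isHom :=
    { map_bracket := fun x y => by
        apply e.toLinearEquiv.injective
        simp [e.map_bracket]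
      map_parity := fun i x hx => by
        rw [← e.mem_parity_iff]
        simpa using hx }

/-- The composition of two isomorphisms. -/
def Iso.trans {L'' : Type w} [AddCommGroup L''] [Module ℂ L''] [LieSuperalgebra L'']
    (e : Iso L L') (f : Iso L' L'') : Iso L L'' where
  toLinearEquiv := e.toLinearEquiv.trans f.toLinearEquiv
  isHom :=
    { map_bracket := fun x y => by simp [e.map_bracket, f.map_bracket]
      map_parity := fun i x hx => by simpa using f.map_mem_parity (e.map_mem_parity hx) }

/-- The image of a family of subspaces under an isomorphism. -/
def Iso.mapGrading (e : Iso L L') (G : ℤ → Submodule ℂ L) (k : ℤ) : Submodule ℂ L' :=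
  (G k).map e.toLinearEquiv.toLinearMap

theorem Iso.mem_mapGrading (e : Iso L L') {G : ℤ → Submodule ℂ L} {k : ℤ} {x : L'} :
    x ∈ e.mapGrading G k ↔ e.toLinearEquiv.symm x ∈ G k := by
  constructor
  · rintro ⟨y, hy, rfl⟩
    simpa using hy
  · intro h
    exact ⟨_, h, by simp⟩

theorem Iso.apply_mem_mapGrading (e : Iso L L') {G : ℤ → Submodule ℂ L} {k : ℤ} {x : L} :
    e.toLinearEquiv x ∈ e.mapGrading G k ↔ x ∈ G k := by
  rw [e.mem_mapGrading, LinearEquiv.symm_apply_apply]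

theorem Iso.mapGrading_symm (e : Iso L L') (G : ℤ → Submodule ℂ L) :
    e.symm.mapGrading (e.mapGrading G) = G := by
  ext k x
  rw [e.symm.mem_mapGrading, e.mem_mapGrading]
  simp [Iso.symm]

theorem IsGrading.map {G : ℤ → Submodule ℂ L} (hG : IsGrading G) (e : Iso L L') :
    IsGrading (e.mapGrading G) where
  isInternal := by
    rw [DirectSum.isInternal_submodule_iff_iSupIndep_and_iSup_eq_top]
    constructor
    · exact (iSupIndep_map_orderIso_iff (Submodule.orderIsoMapComap e.toLinearEquiv)).2
        hG.isInternal.submodule_iSupIndep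
    · change ⨆ k, (G k).map e.toLinearEquiv.toLinearMap = ⊤
      rw [← Submodule.map_iSup, hG.isInternal.submodule_iSup_eq_top, Submodule.map_top]
      exact LinearEquiv.range _
  homogeneous k := by
    apply le_antisymm
    · intro x hx
      rw [← parityComponent_add x]
      refine Submodule.add_mem_sup ⟨?_, LieSuperalgebra.parityComponent_mem 0 x⟩
        ⟨?_, LieSuperalgebra.parityComponent_mem 1 x⟩ <;>
      · rw [SetLike.mem_coe, e.mem_mapGrading] at *
        rw [parityComponent_apply, map_smul, map_add, map_smul]
        have := hG.sigma_mem hx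
        rw [show sigma L (e.toLinearEquiv.symm x) = e.toLinearEquiv.symm (sigma L' x) from
          (e.symm.map_sigma x).symm] at this
        exact Submodule.smul_mem _ _ (add_mem hx (Submodule.smul_mem _ _ this))
    · exact sup_le inf_le_left inf_le_left
  bracket_mem i j x hx y hy := by
    rw [e.mem_mapGrading] at *
    have := hG.bracket_mem i j _ hx _ hy
    rwa [← show _ = bracket (e.toLinearEquiv.symm x) (e.toLinearEquiv.symm y) from
      e.symm.map_bracket x y] at this

theorem IsEffective.map {G : ℤ → Submodule ℂ L} (hG : IsEffective G) (e : Iso L L') :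
    IsEffective (e.mapGrading G) := by
  intro k hk x hx h
  rw [e.mem_mapGrading] at hx
  rw [← e.toLinearEquiv.symm.map_eq_zero_iff]
  refine hG k hk _ hx fun y hy => ?_
  have := h (e.toLinearEquiv y) (e.apply_mem_mapGrading.2 hy)
  apply e.toLinearEquiv.injective
  rw [e.map_bracket, LinearEquiv.apply_symm_apply, this, map_zero]

variable {Q : Type w} [AddCommGroup Q] [Module ℂ Q] [LieSuperalgebra Q]

/-- Effective extensions can be replaced by isomorphic ones. -/
theorem IsEffectiveExtension.map_target {G : ℤ → Submodule ℂ Q} {k : ℤ}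
    {G' : ℤ → Submodule ℂ L} {ι : truncation G k →ₗ[ℂ] L} (h : IsEffectiveExtension G k G' ι)
    (e : Iso L L') :
    IsEffectiveExtension G k (e.mapGrading G') (e.toLinearEquiv.toLinearMap ∘ₗ ι) where
  isGrading := h.isGrading.map e
  isEffective := h.isEffective.map e
  injective := e.toLinearEquiv.injective.comp h.injective
  map_comp i hi := by rw [Submodule.map_comp, h.map_comp i hi]; rfl
  map_parity i x hx := e.map_mem_parity (h.map_parity i x hx)
  map_bracket i j hi hj hij x y z hx hy hz := by
    have := h.map_bracket i j hi hj hij x y z hx hy hz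
    simp only [LinearMap.comp_apply, LinearEquiv.coe_coe, ← this, e.map_bracket]

/-- The equivalence of truncations induced by an isomorphism. -/
noncomputable def Iso.truncationEquiv (e : Iso L L') (G : ℤ → Submodule ℂ L) (k : ℤ) :
    truncation G k ≃ₗ[ℂ] truncation (e.mapGrading G) k :=
  (e.toLinearEquiv.submoduleMap (truncation G k)).trans (LinearEquiv.ofEq _ _ (by
    simp only [truncation, Submodule.map_iSup]; rfl))

theorem Iso.coe_truncationEquiv (e : Iso L L') (G : ℤ → Submodule ℂ L) (k : ℤ)
    (x : truncation G k) : (e.truncationEquiv G k x : L') = e.toLinearEquiv x := rfl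

theorem IsEffectiveExtension.map_source {G : ℤ → Submodule ℂ L} {k : ℤ} (e : Iso L L')
    {G' : ℤ → Submodule ℂ Q} {ι : truncation (e.mapGrading G) k →ₗ[ℂ] Q}
    (h : IsEffectiveExtension (e.mapGrading G) k G' ι) :
    IsEffectiveExtension G k G' (ι ∘ₗ (e.truncationEquiv G k).toLinearMap) where
  isGrading := h.isGrading
  isEffective := h.isEffective
  injective := h.injective.comp (e.truncationEquiv G k).injective
  map_comp i hi := by
    rw [Submodule.map_comp, ← h.map_comp i hi]
    congr 1
    ext x
    rw [Submodule.mem_comap, e.mem_mapGrading]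
    constructor
    · rintro ⟨y, hy, rfl⟩
      simpa [Iso.coe_truncationEquiv] using hy
    · intro hx
      refine ⟨(e.truncationEquiv G k).symm x, ?_, by simp⟩
      have : (((e.truncationEquiv G k).symm x : truncation G k) : L) =
          e.toLinearEquiv.symm x := by
        rw [LinearEquiv.eq_symm_apply, ← e.coe_truncationEquiv, LinearEquiv.apply_symm_apply]
      simpa [this] using hx
  map_parity i x hx := h.map_parity i _ (e.map_mem_parity hx)
  map_bracket i j hi hj hij x y z hx hy hz := by
    refine h.map_bracket i j hi hj hij _ _ _ (e.apply_mem_mapGrading.2 hx)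
      (e.apply_mem_mapGrading.2 hy) ?_
    simp only [LinearEquiv.coe_coe, Iso.coe_truncationEquiv, ← e.map_bracket, hz]

theorem IsEffectiveExtension.map_source_symm {G : ℤ → Submodule ℂ L} {k : ℤ} (e : Iso L L')
    {G' : ℤ → Submodule ℂ Q} {ι : truncation G k →ₗ[ℂ] Q} (h : IsEffectiveExtension G k G' ι) :
    IsEffectiveExtension (e.mapGrading G) k G' (ι ∘ₗ (e.truncationEquiv G k).symm.toLinearMap) := by
  have hcoe : ∀ x, (((e.truncationEquiv G k).symm x : truncation G k) : L) =
      e.toLinearEquiv.symm x := by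
    intro x
    rw [LinearEquiv.eq_symm_apply, ← e.coe_truncationEquiv, LinearEquiv.apply_symm_apply]
  refine ⟨h.isGrading, h.isEffective, h.injective.comp (e.truncationEquiv G k).symm.injective,
    ?_, ?_, ?_⟩
  · intro i hi
    rw [Submodule.map_comp, ← h.map_comp i hi]
    congr 1
    ext x
    constructor
    · rintro ⟨y, hy, rfl⟩
      have hy' := e.mem_mapGrading.1 hy
      simpa [hcoe] using hy'
    · intro hx
      refine ⟨e.truncationEquiv G k x, ?_, by simp⟩
      simpa [Iso.coe_truncationEquiv, e.apply_mem_mapGrading] using hx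
  · intro i x hx
    refine h.map_parity i _ ?_
    simp only [LinearEquiv.coe_coe, hcoe]
    exact e.symm.map_mem_parity hx
  · intro i j hi hj hij x y z hx hy hz
    refine h.map_bracket i j hi hj hij _ _ _ ?_ ?_ ?_
    · simpa only [LinearEquiv.coe_coe, hcoe] using e.mem_mapGrading.1 hx
    · simpa only [LinearEquiv.coe_coe, hcoe] using e.mem_mapGrading.1 hy
    · simp only [LinearEquiv.coe_coe, hcoe, ← hz]
      exact (e.symm.map_bracket _ _).symm

theorem IsMaximalProlongation.map_source {G : ℤ → Submodule ℂ L} {k : ℤ} (e : Iso L L')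
    {P : Type*} [AddCommGroup P] [Module ℂ P] [LieSuperalgebra P]
    {G' : ℤ → Submodule ℂ P} {ι : truncation (e.mapGrading G) k →ₗ[ℂ] P}
    (h : IsMaximalProlongation.{v, _, w} (e.mapGrading G) k G' ι) :
    IsMaximalProlongation.{u, _, w} G k G' (ι ∘ₗ (e.truncationEquiv G k).toLinearMap) := by
  refine ⟨h.1.map_source e, fun R _ _ _ GR κ hR => ?_⟩
  obtain ⟨f, hf, hinj, hgr, hκ⟩ := h.2 R GR _ (hR.map_source_symm e)
  refine ⟨f, hf, hinj, hgr, fun x => ?_⟩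
  have := hκ (e.truncationEquiv G k x)
  simpa using this

end Transport

theorem ProlongationIsInfinite.of_iso {L L' : Type u} [AddCommGroup L] [Module ℂ L]
    [LieSuperalgebra L] [AddCommGroup L'] [Module ℂ L'] [LieSuperalgebra L'] (e : Iso L L')
    {G : ℤ → Submodule ℂ L} {k : ℤ} (h : ProlongationIsInfinite.{u, w} (e.mapGrading G) k) :
    ProlongationIsInfinite.{u, w} G k := by
  obtain ⟨P, i1, i2, i3, GP, ι, h1, h2⟩ := h
  exact ⟨P, i1, i2, i3, GP, _, h1.map_source e, h2⟩

/-- Source and target have to be moved together: composing with the inverse isomorphism turns the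
transported inclusion of the truncation back into the inclusion. -/
theorem ProlongationIsSelf.of_iso {L L' : Type u} [AddCommGroup L] [Module ℂ L]
    [LieSuperalgebra L] [AddCommGroup L'] [Module ℂ L'] [LieSuperalgebra L'] (e : Iso L L')
    {G : ℤ → Submodule ℂ L} {k : ℤ} (h : ProlongationIsSelf.{u, w} (e.mapGrading G) k) :
    ProlongationIsSelf.{u, w} G k := by
  have h' := IsMaximalProlongation.map_source e h
  have h1 := h'.1.map_target e.symm
  rw [e.mapGrading_symm] at h1
  have hι : (e.symm.toLinearEquiv.toLinearMap ∘ₗ (truncation (e.mapGrading G) k).subtype ∘ₗ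
      (e.truncationEquiv G k).toLinearMap) = (truncation G k).subtype := by
    ext x
    simp [Iso.symm, Iso.coe_truncationEquiv]
  rw [hι] at h1
  refine ⟨h1, fun R _ _ _ GR κ hR => ?_⟩
  obtain ⟨f, hf, hinj, hgr, hκ⟩ := h'.2 R GR κ hR
  refine ⟨e.symm.toLinearEquiv.toLinearMap ∘ₗ f, ⟨?_, ?_⟩,
    e.symm.toLinearEquiv.injective.comp hinj, ?_, ?_⟩
  · intro x y
    simp [hf.map_bracket, e.symm.map_bracket]
  · intro i x hx
    exact e.symm.map_mem_parity (hf.map_parity i x hx)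
  · intro i
    rw [Submodule.map_comp]
    refine (Submodule.map_mono (hgr i)).trans ?_
    exact (congrFun (e.mapGrading_symm G) i).le
  · intro x
    have := congrArg e.toLinearEquiv.symm (hκ x)
    simpa [Iso.symm, Iso.coe_truncationEquiv] using this

/-- The structure of a Lie superalgebra on `ULift`. -/
@[reducible]
noncomputable def uliftLieSuperalgebra (P : Type u) [AddCommGroup P] [Module ℂ P]
    [LieSuperalgebra P] : LieSuperalgebra (ULift.{w} P) where
  bracket := LinearMap.mk₂ ℂ (fun x y => ⟨bracket x.down y.down⟩)
    (by intros; ext; simp) (by intros; ext; simp) (by intros; ext; simp) (by intros; ext; simp)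
  parity i := (parity i).comap ULift.moduleEquiv.toLinearMap
  isCompl_parity := by
    have h := isCompl_parity (L := P)
    constructor
    · rw [Submodule.disjoint_def]
      intro x h0 h1
      exact ULift.ext _ _ ((Submodule.disjoint_def.1 h.disjoint) _ h0 h1)
    · rw [codisjoint_iff, eq_top_iff]
      rintro ⟨x⟩ -
      obtain ⟨y, hy, z, hz, rfl⟩ := exists_even_add_odd x
      rw [show (⟨y + z⟩ : ULift.{w} P) = ⟨y⟩ + ⟨z⟩ from rfl]
      exact Submodule.add_mem_sup hy hz
  bracket_mem hx hy := LieSuperalgebra.bracket_mem (L := P) hx hy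
  skew hx hy := ULift.ext _ _ (LieSuperalgebra.skew (L := P) hx hy)
  jacobi z hx hy := ULift.ext _ _ (LieSuperalgebra.jacobi (L := P) z.down hx hy)

/-- If the prolongation is infinite-dimensional, then it differs from the algebra itself. -/
theorem ProlongationIsInfinite.not_self {L : Type} [AddCommGroup L] [Module ℂ L]
    [LieSuperalgebra L] [FiniteDimensional ℂ L] {G : ℤ → Submodule ℂ L} {k : ℤ}
    (h : ProlongationIsInfinite.{0, w} G k) : ¬ ProlongationIsSelf.{0, w} G k := by
  intro hs
  obtain ⟨P, _, _, _, GP, ι, h1, h2⟩ := h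
  -- Maximality is tested against extensions in universe `w`, so the prolongation is lifted there
  -- before it is embedded into the finite-dimensional algebra.
  let := uliftLieSuperalgebra.{0, w} P
  let e : Iso P (ULift.{w} P) :=
    { toLinearEquiv := ULift.moduleEquiv.symm
      isHom := { map_bracket := fun x y => rfl, map_parity := fun i x hx => hx } }
  obtain ⟨f, -, hf, -⟩ := hs.2 (ULift.{w} P) _ _ (h1.1.map_target e)
  exact h2 (FiniteDimensional.of_injective (f ∘ₗ e.toLinearEquiv.toLinearMap)
    (hf.comp e.toLinearEquiv.injective))

/-! ### Existence of the maximal prolongation and two criteria -/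

section Criteria

variable {k : ℤ}

/-- Makes the sum of the independent pieces a graded space in its own right. -/
theorem isInternal_comap_iSup {V : Type*} [AddCommGroup V] [Module ℂ V] {F : ℤ → Submodule ℂ V}
    (h : iSupIndep F) : DirectSum.IsInternal fun j => (F j).comap (⨆ j, F j).subtype := by
  rw [DirectSum.isInternal_submodule_iff_iSupIndep_and_iSup_eq_top]
  constructor
  · rw [iSupIndep_iff_finsetSum_eq_zero_imp_eq_zero] at h ⊢
    intro s v hv hsum i hi
    exact Subtype.ext (h s (fun i => (v i : V)) hv (by rw [← Submodule.coe_sum, hsum]; rfl) i hi)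
  · have : (⨆ j, F j) ≤ (⨆ j, (F j).comap (⨆ j, F j).subtype).map (⨆ j, F j).subtype :=
      iSup_le fun j T hT => ⟨⟨T, Submodule.mem_iSup_of_mem j hT⟩,
        Submodule.mem_iSup_of_mem (p := fun j => (F j).comap (⨆ j, F j).subtype) j hT, rfl⟩
    rw [eq_top_iff]
    intro x _
    obtain ⟨y, hy, hyx⟩ := this x.2
    rwa [← Subtype.ext hyx]

/-- The prolongation is infinite-dimensional if the space spanned by its pieces is. -/
theorem prolongationIsInfinite_of_piece {L : Type} [AddCommGroup L] [Module ℂ L]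
    [LieSuperalgebra L] {G : ℤ → Submodule ℂ L} (hG : IsGrading G) (hE : IsEffective G)
    (hk : -1 ≤ k) (hF : IsFundamental G)
    (hinf : ¬ FiniteDimensional ℂ (⨆ j, piece hG hE hk j : Submodule ℂ (Module.End ℂ (Env G)))) :
    ProlongationIsInfinite.{0, w} G k := by
  -- This span is the maximal prolongation. It is stable under supercommutators and parity because
  -- the pieces are.
  set p : Submodule ℂ (Module.End ℂ (Env G)) := ⨆ j, piece hG hE hk j with hp
  have hle : ∀ j, piece hG hE hk j ≤ p := le_iSup _
  have hbr : ∀ S ∈ p, ∀ T ∈ p, superBracket (endSigma hG) S T ∈ p := by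
    intro S hS T hT
    have h1 : ∀ i, ∀ S ∈ piece hG hE hk i, p ≤ p.comap (superBracket (endSigma hG) S) :=
      fun i S hS => iSup_le fun j T hT => hle _ (superBracket_mem_piece hG hE hk hS hT)
    have h2 : p ≤ p.comap ((superBracket (endSigma hG)).flip T) :=
      iSup_le fun i S hS => h1 i S hS hT
    exact h2 hS
  have hσ : ∀ T ∈ p, endSigma hG T ∈ p := by
    intro T hT
    have : p ≤ p.comap (endSigma hG).toLinearMap :=
      iSup_le fun i T hT => hle _ (endSigma_mem_piece hG hE hk hT)
    exact this hT
  let : LieSuperalgebra p := ofSuperBracket (endSigma_endSigma hG) p hbr hσ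
  have hrepL : ∀ x : L, selfRep hG hE hk x ∈ p := by
    intro x
    exact graded_induction (p := p.comap (selfRep hG hE hk)) hG.isInternal (fun j x hx =>
      hle j (extRep_mem_piece hG hE hk (self_isEffectiveExtension hG hE k) hx)) x
  let GP : ℤ → Submodule ℂ p := fun j => (piece hG hE hk j).comap p.subtype
  have hGP : IsGrading (L := p) GP := by
    refine ⟨?_, ?_, ?_⟩
    · exact isInternal_comap_iSup (piece_iSupIndep hG hE hk hF)
    · intro j
      apply le_antisymm
      · intro x hx
        obtain ⟨T0, h0, T1, h1, e0, e1, h⟩ := exists_homogeneous_add_piece hG hE hk hx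
        have : x = ⟨T0, hle j h0⟩ + ⟨T1, hle j h1⟩ := Subtype.ext h
        rw [this]
        exact Submodule.add_mem_sup ⟨h0, e0⟩ ⟨h1, e1⟩
      · exact sup_le inf_le_left inf_le_left
    · intro i j x hx y hy
      exact superBracket_mem_piece hG hE hk hx hy
  -- Effectivity is the uniqueness principle for operators: a nonnegative element kills 1, and G₋₁
  -- acts by left multiplications.
  have hEP : IsEffective (L := p) GP := by
    intro j hj x hx h
    refine Subtype.ext (eq_zero_of_commutes hG hF (piece_apply_one hG hE hk hj hx) fun y hy => ?_)
    have hy' := envL_mem_piece hG hE hk (by omega) hy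
    exact congrArg Subtype.val (h ⟨_, hle _ hy'⟩ hy')
  let ι : truncation G k →ₗ[ℂ] p :=
    (selfRep hG hE hk ∘ₗ (truncation G k).subtype).codRestrict p fun x => hrepL x
  have hι : IsEffectiveExtension (L' := p) G k GP ι := by
    refine ⟨hGP, hEP, ?_, ?_, ?_, ?_⟩
    · intro x y hxy
      exact Subtype.ext (extRep_injective hG hE hk hF (self_isEffectiveExtension hG hE k)
        (congrArg Subtype.val hxy))
    · intro i hi
      ext T
      change _ ↔ (T : Module.End ℂ (Env G)) ∈ piece hG hE hk i
      rw [piece_of_le hG hE hk hi]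
      constructor
      · rintro ⟨x, hx, rfl⟩
        exact ⟨x, hx, rfl⟩
      · rintro ⟨x, hx, hxT⟩
        exact ⟨⟨x, mem_truncation hi hx⟩, hx, Subtype.ext hxT⟩
    · intro i x hx
      change endSigma hG (selfRep hG hE hk x) = koszulSign i 1 • selfRep hG hE hk x
      rw [endSigma_extRep, sigma_of_mem hx, map_smul]
    · intro i j _ _ _ x y z _ _ hz
      refine Subtype.ext ?_
      change superBracket (endSigma hG) (selfRep hG hE hk x) (selfRep hG hE hk y) =
        selfRep hG hE hk z
      rw [← extRep_bracket, hz]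
  refine ⟨p, inferInstance, inferInstance, inferInstance, GP, ι, ⟨hι, ?_⟩, hinf⟩
  -- Maximality: the action of any extension on U(𝔪) is an injective homomorphism with values in the
  -- pieces.
  intro Q _ _ _ GQ κ hQ
  have hQp : ∀ x : Q, extRep hG hQ hk x ∈ p := fun x =>
    graded_induction (p := p.comap (extRep hG hQ hk)) hQ.isGrading.isInternal
      (fun j x hx => hle j (extRep_mem_piece hG hE hk hQ hx)) x
  refine ⟨(extRep hG hQ hk).codRestrict p hQp, ⟨?_, ?_⟩, ?_, ?_, ?_⟩
  · intro x y
    exact Subtype.ext (extRep_bracket hG hQ hk x y)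
  · intro i x hx
    change endSigma hG (extRep hG hQ hk x) = koszulSign i 1 • extRep hG hQ hk x
    rw [endSigma_extRep, sigma_of_mem hx, map_smul]
  · intro x y hxy
    exact extRep_injective hG hE hk hF hQ (congrArg Subtype.val hxy)
  · rintro i _ ⟨x, hx, rfl⟩
    exact extRep_mem_piece hG hE hk hQ hx
  · intro x
    refine Subtype.ext ?_
    change extRep hG hQ hk (κ x) = selfRep hG hE hk x
    have hx : (x : L) ∈ LinearMap.ker (extRep hG hQ hk ∘ₗ extMap hG κ - selfRep hG hE hk) := by
      refine truncation_induction (fun j hj y hy => ?_) x.2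
      have := extRep_extMap hG hQ hk (self_isEffectiveExtension hG hE k) hj hy
      rw [extMap_apply hG (truncation G k).subtype hj hy] at this
      exact sub_eq_zero.2 this
    have := sub_eq_zero.1 hx
    rwa [LinearMap.comp_apply, extMap_coe] at this

/-- Every derivation of degree `j` from the negative part to the whole algebra agrees with an inner
derivation on `G₋₁`. -/
def InnerDerivations {L : Type u} [AddCommGroup L] [Module ℂ L] [LieSuperalgebra L]
    (G : ℤ → Submodule ℂ L) (j : ℤ) : Prop :=
  ∀ (ε : ZMod 2) (D : L →ₗ[ℂ] L),
    (∀ a < 0, ∀ y ∈ G a, D y ∈ G (j + a)) →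
    (∀ a < 0, ∀ p, ∀ y ∈ G a, y ∈ parity p → D y ∈ parity (ε + p)) →
    (∀ a < 0, ∀ b < 0, ∀ p q, ∀ y ∈ G a, y ∈ parity p → ∀ z ∈ G b, z ∈ parity q →
      D (bracket y z) = bracket (D y) z + koszulSign ε p • bracket y (D z)) →
    ∃ x ∈ G j, ∀ y ∈ G (-1), D y = bracket x y

/-- Let x be an element of an extension, of degree above `k`. By induction on the degree, the
brackets of x with 𝔪 are already represented in the algebra, so ad x is a derivation from 𝔪 to the
algebra. If it agrees on G₋₁ with ad z, then T_x - T_z kills 1 and commutes with G₋₁, so x acts as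
z. -/
theorem prolongationIsSelf_of_innerDerivations {L : Type u} [AddCommGroup L] [Module ℂ L]
    [LieSuperalgebra L] {G : ℤ → Submodule ℂ L} (hG : IsGrading G) (hE : IsEffective G)
    (hk : -1 ≤ k) (hF : IsFundamental G) (hD : ∀ j > k, InnerDerivations G j) :
    ProlongationIsSelf.{u, w} G k := by
  have hL := self_isEffectiveExtension hG hE k
  refine ⟨hL, fun Q _ _ _ GQ κ hQ => ?_⟩
  have hinj := extRep_injective hG hE hk hF hL
  let R := LinearEquiv.ofInjective (selfRep hG hE hk) hinj
  have hR : ∀ (T : LinearMap.range (selfRep hG hE hk)), selfRep hG hE hk (R.symm T) = T := by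
    intro T
    have := congrArg Subtype.val (R.apply_symm_apply T)
    exact this
  have hself : ∀ {j : ℤ}, j ≤ k → ∀ x ∈ G j, extMap hG (truncation G k).subtype x = x :=
    fun hj x hx => extMap_apply hG _ hj hx
  have main : ∀ n : ℕ, ∀ j ≤ k + n, ∀ x ∈ GQ j,
      extRep hG hQ hk x ∈ (G j).map (selfRep hG hE hk) := by
    intro n
    induction n with
    | zero =>
      intro j hj x hx
      have := extRep_mem_piece hG hE hk hQ hx
      rwa [piece_of_le hG hE hk (by simpa using hj)] at this
    | succ n ih =>
      intro j hj x hx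
      rcases le_or_gt j k with hjk | hjk
      · have := extRep_mem_piece hG hE hk hQ hx
        rwa [piece_of_le hG hE hk hjk] at this
      have key : ∀ {ε : ZMod 2} {x : Q}, x ∈ GQ j → x ∈ parity ε →
          extRep hG hQ hk x ∈ (G j).map (selfRep hG hE hk) := by
        intro ε x hx hxε
        -- `N` is ad x on 𝔪, written as operators and extended by zero; the induction hypothesis
        -- allows its values to be pulled back to the algebra.
        let N : L →ₗ[ℂ] Module.End ℂ (Env G) :=
          extRep hG hQ hk ∘ₗ bracket x ∘ₗ extMap hG κ ∘ₗ negPart hG.isInternal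
        have hN : ∀ a < 0, ∀ y ∈ G a, N y = extRep hG hQ hk (bracket x (extMap hG κ y)) := by
          intro a ha y hy
          simp only [N, LinearMap.comp_apply, negPart_of_neg hG.isInternal ha hy]
        have hNm : ∀ a < 0, ∀ y ∈ G a, N y ∈ (G (j + a)).map (selfRep hG hE hk) := by
          intro a ha y hy
          rw [hN a ha y hy]
          exact ih _ (by push_cast at hj; omega) _ (hQ.isGrading.bracket_mem _ _ _ hx _
            (extMap_mem hG hQ (by omega) hy))
        have hNr : ∀ y, N y ∈ LinearMap.range (selfRep hG hE hk) := by
          intro y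
          refine graded_induction (p := (LinearMap.range (selfRep hG hE hk)).comap N)
            hG.isInternal (fun a y hy => ?_) y
          rcases lt_or_ge a 0 with ha | ha
          · obtain ⟨z, -, hz⟩ := hNm a ha y hy
            exact ⟨z, hz⟩
          · refine ⟨0, ?_⟩
            simp [N, negPart_of_nonneg hG.isInternal ha hy]
        let D : L →ₗ[ℂ] L := R.symm.toLinearMap ∘ₗ N.codRestrict _ hNr
        have hDN : ∀ y, selfRep hG hE hk (D y) = N y := fun y => hR _
        have hDmem : ∀ a < 0, ∀ y ∈ G a, D y ∈ G (j + a) := by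
          intro a ha y hy
          obtain ⟨z, hz, hzN⟩ := hNm a ha y hy
          rw [← hDN] at hzN
          rwa [← hinj hzN]
        obtain ⟨z, hz, hzD⟩ := hD j hjk ε D hDmem
          (by
            intro a ha p y hy hyp
            rw [mem_parity_iff]
            apply hinj
            rw [← endSigma_extRep, hDN, map_smul, hDN, hN a ha y hy, endSigma_extRep,
              sigma_of_mem (bracket_mem hxε (extMap_parity hG hQ (by omega) hy hyp)), map_smul])
          (by
            intro a ha b hb p q y hy hyp z hz hzq
            apply hinj
            have h1 := extMap_parity hG hQ (by omega : a ≤ k) hy hyp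
            rw [map_add, map_smul, hDN, extRep_bracket, extRep_bracket, hDN, hDN,
              hN _ (add_neg ha hb) _ (hG.bracket_mem a b y hy z hz), hN a ha y hy, hN b hb z hz,
              ← extMap_bracket hG hQ (by omega) (by omega) (by omega) hy hz, jacobi _ hxε h1,
              map_add, map_smul, extRep_bracket hG hQ hk (bracket x _),
              extRep_bracket hG hQ hk (extMap hG κ y)]
            congr 2
            · rw [extRep_neg hG hQ hk hb hz, selfRep_neg hG hE hk hb hz]
            · congr 2
              rw [extRep_neg hG hQ hk ha hy, selfRep_neg hG hE hk ha hy])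
        refine ⟨z, hz, ?_⟩
        -- Agreement of the two derivations on G₋₁ is all that the uniqueness principle needs.
        refine sub_eq_zero.1 (eq_zero_of_commutes hG hF ?_ fun y hy => ?_)
        · rw [LinearMap.sub_apply, extRep_one_of_nonneg hG hL hk (by omega) hz,
            extRep_one_of_nonneg hG hQ hk (by omega) hx, sub_zero]
        · rw [map_sub, LinearMap.sub_apply, superBracket_extRep_envL hG hQ hk (by omega) hy,
            superBracket_extRep_envL hG hL hk (by omega) hy, hself hk y hy, ← hzD y hy, hDN,
            hN _ (by omega) y hy, sub_self]
      rw [← parityComponent_add x, map_add]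
      exact add_mem (key (hQ.isGrading.parityComponent_mem 0 hx) (parityComponent_mem 0 x))
        (key (hQ.isGrading.parityComponent_mem 1 hx) (parityComponent_mem 1 x))
  have main' : ∀ j, ∀ x ∈ GQ j, extRep hG hQ hk x ∈ (G j).map (selfRep hG hE hk) :=
    fun j => main (j - k).toNat j (by omega)
  have hrange : ∀ x, extRep hG hQ hk x ∈ LinearMap.range (selfRep hG hE hk) := by
    intro x
    refine graded_induction (p := (LinearMap.range (selfRep hG hE hk)).comap (extRep hG hQ hk))
      hQ.isGrading.isInternal (fun j x hx => ?_) x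
    obtain ⟨y, -, hy⟩ := main' j x hx
    exact ⟨y, hy⟩
  let f : Q →ₗ[ℂ] L := R.symm.toLinearMap ∘ₗ (extRep hG hQ hk).codRestrict _ hrange
  have hf : ∀ x, selfRep hG hE hk (f x) = extRep hG hQ hk x := fun x => hR _
  refine ⟨f, ⟨?_, ?_⟩, ?_, ?_, ?_⟩
  · intro x y
    apply hinj
    rw [hf, extRep_bracket, extRep_bracket, hf, hf]
  · intro i x hx
    rw [mem_parity_iff]
    apply hinj
    rw [← endSigma_extRep, map_smul, hf, endSigma_extRep, sigma_of_mem hx, map_smul]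
  · intro x y hxy
    apply extRep_injective hG hE hk hF hQ
    rw [← hf, ← hf, hxy]
  · rintro j _ ⟨x, hx, rfl⟩
    obtain ⟨y, hy, hyx⟩ := main' j x hx
    rw [← hf] at hyx
    rwa [← hinj hyx]
  · intro x
    apply hinj
    rw [hf]
    have hx : (x : L) ∈ LinearMap.ker (extRep hG hQ hk ∘ₗ extMap hG κ - selfRep hG hE hk) := by
      refine truncation_induction (fun j hj y hy => ?_) x.2
      have := extRep_extMap hG hQ hk hL hj hy
      rw [hself hj y hy] at this
      exact sub_eq_zero.2 this
    have := sub_eq_zero.1 hx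
    rwa [LinearMap.comp_apply, extMap_coe] at this

end Criteria

end LieSuperalgebra

namespace D21

open LieSuperalgebra LieAlgebra.SpecialLinear

/-! ### Coordinates in a basis of weight vectors -/

/-- The index set of the weight basis: `inl (i, 0)`, `inl (i, 1)`, `inl (i, 2)` stand for
`Hᵢ`, `Xᵢ`, `Yᵢ`, and `inr (p, q, r)` for `e p ⊗ e q ⊗ e r`. -/
abbrev Idx : Type := (Fin 3 × Fin 3) ⊕ (Fin 2 × Fin 2 × Fin 2)

/-- The even vector with coordinates `h`, `x`, `y` in each factor. -/
noncomputable def slOf (h x y : ℂ) : sl (Fin 2) ℂ := h • slH + x • slX + y • slY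

theorem slOf_entries (h x y : ℂ) :
    (slOf h x y).1 0 0 = h ∧ (slOf h x y).1 0 1 = x ∧ (slOf h x y).1 1 0 = y := by
  have key : ∀ i j, (slOf h x y).1 i j =
      h * !![(1 : ℂ), 0; 0, -1] i j + x * !![(0 : ℂ), 1; 0, 0] i j +
        y * !![(0 : ℂ), 0; 1, 0] i j := fun i j => rfl
  simp [key]

/-- The coordinates in the weight basis. -/
noncomputable def coordGamma : (Even × Odd) ≃ₗ[ℂ] (Idx → ℂ) where
  toFun x := Sum.elim (fun i => ![(x.1 i.1).1 0 0, (x.1 i.1).1 0 1, (x.1 i.1).1 1 0] i.2)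
    (fun p => x.2 ![p.1, p.2.1, p.2.2])
  map_add' x y := by
    ext (⟨i, t⟩ | p)
    · fin_cases t <;> rfl
    · rfl
  map_smul' c x := by
    ext (⟨i, t⟩ | p)
    · fin_cases t <;> rfl
    · rfl
  invFun f := ((fun i => slOf (f (.inl (i, 0))) (f (.inl (i, 1))) (f (.inl (i, 2))),
    fun p => f (.inr (p 0, p 1, p 2))) : Even × Odd)
  left_inv x := by
    refine Prod.ext (funext fun i => ?_) (odd_ext fun p q r => rfl)
    obtain ⟨h1, h2, h3⟩ := slOf_entries ((x.1 i).1 0 0) ((x.1 i).1 0 1) ((x.1 i).1 1 0)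
    exact sl_ext h1 h2 h3
  right_inv f := by
    ext (⟨i, t⟩ | p)
    · obtain ⟨h1, h2, h3⟩ := slOf_entries (f (.inl (i, 0))) (f (.inl (i, 1))) (f (.inl (i, 2)))
      fin_cases t
      · exact h1
      · exact h2
      · exact h3
    · rfl

/-- The coordinates of an element of `D(2,1;a)` in the weight basis. -/
noncomputable def coord (a : ℂ) : D21 a ≃ₗ[ℂ] (Idx → ℂ) := coordGamma

variable {a : ℂ}

theorem coordGamma_inl (x : Even × Odd) (i t : Fin 3) : coordGamma x (.inl (i, t)) =
    ![(x.1 i).1 0 0, (x.1 i).1 0 1, (x.1 i).1 1 0] t := rfl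

theorem coordGamma_inr (x : Even × Odd) (p : Fin 2 × Fin 2 × Fin 2) :
    coordGamma x (.inr p) = x.2 ![p.1, p.2.1, p.2.2] := rfl

/-- The weights of the basis vectors. -/
def wt : Idx → Fin 3 → ℤ
  | .inl (i, t) => fun j => if i = j then ![0, 2, -2] t else 0
  | .inr (p, q, r) => ![1 - 2 * p.val, 1 - 2 * q.val, 1 - 2 * r.val]

theorem act_slH (h : Fin 3 → ℂ) (u : Odd) (p q r : Fin 2) :
    act (fun i => h i • slH) u ![p, q, r] =
      (h 0 * (1 - 2 * p.val) + h 1 * (1 - 2 * q.val) + h 2 * (1 - 2 * r.val)) * u ![p, q, r] := by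
  have key : ∀ i k l, ((h i • slH : sl (Fin 2) ℂ)).1 k l = h i * !![(1 : ℂ), 0; 0, -1] k l :=
    fun i k l => rfl
  simp only [act_cons, key]
  fin_cases p <;> fin_cases q <;> fin_cases r <;> simp <;> ring

theorem coordGamma_bracket_slH (s : Fin 3 → ℂ) (h : Fin 3 → ℂ) (x : Even × Odd) (i : Idx) :
    coordGamma (gammaBracket s ((fun i => h i • slH, 0) : Even × Odd) x) i =
      (∑ k, (wt i k : ℂ) * h k) * coordGamma x i := by
  rw [gammaBracket_apply]
  simp only [map_zero, LinearMap.zero_apply, sub_zero, add_zero]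
  rcases i with ⟨i, t⟩ | ⟨p, q, r⟩
  · have key : ∀ k l, ((h i • slH : sl (Fin 2) ℂ)).1 k l = h i * !![(1 : ℂ), 0; 0, -1] k l :=
      fun k l => rfl
    have t1 := sl_entry (x.1 i)
    rw [coordGamma_inl, coordGamma_inl]
    fin_cases t
    · change (⁅h i • slH, x.1 i⁆ : sl (Fin 2) ℂ).1 0 0 = _
      rw [lie_entry, key, key, key]
      simp [wt, mul_comm]
    · change (⁅h i • slH, x.1 i⁆ : sl (Fin 2) ℂ).1 0 1 = _
      rw [lie_entry, key, key, key]
      simp [wt]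
      ring
    · change (⁅h i • slH, x.1 i⁆ : sl (Fin 2) ℂ).1 1 0 = _
      rw [lie_entry, key, key, key]
      simp [wt]
      ring
  · rw [coordGamma_inr, coordGamma_inr]
    simp only [act_slH, Fin.sum_univ_three, wt]
    simp
    exact Or.inl (by ring)

theorem coord_bracket_cartan (h : Fin 3 → ℂ) (x : D21 a) (i : Idx) :
    coord a (bracket (cartan a h) x) i = (∑ k, (wt i k : ℂ) * h k) * coord a x i :=
  coordGamma_bracket_slH (s a) h x i

/-- The coordinate formula for the bracket. -/
noncomputable def coordBracket (s : Fin 3 → ℂ) (f g : Idx → ℂ) : Idx → ℂ :=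
  let u : Fin 2 → Fin 2 → Fin 2 → ℂ := fun p q r => f (.inr (p, q, r))
  let v : Fin 2 → Fin 2 → Fin 2 → ℂ := fun p q r => g (.inr (p, q, r))
  let c : Fin 3 → Fin 2 → Fin 2 → ℂ := ![
    fun x y => u x 0 0 * v y 1 1 - u x 0 1 * v y 1 0 - u x 1 0 * v y 0 1 + u x 1 1 * v y 0 0,
    fun x y => u 0 x 0 * v 1 y 1 - u 0 x 1 * v 1 y 0 - u 1 x 0 * v 0 y 1 + u 1 x 1 * v 0 y 0,
    fun x y => u 0 0 x * v 1 1 y - u 0 1 x * v 1 0 y - u 1 0 x * v 0 1 y + u 1 1 x * v 0 0 y]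
  let A : (Idx → ℂ) → Fin 3 → Fin 2 → Fin 2 → ℂ := fun f i =>
    ![![f (.inl (i, 0)), f (.inl (i, 1))], ![f (.inl (i, 2)), -f (.inl (i, 0))]]
  let ac : (Idx → ℂ) → (Fin 2 → Fin 2 → Fin 2 → ℂ) → Fin 2 → Fin 2 → Fin 2 → ℂ :=
    fun f u p q r => A f 0 p 0 * u 0 q r + A f 0 p 1 * u 1 q r +
      (A f 1 q 0 * u p 0 r + A f 1 q 1 * u p 1 r) + (A f 2 r 0 * u p q 0 + A f 2 r 1 * u p q 1)
  Sum.elim (fun i => ![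
      f (.inl (i.1, 1)) * g (.inl (i.1, 2)) - f (.inl (i.1, 2)) * g (.inl (i.1, 1))
        - s i.1 * (c i.1 0 1 + c i.1 1 0) / 2,
      2 * (f (.inl (i.1, 0)) * g (.inl (i.1, 1)) - f (.inl (i.1, 1)) * g (.inl (i.1, 0)))
        + s i.1 * c i.1 0 0,
      2 * (f (.inl (i.1, 2)) * g (.inl (i.1, 0)) - f (.inl (i.1, 0)) * g (.inl (i.1, 2)))
        - s i.1 * c i.1 1 1] i.2)
    (fun p => ac f v p.1 p.2.1 p.2.2 - ac g u p.1 p.2.1 p.2.2)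

theorem coordBracket_H0 (s : Fin 3 → ℂ) (f g : Idx → ℂ) :
    coordBracket s f g (.inl (0, 0)) =
      f (.inl (0, 1)) * g (.inl (0, 2)) - f (.inl (0, 2)) * g (.inl (0, 1))
      - 1 / 2 * s 0 * f (.inr (0, 0, 0)) * g (.inr (1, 1, 1))
      + 1 / 2 * s 0 * f (.inr (0, 0, 1)) * g (.inr (1, 1, 0))
      + 1 / 2 * s 0 * f (.inr (0, 1, 0)) * g (.inr (1, 0, 1))
      - 1 / 2 * s 0 * f (.inr (0, 1, 1)) * g (.inr (1, 0, 0))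
      - 1 / 2 * s 0 * f (.inr (1, 0, 0)) * g (.inr (0, 1, 1))
      + 1 / 2 * s 0 * f (.inr (1, 0, 1)) * g (.inr (0, 1, 0))
      + 1 / 2 * s 0 * f (.inr (1, 1, 0)) * g (.inr (0, 0, 1))
      - 1 / 2 * s 0 * f (.inr (1, 1, 1)) * g (.inr (0, 0, 0)) := by
  simp [coordBracket]; ring

theorem coordBracket_X0 (s : Fin 3 → ℂ) (f g : Idx → ℂ) :
    coordBracket s f g (.inl (0, 1)) =
      2 * f (.inl (0, 0)) * g (.inl (0, 1)) - 2 * f (.inl (0, 1)) * g (.inl (0, 0))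
      + s 0 * f (.inr (0, 0, 0)) * g (.inr (0, 1, 1))
      - s 0 * f (.inr (0, 0, 1)) * g (.inr (0, 1, 0))
      - s 0 * f (.inr (0, 1, 0)) * g (.inr (0, 0, 1))
      + s 0 * f (.inr (0, 1, 1)) * g (.inr (0, 0, 0)) := by
  simp [coordBracket]; ring

theorem coordBracket_Y0 (s : Fin 3 → ℂ) (f g : Idx → ℂ) :
    coordBracket s f g (.inl (0, 2)) =
      -2 * f (.inl (0, 0)) * g (.inl (0, 2)) + 2 * f (.inl (0, 2)) * g (.inl (0, 0))
      - s 0 * f (.inr (1, 0, 0)) * g (.inr (1, 1, 1))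
      + s 0 * f (.inr (1, 0, 1)) * g (.inr (1, 1, 0))
      + s 0 * f (.inr (1, 1, 0)) * g (.inr (1, 0, 1))
      - s 0 * f (.inr (1, 1, 1)) * g (.inr (1, 0, 0)) := by
  simp [coordBracket]; ring

theorem coordBracket_H1 (s : Fin 3 → ℂ) (f g : Idx → ℂ) :
    coordBracket s f g (.inl (1, 0)) =
      f (.inl (1, 1)) * g (.inl (1, 2)) - f (.inl (1, 2)) * g (.inl (1, 1))
      - 1 / 2 * s 1 * f (.inr (0, 0, 0)) * g (.inr (1, 1, 1))
      + 1 / 2 * s 1 * f (.inr (0, 0, 1)) * g (.inr (1, 1, 0))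
      - 1 / 2 * s 1 * f (.inr (0, 1, 0)) * g (.inr (1, 0, 1))
      + 1 / 2 * s 1 * f (.inr (0, 1, 1)) * g (.inr (1, 0, 0))
      + 1 / 2 * s 1 * f (.inr (1, 0, 0)) * g (.inr (0, 1, 1))
      - 1 / 2 * s 1 * f (.inr (1, 0, 1)) * g (.inr (0, 1, 0))
      + 1 / 2 * s 1 * f (.inr (1, 1, 0)) * g (.inr (0, 0, 1))
      - 1 / 2 * s 1 * f (.inr (1, 1, 1)) * g (.inr (0, 0, 0)) := by
  simp [coordBracket]; ring

theorem coordBracket_X1 (s : Fin 3 → ℂ) (f g : Idx → ℂ) :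
    coordBracket s f g (.inl (1, 1)) =
      2 * f (.inl (1, 0)) * g (.inl (1, 1)) - 2 * f (.inl (1, 1)) * g (.inl (1, 0))
      + s 1 * f (.inr (0, 0, 0)) * g (.inr (1, 0, 1))
      - s 1 * f (.inr (0, 0, 1)) * g (.inr (1, 0, 0))
      - s 1 * f (.inr (1, 0, 0)) * g (.inr (0, 0, 1))
      + s 1 * f (.inr (1, 0, 1)) * g (.inr (0, 0, 0)) := by
  simp [coordBracket]; ring

theorem coordBracket_Y1 (s : Fin 3 → ℂ) (f g : Idx → ℂ) :
    coordBracket s f g (.inl (1, 2)) =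
      -2 * f (.inl (1, 0)) * g (.inl (1, 2)) + 2 * f (.inl (1, 2)) * g (.inl (1, 0))
      - s 1 * f (.inr (0, 1, 0)) * g (.inr (1, 1, 1))
      + s 1 * f (.inr (0, 1, 1)) * g (.inr (1, 1, 0))
      + s 1 * f (.inr (1, 1, 0)) * g (.inr (0, 1, 1))
      - s 1 * f (.inr (1, 1, 1)) * g (.inr (0, 1, 0)) := by
  simp [coordBracket]; ring

theorem coordBracket_H2 (s : Fin 3 → ℂ) (f g : Idx → ℂ) :
    coordBracket s f g (.inl (2, 0)) =
      f (.inl (2, 1)) * g (.inl (2, 2)) - f (.inl (2, 2)) * g (.inl (2, 1))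
      - 1 / 2 * s 2 * f (.inr (0, 0, 0)) * g (.inr (1, 1, 1))
      - 1 / 2 * s 2 * f (.inr (0, 0, 1)) * g (.inr (1, 1, 0))
      + 1 / 2 * s 2 * f (.inr (0, 1, 0)) * g (.inr (1, 0, 1))
      + 1 / 2 * s 2 * f (.inr (0, 1, 1)) * g (.inr (1, 0, 0))
      + 1 / 2 * s 2 * f (.inr (1, 0, 0)) * g (.inr (0, 1, 1))
      + 1 / 2 * s 2 * f (.inr (1, 0, 1)) * g (.inr (0, 1, 0))
      - 1 / 2 * s 2 * f (.inr (1, 1, 0)) * g (.inr (0, 0, 1))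
      - 1 / 2 * s 2 * f (.inr (1, 1, 1)) * g (.inr (0, 0, 0)) := by
  simp [coordBracket]; ring

theorem coordBracket_X2 (s : Fin 3 → ℂ) (f g : Idx → ℂ) :
    coordBracket s f g (.inl (2, 1)) =
      2 * f (.inl (2, 0)) * g (.inl (2, 1)) - 2 * f (.inl (2, 1)) * g (.inl (2, 0))
      + s 2 * f (.inr (0, 0, 0)) * g (.inr (1, 1, 0))
      - s 2 * f (.inr (0, 1, 0)) * g (.inr (1, 0, 0))
      - s 2 * f (.inr (1, 0, 0)) * g (.inr (0, 1, 0))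
      + s 2 * f (.inr (1, 1, 0)) * g (.inr (0, 0, 0)) := by
  simp [coordBracket]; ring

theorem coordBracket_Y2 (s : Fin 3 → ℂ) (f g : Idx → ℂ) :
    coordBracket s f g (.inl (2, 2)) =
      -2 * f (.inl (2, 0)) * g (.inl (2, 2)) + 2 * f (.inl (2, 2)) * g (.inl (2, 0))
      - s 2 * f (.inr (0, 0, 1)) * g (.inr (1, 1, 1))
      + s 2 * f (.inr (0, 1, 1)) * g (.inr (1, 0, 1))
      + s 2 * f (.inr (1, 0, 1)) * g (.inr (0, 1, 1))
      - s 2 * f (.inr (1, 1, 1)) * g (.inr (0, 0, 1)) := by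
  simp [coordBracket]; ring

theorem coordBracket_O000 (s : Fin 3 → ℂ) (f g : Idx → ℂ) :
    coordBracket s f g (.inr (0, 0, 0)) =
      f (.inl (0, 0)) * g (.inr (0, 0, 0)) + f (.inl (0, 1)) * g (.inr (1, 0, 0))
      + f (.inl (1, 0)) * g (.inr (0, 0, 0)) + f (.inl (1, 1)) * g (.inr (0, 1, 0))
      + f (.inl (2, 0)) * g (.inr (0, 0, 0)) + f (.inl (2, 1)) * g (.inr (0, 0, 1))
      - f (.inr (0, 0, 0)) * g (.inl (0, 0)) - f (.inr (0, 0, 0)) * g (.inl (1, 0))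
      - f (.inr (0, 0, 0)) * g (.inl (2, 0)) - f (.inr (0, 0, 1)) * g (.inl (2, 1))
      - f (.inr (0, 1, 0)) * g (.inl (1, 1)) - f (.inr (1, 0, 0)) * g (.inl (0, 1)) := by
  simp [coordBracket]; ring

theorem coordBracket_O001 (s : Fin 3 → ℂ) (f g : Idx → ℂ) :
    coordBracket s f g (.inr (0, 0, 1)) =
      f (.inl (0, 0)) * g (.inr (0, 0, 1)) + f (.inl (0, 1)) * g (.inr (1, 0, 1))
      + f (.inl (1, 0)) * g (.inr (0, 0, 1)) + f (.inl (1, 1)) * g (.inr (0, 1, 1))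
      - f (.inl (2, 0)) * g (.inr (0, 0, 1)) + f (.inl (2, 2)) * g (.inr (0, 0, 0))
      - f (.inr (0, 0, 0)) * g (.inl (2, 2)) - f (.inr (0, 0, 1)) * g (.inl (0, 0))
      - f (.inr (0, 0, 1)) * g (.inl (1, 0)) + f (.inr (0, 0, 1)) * g (.inl (2, 0))
      - f (.inr (0, 1, 1)) * g (.inl (1, 1)) - f (.inr (1, 0, 1)) * g (.inl (0, 1)) := by
  simp [coordBracket]; ring

theorem coordBracket_O010 (s : Fin 3 → ℂ) (f g : Idx → ℂ) :
    coordBracket s f g (.inr (0, 1, 0)) =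
      f (.inl (0, 0)) * g (.inr (0, 1, 0)) + f (.inl (0, 1)) * g (.inr (1, 1, 0))
      - f (.inl (1, 0)) * g (.inr (0, 1, 0)) + f (.inl (1, 2)) * g (.inr (0, 0, 0))
      + f (.inl (2, 0)) * g (.inr (0, 1, 0)) + f (.inl (2, 1)) * g (.inr (0, 1, 1))
      - f (.inr (0, 0, 0)) * g (.inl (1, 2)) - f (.inr (0, 1, 0)) * g (.inl (0, 0))
      + f (.inr (0, 1, 0)) * g (.inl (1, 0)) - f (.inr (0, 1, 0)) * g (.inl (2, 0))
      - f (.inr (0, 1, 1)) * g (.inl (2, 1)) - f (.inr (1, 1, 0)) * g (.inl (0, 1)) := by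
  simp [coordBracket]; ring

theorem coordBracket_O011 (s : Fin 3 → ℂ) (f g : Idx → ℂ) :
    coordBracket s f g (.inr (0, 1, 1)) =
      f (.inl (0, 0)) * g (.inr (0, 1, 1)) + f (.inl (0, 1)) * g (.inr (1, 1, 1))
      - f (.inl (1, 0)) * g (.inr (0, 1, 1)) + f (.inl (1, 2)) * g (.inr (0, 0, 1))
      - f (.inl (2, 0)) * g (.inr (0, 1, 1)) + f (.inl (2, 2)) * g (.inr (0, 1, 0))
      - f (.inr (0, 0, 1)) * g (.inl (1, 2)) - f (.inr (0, 1, 0)) * g (.inl (2, 2))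
      - f (.inr (0, 1, 1)) * g (.inl (0, 0)) + f (.inr (0, 1, 1)) * g (.inl (1, 0))
      + f (.inr (0, 1, 1)) * g (.inl (2, 0)) - f (.inr (1, 1, 1)) * g (.inl (0, 1)) := by
  simp [coordBracket]; ring

theorem coordBracket_O100 (s : Fin 3 → ℂ) (f g : Idx → ℂ) :
    coordBracket s f g (.inr (1, 0, 0)) =
      -f (.inl (0, 0)) * g (.inr (1, 0, 0)) + f (.inl (0, 2)) * g (.inr (0, 0, 0))
      + f (.inl (1, 0)) * g (.inr (1, 0, 0)) + f (.inl (1, 1)) * g (.inr (1, 1, 0))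
      + f (.inl (2, 0)) * g (.inr (1, 0, 0)) + f (.inl (2, 1)) * g (.inr (1, 0, 1))
      - f (.inr (0, 0, 0)) * g (.inl (0, 2)) + f (.inr (1, 0, 0)) * g (.inl (0, 0))
      - f (.inr (1, 0, 0)) * g (.inl (1, 0)) - f (.inr (1, 0, 0)) * g (.inl (2, 0))
      - f (.inr (1, 0, 1)) * g (.inl (2, 1)) - f (.inr (1, 1, 0)) * g (.inl (1, 1)) := by
  simp [coordBracket]; ring

theorem coordBracket_O101 (s : Fin 3 → ℂ) (f g : Idx → ℂ) :
    coordBracket s f g (.inr (1, 0, 1)) =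
      -f (.inl (0, 0)) * g (.inr (1, 0, 1)) + f (.inl (0, 2)) * g (.inr (0, 0, 1))
      + f (.inl (1, 0)) * g (.inr (1, 0, 1)) + f (.inl (1, 1)) * g (.inr (1, 1, 1))
      - f (.inl (2, 0)) * g (.inr (1, 0, 1)) + f (.inl (2, 2)) * g (.inr (1, 0, 0))
      - f (.inr (0, 0, 1)) * g (.inl (0, 2)) - f (.inr (1, 0, 0)) * g (.inl (2, 2))
      + f (.inr (1, 0, 1)) * g (.inl (0, 0)) - f (.inr (1, 0, 1)) * g (.inl (1, 0))
      + f (.inr (1, 0, 1)) * g (.inl (2, 0)) - f (.inr (1, 1, 1)) * g (.inl (1, 1)) := by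
  simp [coordBracket]; ring

theorem coordBracket_O110 (s : Fin 3 → ℂ) (f g : Idx → ℂ) :
    coordBracket s f g (.inr (1, 1, 0)) =
      -f (.inl (0, 0)) * g (.inr (1, 1, 0)) + f (.inl (0, 2)) * g (.inr (0, 1, 0))
      - f (.inl (1, 0)) * g (.inr (1, 1, 0)) + f (.inl (1, 2)) * g (.inr (1, 0, 0))
      + f (.inl (2, 0)) * g (.inr (1, 1, 0)) + f (.inl (2, 1)) * g (.inr (1, 1, 1))
      - f (.inr (0, 1, 0)) * g (.inl (0, 2)) - f (.inr (1, 0, 0)) * g (.inl (1, 2))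
      + f (.inr (1, 1, 0)) * g (.inl (0, 0)) + f (.inr (1, 1, 0)) * g (.inl (1, 0))
      - f (.inr (1, 1, 0)) * g (.inl (2, 0)) - f (.inr (1, 1, 1)) * g (.inl (2, 1)) := by
  simp [coordBracket]; ring

theorem coordBracket_O111 (s : Fin 3 → ℂ) (f g : Idx → ℂ) :
    coordBracket s f g (.inr (1, 1, 1)) =
      -f (.inl (0, 0)) * g (.inr (1, 1, 1)) + f (.inl (0, 2)) * g (.inr (0, 1, 1))
      - f (.inl (1, 0)) * g (.inr (1, 1, 1)) + f (.inl (1, 2)) * g (.inr (1, 0, 1))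
      - f (.inl (2, 0)) * g (.inr (1, 1, 1)) + f (.inl (2, 2)) * g (.inr (1, 1, 0))
      - f (.inr (0, 1, 1)) * g (.inl (0, 2)) - f (.inr (1, 0, 1)) * g (.inl (1, 2))
      - f (.inr (1, 1, 0)) * g (.inl (2, 2)) + f (.inr (1, 1, 1)) * g (.inl (0, 0))
      + f (.inr (1, 1, 1)) * g (.inl (1, 0)) + f (.inr (1, 1, 1)) * g (.inl (2, 0)) := by
  simp [coordBracket]; ring

/-- Turns every later computation with brackets into a polynomial identity in coordinates. -/
theorem coordGamma_bracket (s : Fin 3 → ℂ) (x y : Even × Odd) :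
    coordGamma (gammaBracket s x y) = coordBracket s (coordGamma x) (coordGamma y) := by
  rw [gammaBracket_apply]
  have t1 := fun i => sl_entry (x.1 i)
  have t2 := fun i => sl_entry (y.1 i)
  ext (⟨i, t⟩ | ⟨p, q, r⟩)
  · rw [coordGamma_inl]
    obtain ⟨h1, h2, h3, -⟩ := oddBracket_entries0 s x.2 y.2
    obtain ⟨h4, h5, h6, -⟩ := oddBracket_entries1 s x.2 y.2
    obtain ⟨h7, h8, h9, -⟩ := oddBracket_entries2 s x.2 y.2
    fin_cases i <;> fin_cases t <;>
      simp [lie_entry, coordBracket, coordGamma_inl, coordGamma_inr, *, contr0, contr1, contr2,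
        coe_add_entry] <;> ring
  · rw [coordGamma_inr]
    simp only [Pi.sub_apply, act_cons, coordBracket, coordGamma_inl, coordGamma_inr, Sum.elim_inr]
    fin_cases p <;> fin_cases q <;> fin_cases r <;> simp [t1, t2]

theorem coord_bracket (x y : D21 a) :
    coord a (bracket x y) = coordBracket (s a) (coord a x) (coord a y) :=
  coordGamma_bracket (s a) x y

end D21

namespace D21

open LieSuperalgebra

variable {a : ℂ}

/-! ### Coordinate subspaces -/

/-- The basis vectors. -/
noncomputable def bv (a : ℂ) (i : Idx) : D21 a := (coord a).symm (Pi.single i 1)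

theorem coord_bv (i j : Idx) : coord a (bv a i) j = if j = i then 1 else 0 := by
  rw [bv, LinearEquiv.apply_symm_apply, Pi.single_apply]

theorem sum_coord (x : D21 a) : ∑ i, coord a x i • bv a i = x := by
  apply (coord a).injective
  ext j
  rw [map_sum, Finset.sum_apply, Finset.sum_eq_single j]
  · simp [coord_bv]
  · intro i _ hi
    simp [coord_bv, hi.symm]
  · exact fun h => absurd (Finset.mem_univ j) h

/-- The span of the basis vectors with index in `S`. -/
def coordSub (a : ℂ) (S : Set Idx) : Submodule ℂ (D21 a) where
  carrier := {x | ∀ i, i ∉ S → coord a x i = 0}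
  add_mem' hx hy i hi := by rw [map_add, Pi.add_apply, hx i hi, hy i hi, add_zero]
  zero_mem' i _ := by rw [map_zero, Pi.zero_apply]
  smul_mem' c x hx i hi := by rw [map_smul, Pi.smul_apply, hx i hi, smul_zero]

theorem mem_coordSub {S : Set Idx} {x : D21 a} :
    x ∈ coordSub a S ↔ ∀ i, i ∉ S → coord a x i = 0 := Iff.rfl

theorem bv_mem {S : Set Idx} {i : Idx} : bv a i ∈ coordSub a S ↔ i ∈ S := by
  constructor
  · intro h
    by_contra hi
    simpa [coord_bv] using h i hi
  · intro h j hj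
    rw [coord_bv, if_neg]
    rintro rfl
    exact hj h

theorem coordSub_le {S : Set Idx} {p : Submodule ℂ (D21 a)} :
    coordSub a S ≤ p ↔ ∀ i ∈ S, bv a i ∈ p := by
  constructor
  · exact fun h i hi => h (bv_mem.2 hi)
  · intro h x hx
    rw [← sum_coord x]
    refine Submodule.sum_mem _ fun i _ => ?_
    by_cases hi : i ∈ S
    · exact p.smul_mem _ (h i hi)
    · rw [hx i hi, zero_smul]
      exact p.zero_mem

theorem coordSub_mono {S T : Set Idx} (h : S ⊆ T) : coordSub a S ≤ coordSub a T :=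
  fun _ hx i hi => hx i fun hS => hi (h hS)

theorem iSup_coordSub {ι : Sort*} (S : ι → Set Idx) :
    ⨆ j, coordSub a (S j) = coordSub a (⋃ j, S j) := by
  apply le_antisymm
  · exact iSup_le fun j => coordSub_mono (Set.subset_iUnion S j)
  · rw [coordSub_le]
    intro i hi
    obtain ⟨j, hj⟩ := Set.mem_iUnion.1 hi
    exact Submodule.mem_iSup_of_mem j (bv_mem.2 hj)

theorem coordSub_inf (S T : Set Idx) : coordSub a S ⊓ coordSub a T = coordSub a (S ∩ T) := by
  ext x
  rw [Submodule.mem_inf, mem_coordSub, mem_coordSub, mem_coordSub, ← forall_and]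
  refine forall_congr' fun i => ?_
  rw [Set.mem_inter_iff]
  tauto

theorem coordSub_sup (S T : Set Idx) : coordSub a S ⊔ coordSub a T = coordSub a (S ∪ T) := by
  apply le_antisymm
  · exact sup_le (coordSub_mono Set.subset_union_left) (coordSub_mono Set.subset_union_right)
  · rw [coordSub_le]
    rintro i (hi | hi)
    · exact Submodule.mem_sup_left (bv_mem.2 hi)
    · exact Submodule.mem_sup_right (bv_mem.2 hi)

theorem coordSub_univ : coordSub a Set.univ = ⊤ := by
  rw [eq_top_iff]
  exact fun x _ i hi => absurd (Set.mem_univ i) hi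

theorem coordSub_empty : coordSub a ∅ = ⊥ := by
  rw [eq_bot_iff]
  intro x hx
  apply (coord a).injective
  ext i
  rw [hx i (Set.notMem_empty i), map_zero, Pi.zero_apply]

theorem coordSub_eq_bot {S : Set Idx} : coordSub a S = ⊥ ↔ S = ∅ := by
  constructor
  · intro h
    by_contra hS
    obtain ⟨i, hi⟩ := Set.nonempty_iff_ne_empty.2 hS
    have h0 : bv a i ∈ (⊥ : Submodule ℂ (D21 a)) := h ▸ bv_mem.2 hi
    have := coord_bv (a := a) i i
    rw [(Submodule.mem_bot ℂ).1 h0] at this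
    simp at this
  · rintro rfl
    exact coordSub_empty

theorem coordSub_injective : Function.Injective (coordSub a) := by
  intro S T h
  ext i
  rw [← bv_mem (a := a), h, bv_mem]

theorem finrank_coordSub (P : Idx → Prop) [DecidablePred P] :
    Module.finrank ℂ (coordSub a {i | P i}) = (Finset.univ.filter P).card := by
  let f : coordSub a {i | P i} ≃ₗ[ℂ] ({i // P i} → ℂ) :=
    LinearEquiv.ofBijective ((LinearMap.funLeft ℂ ℂ Subtype.val) ∘ₗ (coord a).toLinearMap ∘ₗ
      (coordSub a {i | P i}).subtype) (by
      constructor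
      · rw [← LinearMap.ker_eq_bot, LinearMap.ker_eq_bot']
        intro x hx
        apply Subtype.ext
        apply (coord a).injective
        ext i
        rw [ZeroMemClass.coe_zero, map_zero, Pi.zero_apply]
        by_cases hi : P i
        · exact congrFun hx ⟨i, hi⟩
        · exact x.2 i hi
      · intro g
        refine ⟨⟨(coord a).symm fun i => if h : P i then g ⟨i, h⟩ else 0, ?_⟩, ?_⟩
        · intro i hi
          rw [LinearEquiv.apply_symm_apply]
          exact dif_neg hi
        · ext ⟨i, hi⟩
          change coord a ((coord a).symm _) i = _
          rw [LinearEquiv.apply_symm_apply, dif_pos hi])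
  rw [f.finrank_eq, Module.finrank_fintype_fun_eq_card, Fintype.card_subtype]

instance : FiniteDimensional ℂ (D21 a) := LinearEquiv.finiteDimensional (coord a).symm

theorem parity_zero_eq : parity (L := D21 a) 0 = coordSub a {i | i.isLeft} := by
  ext x
  refine mem_parity_zero.trans ?_
  constructor
  · rintro ⟨A, rfl⟩ (i | p) hi
    · exact absurd rfl hi
    · rfl
  · intro h
    refine ⟨x.1, Prod.ext rfl (odd_ext fun p q r => ?_)⟩
    exact h (.inr (p, q, r)) (by simp)

theorem parity_one_eq : parity (L := D21 a) 1 = coordSub a {i | i.isRight} := by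
  ext x
  refine mem_parity_one.trans ?_
  constructor
  · rintro ⟨u, rfl⟩ (⟨i, t⟩ | p) hi
    · change ![_, _, _] t = _
      fin_cases t <;> rfl
    · exact absurd rfl hi
  · intro h
    refine ⟨x.2, Prod.ext (funext fun i => ?_) rfl⟩
    exact sl_ext (h (.inl (i, 0)) (by simp)) (h (.inl (i, 1)) (by simp))
      (h (.inl (i, 2)) (by simp))

/-! ### Root spaces -/

/-- Roots have multiplicity one; only the weight zero is repeated. -/
theorem wt_injective_of_ne : ∀ i j : Idx, wt i = wt j → wt i ≠ 0 → i = j := by decide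

/-- Testing against each `Hₖ` compares a coordinate of the functional with the eigenvalue of every
basis vector that occurs. -/
theorem rootSpace_eq (α : Fin 3 → ℂ) :
    rootSpace a α = coordSub a {i | (fun k => (wt i k : ℂ)) = α} := by
  ext x
  constructor
  · intro h i hi
    by_contra hx
    apply hi
    ext k
    have h1 := congrArg (fun y => coord a y i) (h (Pi.single k 1))
    simp only [coord_bracket_cartan, map_smul, Pi.smul_apply, smul_eq_mul] at h1
    have h2 := mul_right_cancel₀ hx h1
    simpa [Pi.single_apply] using h2
  · intro h c
    apply (coord a).injective
    ext i
    rw [coord_bracket_cartan, map_smul, Pi.smul_apply, smul_eq_mul]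
    by_cases hi : (fun k => (wt i k : ℂ)) = α
    · rw [← hi]
    · rw [h i hi, mul_zero, mul_zero]

theorem cartan_mem_parity (h : Fin 3 → ℂ) : cartan a h ∈ parity (L := D21 a) 0 :=
  mem_parity_zero.2 ⟨_, rfl⟩

theorem bracket_mem_rootSpace {α β : Fin 3 → ℂ} {x y : D21 a} (hx : x ∈ rootSpace a α)
    (hy : y ∈ rootSpace a β) : bracket x y ∈ rootSpace a (α + β) := by
  intro h
  obtain ⟨x0, h0, x1, h1, rfl⟩ := exists_even_add_odd x
  have key : ∀ {p : ZMod 2} {z : D21 a}, z ∈ parity p → bracket (cartan a h) (bracket z y) =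
      bracket (bracket (cartan a h) z) y + bracket z (bracket (cartan a h) y) := fun hz => by
    rw [jacobi _ (cartan_mem_parity h) hz, koszulSign_zero_left, one_smul]
  have e : bracket (cartan a h) (bracket (x0 + x1) y) =
      bracket (bracket (cartan a h) (x0 + x1)) y + bracket (x0 + x1) (bracket (cartan a h) y) := by
    simp only [map_add, LinearMap.add_apply, key h0, key h1]
    abel
  rw [e, hx h, hy h, map_smul, map_smul, LinearMap.smul_apply, ← add_smul,
    ← Finset.sum_add_distrib]
  simp only [Pi.add_apply, add_mul]

theorem bv_mem_rootSpace (i : Idx) : bv a i ∈ rootSpace a fun k => (wt i k : ℂ) := by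
  rw [rootSpace_eq]
  exact bv_mem.2 rfl

/-- Closure under brackets is decided by weights alone, with no reference to the structure
constants. -/
theorem bracket_mem_coordSub {S T U : Set Idx}
    (h : ∀ i ∈ S, ∀ j ∈ T, ∀ k, wt k = wt i + wt j → k ∈ U) {x y : D21 a}
    (hx : x ∈ coordSub a S) (hy : y ∈ coordSub a T) : bracket x y ∈ coordSub a U := by
  have h1 : ∀ i ∈ S, ∀ j ∈ T, bracket (bv a i) (bv a j) ∈ coordSub a U := by
    intro i hi j hj
    have := bracket_mem_rootSpace (bv_mem_rootSpace (a := a) i) (bv_mem_rootSpace j)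
    rw [rootSpace_eq] at this
    refine coordSub_mono (fun k hk => h i hi j hj k ?_) this
    ext l
    have := congrFun hk l
    simp only [Pi.add_apply] at this ⊢
    exact_mod_cast this
  have h2 : ∀ i ∈ S, coordSub a T ≤ (coordSub a U).comap (bracket (bv a i)) := fun i hi =>
    coordSub_le.2 fun j hj => h1 i hi j hj
  have h3 : coordSub a S ≤ (coordSub a U).comap (bracket.flip y) :=
    coordSub_le.2 fun i hi => h2 i hi hy
  exact h3 hx

/-- The Cartan subalgebra is abelian, so bracketing with a suitable `Hₖ` multiplies a coordinate of
nonzero weight by a nonzero number and still gives zero. -/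
theorem range_cartan_le {S : Set Idx} (h : ∀ i, wt i = 0 → i ∈ S) :
    LinearMap.range (cartan a) ≤ coordSub a S := by
  rintro _ ⟨c, rfl⟩ i hi
  have hw : ∃ k, wt i k ≠ 0 := by
    by_contra! h0
    exact hi (h i (funext h0))
  obtain ⟨k, hk⟩ := hw
  have h1 := coord_bracket_cartan (a := a) (Pi.single k 1) (cartan a c) i
  have h2 : bracket (cartan a (Pi.single k 1)) (cartan a c) = 0 := by
    refine (bracket_even_even (s a) _ _).trans (Prod.ext (funext fun j => ?_) rfl)
    change ⁅_ • slH, _ • slH⁆ = (0 : LieAlgebra.SpecialLinear.sl (Fin 2) ℂ)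
    rw [smul_lie, lie_smul, lie_self, smul_zero, smul_zero]
  rw [h2, map_zero, Pi.zero_apply] at h1
  simpa [Pi.single_apply, hk] using h1.symm

/-! ### Gradings defined by degree functions on the basis -/

/-- The degree is additive with respect to the weights. -/
def IsDegree (d : Idx → ℤ) : Prop := ∀ i j k, wt k = wt i + wt j → d k = d i + d j

theorem isGrading_of_isDegree {d : Idx → ℤ} (hd : IsDegree d) :
    IsGrading fun k => coordSub a {i | d i = k} := by
  refine ⟨?_, ?_, ?_⟩
  · rw [DirectSum.isInternal_submodule_iff_iSupIndep_and_iSup_eq_top]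
    constructor
    · intro k
      rw [disjoint_iff]
      simp only [iSup_coordSub]
      rw [coordSub_inf, coordSub_eq_bot]
      ext i
      simp only [Set.mem_inter_iff, Set.mem_iUnion, Set.mem_empty_iff_false, iff_false]
      rintro ⟨h, j, hj, h'⟩
      exact hj (h'.symm.trans h)
    · rw [iSup_coordSub, ← coordSub_univ]
      congr 1
      ext i
      simp
  · intro k
    rw [parity_zero_eq, parity_one_eq, coordSub_inf, coordSub_inf, coordSub_sup]
    congr 1
    ext (i | i) <;> simp
  · intro i j x hx y hy
    exact bracket_mem_coordSub (fun k hk l hl m hm => by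
      rw [Set.mem_ofPred_eq, hd k l m hm, hk, hl]) hx hy

/-! ### The four simple root systems -/

/-- The integer coordinates of the simple roots. -/
def rootsZ : Diagram → Fin 3 → Fin 3 → ℤ
  | .I => ![![1, -1, -1], ![0, 2, 0], ![0, 0, 2]]
  | .II => ![![0, 2, 0], ![-1, -1, 1], ![2, 0, 0]]
  | .III => ![![0, 0, 2], ![2, 0, 0], ![-1, 1, -1]]
  | .IV => ![![-1, 1, 1], ![1, 1, -1], ![1, -1, 1]]

/-- Twice the dual basis of the simple roots. -/
def dualZ : Diagram → Fin 3 → Fin 3 → ℤ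
  | .I => ![![2, 0, 0], ![1, 1, 0], ![1, 0, 1]]
  | .II => ![![0, 1, 1], ![0, 0, 2], ![1, 0, 1]]
  | .III => ![![0, 1, 1], ![1, 1, 0], ![0, 2, 0]]
  | .IV => ![![0, 1, 1], ![1, 1, 0], ![1, 0, 1]]

/-- The coefficients of the weights with respect to the simple roots. -/
def coeff (Ξ : Diagram) (i : Idx) (j : Fin 3) : ℤ := (∑ k, dualZ Ξ j k * wt i k) / 2

theorem simpleRoots_eq (Ξ : Diagram) (j k : Fin 3) : simpleRoots Ξ j k = rootsZ Ξ j k := by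
  cases Ξ <;> fin_cases j <;> fin_cases k <;> simp [simpleRoots, rootsZ]

theorem dual_roots (Ξ : Diagram) :
    ∀ j l, ∑ k, dualZ Ξ j k * rootsZ Ξ l k = if j = l then 2 else 0 := by
  cases Ξ <;> decide

/-- The division by two in `coeff` is exact, since every weight lies in the lattice spanned by the
simple roots. -/
theorem two_mul_coeff (Ξ : Diagram) : ∀ i j, 2 * coeff Ξ i j = ∑ k, dualZ Ξ j k * wt i k := by
  cases Ξ <;> decide

theorem wt_eq (Ξ : Diagram) : ∀ i k, wt i k = ∑ j, coeff Ξ i j * rootsZ Ξ j k := by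
  cases Ξ <;> decide

theorem coeff_pos_or_neg (Ξ : Diagram) :
    ∀ i, (∀ j, 0 ≤ coeff Ξ i j) ∨ ∀ j, 0 ≤ -coeff Ξ i j := by
  cases Ξ <;> decide

theorem coeff_add (Ξ : Diagram) {i j k : Idx} (h : wt k = wt i + wt j) (l : Fin 3) :
    coeff Ξ k l = coeff Ξ i l + coeff Ξ j l := by
  have : 2 * coeff Ξ k l = 2 * coeff Ξ i l + 2 * coeff Ξ j l := by
    rw [two_mul_coeff, two_mul_coeff, two_mul_coeff, h, ← Finset.sum_add_distrib]
    simp only [Pi.add_apply, mul_add]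
  omega

/-- Pairing with the doubled dual basis recovers twice the coefficients, and the factor two cancels
in ℤ. -/
theorem wt_eq_sum_iff {Ξ : Diagram} {i : Idx} {n : Fin 3 → ℤ} :
    (fun k => (wt i k : ℂ)) = ∑ j, (n j : ℂ) • simpleRoots Ξ j ↔ coeff Ξ i = n := by
  have h1 : ∀ m : Fin 3 → ℤ, ∑ j, (m j : ℂ) • simpleRoots Ξ j =
      fun k => ((∑ j, m j * rootsZ Ξ j k : ℤ) : ℂ) := by
    intro m
    ext k
    simp [simpleRoots_eq]
  rw [h1]
  constructor
  · intro h
    have h2 : ∀ k, wt i k = ∑ j, n j * rootsZ Ξ j k := fun k => by exact_mod_cast congrFun h k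
    ext j
    have h3 : 2 * coeff Ξ i j = 2 * n j := by
      rw [two_mul_coeff]
      simp only [h2, Finset.mul_sum]
      rw [Finset.sum_comm]
      have : ∀ l, ∑ k, dualZ Ξ j k * (n l * rootsZ Ξ l k) = if j = l then 2 * n l else 0 := by
        intro l
        have := congrArg (n l * ·) (dual_roots Ξ j l)
        simp only [Finset.mul_sum] at this
        rw [← Finset.sum_congr rfl fun k _ => mul_left_comm (n l) (dualZ Ξ j k) _, this]
        split_ifs <;> ring
      simp [this]
    omega
  · rintro rfl
    ext k
    rw [← wt_eq]

/-- The degree defined by the simple root system and the crossed nodes. -/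
def deg (Ξ : Diagram) (χ : Finset (Fin 3)) (i : Idx) : ℤ := ∑ j ∈ χ, coeff Ξ i j

theorem isDegree_deg (Ξ : Diagram) (χ : Finset (Fin 3)) : IsDegree (deg Ξ χ) := by
  intro i j k h
  rw [deg, deg, deg, ← Finset.sum_add_distrib]
  exact Finset.sum_congr rfl fun l _ => coeff_add Ξ h l

theorem gradedPiece_eq (Ξ : Diagram) (χ : Finset (Fin 3)) (k : ℤ) :
    gradedPiece a (simpleRoots Ξ) χ k = coordSub a {i | deg Ξ χ i = k} := by
  unfold gradedPiece
  simp only [rootSpace_eq, iSup_coordSub, wt_eq_sum_iff]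
  congr 1
  ext i
  simp only [Set.mem_iUnion, Set.mem_ofPred_eq]
  constructor
  · rintro ⟨_, h, rfl⟩
    exact h
  · intro h
    exact ⟨_, h, rfl⟩

theorem isGrading_gradedPiece (Ξ : Diagram) (χ : Finset (Fin 3)) :
    IsGrading (gradedPiece a (simpleRoots Ξ) χ) := by
  rw [funext (gradedPiece_eq Ξ χ)]
  exact isGrading_of_isDegree (isDegree_deg Ξ χ)

theorem parabolic_eq (Ξ : Diagram) (χ : Finset (Fin 3)) :
    parabolic a (simpleRoots Ξ) χ = coordSub a {i | 0 ≤ deg Ξ χ i} := by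
  unfold parabolic
  simp only [gradedPiece_eq, iSup_coordSub]
  congr 1
  ext i
  simp

theorem isRoot_iff {α : Fin 3 → ℂ} :
    IsRoot a α ↔ α ≠ 0 ∧ ∃ i, (fun k => (wt i k : ℂ)) = α := by
  rw [IsRoot, rootSpace_eq, ne_eq (coordSub a _), coordSub_eq_bot, ← ne_eq,
    ← Set.nonempty_iff_ne_empty]
  rfl

theorem isNonnegCombination_wt {Ξ : Diagram} {i : Idx} (h : ∀ j, 0 ≤ coeff Ξ i j) :
    IsNonnegCombination (simpleRoots Ξ) fun k => (wt i k : ℂ) := by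
  refine ⟨fun j => (coeff Ξ i j).toNat, ?_⟩
  rw [wt_eq_sum_iff (n := coeff Ξ i) |>.2 rfl]
  refine Finset.sum_congr rfl fun j _ => ?_
  congr 1
  exact_mod_cast (Int.toNat_of_nonneg (h j)).symm

theorem exists_wt_neg : ∀ i : Idx, ∃ j : Idx, wt j = -wt i := by decide

theorem exists_wt_root (Ξ : Diagram) : ∀ j, ∃ i, wt i = rootsZ Ξ j := by cases Ξ <;> decide

/-- The dual basis gives independence. For a root with nonpositive coefficients, the opposite weight
also occurs in the basis, and its coefficients are nonnegative. -/
theorem isSimpleRootSystem_simpleRoots (Ξ : Diagram) : IsSimpleRootSystem a (simpleRoots Ξ) := by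
  have hli : LinearIndependent ℂ (simpleRoots Ξ) := by
    rw [Fintype.linearIndependent_iff]
    intro g hg j
    have h1 : ∀ k, ∑ l, g l * rootsZ Ξ l k = 0 := by
      intro k
      have := congrFun hg k
      simpa [simpleRoots_eq] using this
    have h2 : ∑ k, (dualZ Ξ j k : ℂ) * ∑ l, g l * rootsZ Ξ l k = 2 * g j := by
      simp only [Finset.mul_sum]
      rw [Finset.sum_comm]
      have : ∀ l, ∑ k, (dualZ Ξ j k : ℂ) * (g l * rootsZ Ξ l k) = if j = l then 2 * g l else 0 := by
        intro l
        have := congrArg (fun z : ℤ => g l * (z : ℂ)) (dual_roots Ξ j l)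
        simp only [Int.cast_sum, Int.cast_mul, Finset.mul_sum] at this
        rw [← Finset.sum_congr rfl fun k _ => mul_left_comm (g l) (dualZ Ξ j k : ℂ) _, this]
        split_ifs <;> simp [mul_comm]
      simp [this]
    simp only [h1, mul_zero, Finset.sum_const_zero] at h2
    simpa using h2.symm
  refine ⟨hli, fun j => isRoot_iff.2 ⟨hli.ne_zero j, ?_⟩, fun α hα => ?_⟩
  · obtain ⟨i, hi⟩ := exists_wt_root Ξ j
    exact ⟨i, funext fun k => by rw [hi, simpleRoots_eq]⟩
  · obtain ⟨-, i, rfl⟩ := isRoot_iff.1 hα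
    refine (coeff_pos_or_neg Ξ i).imp isNonnegCombination_wt fun h => ?_
    obtain ⟨i', hi'⟩ := exists_wt_neg i
    have h2 : ∀ j, coeff Ξ i' j = -coeff Ξ i j := by
      intro j
      have : 2 * coeff Ξ i' j = -(2 * coeff Ξ i j) := by
        rw [two_mul_coeff, two_mul_coeff, hi', ← Finset.sum_neg_distrib]
        simp only [Pi.neg_apply, mul_neg]
      omega
    have h3 : (-fun k => (wt i k : ℂ)) = fun k => (wt i' k : ℂ) := by
      ext k
      simp [hi']
    rw [h3]
    exact isNonnegCombination_wt fun j => by rw [h2]; exact h j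

theorem exists_deg_neg (Ξ : Diagram) :
    ∀ χ : Finset (Fin 3), χ.Nonempty → ∃ i, deg Ξ χ i < 0 := by
  cases Ξ <;> decide

theorem deg_of_wt_eq_zero (Ξ : Diagram) (χ : Finset (Fin 3)) {i : Idx} (h : wt i = 0) :
    deg Ξ χ i = 0 := by
  have := isDegree_deg Ξ χ i i i (by rw [h, add_zero])
  omega

/-- Nonnegative combinations of simple roots have nonnegative degree, so the Borel subalgebra is
contained; a nonempty set of crossed nodes leaves some weight of negative degree outside. -/
theorem isParabolic_parabolic (Ξ : Diagram) {χ : Finset (Fin 3)} (hχ : χ.Nonempty) :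
    IsParabolic a (parabolic a (simpleRoots Ξ) χ) := by
  rw [parabolic_eq]
  refine ⟨?_, ?_, simpleRoots Ξ, isSimpleRootSystem_simpleRoots Ξ, ?_⟩
  · rw [← coordSub_univ]
    intro h
    obtain ⟨i, hi⟩ := exists_deg_neg Ξ χ hχ
    have : i ∈ {i | 0 ≤ deg Ξ χ i} := coordSub_injective h ▸ Set.mem_univ i
    exact absurd this (not_le.2 hi)
  · intro x hx y hy
    refine bracket_mem_coordSub (fun i hi j hj k hk => ?_) hx hy
    rw [Set.mem_ofPred_eq, isDegree_deg Ξ χ i j k hk]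
    exact add_nonneg hi hj
  · refine sup_le (range_cartan_le fun i hi => (deg_of_wt_eq_zero Ξ χ hi).ge) ?_
    refine iSup_le fun α => iSup_le fun hα => ?_
    obtain ⟨-, n, rfl⟩ := hα
    rw [rootSpace_eq]
    refine coordSub_mono fun i hi => ?_
    have hi' : coeff Ξ i = fun j => (n j : ℤ) := wt_eq_sum_iff.1 (by simpa using hi)
    rw [Set.mem_ofPred_eq, deg, hi']
    exact Finset.sum_nonneg fun j _ => Int.natCast_nonneg _

end D21

namespace D21

open LieSuperalgebra

/-! ### Isomorphisms that permute the basis up to scalars -/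

/-- An isomorphism that permutes the weight basis up to scalars. -/
structure MonomialIso (a a' : ℂ) where
  iso : Iso (D21 a) (D21 a')
  perm : Idx ≃ Idx
  scale : Idx → ℂ
  scale_ne : ∀ i, scale i ≠ 0
  coord_iso : ∀ x i, coord a' (iso.toLinearEquiv x) i = scale i * coord a x (perm i)

theorem MonomialIso.map_coordSub {a a' : ℂ} (e : MonomialIso a a') (S : Set Idx) :
    (coordSub a S).map e.iso.toLinearEquiv.toLinearMap = coordSub a' {i | e.perm i ∈ S} := by
  ext y
  constructor
  · rintro ⟨x, hx, rfl⟩ i hi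
    change coord a' (e.iso.toLinearEquiv x) i = 0
    rw [e.coord_iso, hx _ hi, mul_zero]
  · intro hy
    refine ⟨e.iso.toLinearEquiv.symm y, fun i hi => ?_, e.iso.toLinearEquiv.apply_symm_apply y⟩
    have h := e.coord_iso (e.iso.toLinearEquiv.symm y) (e.perm.symm i)
    rw [LinearEquiv.apply_symm_apply, Equiv.apply_symm_apply,
      hy _ (by rwa [Set.mem_ofPred_eq, Equiv.apply_symm_apply])] at h
    exact (mul_eq_zero.1 h.symm).resolve_left (e.scale_ne _)

theorem parity_eq (a : ℂ) (j : ZMod 2) :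
    parity (L := D21 a) j = coordSub a {i | i.isLeft = decide (j = 0)} := by
  rcases LieSuperalgebra.zmod_two_cases j with rfl | rfl
  · rw [parity_zero_eq]
    simp
  · rw [parity_one_eq]
    simp

/-- A permutation of the basis with scalars that is compatible with the coordinate formula for
the bracket defines an isomorphism. -/
noncomputable def MonomialIso.mk' {a a' : ℂ} (r : Idx ≃ Idx) (c : Idx → ℂ) (hc : ∀ i, c i ≠ 0)
    (hr : ∀ i, (r i).isLeft = i.isLeft)
    (h : ∀ f g : Idx → ℂ, coordBracket (s a') (fun i => c i * f (r i)) (fun i => c i * g (r i)) =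
      fun i => c i * coordBracket (s a) f g (r i)) : MonomialIso a a' :=
  let M : (Idx → ℂ) ≃ₗ[ℂ] (Idx → ℂ) :=
    { toFun := fun f i => c i * f (r i)
      map_add' := fun f g => funext fun i => mul_add _ _ _
      map_smul' := fun k f => funext fun i => mul_left_comm _ _ _
      invFun := fun f i => (c (r.symm i))⁻¹ * f (r.symm i)
      left_inv := fun f => funext fun i => by simp [hc]
      right_inv := fun f => funext fun i => by simp [hc] }
  let e : D21 a ≃ₗ[ℂ] D21 a' := (coord a).trans (M.trans (coord a').symm)
  have he : ∀ x i, coord a' (e x) i = c i * coord a x (r i) := fun x i =>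
    congrFun ((coord a').apply_symm_apply (M (coord a x))) i
  { iso :=
      { toLinearEquiv := e
        isHom :=
          { map_bracket := fun x y => by
              apply (coord a').injective
              change coord a' (e (bracket x y)) = coord a' (bracket (e x) (e y))
              rw [coord_bracket, funext (he x), funext (he y), h, funext (he _), coord_bracket]
            map_parity := fun j x hx => by
              rw [parity_eq] at hx ⊢
              intro i hi
              change coord a' (e x) i = 0
              rw [he, hx _ (by rwa [Set.mem_ofPred_eq, hr]), mul_zero] } }
    perm := r
    scale := c
    scale_ne := hc
    coord_iso := he }

/-- The function on the basis indices that exchanges positive and negative weights of the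
factor `i`. -/
def reflFun (i : Fin 3) : Idx → Idx :=
  Sum.map (fun k => (k.1, if k.1 = i then ![0, 2, 1] k.2 else k.2))
    (fun p => (if i = 0 then 1 - p.1 else p.1, if i = 1 then 1 - p.2.1 else p.2.1,
      if i = 2 then 1 - p.2.2 else p.2.2))

/-- The involution `reflFun` as a permutation. -/
def reflIdx (i : Fin 3) : Idx ≃ Idx :=
  Function.Involutive.toPerm (reflFun i)
    (by
      have : ∀ (i : Fin 3) (k : Idx), reflFun i (reflFun i k) = k := by decide
      exact this i)

/-- The signs of the Weyl reflection in the factor `i`. -/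
def reflSign (i : Fin 3) : Idx → ℂ :=
  Sum.elim (fun k => if k.1 = i then -1 else 1) fun p => if ![p.1, p.2.1, p.2.2] i = 0 then 1 else -1

/-- The Weyl reflection in the factor `i`. -/
noncomputable def reflIso (a : ℂ) (i : Fin 3) : MonomialIso a a :=
  MonomialIso.mk' (reflIdx i) (reflSign i)
    (by
      rintro (k | p)
      · simp only [reflSign, Sum.elim_inl]
        split_ifs <;> simp
      · simp only [reflSign, Sum.elim_inr]
        split_ifs <;> simp)
    (by rintro (k | p) <;> rfl)
    (by
      intro f g
      ext (⟨k, t⟩ | ⟨p, q, r⟩)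
      · fin_cases i <;> fin_cases k <;> fin_cases t <;>
          simp [coordBracket_H0, coordBracket_X0, coordBracket_Y0, coordBracket_H1, coordBracket_X1,
            coordBracket_Y1, coordBracket_H2, coordBracket_X2, coordBracket_Y2, reflIdx, reflFun, reflSign] <;> ring
      · fin_cases i <;> fin_cases p <;> fin_cases q <;> fin_cases r <;>
          simp [coordBracket_O000, coordBracket_O001, coordBracket_O010, coordBracket_O011,
            coordBracket_O100, coordBracket_O101, coordBracket_O110, coordBracket_O111, reflIdx, reflFun, reflSign] <;> ring)

/-- The permutation of the basis indices defined by a permutation of the factors. -/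
def permIdx (σ : Equiv.Perm (Fin 3)) : Idx ≃ Idx where
  toFun := Sum.map (fun k => (σ.symm k.1, k.2)) fun p =>
    let P := ![p.1, p.2.1, p.2.2]
    (P (σ 0), P (σ 1), P (σ 2))
  invFun := Sum.map (fun k => (σ k.1, k.2)) fun p =>
    let P := ![p.1, p.2.1, p.2.2]
    (P (σ.symm 0), P (σ.symm 1), P (σ.symm 2))
  left_inv := by revert σ; decide
  right_inv := by revert σ; decide

theorem perm_cases : ∀ σ : Equiv.Perm (Fin 3),
    (σ 0 = 0 ∧ σ 1 = 1 ∧ σ 2 = 2 ∧ σ.symm 0 = 0 ∧ σ.symm 1 = 1 ∧ σ.symm 2 = 2) ∨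
    (σ 0 = 1 ∧ σ 1 = 0 ∧ σ 2 = 2 ∧ σ.symm 0 = 1 ∧ σ.symm 1 = 0 ∧ σ.symm 2 = 2) ∨
    (σ 0 = 2 ∧ σ 1 = 1 ∧ σ 2 = 0 ∧ σ.symm 0 = 2 ∧ σ.symm 1 = 1 ∧ σ.symm 2 = 0) ∨
    (σ 0 = 0 ∧ σ 1 = 2 ∧ σ 2 = 1 ∧ σ.symm 0 = 0 ∧ σ.symm 1 = 2 ∧ σ.symm 2 = 1) ∨
    (σ 0 = 1 ∧ σ 1 = 2 ∧ σ 2 = 0 ∧ σ.symm 0 = 2 ∧ σ.symm 1 = 0 ∧ σ.symm 2 = 1) ∨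
    (σ 0 = 2 ∧ σ 1 = 0 ∧ σ 2 = 1 ∧ σ.symm 0 = 1 ∧ σ.symm 1 = 2 ∧ σ.symm 2 = 0) := by decide

-- Brackets with an even entry are symmetric under relabelling of the factors. A bracket of two odd
-- elements acquires the factor `z ^ 2`, which is what converts `s'` into `s`.
set_option maxHeartbeats 1000000 in
theorem coordBracket_perm {s s' : Fin 3 → ℂ} {z : ℂ} (σ : Equiv.Perm (Fin 3))
    (h : ∀ i, s i = z ^ 2 * s' (σ i)) (f g : Idx → ℂ) :
    coordBracket s' (fun i => i.elim (fun _ => 1) (fun _ => z) * f (permIdx σ i))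
        (fun i => i.elim (fun _ => 1) (fun _ => z) * g (permIdx σ i)) =
      fun i => i.elim (fun _ => 1) (fun _ => z) * coordBracket s f g (permIdx σ i) := by
  ext (⟨k, t⟩ | ⟨p, q, r⟩)
  · rcases perm_cases σ with ⟨h0, h1, h2, h3, h4, h5⟩ | ⟨h0, h1, h2, h3, h4, h5⟩ |
      ⟨h0, h1, h2, h3, h4, h5⟩ | ⟨h0, h1, h2, h3, h4, h5⟩ | ⟨h0, h1, h2, h3, h4, h5⟩ |
      ⟨h0, h1, h2, h3, h4, h5⟩ <;>
    fin_cases k <;> fin_cases t <;>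
      simp [coordBracket_H0, coordBracket_X0, coordBracket_Y0, coordBracket_H1, coordBracket_X1,
            coordBracket_Y1, coordBracket_H2, coordBracket_X2, coordBracket_Y2,
        permIdx, h0, h1, h2, h3, h4, h5, h] <;> ring
  · rcases perm_cases σ with ⟨h0, h1, h2, h3, h4, h5⟩ | ⟨h0, h1, h2, h3, h4, h5⟩ |
      ⟨h0, h1, h2, h3, h4, h5⟩ | ⟨h0, h1, h2, h3, h4, h5⟩ | ⟨h0, h1, h2, h3, h4, h5⟩ |
      ⟨h0, h1, h2, h3, h4, h5⟩ <;>
    fin_cases p <;> fin_cases q <;> fin_cases r <;>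
      simp [coordBracket_O000, coordBracket_O001, coordBracket_O010, coordBracket_O011,
            coordBracket_O100, coordBracket_O101, coordBracket_O110, coordBracket_O111,
        permIdx, h0, h1, h2, h3, h4, h5] <;> ring

/-- The isomorphism defined by a permutation of the factors. -/
noncomputable def permIso {a a' z : ℂ} (hz : z ≠ 0) (σ : Equiv.Perm (Fin 3))
    (h : ∀ i, s a i = z ^ 2 * s a' (σ i)) : MonomialIso a a' :=
  MonomialIso.mk' (permIdx σ) (fun i => i.elim (fun _ => 1) fun _ => z)
    (by
      rintro (k | p)
      · exact one_ne_zero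
      · exact hz)
    (by rintro (k | p) <;> rfl) (coordBracket_perm σ h)

/-- The permuted triple of structure constants is divided by `c` so that its entry of index 1
becomes 1; the new parameter is then its entry of index 2. A square root of `c`, which exists in ℂ,
is the scale of the odd part. -/
theorem exists_permIso {a : ℂ} (ha0 : a ≠ 0) (ha1 : a ≠ -1) (σ : Equiv.Perm (Fin 3)) :
    ∃ a' ∈ paramOrbit a, a' ≠ 0 ∧ a' ≠ -1 ∧ ∃ e : MonomialIso a a', e.perm = permIdx σ := by
  have ha : 1 + a ≠ 0 := fun h => ha1 (by linear_combination h)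
  have key : ∀ c a' : ℂ, c ≠ 0 → (∀ i, s a i = c * s a' (σ i)) → a' ∈ paramOrbit a →
      a' ≠ 0 → a' ≠ -1 → ∃ a' ∈ paramOrbit a, a' ≠ 0 ∧ a' ≠ -1 ∧
        ∃ e : MonomialIso a a', e.perm = permIdx σ := by
    intro c a' hc h hmem h0 h1
    obtain ⟨z, hz⟩ := IsAlgClosed.exists_pow_nat_eq c two_pos
    have hz0 : z ≠ 0 := by
      rintro rfl
      exact hc (by simpa using hz.symm)
    exact ⟨a', hmem, h0, h1, permIso hz0 σ fun i => by rw [hz, h i], rfl⟩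
  have h3 : ∀ c a' : ℂ, s a 0 = c * s a' (σ 0) → s a 1 = c * s a' (σ 1) →
      s a 2 = c * s a' (σ 2) → ∀ i, s a i = c * s a' (σ i) := by
    intro c a' e0 e1 e2 i
    fin_cases i
    · exact e0
    · exact e1
    · exact e2
  simp only [s] at h3
  have hm1 : -1 - a ≠ 0 := fun h => ha (by linear_combination -h)
  rcases perm_cases σ with ⟨h0, h1, h2, -⟩ | ⟨h0, h1, h2, -⟩ |
      ⟨h0, h1, h2, -⟩ | ⟨h0, h1, h2, -⟩ | ⟨h0, h1, h2, -⟩ | ⟨h0, h1, h2, -⟩ <;>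
    simp only [h0, h1, h2] at h3
  · exact key 1 a one_ne_zero (h3 _ _ (by simp) (by simp) (by simp)) (by simp [paramOrbit]) ha0 ha1
  · refine key (-1 - a) (-a / (1 + a)) hm1
      (h3 _ _ (by simp) (by simp; field_simp; ring) (by simp; field_simp; ring))
      (by simp [paramOrbit]) (by simp [ha0, ha]) ?_
    intro h
    rw [div_eq_iff ha] at h
    exact one_ne_zero (by linear_combination h : (1 : ℂ) = 0)
  · refine key 1 (-1 - a) one_ne_zero
      (h3 _ _ (by simp) (by simp) (by simp)) (by simp [paramOrbit]) hm1 ?_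
    intro h
    exact ha0 (by linear_combination -h)
  · refine key a (1 / a) ha0
      (h3 _ _ (by simp; field_simp; ring) (by simp [ha0]) (by simp))
      (by simp [paramOrbit]) (by simp [ha0]) ?_
    intro h
    rw [div_eq_iff ha0] at h
    exact ha (by linear_combination h)
  · refine key (-1 - a) (-1 / (1 + a)) hm1
      (h3 _ _ (by simp) (by simp; field_simp; ring) (by simp; field_simp; ring))
      (by simp [paramOrbit]) (by simp [ha]) ?_
    intro h
    rw [div_eq_iff ha] at h
    exact ha0 (by linear_combination h)
  · refine key a (-(1 + a) / a) ha0
      (h3 _ _ (by simp; field_simp; ring) (by simp; field_simp; ring) (by simp))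
      (by simp [paramOrbit]) (by simp [ha0]; exact fun h => ha (by linear_combination -h)) ?_
    intro h
    rw [div_eq_iff ha0] at h
    exact one_ne_zero (by linear_combination -h : (1 : ℂ) = 0)

end D21

namespace D21

open LieSuperalgebra

/-! ### Combinatorics of the marked diagrams -/

instance : DecidableEq Diagram := fun x y => by
  cases x <;> cases y <;> first | exact isTrue rfl | exact isFalse nofun

instance : DecidableEq ParabolicType := fun x y => by
  cases x <;> cases y <;> first | exact isTrue rfl | exact isFalse nofun

instance : Fintype ParabolicType where
  elems := {.I1, .I2, .I12, .I23, .I123, .IV123}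
  complete := by rintro (_ | _ | _ | _ | _ | _) <;> decide

theorem existsUnique_marked (Ξ : Diagram) :
    ∀ χ : Finset (Fin 3), χ.Nonempty → ∃! t : ParabolicType, (Ξ, χ) ∈ t.marked := by
  simp only [ExistsUnique]
  cases Ξ <;> decide

theorem deg_eq_of_notMem : ∀ Ξj ∈ [(Diagram.I, (0 : Fin 3)), (Diagram.II, 1), (Diagram.III, 2)],
    ∀ χ : Finset (Fin 3), Ξj.2 ∉ χ → ∀ i, deg Ξj.1 χ i = deg .IV χ i := by
  decide

/-- In all four systems the roots 2εᵢ are positive, so no Weyl reflection is needed: the gradings in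
one row differ only by a permutation of the factors. -/
theorem exists_perm_deg (t : ParabolicType) : ∀ m ∈ t.marked, ∃ σ : Equiv.Perm (Fin 3),
    ∀ i, deg t.rep.1 t.rep.2 i = deg m.1 m.2 (permIdx σ i) := by
  cases t <;> decide

theorem card_deg (t : ParabolicType) : ∀ m ∈ t.marked,
    (List.range (t.depth + 1)).map (fun k : ℕ =>
      ((Finset.univ.filter fun i : Idx => deg m.1 m.2 i = -(k : ℤ) ∧ i.isLeft).card,
        (Finset.univ.filter fun i : Idx => deg m.1 m.2 i = -(k : ℤ) ∧ i.isRight).card)) =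
      t.dims := by
  cases t <;> decide

theorem exists_deg_eq_depth (t : ParabolicType) : ∀ m ∈ t.marked,
    (∃ i, deg m.1 m.2 i = -(t.depth : ℤ)) ∧ ∀ i, |deg m.1 m.2 i| ≤ (t.depth : ℤ) := by
  cases t <;> decide

theorem finrank_gradedPiece {a : ℂ} (t : ParabolicType) (m : Diagram × Finset (Fin 3))
    (hm : m ∈ t.marked) :
    (List.range (t.depth + 1)).map (fun k : ℕ =>
        (Module.finrank ℂ ↥(gradedPiece a (simpleRoots m.1) m.2 (-(k : ℤ)) ⊓ parity 0),
          Module.finrank ℂ ↥(gradedPiece a (simpleRoots m.1) m.2 (-(k : ℤ)) ⊓ parity 1))) =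
        t.dims := by
  rw [← card_deg t m hm]
  refine List.map_congr_left fun k _ => ?_
  rw [gradedPiece_eq, parity_zero_eq, parity_one_eq, coordSub_inf, coordSub_inf]
  exact congrArg₂ _ (finrank_coordSub fun i => deg m.1 m.2 i = -(k : ℤ) ∧ i.isLeft)
    (finrank_coordSub fun i => deg m.1 m.2 i = -(k : ℤ) ∧ i.isRight)

/-- The scalar products of the odd simple root with the two even ones are of the form ±2sᵢ, nonzero
because a ≠ 0, -1. Hence both even roots are changed. -/
theorem oddReflection_simpleRoots {a : ℂ} (ha0 : a ≠ 0) (ha1 : a ≠ -1) :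
    ∀ Ξj ∈ [(Diagram.I, (0 : Fin 3)), (Diagram.II, 1), (Diagram.III, 2)],
      oddReflection a (simpleRoots Ξj.1) Ξj.2 = simpleRoots Diagram.IV := by
  have hm1 : -1 - a ≠ 0 := fun h => ha1 (by linear_combination -h)
  have h2 : ∀ z w : ℂ, z ≠ 0 → w = 2 * z ∨ w = -(2 * z) → w ≠ 0 := by
    rintro z w hz (rfl | rfl)
    · simpa using hz
    · simpa using hz
  simp only [List.forall_mem_cons]
  refine ⟨?_, ?_, ?_, by simp⟩
  · have e1 : scalarProduct a (simpleRoots .I 0) (simpleRoots .I 1) ≠ 0 := by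
      simp [scalarProduct, simpleRoots, s, Fin.sum_univ_three]
    have e2 : scalarProduct a (simpleRoots .I 0) (simpleRoots .I 2) ≠ 0 := by
      simp [scalarProduct, simpleRoots, s, Fin.sum_univ_three, ha0]
    funext i
    fin_cases i
    · ext k; fin_cases k <;> simp [oddReflection, simpleRoots]
    · refine (if_neg (by decide)).trans ((if_pos e1).trans ?_)
      ext k; (fin_cases k <;> simp [simpleRoots]); norm_num
    · refine (if_neg (by decide)).trans ((if_pos e2).trans ?_)
      ext k; (fin_cases k <;> simp [simpleRoots]); norm_num
  · have e1 : scalarProduct a (simpleRoots .II 1) (simpleRoots .II 0) ≠ 0 := by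
      simp [scalarProduct, simpleRoots, s, Fin.sum_univ_three]
    have e2 : scalarProduct a (simpleRoots .II 1) (simpleRoots .II 2) ≠ 0 := by
      apply h2 _ _ hm1
      simp [scalarProduct, simpleRoots, s, Fin.sum_univ_three]
      right; ring
    funext i
    fin_cases i
    · refine (if_neg (by decide)).trans ((if_pos e1).trans ?_)
      ext k; (fin_cases k <;> simp [simpleRoots]); norm_num
    · ext k; fin_cases k <;> simp [oddReflection, simpleRoots]
    · refine (if_neg (by decide)).trans ((if_pos e2).trans ?_)
      ext k; (fin_cases k <;> simp [simpleRoots]); norm_num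
  · have e1 : scalarProduct a (simpleRoots .III 2) (simpleRoots .III 0) ≠ 0 := by
      simp [scalarProduct, simpleRoots, s, Fin.sum_univ_three, ha0]
    have e2 : scalarProduct a (simpleRoots .III 2) (simpleRoots .III 1) ≠ 0 := by
      apply h2 _ _ hm1
      simp [scalarProduct, simpleRoots, s, Fin.sum_univ_three]
      right; ring
    funext i
    fin_cases i
    · refine (if_neg (by decide)).trans ((if_pos e1).trans ?_)
      ext k; (fin_cases k <;> simp [simpleRoots]); norm_num
    · refine (if_neg (by decide)).trans ((if_pos e2).trans ?_)
      ext k; (fin_cases k <;> simp [simpleRoots]); norm_num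
    · ext k; fin_cases k <;> simp [oddReflection, simpleRoots]

theorem exists_monomialIso_rep {a : ℂ} (ha0 : a ≠ 0) (ha1 : a ≠ -1) (t : ParabolicType)
    (m : Diagram × Finset (Fin 3)) (hm : m ∈ t.marked) :
    ∃ a' ∈ paramOrbit a, a' ≠ 0 ∧ a' ≠ -1 ∧ ∃ e : Iso (D21 a) (D21 a'), ∀ k : ℤ,
      (gradedPiece a (simpleRoots m.1) m.2 k).map e.toLinearEquiv.toLinearMap =
        gradedPiece a' (simpleRoots t.rep.1) t.rep.2 k := by
  obtain ⟨σ, hσ⟩ := exists_perm_deg t m hm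
  obtain ⟨a', h1, h2, h3, e, he⟩ := exists_permIso ha0 ha1 σ
  refine ⟨a', h1, h2, h3, e.iso, fun k => ?_⟩
  rw [gradedPiece_eq, gradedPiece_eq, e.map_coordSub]
  congr 1
  ext i
  rw [Set.mem_ofPred_eq, Set.mem_ofPred_eq, Set.mem_ofPred_eq, he, hσ]

end D21

namespace D21

open LieSuperalgebra

/-! ### Classification of the parabolic subalgebras -/

/-- The eigenvalues of `H₁ + 3 H₂ + 9 H₃` on the basis. -/
def genericWt (i : Idx) : ℤ := wt i 0 + 3 * wt i 1 + 9 * wt i 2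

/-- The coefficients 1, 3, 9 make the element regular: its eigenvalues separate all roots from each
other and from zero. -/
theorem genericWt_injective : ∀ i j : Idx, genericWt i = genericWt j → wt i = 0 ∨ i = j := by
  decide

/-- A subalgebra that contains the Cartan subalgebra is a sum of weight spaces. -/
theorem eq_coordSub_of_range_cartan_le {a : ℂ} {p : Submodule ℂ (D21 a)} (hp : IsSubalgebra p)
    (hS : ∀ i, wt i = 0 → bv a i ∈ p) (hc : LinearMap.range (cartan a) ≤ p) :
    p = coordSub a {i | bv a i ∈ p} := by
  apply le_antisymm _ (coordSub_le.2 fun i hi => hi)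
  let f : Module.End ℂ (D21 a) := bracket (cartan a ![1, 3, 9])
  have hf : ∀ x i, coord a (f x) i = genericWt i * coord a x i := by
    intro x i
    rw [coord_bracket_cartan, Fin.sum_univ_three, genericWt]
    push_cast
    simp
    exact Or.inl (by ring)
  have hE : ∀ μ : ℂ, f.genEigenspace μ 1 = coordSub a {i | (genericWt i : ℂ) = μ} := by
    intro μ
    ext x
    rw [Module.End.mem_genEigenspace_one]
    constructor
    · intro h i hi
      have h1 := congrArg (fun y => coord a y i) h
      simp only [hf, map_smul, Pi.smul_apply, smul_eq_mul] at h1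
      by_contra hx
      exact hi (mul_right_cancel₀ hx h1)
    · intro h
      apply (coord a).injective
      ext i
      rw [hf, map_smul, Pi.smul_apply, smul_eq_mul]
      by_cases hi : (genericWt i : ℂ) = μ
      · rw [hi]
      · rw [h i hi, mul_zero, mul_zero]
  -- The operator is diagonalizable and preserves `p`, so `p` is the sum of its intersections with
  -- the eigenspaces.
  have htop : ⨆ μ, f.genEigenspace μ 1 = ⊤ := by
    simp only [hE, iSup_coordSub]
    rw [← coordSub_univ]
    congr 1
    ext i
    simp
  rw [Submodule.eq_iSup_inf_genEigenspace 1 (fun x hx => hp _ (hc ⟨_, rfl⟩) x hx) htop]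
  refine iSup_le fun μ => ?_
  rw [hE]
  -- Away from weight zero the eigenspaces are lines, so a nonzero coordinate puts the basis vector
  -- itself into `p`; weight zero is in `p` by hypothesis.
  rintro x ⟨hxp, hx⟩ i hi
  by_contra hxi
  have hiμ : (genericWt i : ℂ) = μ := by
    by_contra h
    exact hxi (hx i h)
  have hi0 : wt i ≠ 0 := fun h => hi (Submodule.eq_iSup_inf_genEigenspace 1
    (fun x hx => hp _ (hc ⟨_, rfl⟩) x hx) htop ▸ hS i h)
  apply hi
  have hx' : x = coord a x i • bv a i := by
    conv_lhs => rw [← sum_coord x]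
    refine Finset.sum_eq_single i (fun j _ hj => ?_) fun h => absurd (Finset.mem_univ i) h
    rw [hx j, zero_smul]
    intro hjμ
    have : genericWt i = genericWt j := by exact_mod_cast hiμ.trans hjμ.symm
    rcases genericWt_injective i j this with h | h
    · exact hi0 h
    · exact hj h.symm
  have : bv a i ∈ p := by
    rw [hx'] at hxp
    exact (Submodule.smul_mem_iff p hxi).1 hxp
  exact Submodule.eq_iSup_inf_genEigenspace 1 (fun x hx => hp _ (hc ⟨_, rfl⟩) x hx) htop ▸ this

/-- The properties of the index set of a parabolic subalgebra. -/
structure IsAdmissible (a : ℂ) (S : Set Idx) : Prop where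
  isSubalgebra : IsSubalgebra (coordSub a S)
  ne_univ : S ≠ Set.univ
  zero_mem : ∀ i, wt i = 0 → i ∈ S
  mem_or : ∀ i j, wt i + wt j = 0 → i ∈ S ∨ j ∈ S

theorem bv_mem_range_cartan (a : ℂ) (i : Fin 3) :
    bv a (.inl (i, 0)) ∈ LinearMap.range (cartan a) := by
  refine ⟨Pi.single i 1, ?_⟩
  apply (coord a).injective
  ext (⟨k, t⟩ | p)
  · rw [coord_bv]
    change ![((Pi.single i 1 : Fin 3 → ℂ) k • slH).1 0 0, ((Pi.single i 1 : Fin 3 → ℂ) k • slH).1 0 1,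
      ((Pi.single i 1 : Fin 3 → ℂ) k • slH).1 1 0] t = _
    have key : ∀ k l m, ((Pi.single i 1 : Fin 3 → ℂ) k • slH).1 l m =
      (Pi.single i 1 : Fin 3 → ℂ) k * !![(1 : ℂ), 0; 0, -1] l m := fun k l m => rfl
    rw [key, key, key]
    fin_cases t <;> simp [Pi.single_apply]
  · rw [coord_bv]
    rfl

theorem wt_eq_zero : ∀ i : Idx, wt i = 0 → ∃ k, i = .inl (k, 0) := by decide

/-- Only two consequences of containing a Borel subalgebra are kept: the Cartan subalgebra lies in
`p`, and of two opposite roots at least one does. They survive the Weyl reflections, whereas the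
root system would have to be moved along. -/
theorem IsParabolic.exists_isAdmissible {a : ℂ} {p : Submodule ℂ (D21 a)} (hp : IsParabolic a p) :
    ∃ S, IsAdmissible a S ∧ p = coordSub a S := by
  obtain ⟨h1, h2, R, hR, hle⟩ := hp
  have hc : LinearMap.range (cartan a) ≤ p := le_sup_left.trans hle
  have h0 : ∀ i, wt i = 0 → bv a i ∈ p := by
    intro i hi
    obtain ⟨k, rfl⟩ := wt_eq_zero i hi
    exact hc (bv_mem_range_cartan a k)
  have hpS := eq_coordSub_of_range_cartan_le h2 h0 hc
  refine ⟨_, ⟨hpS ▸ h2, ?_, h0, ?_⟩, hpS⟩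
  · intro h
    exact h1 (hpS.trans ((congrArg (coordSub a) h).trans coordSub_univ))
  · have hpos : ∀ i, IsRoot a (fun k => (wt i k : ℂ)) →
        IsNonnegCombination R (fun k => (wt i k : ℂ)) → bv a i ∈ p := fun i hi hn =>
      hle (Submodule.mem_sup_right (Submodule.mem_iSup_of_mem _
        (Submodule.mem_iSup_of_mem ⟨hi, hn⟩ (bv_mem_rootSpace i))))
    intro i j hij
    by_cases hi : wt i = 0
    · exact Or.inl (h0 i hi)
    have hne : ∀ i, wt i ≠ 0 → IsRoot a fun k => (wt i k : ℂ) := fun i hi =>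
      isRoot_iff.2 ⟨fun h => hi (funext fun k => Int.cast_eq_zero.1 (congrFun h k)), i, rfl⟩
    have hj : wt j = -wt i := eq_neg_of_add_eq_zero_right hij
    have hj0 : wt j ≠ 0 := by rwa [hj, neg_ne_zero]
    have hjc : (-fun k => (wt i k : ℂ)) = fun k => (wt j k : ℂ) := by
      ext k
      simp [hj]
    rcases hR.pos_or_neg _ (hne i hi) with h | h
    · exact Or.inl (hpos i (hne i hi) h)
    · rw [hjc] at h
      exact Or.inr (hpos j (hne j hj0) h)

theorem IsAdmissible.refl {a : ℂ} {S : Set Idx} (h : IsAdmissible a S) (k : Fin 3) :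
    IsAdmissible a {i | reflIdx k i ∈ S} := by
  have h0 : ∀ k i, wt i = 0 → wt (reflIdx k i) = 0 := by decide
  have hadd : ∀ k i j, wt i + wt j = 0 → wt (reflIdx k i) + wt (reflIdx k j) = 0 := by decide
  refine ⟨?_, ?_, fun i hi => h.zero_mem _ (h0 k i hi), fun i j hij => h.mem_or _ _ (hadd k i j hij)⟩
  · have := (reflIso a k).map_coordSub S
    rintro x hx y hy
    change x ∈ coordSub a {i | (reflIso a k).perm i ∈ S} at hx
    change y ∈ coordSub a {i | (reflIso a k).perm i ∈ S} at hy
    change _ ∈ coordSub a {i | (reflIso a k).perm i ∈ S}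
    rw [← this] at hx hy ⊢
    obtain ⟨x, hx, rfl⟩ := hx
    obtain ⟨y, hy, rfl⟩ := hy
    exact ⟨_, h.isSubalgebra x hx y hy, (reflIso a k).iso.map_bracket x y⟩
  · intro hu
    apply h.ne_univ
    rw [Set.eq_univ_iff_forall] at hu ⊢
    intro i
    have := hu ((reflIdx k).symm i)
    rwa [Set.mem_ofPred_eq, Equiv.apply_symm_apply] at this

/-- One of `Xₖ`, `Yₖ` belongs to the index set; if it is only `Yₖ`, the reflection in that factor
exchanges the two. The clause about the other factors lets the three normalizations be made one
after another. -/
theorem IsAdmissible.exists_refl {a : ℂ} {S : Set Idx} (h : IsAdmissible a S) (k : Fin 3)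
    {P : Submodule ℂ (D21 a) → Prop}
    (hP : ∀ (i : Fin 3) (p : Submodule ℂ (D21 a)),
      P (p.map (reflIso a i).iso.toLinearEquiv.toLinearMap) → P p)
    (hS : ∀ S', IsAdmissible a S' → .inl (k, 1) ∈ S' →
      (∀ i ≠ k, .inl (i, 1) ∈ S → .inl (i, 1) ∈ S') → P (coordSub a S')) : P (coordSub a S) := by
  by_cases hk : .inl (k, 1) ∈ S
  · exact hS S h hk fun i _ hi => hi
  · apply hP k
    rw [MonomialIso.map_coordSub]
    apply hS _ (h.refl k)
    · have e : ∀ k, reflIdx k (.inl (k, 1)) = .inl (k, 2) := by decide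
      have e' : ∀ k : Fin 3, wt (.inl (k, 1)) + wt (.inl (k, 2)) = 0 := by decide
      rw [Set.mem_ofPred_eq, e]
      exact (h.mem_or _ _ (e' k)).resolve_left hk
    · have e : ∀ k i, i ≠ k → reflIdx k (.inl (i, 1)) = .inl (i, 1) := by decide
      intro i hi hi1
      rwa [Set.mem_ofPred_eq, e k i hi]

theorem IsAdmissible.mem_of_coordBracket_ne {a : ℂ} {S : Set Idx} (h : IsAdmissible a S)
    {i j k : Idx} (hi : i ∈ S) (hj : j ∈ S)
    (hk : coordBracket (s a) (Pi.single i 1) (Pi.single j 1) k ≠ 0) : k ∈ S := by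
  by_contra hkS
  apply hk
  have := h.isSubalgebra _ (bv_mem.2 hi) _ (bv_mem.2 hj) k hkS
  rwa [coord_bracket, bv, bv, LinearEquiv.apply_symm_apply, LinearEquiv.apply_symm_apply] at this

/-- The indicator function of an index set that contains all `Hᵢ` and `Xᵢ`. -/
def indicator (y0 y1 y2 o000 o001 o010 o011 o100 o101 o110 o111 : Bool) : Idx → Bool :=
  Sum.elim (fun k => ![true, true, ![y0, y1, y2] k.1] k.2)
    (fun p => ![![![o000, o001], ![o010, o011]], ![![o100, o101], ![o110, o111]]] p.1 p.2.1 p.2.2)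

/-- An index set with all `Hᵢ` and `Xᵢ` is given by eleven bits. The implications listed are closure
under the `Xᵢ`, the choice between opposite odd roots, closure under the `Yᵢ`, odd brackets that
produce a `Yᵢ`, and properness. The rest is a finite check. -/
theorem exists_type_of_indicator : ∀ y0 y1 y2 o000 o001 o010 o011 o100 o101 o110 o111 : Bool,
    (∀ x ∈ [(o100, o000), (o101, o001), (o110, o010), (o111, o011), (o010, o000), (o011, o001),
      (o110, o100), (o111, o101), (o001, o000), (o011, o010), (o101, o100), (o111, o110),
      (!o000, o111), (!o001, o110), (!o010, o101), (!o100, o011),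
      (y0 && o000, o100), (y0 && o001, o101), (y0 && o010, o110), (y0 && o011, o111),
      (y1 && o000, o010), (y1 && o001, o011), (y1 && o100, o110), (y1 && o101, o111),
      (y2 && o000, o001), (y2 && o010, o011), (y2 && o100, o101), (y2 && o110, o111),
      (o100 && o111, y0), (o101 && o110, y0), (o010 && o111, y1), (o011 && o110, y1),
      (o001 && o111, y2), (o011 && o101, y2),
      (y0 && y1 && y2 && o000 && o001 && o010 && o011 && o100 && o101 && o110 && o111, false)],
      x.1 = true → x.2 = true) →
    ∃ t : ParabolicType, ∃ σ : Equiv.Perm (Fin 3), ∀ i,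
      indicator y0 y1 y2 o000 o001 o010 o011 o100 o101 o110 o111 (permIdx σ i) =
        decide (0 ≤ deg t.rep.1 t.rep.2 i) := by
  decide

theorem IsAdmissible.exists_type {a : ℂ} (ha0 : a ≠ 0) (ha1 : a ≠ -1) {S : Set Idx}
    (h : IsAdmissible a S) (hX : ∀ k, .inl (k, 1) ∈ S) :
    ∃ t : ParabolicType, ∃ σ : Equiv.Perm (Fin 3), ∀ i,
      permIdx σ i ∈ S ↔ 0 ≤ deg t.rep.1 t.rep.2 i := by
  classical
  have hH : ∀ k, .inl (k, 0) ∈ S := fun k => h.zero_mem _ (by revert k; decide)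
  have hm1 : -1 - a ≠ 0 := fun h => ha1 (by linear_combination -h)
  have hp1 : a + 1 ≠ 0 := fun h => ha1 (by linear_combination h)
  let b : Idx → Bool := fun i => decide (i ∈ S)
  have hb : ∀ i, b i = indicator (b (.inl (0, 2))) (b (.inl (1, 2))) (b (.inl (2, 2)))
      (b (.inr (0, 0, 0))) (b (.inr (0, 0, 1))) (b (.inr (0, 1, 0))) (b (.inr (0, 1, 1)))
      (b (.inr (1, 0, 0))) (b (.inr (1, 0, 1))) (b (.inr (1, 1, 0))) (b (.inr (1, 1, 1))) i := by
    rintro (⟨k, t⟩ | ⟨p, q, r⟩)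
    · fin_cases t
      · exact decide_eq_true (hH k)
      · exact decide_eq_true (hX k)
      · fin_cases k <;> rfl
    · fin_cases p <;> fin_cases q <;> fin_cases r <;> rfl
  have hY : ∀ {i j k : Idx}, coordBracket (s a) (Pi.single i 1) (Pi.single j 1) k ≠ 0 →
      (b i && b j) = true → b k = true := by
    intro i j k hk hij
    rw [Bool.and_eq_true] at hij
    exact decide_eq_true (h.mem_of_coordBracket_ne (of_decide_eq_true hij.1)
      (of_decide_eq_true hij.2) hk)
  have hXm : ∀ {i : Fin 3} {j k : Idx},
      coordBracket (s a) (Pi.single (.inl (i, 1)) 1) (Pi.single j 1) k ≠ 0 →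
      b j = true → b k = true := by
    intro i j k hk hj
    exact hY hk (by rw [hj, Bool.and_true]; exact decide_eq_true (hX i))
  have hor : ∀ {i j : Idx}, wt i + wt j = 0 → (!b i) = true → b j = true := by
    intro i j hij hi
    refine decide_eq_true ((h.mem_or i j hij).resolve_left ?_)
    have : b i = false := by simpa using hi
    exact of_decide_eq_false this
  obtain ⟨t, σ, hσ⟩ := exists_type_of_indicator (b (.inl (0, 2))) (b (.inl (1, 2)))
    (b (.inl (2, 2))) (b (.inr (0, 0, 0))) (b (.inr (0, 0, 1))) (b (.inr (0, 1, 0)))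
    (b (.inr (0, 1, 1))) (b (.inr (1, 0, 0))) (b (.inr (1, 0, 1))) (b (.inr (1, 1, 0)))
    (b (.inr (1, 1, 1))) (by
      simp only [List.forall_mem_cons]
      refine ⟨hXm (i := 0) ?_, hXm (i := 0) ?_, hXm (i := 0) ?_, hXm (i := 0) ?_,
        hXm (i := 1) ?_, hXm (i := 1) ?_, hXm (i := 1) ?_, hXm (i := 1) ?_,
        hXm (i := 2) ?_, hXm (i := 2) ?_, hXm (i := 2) ?_, hXm (i := 2) ?_,
        hor (by decide), hor (by decide), hor (by decide), hor (by decide),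
        hY ?_, hY ?_, hY ?_, hY ?_, hY ?_, hY ?_, hY ?_, hY ?_, hY ?_, hY ?_, hY ?_, hY ?_,
        hY ?_, hY ?_, hY ?_, hY ?_, hY ?_, hY ?_, ?_, by simp⟩
      -- The last implication is properness: if all eleven bits are true, the index set is
      -- everything.
      on_goal 31 =>
        intro hall
        exfalso
        apply h.ne_univ
        rw [Set.eq_univ_iff_forall]
        intro i
        have hi := hb i
        simp only [Bool.and_eq_true] at hall
        simp only [hall] at hi
        have : b i = true := hi.trans ((by decide : ∀ i, indicator true true true true true true true
          true true true true i = true) i)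
        exact of_decide_eq_true this
      -- What remains is the nonvanishing of structure constants; for two odd vectors they are
      -- multiples of some sᵢ, where the conditions on `a` enter.
      all_goals
        simp [coordBracket_Y0, coordBracket_Y1, coordBracket_Y2, coordBracket_O000, coordBracket_O001,
          coordBracket_O010, coordBracket_O011, coordBracket_O100, coordBracket_O101,
          coordBracket_O110, coordBracket_O111,
          s, ha0, hm1, hp1])
  refine ⟨t, σ, fun i => ?_⟩
  have := hσ i
  rw [← hb] at this
  simpa [b] using this

/-- Every parabolic subalgebra is isomorphic to one of the six. -/
theorem IsParabolic.exists_type {a : ℂ} (ha0 : a ≠ 0) (ha1 : a ≠ -1) {p : Submodule ℂ (D21 a)}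
    (hp : IsParabolic a p) :
    ∃ t : ParabolicType, ∃ a' ∈ paramOrbit a, ∃ e : Iso (D21 a) (D21 a'),
      p.map e.toLinearEquiv.toLinearMap = parabolic a' (simpleRoots t.rep.1) t.rep.2 := by
  obtain ⟨S, hS, rfl⟩ := hp.exists_isAdmissible
  let P : Submodule ℂ (D21 a) → Prop := fun p =>
    ∃ t : ParabolicType, ∃ a' ∈ paramOrbit a, ∃ e : Iso (D21 a) (D21 a'),
      p.map e.toLinearEquiv.toLinearMap = parabolic a' (simpleRoots t.rep.1) t.rep.2
  have hP : ∀ (i : Fin 3) (p : Submodule ℂ (D21 a)),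
      P (p.map (reflIso a i).iso.toLinearEquiv.toLinearMap) → P p := by
    rintro i p ⟨t, a', ha', e, he⟩
    refine ⟨t, a', ha', (reflIso a i).iso.trans e, ?_⟩
    rw [← he, ← Submodule.map_comp]
    rfl
  refine hS.exists_refl (P := P) 0 hP fun S1 h1 hX0 _ => ?_
  refine h1.exists_refl (P := P) 1 hP fun S2 h2 hX1 hX => ?_
  have hX0 := hX 0 (by decide) hX0
  refine h2.exists_refl (P := P) 2 hP fun S3 h3 hX2 hX => ?_
  have hX0 := hX 0 (by decide) hX0
  have hX1 := hX 1 (by decide) hX1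
  obtain ⟨t, σ, hσ⟩ := h3.exists_type ha0 ha1 (by
    intro k
    fin_cases k
    · exact hX0
    · exact hX1
    · exact hX2)
  obtain ⟨a', ha', -, -, e, he⟩ := exists_permIso ha0 ha1 σ
  refine ⟨t, a', ha', e.iso, ?_⟩
  rw [e.map_coordSub, parabolic_eq, he]
  congr 1
  ext i
  exact hσ i

end D21

/-! ### Invariants that separate the six types -/

namespace LieSuperalgebra

section
variable {L : Type u} [AddCommGroup L] [Module ℂ L] [LieSuperalgebra L]
variable {L' : Type v} [AddCommGroup L'] [Module ℂ L'] [LieSuperalgebra L']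

/-- Preservation of parity by the inverse is not part of the definition. It holds when `p` contains
parity components: the component of `x` of the wrong parity is sent to an element that is both even
and odd, hence to zero. -/
theorem SubalgebraIso.symm {p : Submodule ℂ L} {q : Submodule ℂ L'}
    (hp : ∀ i, ∀ x ∈ p, parityComponent i x ∈ p) (h : SubalgebraIso p q) : SubalgebraIso q p := by
  obtain ⟨h1, h2, e, he, hpar⟩ := h
  refine ⟨h2, h1, e.symm, fun x y z hz => ?_, fun i y hy => ?_⟩
  · let w : p := ⟨bracket (e.symm x : L) (e.symm y : L), h1 _ (e.symm x).2 _ (e.symm y).2⟩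
    have hw := he (e.symm x) (e.symm y) w rfl
    rw [e.apply_symm_apply, e.apply_symm_apply, hz] at hw
    have : z = e w := Subtype.ext hw
    rw [this, e.symm_apply_apply]
  · obtain ⟨x, rfl⟩ := e.surjective y
    rw [e.symm_apply_apply]
    have hc : ∀ j, (e x : L') ∈ parity i → parityComponent j (x : L) ≠ 0 → i = j := by
      intro j hi hj
      by_contra hij
      let x0 : ZMod 2 → p := fun k => ⟨parityComponent k x, hp k x x.2⟩
      have hx : x = x0 0 + x0 1 := Subtype.ext (parityComponent_add (x : L)).symm
      have hpc : ∀ k, (e (x0 k) : L') ∈ parity k := fun k => hpar k _ (parityComponent_mem k _)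
      have hd := (isCompl_parity (L := L')).disjoint
      rw [Submodule.disjoint_def] at hd
      have hex : (e x : L') = e (x0 0) + e (x0 1) := by
        conv_lhs => rw [hx, map_add]
        rfl
      have h0 : (e (x0 j) : L') = 0 := by
        rcases zmod_two_cases i with rfl | rfl <;> rcases zmod_two_cases j with rfl | rfl
        · exact absurd rfl hij
        · refine hd _ ?_ (hpc 1)
          rw [← sub_eq_of_eq_add' hex]
          exact sub_mem hi (hpc 0)
        · refine hd _ (hpc 0) ?_
          rw [← sub_eq_of_eq_add hex]
          exact sub_mem hi (hpc 1)
        · exact absurd rfl hij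
      have h1 : x0 j = 0 := e.injective (Subtype.ext (by rw [h0, map_zero]; rfl))
      exact hj (congrArg Subtype.val h1)
    rw [← parityComponent_add (x : L)]
    refine add_mem ?_ ?_
    · by_cases h0 : parityComponent 0 (x : L) = 0
      · rw [h0]; exact zero_mem _
      · rw [hc 0 hy h0]; exact parityComponent_mem 0 _
    · by_cases h0 : parityComponent 1 (x : L) = 0
      · rw [h0]; exact zero_mem _
      · rw [hc 1 hy h0]; exact parityComponent_mem 1 _

theorem SubalgebraIso.finrank_le {p : Submodule ℂ L} {q : Submodule ℂ L'} [FiniteDimensional ℂ L']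
    (h : SubalgebraIso p q) (i : ZMod 2) :
    Module.finrank ℂ ↥(p ⊓ parity i) ≤ Module.finrank ℂ ↥(q ⊓ parity i) := by
  obtain ⟨-, -, e, -, hpar⟩ := h
  let f : ↥(p ⊓ parity i) →ₗ[ℂ] ↥(q ⊓ parity i) :=
    (q.subtype ∘ₗ e.toLinearMap ∘ₗ Submodule.inclusion inf_le_left).codRestrict _ fun x =>
      ⟨(e _).2, hpar i _ x.2.2⟩
  refine LinearMap.finrank_le_finrank_of_injective (f := f) fun x y hxy => ?_
  have := e.injective (Subtype.ext (congrArg Subtype.val hxy : (f x : L') = f y))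
  exact Subtype.ext (congrArg (fun z : p => (z : L)) this)

/-- The brackets of odd elements of `p` are proportional to each other. -/
def OddBracketsProportional (p : Submodule ℂ L) : Prop :=
  ∀ x y x' y', x ∈ p ⊓ parity 1 → y ∈ p ⊓ parity 1 → x' ∈ p ⊓ parity 1 → y' ∈ p ⊓ parity 1 →
    ∃ c d : ℂ, (c ≠ 0 ∨ d ≠ 0) ∧ c • bracket x y + d • bracket x' y' = 0

theorem SubalgebraIso.oddBracketsProportional {p : Submodule ℂ L} {q : Submodule ℂ L'}
    (h : SubalgebraIso p q) (hq : OddBracketsProportional q) : OddBracketsProportional p := by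
  obtain ⟨h1, -, e, he, hpar⟩ := h
  intro x y x' y' hx hy hx' hy'
  have hm : ∀ (x : L) (hx : x ∈ p ⊓ parity 1), (e ⟨x, hx.1⟩ : L') ∈ q ⊓ parity 1 := fun x hx =>
    ⟨(e _).2, hpar 1 _ hx.2⟩
  obtain ⟨c, d, hcd, h⟩ := hq _ _ _ _ (hm x hx) (hm y hy) (hm x' hx') (hm y' hy')
  refine ⟨c, d, hcd, ?_⟩
  have hb : ∀ (x : L) (hx : x ∈ p) (y : L) (hy : y ∈ p),
      bracket (e ⟨x, hx⟩ : L') (e ⟨y, hy⟩ : L') = e ⟨bracket x y, h1 x hx y hy⟩ :=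
    fun x hx y hy => he _ _ _ rfl
  rw [hb, hb] at h
  have h' : e (c • ⟨bracket x y, h1 x hx.1 y hy.1⟩ + d • ⟨bracket x' y', h1 x' hx'.1 y' hy'.1⟩) =
      0 := Subtype.ext (by rw [map_add, map_smul, map_smul]; exact h)
  exact congrArg Subtype.val (e.map_eq_zero_iff.1 h')

end

end LieSuperalgebra

namespace D21

open LieSuperalgebra

theorem parityComponent_mem_coordSub {a : ℂ} {S : Set Idx} (i : ZMod 2) {x : D21 a}
    (hx : x ∈ coordSub a S) : parityComponent i x ∈ coordSub a S := by
  have h0 : ∀ k : Idx, k.isLeft → bv a k ∈ parity (L := D21 a) 0 := fun k hk => by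
    rw [parity_zero_eq]; exact bv_mem.2 hk
  have h1 : ∀ k : Idx, k.isRight → bv a k ∈ parity (L := D21 a) 1 := fun k hk => by
    rw [parity_one_eq]; exact bv_mem.2 hk
  have key : ∀ k ∈ S, parityComponent i (bv a k) ∈ coordSub a S := by
    intro k hk
    rcases LieSuperalgebra.zmod_two_cases i with rfl | rfl <;> rcases k with k | k
    · rw [parityComponent_self (h0 _ rfl)]; exact bv_mem.2 hk
    · rw [parityComponent_zero_of_odd (h1 _ rfl)]; exact zero_mem _
    · rw [parityComponent_one_of_even (h0 _ rfl)]; exact zero_mem _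
    · rw [parityComponent_self (h1 _ rfl)]; exact bv_mem.2 hk
  have hle : coordSub a S ≤ (coordSub a S).comap (parityComponent i) := coordSub_le.2 key
  exact hle hx

/-- The superdimensions of the six parabolic subalgebras. -/
def parabolicDim : ParabolicType → ℕ × ℕ
  | .I1 => (8, 4)
  | .I2 => (7, 6)
  | .I12 => (7, 4)
  | .I23 => (6, 5)
  | .I123 => (6, 4)
  | .IV123 => (6, 4)

theorem card_deg_nonneg : ∀ t : ParabolicType,
    ((Finset.univ.filter fun i : Idx => 0 ≤ deg t.rep.1 t.rep.2 i ∧ i.isLeft).card,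
      (Finset.univ.filter fun i : Idx => 0 ≤ deg t.rep.1 t.rep.2 i ∧ i.isRight).card) =
      parabolicDim t := by
  decide

theorem finrank_parabolic (a : ℂ) (t : ParabolicType) :
    (Module.finrank ℂ ↥(parabolic a (simpleRoots t.rep.1) t.rep.2 ⊓ parity 0),
      Module.finrank ℂ ↥(parabolic a (simpleRoots t.rep.1) t.rep.2 ⊓ parity 1)) =
      parabolicDim t := by
  rw [← card_deg_nonneg, parabolic_eq, parity_zero_eq, parity_one_eq, coordSub_inf, coordSub_inf]
  exact congrArg₂ _ (finrank_coordSub fun i => 0 ≤ deg t.rep.1 t.rep.2 i ∧ i.isLeft)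
    (finrank_coordSub fun i => 0 ≤ deg t.rep.1 t.rep.2 i ∧ i.isRight)

/-- Superdimension separates all types except the two of dimension (6|4), for which brackets of odd
elements are compared. -/
theorem parabolicDim_eq : ∀ t t' : ParabolicType, parabolicDim t = parabolicDim t' →
    t = t' ∨ (t = .I123 ∧ t' = .IV123) ∨ (t = .IV123 ∧ t' = .I123) := by
  decide

/-- The odd part is spanned by the four vectors with first weight +1. The only root that is a sum of
two of their weights is 2ε₁, so all these brackets lie on one line. -/
theorem oddBracketsProportional_I123 (a : ℂ) : OddBracketsProportional
    (parabolic a (simpleRoots ParabolicType.I123.rep.1) ParabolicType.I123.rep.2) := by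
  have hS : parabolic a (simpleRoots ParabolicType.I123.rep.1) ParabolicType.I123.rep.2 ⊓
      parity 1 = coordSub a {i | i.elim (fun _ => false) (fun p => p.1 == 0)} := by
    rw [parabolic_eq, parity_one_eq, coordSub_inf]
    congr 1
    ext i
    have : ∀ i : Idx, (0 ≤ deg ParabolicType.I123.rep.1 ParabolicType.I123.rep.2 i ∧ i.isRight) ↔
        i.elim (fun _ => false) (fun p => p.1 == 0) = true := by decide
    exact this i
  have hw : ∀ i : Idx, i.elim (fun _ => false) (fun p => p.1 == 0) = true →
      ∀ j : Idx, j.elim (fun _ => false) (fun p => p.1 == 0) = true →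
      ∀ k, wt k = wt i + wt j → k = .inl (0, 1) := by decide
  intro x y x' y' hx hy hx' hy'
  rw [hS] at hx hy hx' hy'
  have h1 := bracket_mem_coordSub (U := {.inl (0, 1)}) hw hx hy
  have h2 := bracket_mem_coordSub (U := {.inl (0, 1)}) hw hx' hy'
  set c := coord a (bracket x y) (.inl (0, 1)) with hc
  set d := coord a (bracket x' y') (.inl (0, 1)) with hd
  have key : ∀ c' d' : ℂ, c' * c + d' * d = 0 → c' • bracket x y + d' • bracket x' y' = 0 := by
    intro c' d' h
    apply (coord a).injective
    ext i
    simp only [map_add, map_smul, Pi.add_apply, Pi.smul_apply, smul_eq_mul, map_zero, Pi.zero_apply]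
    by_cases hi : i = .inl (0, 1)
    · rw [hi]; exact h
    · rw [h1 i hi, h2 i hi, mul_zero, mul_zero, add_zero]
  by_cases h0 : d = 0
  · exact ⟨0, 1, Or.inr one_ne_zero, key _ _ (by rw [h0]; ring)⟩
  · exact ⟨d, -c, Or.inl h0, key _ _ (by ring)⟩

/-- Two brackets of simple root vectors point along the positive root vectors of the first and of
the second factor, with coefficients that are multiples of -1-a and 1; a relation between them would
be trivial. -/
theorem not_oddBracketsProportional_IV123 {a : ℂ} (ha1 : a ≠ -1) : ¬ OddBracketsProportional
    (parabolic a (simpleRoots ParabolicType.IV123.rep.1) ParabolicType.IV123.rep.2) := by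
  intro h
  have hm : ∀ i : Idx, 0 ≤ deg ParabolicType.IV123.rep.1 ParabolicType.IV123.rep.2 i → i.isRight →
      bv a i ∈ parabolic a (simpleRoots ParabolicType.IV123.rep.1) ParabolicType.IV123.rep.2 ⊓
        parity 1 := by
    intro i h0 h1
    rw [parabolic_eq, parity_one_eq]
    exact ⟨bv_mem.2 h0, bv_mem.2 h1⟩
  obtain ⟨c, d, hcd, h0⟩ := h _ _ _ _ (hm (.inr (0, 0, 1)) (by decide) rfl)
    (hm (.inr (0, 1, 0)) (by decide) rfl) (hm (.inr (0, 0, 1)) (by decide) rfl)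
    (hm (.inr (1, 0, 0)) (by decide) rfl)
  have hp1 : a + 1 ≠ 0 := fun h => ha1 (by linear_combination h)
  have e1 := congrArg (fun x => coord a x (.inl (0, 1))) h0
  have e2 := congrArg (fun x => coord a x (.inl (1, 1))) h0
  simp [coord_bracket, coordBracket_X0, coordBracket_X1, coord_bv, s, hp1] at e1 e2
  rcases hcd with h | h
  · exact h e1
  · exact h e2

theorem not_subalgebraIso_parabolic (t t' : ParabolicType) (htt' : t ≠ t') (a a' : ℂ)
    (ha1 : a ≠ -1) (ha1' : a' ≠ -1) :
    ¬ SubalgebraIso (parabolic a (simpleRoots t.rep.1) t.rep.2)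
        (parabolic a' (simpleRoots t'.rep.1) t'.rep.2) := by
  intro h
  have h' := h.symm (by
    rw [parabolic_eq]
    exact fun i x hx => parityComponent_mem_coordSub i hx)
  have hd : parabolicDim t = parabolicDim t' := by
    rw [← finrank_parabolic a, ← finrank_parabolic a']
    exact congrArg₂ _ (le_antisymm (h.finrank_le 0) (h'.finrank_le 0))
      (le_antisymm (h.finrank_le 1) (h'.finrank_le 1))
  rcases parabolicDim_eq t t' hd with rfl | ⟨rfl, rfl⟩ | ⟨rfl, rfl⟩
  · exact htt' rfl
  · exact not_oddBracketsProportional_IV123 ha1'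
      (h'.oddBracketsProportional (oddBracketsProportional_I123 a))
  · exact not_oddBracketsProportional_IV123 ha1
      (h.oddBracketsProportional (oddBracketsProportional_I123 a'))

end D21

/-! ### The degree zero components as matrix Lie superalgebras -/

namespace LieSuperalgebra

section
variable {L : Type u} [AddCommGroup L] [Module ℂ L] [LieSuperalgebra L]
variable {L' : Type v} [AddCommGroup L'] [Module ℂ L'] [LieSuperalgebra L']

theorem SubalgebraIso.trans {L'' : Type w} [AddCommGroup L''] [Module ℂ L''] [LieSuperalgebra L'']
    {p : Submodule ℂ L} {q : Submodule ℂ L'} {r : Submodule ℂ L''} (h : SubalgebraIso p q)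
    (h' : SubalgebraIso q r) : SubalgebraIso p r := by
  obtain ⟨h1, -, e, he, hpar⟩ := h
  obtain ⟨-, h2, e', he', hpar'⟩ := h'
  exact ⟨h1, h2, e.trans e', fun x y z h => he' _ _ _ (he x y z h),
    fun i x hx => hpar' i _ (hpar i x hx)⟩

/-- A linear map that is injective and compatible with brackets and parity on the subalgebra `p`
defines an isomorphism of `p` with its image. -/
theorem subalgebraIso_of_linearMap {p : Submodule ℂ L} (hp : IsSubalgebra p) (φ : L →ₗ[ℂ] L')
    (hinj : ∀ x ∈ p, φ x = 0 → x = 0)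
    (hbr : ∀ x ∈ p, ∀ y ∈ p, φ (bracket x y) = bracket (φ x) (φ y))
    (hpar : ∀ i, ∀ x ∈ p, x ∈ parity i → φ x ∈ parity i) {q : Submodule ℂ L'}
    (hq : p.map φ = q) : SubalgebraIso p q := by
  subst hq
  refine ⟨hp, ?_, LinearEquiv.ofBijective (φ.submoduleMap p) ⟨?_, φ.submoduleMap_surjective p⟩,
    ?_, fun i x hx => hpar i x x.2 hx⟩
  · rintro _ ⟨x, hx, rfl⟩ _ ⟨y, hy, rfl⟩
    exact ⟨_, hp x hx y hy, hbr x hx y hy⟩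
  · rw [← LinearMap.ker_eq_bot, LinearMap.ker_eq_bot']
    exact fun x hx => Subtype.ext (hinj x x.2 (congrArg Subtype.val hx))
  · intro x y z h
    exact (hbr x x.2 y y.2).symm.trans (congrArg φ h)

theorem subalgebraIso_map {p : Submodule ℂ L} (hp : IsSubalgebra p) (e : Iso L L') :
    SubalgebraIso p (p.map e.toLinearEquiv.toLinearMap) :=
  subalgebraIso_of_linearMap hp _ (fun _ _ h => e.toLinearEquiv.map_eq_zero_iff.1 h)
    (fun x _ y _ => e.map_bracket x y) (fun _ _ _ hx => e.map_mem_parity hx) rfl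

end

theorem map_eq_top_of_finrank_eq {L : Type u} [AddCommGroup L] [Module ℂ L] {L' : Type v}
    [AddCommGroup L'] [Module ℂ L'] {p : Submodule ℂ L} [FiniteDimensional ℂ L'] (φ : L →ₗ[ℂ] L')
    (hinj : ∀ x ∈ p, φ x = 0 → x = 0) (h : Module.finrank ℂ p = Module.finrank ℂ L') :
    p.map φ = ⊤ := by
  apply Submodule.eq_top_of_finrank_eq
  rw [← h]
  refine (LinearEquiv.ofBijective (φ.submoduleMap p)
    ⟨?_, φ.submoduleMap_surjective p⟩).finrank_eq.symm
  rw [← LinearMap.ker_eq_bot, LinearMap.ker_eq_bot']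
  exact fun x hx => Subtype.ext (hinj x x.2 (congrArg Subtype.val hx))

/-- The element of `𝔤𝔩(m|n)` with the given blocks. -/
def GeneralLinear.blocks {m n : ℕ} (A : Matrix (Fin m) (Fin m) ℂ) (B : Matrix (Fin m) (Fin n) ℂ)
    (C : Matrix (Fin n) (Fin m) ℂ) (D : Matrix (Fin n) (Fin n) ℂ) : GeneralLinear m n :=
  Matrix.fromBlocks A B C D

theorem GeneralLinear.bracket_blocks {m n : ℕ} (A A' : Matrix (Fin m) (Fin m) ℂ)
    (B B' : Matrix (Fin m) (Fin n) ℂ) (C C' : Matrix (Fin n) (Fin m) ℂ)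
    (D D' : Matrix (Fin n) (Fin n) ℂ) :
    bracket (blocks A B C D) (blocks A' B' C' D') =
    blocks (A * A' - A' * A + B * C' + B' * C) (A * B' + B * D' - A' * B - B' * D)
      (C * A' + D * C' - C' * A - D' * C) (D * D' - D' * D + C * B' + C' * B) := by
  have h : ∀ X Y Z : Matrix (Fin m ⊕ Fin n) (Fin m ⊕ Fin n) ℂ,
      X = Matrix.fromBlocks A B C D → Y = Matrix.fromBlocks A' B' C' D' →
      Z = Matrix.fromBlocks 0 B' C' 0 * Matrix.fromBlocks 0 B C 0 →
      X * Y - Y * X + (2 : ℂ) • Z = Matrix.fromBlocks (A * A' - A' * A + B * C' + B' * C)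
        (A * B' + B * D' - A' * B - B' * D)
        (C * A' + D * C' - C' * A - D' * C) (D * D' - D' * D + C * B' + C' * B) := by
    rintro X Y Z rfl rfl rfl
    rw [Matrix.fromBlocks_multiply, Matrix.fromBlocks_multiply, Matrix.fromBlocks_multiply,
      sub_eq_add_neg, Matrix.fromBlocks_neg, Matrix.fromBlocks_add, Matrix.fromBlocks_smul,
      Matrix.fromBlocks_add]
    simp only [Matrix.zero_mul, Matrix.mul_zero, zero_add, add_zero, two_smul, smul_zero]
    congr 1 <;> abel
  exact h _ _ _ rfl rfl rfl

theorem GeneralLinear.blocks_mem_parity_zero {m n : ℕ} {A : Matrix (Fin m) (Fin m) ℂ}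
    {B : Matrix (Fin m) (Fin n) ℂ} {C : Matrix (Fin n) (Fin m) ℂ} {D : Matrix (Fin n) (Fin n) ℂ}
    (hB : B = 0) (hC : C = 0) :
    blocks A B C D ∈ parity (L := GeneralLinear m n) 0 := by
  refine GeneralLinear.mem_parity_zero.2 ?_
  subst hB hC
  exact Matrix.fromBlocks_zero

theorem GeneralLinear.blocks_mem_parity_one {m n : ℕ} {A : Matrix (Fin m) (Fin m) ℂ}
    {B : Matrix (Fin m) (Fin n) ℂ} {C : Matrix (Fin n) (Fin m) ℂ} {D : Matrix (Fin n) (Fin n) ℂ}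
    (hA : A = 0) (hD : D = 0) :
    blocks A B C D ∈ parity (L := GeneralLinear m n) 1 := by
  refine GeneralLinear.mem_parity_one.2 ?_
  subst hA hD
  exact Matrix.fromBlocks_zero

instance (m n : ℕ) : FiniteDimensional ℂ (GeneralLinear m n) :=
  inferInstanceAs (FiniteDimensional ℂ (Matrix (Fin m ⊕ Fin n) (Fin m ⊕ Fin n) ℂ))

theorem GeneralLinear.finrank_eq (m n : ℕ) :
    Module.finrank ℂ (GeneralLinear m n) = (m + n) * (m + n) := by
  change Module.finrank ℂ (Matrix (Fin m ⊕ Fin n) (Fin m ⊕ Fin n) ℂ) = _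
  rw [Module.finrank_matrix]
  simp

instance (n : ℕ) : FiniteDimensional ℂ (EvenAbelian n) :=
  inferInstanceAs (FiniteDimensional ℂ (Fin n → ℂ))

theorem EvenAbelian.finrank_eq (n : ℕ) : Module.finrank ℂ (EvenAbelian n) = n := by
  change Module.finrank ℂ (Fin n → ℂ) = n
  simp

theorem EvenAbelian.mem_parity_zero {n : ℕ} (x : EvenAbelian n) :
    x ∈ parity (L := EvenAbelian n) 0 := by
  change x ∈ (if (0 : ZMod 2) = 0 then (⊤ : Submodule ℂ (EvenAbelian n)) else ⊥)
  rw [if_pos rfl]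
  trivial

end LieSuperalgebra

namespace D21

open LieSuperalgebra

variable {a : ℂ}

theorem isSubalgebra_gradedPiece_zero (Ξ : Diagram) (χ : Finset (Fin 3)) :
    IsSubalgebra (gradedPiece a (simpleRoots Ξ) χ 0) := fun x hx y hy => by
  simpa using (isGrading_gradedPiece Ξ χ).bracket_mem 0 0 x hx y hy

theorem eq_zero_of_coord {x : D21 a} (h : ∀ i, coord a x i = 0) : x = 0 := by
  apply (coord a).injective
  ext i
  rw [h, map_zero, Pi.zero_apply]

theorem mem_gradedPiece {Ξ : Diagram} {χ : Finset (Fin 3)} {k : ℤ} {x : D21 a} :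
    x ∈ gradedPiece a (simpleRoots Ξ) χ k ↔ ∀ i, deg Ξ χ i ≠ k → coord a x i = 0 := by
  rw [gradedPiece_eq]
  rfl

theorem coord_of_even {x : D21 a} (hx : x ∈ parity (L := D21 a) 0) (p : Fin 2 × Fin 2 × Fin 2) :
    coord a x (.inr p) = 0 := by
  rw [parity_zero_eq] at hx
  exact hx _ (by simp)

theorem coord_of_odd {x : D21 a} (hx : x ∈ parity (L := D21 a) 1) (p : Fin 3 × Fin 3) :
    coord a x (.inl p) = 0 := by
  rw [parity_one_eq] at hx
  exact hx _ (by simp)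

theorem finrank_gradedPiece_zero (Ξ : Diagram) (χ : Finset (Fin 3)) :
    Module.finrank ℂ (gradedPiece a (simpleRoots Ξ) χ 0) =
      (Finset.univ.filter fun i => deg Ξ χ i = 0).card := by
  rw [gradedPiece_eq]
  exact finrank_coordSub _

/-- The coordinates of the Cartan part. -/
noncomputable def cartanCoord (a : ℂ) : D21 a →ₗ[ℂ] EvenAbelian 3 where
  toFun x := (fun i => coord a x (.inl (i, 0)) : Fin 3 → ℂ)
  map_add' x y := by rw [map_add]; rfl
  map_smul' c x := by rw [map_smul]; rfl

/-- With all nodes crossed no root has degree zero, so only the abelian Cartan subalgebra remains.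
-/
theorem subalgebraIso_evenAbelian {Ξ : Diagram} {χ : Finset (Fin 3)}
    (h : ∀ i, deg Ξ χ i = 0 → ∃ k, i = .inl (k, 0)) :
    SubalgebraIso (gradedPiece a (simpleRoots Ξ) χ 0) (⊤ : Submodule ℂ (EvenAbelian 3)) := by
  have hz : ∀ x ∈ gradedPiece a (simpleRoots Ξ) χ 0, ∀ i : Idx, (∀ k, i ≠ .inl (k, 0)) →
      coord a x i = 0 := by
    intro x hx i hi
    refine mem_gradedPiece.1 hx i fun hd => ?_
    obtain ⟨k, hk⟩ := h i hd
    exact hi k hk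
  have hinj : ∀ x ∈ gradedPiece a (simpleRoots Ξ) χ 0, cartanCoord a x = 0 → x = 0 := by
    intro x hx h0
    refine eq_zero_of_coord fun i => ?_
    by_cases hi : ∀ k, i ≠ .inl (k, 0)
    · exact hz x hx i hi
    · push Not at hi
      obtain ⟨k, rfl⟩ := hi
      exact congrFun h0 k
  refine subalgebraIso_of_linearMap (isSubalgebra_gradedPiece_zero Ξ χ) (cartanCoord a) hinj ?_ ?_
    ?_
  · intro x hx y hy
    have e1 : ∀ z ∈ gradedPiece a (simpleRoots Ξ) χ 0, ∀ k,
        coord a z (.inl (k, 1)) = 0 ∧ coord a z (.inl (k, 2)) = 0 := fun z hz' k =>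
      ⟨hz z hz' _ (by revert k; decide), hz z hz' _ (by revert k; decide)⟩
    have e2 : ∀ z ∈ gradedPiece a (simpleRoots Ξ) χ 0, ∀ p, coord a z (.inr p) = 0 :=
      fun z hz' p => hz z hz' _ fun _ => Sum.inr_ne_inl
    refine funext fun k => ?_
    change coord a (bracket x y) (.inl (k, 0)) = 0
    rw [coord_bracket]
    fin_cases k <;> simp [coordBracket_H0, coordBracket_H1, coordBracket_H2, e1 x hx, e2 x hx]
  · intro i x hx hxi
    rcases LieSuperalgebra.zmod_two_cases i with rfl | rfl
    · exact EvenAbelian.mem_parity_zero _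
    · have : cartanCoord a x = 0 := funext fun k => coord_of_odd hxi _
      rw [this]
      exact zero_mem _
  · refine map_eq_top_of_finrank_eq _ hinj ?_
    rw [EvenAbelian.finrank_eq, gradedPiece_eq]
    have hd : ∀ i, deg Ξ χ i = 0 ↔ ∃ k, i = .inl (k, 0) := fun i =>
      ⟨h i, by rintro ⟨k, rfl⟩; exact deg_of_wt_eq_zero Ξ χ (by revert k; decide)⟩
    rw [show {i | deg Ξ χ i = 0} = {i : Idx | ∃ k, i = .inl (k, 0)} from Set.ext hd,
      finrank_coordSub]
    decide

end D21

namespace LieSuperalgebra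

theorem GeneralLinear.blocks_add {m n : ℕ} (A A' : Matrix (Fin m) (Fin m) ℂ)
    (B B' : Matrix (Fin m) (Fin n) ℂ) (C C' : Matrix (Fin n) (Fin m) ℂ)
    (D D' : Matrix (Fin n) (Fin n) ℂ) : blocks A B C D + blocks A' B' C' D' =
    blocks (A + A') (B + B') (C + C') (D + D') := Matrix.fromBlocks_add ..

theorem GeneralLinear.smul_blocks {m n : ℕ} (c : ℂ) (A : Matrix (Fin m) (Fin m) ℂ)
    (B : Matrix (Fin m) (Fin n) ℂ) (C : Matrix (Fin n) (Fin m) ℂ)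
    (D : Matrix (Fin n) (Fin n) ℂ) : c • blocks A B C D = blocks (c • A) (c • B) (c • C) (c • D) :=
  Matrix.fromBlocks_smul ..

theorem GeneralLinear.blocks_eq_zero {m n : ℕ} {A : Matrix (Fin m) (Fin m) ℂ}
    {B : Matrix (Fin m) (Fin n) ℂ} {C : Matrix (Fin n) (Fin m) ℂ}
    {D : Matrix (Fin n) (Fin n) ℂ} (h : blocks A B C D = 0) :
    A = 0 ∧ B = 0 ∧ C = 0 ∧ D = 0 :=
  Matrix.fromBlocks_inj.1 (h.trans (Matrix.fromBlocks_zero (α := ℂ)).symm)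

/-- The linear map to `𝔤𝔩(m|n)` with the given linear blocks. -/
noncomputable def GeneralLinear.blocksMap {m n : ℕ} {V : Type u} [AddCommGroup V] [Module ℂ V]
    (A : V →ₗ[ℂ] Matrix (Fin m) (Fin m) ℂ) (B : V →ₗ[ℂ] Matrix (Fin m) (Fin n) ℂ)
    (C : V →ₗ[ℂ] Matrix (Fin n) (Fin m) ℂ) (D : V →ₗ[ℂ] Matrix (Fin n) (Fin n) ℂ) :
    V →ₗ[ℂ] GeneralLinear m n where
  toFun x := blocks (A x) (B x) (C x) (D x)
  map_add' x y := by simp only [map_add, blocks_add]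
  map_smul' c x := by simp only [map_smul, smul_blocks, RingHom.id_apply]

end LieSuperalgebra

namespace D21

open LieSuperalgebra GeneralLinear

variable {a : ℂ}

/-- The matrix of coordinate functionals. -/
noncomputable def matMap {m n : ℕ} (F : Matrix (Fin m) (Fin n) (D21 a →ₗ[ℂ] ℂ)) :
    D21 a →ₗ[ℂ] Matrix (Fin m) (Fin n) ℂ where
  toFun x := Matrix.of fun i j => F i j x
  map_add' x y := by ext i j; simp
  map_smul' c x := by ext i j; simp

theorem matMap_apply {m n : ℕ} (F : Matrix (Fin m) (Fin n) (D21 a →ₗ[ℂ] ℂ)) (x : D21 a)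
    (i : Fin m) (j : Fin n) : matMap F x i j = F i j x := rfl

/-- The coordinate functional. -/
noncomputable def cf (a : ℂ) (i : Idx) : D21 a →ₗ[ℂ] ℂ := LinearMap.proj i ∘ₗ (coord a).toLinearMap

theorem cf_apply (i : Idx) (x : D21 a) : cf a i x = coord a x i := rfl

theorem degreeZeroData_I12 : SubalgebraIso (gradedPiece a (simpleRoots .I) {0, 1} 0)
    (⊤ : Submodule ℂ (GeneralLinear 2 0 × EvenAbelian 1)) := by
  -- The last factor supplies the traceless matrices, the Cartan coordinate of index 1 the scalar
  -- matrices, and that of index 0 the remaining centre.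
  let A := matMap !![cf a (.inl (2, 0)) + cf a (.inl (1, 0)), cf a (.inl (2, 1));
    cf a (.inl (2, 2)), cf a (.inl (1, 0)) - cf a (.inl (2, 0))]
  let z : D21 a →ₗ[ℂ] EvenAbelian 1 :=
    { toFun := fun x => (fun _ => coord a x (.inl (0, 0)) : Fin 1 → ℂ)
      map_add' := fun x y => by rw [map_add]; rfl
      map_smul' := fun c x => by rw [map_smul]; rfl }
  let φ : D21 a →ₗ[ℂ] GeneralLinear 2 0 × EvenAbelian 1 := (blocksMap A 0 0 0).prod z
  have hz : ∀ x ∈ gradedPiece a (simpleRoots .I) {0, 1} 0, ∀ i, deg .I {0, 1} i ≠ 0 →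
      coord a x i = 0 := fun x hx => mem_gradedPiece.1 hx
  have hinj : ∀ x ∈ gradedPiece a (simpleRoots .I) {0, 1} 0, φ x = 0 → x = 0 := by
    intro x hx h
    obtain ⟨h1, h2⟩ := Prod.mk.injEq .. ▸ h
    obtain ⟨hA, -⟩ := blocks_eq_zero h1
    have e00 := congrFun (congrFun hA 0) 0
    have e01 := congrFun (congrFun hA 0) 1
    have e10 := congrFun (congrFun hA 1) 0
    have e11 := congrFun (congrFun hA 1) 1
    have e := congrFun h2 0
    simp [A, matMap_apply, cf_apply] at e00 e01 e10 e11
    have f1 : coord a x (.inl (1, 0)) = 0 := by linear_combination (e00 + e11) / 2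
    have f2 : coord a x (.inl (2, 0)) = 0 := by linear_combination (e00 - e11) / 2
    refine eq_zero_of_coord fun i => ?_
    by_cases hi : deg .I {0, 1} i = 0
    · have : ∀ i, deg .I {0, 1} i = 0 → i = .inl (0, 0) ∨ i = .inl (1, 0) ∨ i = .inl (2, 0) ∨
        i = .inl (2, 1) ∨ i = .inl (2, 2) := by decide
      rcases this i hi with rfl | rfl | rfl | rfl | rfl
      · exact e
      · exact f1
      · exact f2
      · exact e01
      · exact e10
    · exact hz x hx i hi
  refine subalgebraIso_of_linearMap (isSubalgebra_gradedPiece_zero _ _) φ hinj ?_ ?_ ?_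
  · intro x hx y hy
    refine Prod.ext ?_ (funext fun _ => ?_)
    · change blocks _ _ _ _ = bracket (blocks _ _ _ _) (blocks _ _ _ _)
      rw [bracket_blocks]
      congr 1
      · ext i j
        fin_cases i <;> fin_cases j <;>
        simp (disch := decide) [A, matMap_apply, cf_apply, coord_bracket, coordBracket_H1,
          coordBracket_H2, coordBracket_X2, coordBracket_Y2, hz x hx, hz y hy, Matrix.mul_apply] <;>
        ring
      all_goals simp
    · change coord a (bracket x y) (.inl (0, 0)) = 0
      rw [coord_bracket]
      simp (disch := decide) [coordBracket_H0, hz x hx, hz y hy]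
  · intro i x hx hxi
    rcases LieSuperalgebra.zmod_two_cases i with rfl | rfl
    · exact ⟨blocks_mem_parity_zero rfl rfl, EvenAbelian.mem_parity_zero _⟩
    · refine ⟨blocks_mem_parity_one ?_ rfl, ?_⟩
      · ext i j
        fin_cases i <;> fin_cases j <;> simp [A, matMap_apply, cf_apply, coord_of_odd hxi]
      · have : z x = 0 := funext fun _ => coord_of_odd hxi _
        change z x ∈ _
        rw [this]
        exact zero_mem _
  · refine map_eq_top_of_finrank_eq _ hinj ?_
    rw [finrank_gradedPiece_zero, Module.finrank_prod, GeneralLinear.finrank_eq,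
      EvenAbelian.finrank_eq]
    decide

theorem degreeZeroData_I23 : SubalgebraIso (gradedPiece a (simpleRoots .I) {1, 2} 0)
    (⊤ : Submodule ℂ (GeneralLinear 1 1 × EvenAbelian 1)) := by
  -- For the odd vectors e = (0,1,1) and f = (1,0,0), in indices from zero, 2[e, f] = (1+a)H₀ + H₁ +
  -- aH₂. The functionals `A` and `D` both take the value 1 on [e, f], their difference is the
  -- weight of e, and `z` vanishes on [e, f].
  let A := matMap !![cf a (.inl (1, 0)) + cf a (.inl (0, 0)) - cf a (.inl (2, 0))]
  let B := matMap !![cf a (.inr (0, 1, 1))]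
  let C := matMap !![cf a (.inr (1, 0, 0))]
  let D := matMap !![(2 : ℂ) • cf a (.inl (1, 0))]
  let z : D21 a →ₗ[ℂ] EvenAbelian 1 :=
    { toFun := fun x =>
        (fun _ => a * coord a x (.inl (1, 0)) - coord a x (.inl (2, 0)) : Fin 1 → ℂ)
      map_add' := fun x y => funext fun _ => by
        change a * _ - _ = (a * _ - _) + (a * _ - _)
        simp only [map_add, Pi.add_apply]
        ring
      map_smul' := fun c x => funext fun _ => by
        change a * _ - _ = c * (a * _ - _)
        simp only [map_smul, Pi.smul_apply, smul_eq_mul]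
        ring }
  let φ : D21 a →ₗ[ℂ] GeneralLinear 1 1 × EvenAbelian 1 := (blocksMap A B C D).prod z
  have hz : ∀ x ∈ gradedPiece a (simpleRoots .I) {1, 2} 0, ∀ i, deg .I {1, 2} i ≠ 0 →
      coord a x i = 0 := fun x hx => mem_gradedPiece.1 hx
  have hinj : ∀ x ∈ gradedPiece a (simpleRoots .I) {1, 2} 0, φ x = 0 → x = 0 := by
    intro x hx h
    obtain ⟨h1, h2⟩ := Prod.mk.injEq .. ▸ h
    obtain ⟨hA, hB, hC, hD⟩ := blocks_eq_zero h1
    have eA := congrFun (congrFun hA 0) 0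
    have eB := congrFun (congrFun hB 0) 0
    have eC := congrFun (congrFun hC 0) 0
    have eD := congrFun (congrFun hD 0) 0
    have e : a * coord a x (.inl (1, 0)) - coord a x (.inl (2, 0)) = 0 := congrFun h2 0
    simp [A, B, C, D, matMap_apply, cf_apply] at eA eB eC eD
    have f2 : coord a x (.inl (2, 0)) = 0 := by linear_combination a * eD - e
    have f0 : coord a x (.inl (0, 0)) = 0 := by linear_combination eA - eD + f2
    refine eq_zero_of_coord fun i => ?_
    by_cases hi : deg .I {1, 2} i = 0
    · have : ∀ i, deg .I {1, 2} i = 0 → i = .inl (0, 0) ∨ i = .inl (1, 0) ∨ i = .inl (2, 0) ∨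
        i = .inr (0, 1, 1) ∨ i = .inr (1, 0, 0) := by decide
      rcases this i hi with rfl | rfl | rfl | rfl | rfl
      · exact f0
      · exact eD
      · exact f2
      · exact eB
      · exact eC
    · exact hz x hx i hi
  refine subalgebraIso_of_linearMap (isSubalgebra_gradedPiece_zero _ _) φ hinj ?_ ?_ ?_
  · intro x hx y hy
    refine Prod.ext ?_ (funext fun _ => ?_)
    · change blocks _ _ _ _ = bracket (blocks _ _ _ _) (blocks _ _ _ _)
      rw [bracket_blocks]
      congr 1 <;>
      · ext i j
        fin_cases i
        fin_cases j
        simp (disch := decide) [A, B, C, D, matMap_apply, cf_apply, coord_bracket, coordBracket_H0,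
          coordBracket_H1, coordBracket_H2, coordBracket_O011, coordBracket_O100, hz x hx, hz y hy,
          Matrix.mul_apply, s]
        ring
    · change a * coord a (bracket x y) (.inl (1, 0)) - coord a (bracket x y) (.inl (2, 0)) = 0
      rw [coord_bracket]
      simp (disch := decide) [coordBracket_H1, coordBracket_H2, hz x hx, hz y hy, s]
      ring
  · intro i x hx hxi
    rcases LieSuperalgebra.zmod_two_cases i with rfl | rfl
    · refine ⟨blocks_mem_parity_zero ?_ ?_, EvenAbelian.mem_parity_zero _⟩ <;>
      · ext i j
        fin_cases i
        fin_cases j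
        simp [B, C, matMap_apply, cf_apply, coord_of_even hxi]
    · refine ⟨blocks_mem_parity_one ?_ ?_, ?_⟩
      · ext i j
        fin_cases i
        fin_cases j
        simp [A, matMap_apply, cf_apply, coord_of_odd hxi]
      · ext i j
        fin_cases i
        fin_cases j
        simp [D, matMap_apply, cf_apply, coord_of_odd hxi]
      · have : z x = 0 := funext fun _ => by
          change a * coord a x (.inl (1, 0)) - coord a x (.inl (2, 0)) = 0
          rw [coord_of_odd hxi, coord_of_odd hxi, mul_zero, sub_zero]
        change z x ∈ _
        rw [this]
        exact zero_mem _
  · refine map_eq_top_of_finrank_eq _ hinj ?_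
    rw [finrank_gradedPiece_zero, Module.finrank_prod, GeneralLinear.finrank_eq,
      EvenAbelian.finrank_eq]
    decide

theorem degreeZeroData_I2 (ha0 : a ≠ 0) : SubalgebraIso (gradedPiece a (simpleRoots .I) {1} 0)
    (⊤ : Submodule ℂ (GeneralLinear 2 1)) := by
  -- The diagonal entries are chosen so that their differences give the weights of the odd vectors
  -- in `B` and `C`, and so that products of `B` and `C` reproduce the Cartan parts of the odd
  -- brackets. The factor `a` in `C` is the structure constant of the last factor.
  let A := matMap !![cf a (.inl (2, 0)) - a • cf a (.inl (1, 0)), cf a (.inl (2, 1));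
    cf a (.inl (2, 2)), -cf a (.inl (2, 0)) - a • cf a (.inl (1, 0))]
  let B := matMap !![cf a (.inr (0, 1, 0)); cf a (.inr (0, 1, 1))]
  let C := matMap !![a • cf a (.inr (1, 0, 1)), -(a • cf a (.inr (1, 0, 0)))]
  let D := matMap !![cf a (.inl (1, 0)) - cf a (.inl (0, 0)) - a • cf a (.inl (1, 0))]
  let φ : D21 a →ₗ[ℂ] GeneralLinear 2 1 := blocksMap A B C D
  have hz : ∀ x ∈ gradedPiece a (simpleRoots .I) {1} 0, ∀ i, deg .I {1} i ≠ 0 →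
      coord a x i = 0 := fun x hx => mem_gradedPiece.1 hx
  have hinj : ∀ x ∈ gradedPiece a (simpleRoots .I) {1} 0, φ x = 0 → x = 0 := by
    intro x hx h
    obtain ⟨hA, hB, hC, hD⟩ := blocks_eq_zero h
    have a00 := congrFun (congrFun hA 0) 0
    have a01 := congrFun (congrFun hA 0) 1
    have a10 := congrFun (congrFun hA 1) 0
    have a11 := congrFun (congrFun hA 1) 1
    have b0 := congrFun (congrFun hB 0) 0
    have b1 := congrFun (congrFun hB 1) 0
    have c0 := congrFun (congrFun hC 0) 0
    have c1 := congrFun (congrFun hC 0) 1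
    have d := congrFun (congrFun hD 0) 0
    simp [A, B, C, D, matMap_apply, cf_apply, ha0] at a00 a01 a10 a11 b0 b1 c0 c1 d
    have f2 : coord a x (.inl (2, 0)) = 0 := by linear_combination (a00 - a11) / 2
    have f1 : coord a x (.inl (1, 0)) = 0 := by
      refine (mul_eq_zero.1 ?_).resolve_left ha0
      linear_combination -(a00 + a11) / 2
    have f0 : coord a x (.inl (0, 0)) = 0 := by linear_combination (1 - a) * f1 - d
    refine eq_zero_of_coord fun i => ?_
    rcases i with ⟨k, t⟩ | ⟨k, l, m⟩
    · fin_cases k <;> fin_cases t <;> first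
        | exact hz x hx _ (by decide)
        | exact f0
        | exact f1
        | exact f2
        | exact a01
        | exact a10
    · fin_cases k <;> fin_cases l <;> fin_cases m <;> first
        | exact hz x hx _ (by decide)
        | exact b0
        | exact b1
        | exact c0
        | exact c1
  refine subalgebraIso_of_linearMap (isSubalgebra_gradedPiece_zero _ _) φ hinj ?_ ?_ ?_
  · intro x hx y hy
    change blocks _ _ _ _ = bracket (blocks _ _ _ _) (blocks _ _ _ _)
    rw [bracket_blocks]
    congr 1 <;>
    · ext i j
      fin_cases i <;> fin_cases j <;>
      simp (disch := decide) [A, B, C, D, matMap_apply, cf_apply, coord_bracket, coordBracket_H0,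
        coordBracket_H1, coordBracket_H2, coordBracket_X2, coordBracket_Y2, coordBracket_O010,
        coordBracket_O011, coordBracket_O100, coordBracket_O101, hz x hx, hz y hy,
        Matrix.mul_apply, s] <;>
      ring
  · intro i x hx hxi
    rcases LieSuperalgebra.zmod_two_cases i with rfl | rfl
    · refine blocks_mem_parity_zero ?_ ?_ <;>
      · ext i j
        fin_cases i <;> fin_cases j <;>
        simp [B, C, matMap_apply, cf_apply, coord_of_even hxi]
    · refine blocks_mem_parity_one ?_ ?_ <;>
      · ext i j
        fin_cases i <;> fin_cases j <;>
        simp [A, D, matMap_apply, cf_apply, coord_of_odd hxi]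
  · refine map_eq_top_of_finrank_eq _ hinj ?_
    rw [finrank_gradedPiece_zero, GeneralLinear.finrank_eq]
    decide

/-- The scalar `h` plus the left multiplication by the quaternion `(p, q, r)` minus the right
multiplication by the quaternion `(p', q', r')`. -/
def quatMatrix (h p q r p' q' r' : ℂ) : Matrix (Fin 4) (Fin 4) ℂ :=
  !![h, -p + p', -q + q', -r + r';
    p - p', h, -r - r', q + q';
    q - q', r + r', h, -p - p';
    r - r', -q - q', p + p', h]

theorem quatMatrix_commutator (h p q r p' q' r' k u v w u' v' w' : ℂ) :
    quatMatrix h p q r p' q' r' * quatMatrix k u v w u' v' w' -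
      quatMatrix k u v w u' v' w' * quatMatrix h p q r p' q' r' =
    quatMatrix 0 (2 * (q * w - r * v)) (2 * (r * u - p * w)) (2 * (p * v - q * u))
      (2 * (q' * w' - r' * v')) (2 * (r' * u' - p' * w')) (2 * (p' * v' - q' * u')) := by
  ext i j
  rw [Matrix.sub_apply, Matrix.mul_apply, Matrix.mul_apply, Fin.sum_univ_four, Fin.sum_univ_four]
  fin_cases i <;> fin_cases j <;> simp [quatMatrix] <;> ring

theorem quatMatrix_eq_zero {h p q r p' q' r' : ℂ} (H : quatMatrix h p q r p' q' r' = 0) :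
    h = 0 ∧ (p = 0 ∧ q = 0 ∧ r = 0) ∧ p' = 0 ∧ q' = 0 ∧ r' = 0 := by
  have a00 : h = 0 := congrFun (congrFun H 0) 0
  have a01 : -p + p' = 0 := congrFun (congrFun H 0) 1
  have a23 : -p - p' = 0 := congrFun (congrFun H 2) 3
  have a02 : -q + q' = 0 := congrFun (congrFun H 0) 2
  have a13 : q + q' = 0 := congrFun (congrFun H 1) 3
  have a03 : -r + r' = 0 := congrFun (congrFun H 0) 3
  have a12 : -r - r' = 0 := congrFun (congrFun H 1) 2
  refine ⟨a00, ⟨?_, ?_, ?_⟩, ?_, ?_, ?_⟩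
  · linear_combination -(a01 + a23) / 2
  · linear_combination (a13 - a02) / 2
  · linear_combination -(a03 + a12) / 2
  · linear_combination (a01 - a23) / 2
  · linear_combination (a13 + a02) / 2
  · linear_combination (a03 - a12) / 2

open Complex in
/-- The conformal orthogonal representation of the sum of the second and third copy of `𝔰𝔩₂` and
`ℂ H₁`, by left and right multiplications of quaternions. -/
noncomputable def conformalMatrix (a : ℂ) : D21 a →ₗ[ℂ] Matrix (Fin 4) (Fin 4) ℂ where
  toFun x :=
    -- 𝔰𝔩₂ is identified with the complexified imaginary quaternions through i = √-1 H, j = X - Y, k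
    -- = √-1 (X + Y). The arguments are the resulting coefficients in each of the two copies.
    let c := coord a x
    quatMatrix (c (.inl (0, 0)))
      (-(I * c (.inl (1, 0)))) ((c (.inl (1, 1)) - c (.inl (1, 2))) / 2)
      (-(I * (c (.inl (1, 1)) + c (.inl (1, 2)))) / 2)
      (-(I * c (.inl (2, 0)))) ((c (.inl (2, 1)) - c (.inl (2, 2))) / 2)
      (-(I * (c (.inl (2, 1)) + c (.inl (2, 2)))) / 2)
  map_add' x y := by
    ext i j
    rw [map_add]
    fin_cases i <;> fin_cases j <;> simp [quatMatrix] <;> ring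
  map_smul' k x := by
    ext i j
    rw [map_smul]
    fin_cases i <;> fin_cases j <;> simp [quatMatrix] <;> ring

theorem conformalMatrix_apply (x : D21 a) : conformalMatrix a x =
    quatMatrix (coord a x (.inl (0, 0)))
      (-(Complex.I * coord a x (.inl (1, 0))))
      ((coord a x (.inl (1, 1)) - coord a x (.inl (1, 2))) / 2)
      (-(Complex.I * (coord a x (.inl (1, 1)) + coord a x (.inl (1, 2)))) / 2)
      (-(Complex.I * coord a x (.inl (2, 0))))
      ((coord a x (.inl (2, 1)) - coord a x (.inl (2, 2))) / 2)
      (-(Complex.I * (coord a x (.inl (2, 1)) + coord a x (.inl (2, 2)))) / 2) := rfl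

theorem quatMatrix_mem_conformalOrthogonal (h p q r p' q' r' : ℂ) :
    blocks (quatMatrix h p q r p' q' r') 0 0 0 ∈ conformalOrthogonal 4 := by
  refine ⟨2 * h, ?_⟩
  ext (i | i) (j | j)
  · change quatMatrix h p q r p' q' r' i j + quatMatrix h p q r p' q' r' j i =
      2 * h * (1 : Matrix (Fin 4 ⊕ Fin 0) (Fin 4 ⊕ Fin 0) ℂ) (Sum.inl i) (Sum.inl j)
    rw [Matrix.one_apply]
    fin_cases i <;> fin_cases j <;> simp [quatMatrix] <;> ring
  · exact j.elim0
  · exact i.elim0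
  · exact i.elim0

/-- Skew 4×4 matrices split into self-dual and anti-self-dual ones: half-sums and half-differences
of the paired entries 01 and 23, 02 and 13, 03 and 12 recover the two quaternions. -/
theorem exists_quatMatrix {M : GeneralLinear 4 0} (hM : M ∈ conformalOrthogonal 4) :
    ∃ h p q r p' q' r', M = blocks (quatMatrix h p q r p' q' r') 0 0 0 := by
  obtain ⟨c, hc⟩ := hM
  let A : Fin 4 → Fin 4 → ℂ := fun i j =>
    (M : Matrix (Fin 4 ⊕ Fin 0) (Fin 4 ⊕ Fin 0) ℂ) (Sum.inl i) (Sum.inl j)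
  have hA : ∀ i j, A i j + A j i = if i = j then c else 0 := by
    intro i j
    have h1 : A i j + A j i = c * (1 : Matrix (Fin 4 ⊕ Fin 0) (Fin 4 ⊕ Fin 0) ℂ) (.inl i) (.inl j) :=
      congrFun (congrFun hc (.inl i)) (.inl j)
    rw [h1, Matrix.one_apply]
    simp
  have hs : ∀ i, A i i = c / 2 := fun i => by
    have := hA i i
    rw [if_pos rfl] at this
    linear_combination this / 2
  refine ⟨c / 2, -(A 0 1 + A 2 3) / 2, (A 1 3 - A 0 2) / 2, -(A 0 3 + A 1 2) / 2,
    (A 0 1 - A 2 3) / 2, (A 1 3 + A 0 2) / 2, (A 0 3 - A 1 2) / 2, ?_⟩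
  apply Matrix.ext
  rintro (i | i) (j | j)
  · change A i j = quatMatrix _ _ _ _ _ _ _ i j
    have h01 := hA 0 1
    have h02 := hA 0 2
    have h03 := hA 0 3
    have h12 := hA 1 2
    have h13 := hA 1 3
    have h23 := hA 2 3
    simp at h01 h02 h03 h12 h13 h23
    fin_cases i <;> fin_cases j <;> simp [quatMatrix, hs]
    · ring
    · ring
    · ring
    · linear_combination h01
    · ring
    · ring
    · linear_combination h02
    · linear_combination h12
    · ring
    · linear_combination h03
    · linear_combination h13
    · linear_combination h23
  · exact j.elim0
  · exact i.elim0
  · exact i.elim0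

theorem degreeZeroData_I1 : SubalgebraIso (gradedPiece a (simpleRoots .I) {0} 0)
    (conformalOrthogonal 4) := by
  have hI := Complex.I_sq
  let φ : D21 a →ₗ[ℂ] GeneralLinear 4 0 := blocksMap (conformalMatrix a) 0 0 0
  have hz : ∀ x ∈ gradedPiece a (simpleRoots .I) {0} 0, ∀ i, deg .I {0} i ≠ 0 →
      coord a x i = 0 := fun x hx => mem_gradedPiece.1 hx
  refine subalgebraIso_of_linearMap (isSubalgebra_gradedPiece_zero _ _) φ ?_ ?_ ?_ ?_
  · intro x hx h
    obtain ⟨hA, -⟩ := blocks_eq_zero h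
    obtain ⟨h0, ⟨hp, hq, hr⟩, hp', hq', hr'⟩ := quatMatrix_eq_zero hA
    have h10 : coord a x (.inl (1, 0)) = 0 := by simpa using hp
    have h20 : coord a x (.inl (2, 0)) = 0 := by simpa using hp'
    have hr : coord a x (.inl (1, 1)) + coord a x (.inl (1, 2)) = 0 := by simpa using hr
    have hr' : coord a x (.inl (2, 1)) + coord a x (.inl (2, 2)) = 0 := by simpa using hr'
    have h11 : coord a x (.inl (1, 1)) = 0 := by linear_combination hr / 2 + hq
    have h12 : coord a x (.inl (1, 2)) = 0 := by linear_combination hr / 2 - hq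
    have h21 : coord a x (.inl (2, 1)) = 0 := by linear_combination hr' / 2 + hq'
    have h22 : coord a x (.inl (2, 2)) = 0 := by linear_combination hr' / 2 - hq'
    refine eq_zero_of_coord fun i => ?_
    rcases i with ⟨k, t⟩ | ⟨k, l, m⟩
    · fin_cases k <;> fin_cases t <;> first
        | exact hz x hx _ (by decide)
        | exact h0
        | exact h10
        | exact h11
        | exact h12
        | exact h20
        | exact h21
        | exact h22
    · fin_cases k <;> fin_cases l <;> fin_cases m <;> exact hz x hx _ (by decide)
  · intro x hx y hy
    change blocks _ _ _ _ = bracket (blocks _ _ _ _) (blocks _ _ _ _)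
    rw [bracket_blocks]
    congr 1
    · rw [conformalMatrix_apply x, conformalMatrix_apply y, quatMatrix_commutator,
        conformalMatrix_apply, coord_bracket]
      simp (disch := decide) only [coordBracket_H0, coordBracket_H1, coordBracket_H2,
        coordBracket_X1, coordBracket_X2, coordBracket_Y1, coordBracket_Y2, hz x hx, hz y hy,
        mul_zero, add_zero, sub_zero, LinearMap.zero_apply, Matrix.mul_zero]
      congr 1
      · ring
      · linear_combination (-((coord a x (.inl (1, 1)) + coord a x (.inl (1, 2))) *
          coord a y (.inl (1, 0)) - coord a x (.inl (1, 0)) * (coord a y (.inl (1, 1)) +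
            coord a y (.inl (1, 2))))) * hI
      · ring
      · ring
      · linear_combination (-((coord a x (.inl (2, 1)) + coord a x (.inl (2, 2))) *
          coord a y (.inl (2, 0)) - coord a x (.inl (2, 0)) * (coord a y (.inl (2, 1)) +
            coord a y (.inl (2, 2))))) * hI
      · ring
    all_goals simp
  · intro i x hx hxi
    rcases LieSuperalgebra.zmod_two_cases i with rfl | rfl
    · exact blocks_mem_parity_zero rfl rfl
    · refine blocks_mem_parity_one ?_ rfl
      ext i j
      rw [conformalMatrix_apply]
      fin_cases i <;> fin_cases j <;> simp [quatMatrix, coord_of_odd hxi]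
  · apply le_antisymm
    · rintro _ ⟨x, -, rfl⟩
      exact quatMatrix_mem_conformalOrthogonal _ _ _ _ _ _ _
    · intro M hM
      obtain ⟨h, p, q, r, p', q', r', rfl⟩ := exists_quatMatrix hM
      let f : Idx → ℂ := Sum.elim (fun k => ![![h, 0, 0],
        ![Complex.I * p, q + Complex.I * r, -q + Complex.I * r],
        ![Complex.I * p', q' + Complex.I * r', -q' + Complex.I * r']] k.1 k.2) 0
      have hf : coord a ((coord a).symm f) = f := LinearEquiv.apply_symm_apply ..
      refine ⟨(coord a).symm f, mem_gradedPiece.2 ?_, ?_⟩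
      · rw [hf]
        rintro (⟨k, t⟩ | p) hi
        · fin_cases k <;> fin_cases t <;> first
            | rfl
            | exact absurd (by decide) hi
        · rfl
      · change blocks (conformalMatrix a _) 0 0 0 = _
        rw [conformalMatrix_apply, hf]
        simp only [f, Sum.elim_inl, Matrix.cons_val]
        congr 2
        · linear_combination -p * hI
        · ring
        · linear_combination -r * hI
        · linear_combination -p' * hI
        · ring
        · linear_combination -r' * hI

end D21

namespace D21

open LieSuperalgebra

variable {a : ℂ}

instance : DecidableEq Idx := inferInstance

/-! ### Nonvanishing of structure constants, effectivity and generation -/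

theorem coord_bracket_bv_of_ne {i j k : Idx} (h : wt k ≠ wt i + wt j) :
    coord a (bracket (bv a i) (bv a j)) k = 0 :=
  bracket_mem_coordSub (S := {i}) (T := {j}) (U := {k | wt k = wt i + wt j})
    (fun _ hi _ hj _ hk => by rw [Set.mem_ofPred_eq, hk, hi, hj]) (bv_mem.2 rfl) (bv_mem.2 rfl) k h

theorem coord_bracket_bv (i j k : Idx) : coord a (bracket (bv a i) (bv a j)) k =
    coordBracket (s a) (Pi.single i 1) (Pi.single j 1) k := by
  rw [coord_bracket, bv, bv, LinearEquiv.apply_symm_apply, LinearEquiv.apply_symm_apply]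

theorem coord_bracket_right (x : D21 a) (j k : Idx) : coord a (bracket x (bv a j)) k =
    ∑ i, coord a x i * coord a (bracket (bv a i) (bv a j)) k := by
  conv_lhs => rw [← sum_coord x]
  simp only [map_sum, map_smul, LinearMap.sum_apply, LinearMap.smul_apply, Finset.sum_apply,
    Pi.smul_apply, smul_eq_mul]

/-- Multiplicity one: no other component of `x` can contribute to this weight. -/
theorem coord_bracket_right_of_ne {x : D21 a} {i j k : Idx} (hi : wt i ≠ 0)
    (h : wt k = wt i + wt j) :
    coord a (bracket x (bv a j)) k = coord a x i * coord a (bracket (bv a i) (bv a j)) k := by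
  rw [coord_bracket_right]
  refine Finset.sum_eq_single i (fun l _ hl => ?_) fun h => absurd (Finset.mem_univ i) h
  rw [coord_bracket_bv_of_ne, mul_zero]
  intro hk
  have : wt i = wt l := add_right_cancel (h.symm.trans hk)
  exact hl (wt_injective_of_ne i l this hi).symm

/-- A sum of two nonzero even roots is never a nonzero root, so only brackets with an odd entry
occur. The constants are ±1 for an even and an odd vector and ±sᵢ for two odd ones. -/
theorem coord_bracket_ne_zero (ha0 : a ≠ 0) (ha1 : a ≠ -1) {i j k : Idx} (hi : wt i ≠ 0)
    (hj : wt j ≠ 0) (hk : wt k ≠ 0) (h : wt k = wt i + wt j) :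
    coord a (bracket (bv a i) (bv a j)) k ≠ 0 := by
  have hp1 : a + 1 ≠ 0 := fun h => ha1 (by linear_combination h)
  have hm1 : -1 - a ≠ 0 := fun h => ha1 (by linear_combination -h)
  have key : ∀ (m : Fin 3 × Fin 3) (p q : Fin 2 × Fin 2 × Fin 2), wt (.inl m) ≠ 0 →
      wt (.inr q) = wt (.inl m) + wt (.inr p) →
      coord a (bracket (bv a (.inl m)) (bv a (.inr p))) (.inr q) ≠ 0 := by
    rintro ⟨m, t⟩ ⟨p1, p2, p3⟩ q hm h
    have hq : ∀ m t p1 p2 p3 q, wt (.inl (m, t)) ≠ 0 →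
        wt (.inr q) = wt (.inl (m, t)) + wt (.inr (p1, p2, p3)) →
        q = ![(1 - p1, p2, p3), (p1, 1 - p2, p3), (p1, p2, 1 - p3)] m ∧
          t = ![![1, 2] (1 - p1), ![1, 2] (1 - p2), ![1, 2] (1 - p3)] m := by decide
    obtain ⟨rfl, rfl⟩ := hq m t p1 p2 p3 q hm h
    rw [coord_bracket_bv]
    fin_cases m <;> fin_cases p1 <;> fin_cases p2 <;> fin_cases p3 <;>
      simp [coordBracket_O000, coordBracket_O001, coordBracket_O010, coordBracket_O011,
        coordBracket_O100, coordBracket_O101, coordBracket_O110, coordBracket_O111]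
  have key2 : ∀ (p q : Fin 2 × Fin 2 × Fin 2) (m : Fin 3 × Fin 3), wt (.inl m) ≠ 0 →
      wt (.inl m) = wt (.inr p) + wt (.inr q) →
      coord a (bracket (bv a (.inr p)) (bv a (.inr q))) (.inl m) ≠ 0 := by
    rintro ⟨p1, p2, p3⟩ q ⟨m, t⟩ hm h
    have hq : ∀ m t p1 p2 p3 q, wt (.inl (m, t)) ≠ 0 →
        wt (.inl (m, t)) = wt (.inr (p1, p2, p3)) + wt (.inr q) →
        q = ![(p1, 1 - p2, 1 - p3), (1 - p1, p2, 1 - p3), (1 - p1, 1 - p2, p3)] m ∧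
          t = ![![1, 2] p1, ![1, 2] p2, ![1, 2] p3] m := by decide
    obtain ⟨rfl, rfl⟩ := hq m t p1 p2 p3 q hm h
    rw [coord_bracket_bv]
    fin_cases m <;> fin_cases p1 <;> fin_cases p2 <;> fin_cases p3 <;>
      simp [coordBracket_X0, coordBracket_X1, coordBracket_X2, coordBracket_Y0, coordBracket_Y1,
        coordBracket_Y2, s, ha0, hm1, hp1]
  rcases i with i | i <;> rcases j with j | j <;> rcases k with k | k
  · exact absurd ⟨hi, hj, hk, h⟩ ((by decide : ∀ i j k : Fin 3 × Fin 3, ¬ (wt (.inl i) ≠ 0 ∧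
      wt (.inl j) ≠ 0 ∧ wt (.inl k) ≠ 0 ∧ wt (.inl k) = wt (.inl i) + wt (.inl j))) i j k)
  · exact absurd h ((by decide : ∀ (i j : Fin 3 × Fin 3) (k : Fin 2 × Fin 2 × Fin 2),
      wt (.inr k) ≠ wt (.inl i) + wt (.inl j)) i j k)
  · exact absurd h ((by decide : ∀ (i : Fin 3 × Fin 3) (j : Fin 2 × Fin 2 × Fin 2)
      (k : Fin 3 × Fin 3), wt (.inl k) ≠ wt (.inl i) + wt (.inr j)) i j k)
  · exact key i j k hi h
  · exact absurd h ((by decide : ∀ (i : Fin 2 × Fin 2 × Fin 2) (j k : Fin 3 × Fin 3),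
      wt (.inl k) ≠ wt (.inr i) + wt (.inl j)) i j k)
  · have h0 : bv a (.inl j) ∈ parity (L := D21 a) 0 := by rw [parity_zero_eq]; exact bv_mem.2 rfl
    have h1 : bv a (.inr i) ∈ parity (L := D21 a) 1 := by rw [parity_one_eq]; exact bv_mem.2 rfl
    rw [skew h1 h0, koszulSign_zero_right, one_smul, map_neg, Pi.neg_apply, neg_ne_zero]
    exact key j i k hj (by rw [h, add_comm])
  · exact key2 i j k hk h
  · exact absurd h ((by decide : ∀ i j k : Fin 2 × Fin 2 × Fin 2,
      wt (.inr k) ≠ wt (.inr i) + wt (.inr j)) i j k)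

/-- For opposite odd vectors the Cartan coordinate of index 1 serves as witness: its coefficient is
half of the structure constant that equals 1, up to sign. -/
theorem exists_coord_bracket_neg_ne_zero {i j : Idx} (hi : wt i ≠ 0) (h : wt i + wt j = 0) :
    ∃ k, wt k = 0 ∧ coord a (bracket (bv a i) (bv a j)) k ≠ 0 := by
  rcases i with ⟨m, t⟩ | ⟨p1, p2, p3⟩
  · refine ⟨.inl (m, 0), (by decide : ∀ m : Fin 3, wt (.inl (m, 0)) = 0) m, ?_⟩
    have hj : ∀ m t j, wt (.inl (m, t)) ≠ 0 → wt (.inl (m, t)) + wt j = 0 →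
        (t = 1 ∧ j = .inl (m, 2)) ∨ (t = 2 ∧ j = .inl (m, 1)) := by decide
    rw [coord_bracket_bv]
    rcases hj m t j hi h with ⟨rfl, rfl⟩ | ⟨rfl, rfl⟩ <;> fin_cases m <;>
      simp [coordBracket_H0, coordBracket_H1, coordBracket_H2]
  · refine ⟨.inl (1, 0), by decide, ?_⟩
    have hj : ∀ p1 p2 p3 j, wt (.inr (p1, p2, p3)) + wt j = 0 →
        j = .inr (1 - p1, 1 - p2, 1 - p3) := by decide
    rw [coord_bracket_bv, hj p1 p2 p3 j h]
    fin_cases p1 <;> fin_cases p2 <;> fin_cases p3 <;> simp [coordBracket_H1, s]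

theorem exists_coord_bracket_ne_zero (ha0 : a ≠ 0) (ha1 : a ≠ -1) {i j : Idx}
    (hi : wt i ≠ 0) (hj : wt j ≠ 0) (hk : ∃ k, wt k = wt i + wt j) :
    ∃ k, wt k = wt i + wt j ∧ coord a (bracket (bv a i) (bv a j)) k ≠ 0 := by
  obtain ⟨k, hk⟩ := hk
  by_cases h0 : wt k = 0
  · obtain ⟨k', h1, h2⟩ := exists_coord_bracket_neg_ne_zero (a := a) hi (hk ▸ h0)
    exact ⟨k', by rw [h1, ← hk, h0], h2⟩
  · exact ⟨k, hk, coord_bracket_ne_zero ha0 ha1 hi hj h0 hk⟩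

/-- The form in which nonvanishing of structure constants is used: a root component of `x` can be
read off from its bracket with any suitable root vector. -/
theorem coord_eq_zero_of_bracket (ha0 : a ≠ 0) (ha1 : a ≠ -1) {x : D21 a} {i j : Idx}
    (hi : wt i ≠ 0) (hj : wt j ≠ 0) (hk : ∃ k, wt k = wt i + wt j)
    (h : ∀ k, wt k = wt i + wt j → coord a (bracket x (bv a j)) k = 0) : coord a x i = 0 := by
  obtain ⟨k, hk, hne⟩ := exists_coord_bracket_ne_zero ha0 ha1 hi hj hk
  have := coord_bracket_right_of_ne (x := x) hi hk
  rw [h k hk] at this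
  exact (mul_eq_zero.1 this.symm).resolve_right hne

/-- Three basis vectors of degree `-1` with linearly independent weights. -/
def indepIdx : ParabolicType → Fin 3 → Idx
  | .I1 => ![.inr (1, 0, 0), .inr (1, 0, 1), .inr (1, 1, 0)]
  | .I2 => ![.inr (1, 1, 0), .inr (1, 1, 1), .inl (0, 2)]
  | .I12 => ![.inr (1, 0, 0), .inr (1, 0, 1), .inl (1, 2)]
  | .I23 => ![.inl (1, 2), .inl (2, 2), .inr (1, 0, 1)]
  | .I123 => ![.inl (1, 2), .inl (2, 2), .inr (1, 0, 0)]
  | .IV123 => ![.inr (0, 1, 1), .inr (1, 0, 1), .inr (1, 1, 0)]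

theorem deg_indepIdx : ∀ (t : ParabolicType) (m : Fin 3),
    deg t.rep.1 t.rep.2 (indepIdx t m) = -1 := by decide

theorem det_indepIdx (t : ParabolicType) :
    (Matrix.of fun m k => (wt (indepIdx t m) k : ℂ)).det ≠ 0 := by
  cases t <;> simp [Matrix.det_fin_three, indepIdx, wt] <;> norm_num

theorem coord_bracket_of_cartan {x : D21 a} (h : ∀ i, wt i ≠ 0 → coord a x i = 0) (y : D21 a)
    (j : Idx) : coord a (bracket x y) j =
      (∑ k, (wt j k : ℂ) * coord a x (.inl (k, 0))) * coord a y j := by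
  have hx : x = cartan a fun k => coord a x (.inl (k, 0)) := by
    apply (coord a).injective
    ext i
    by_cases hi : wt i = 0
    · obtain ⟨k, rfl⟩ := (by decide : ∀ i : Idx, wt i = 0 → ∃ k, i = .inl (k, 0)) i hi
      change _ = coord a x (.inl (k, 0)) * 1
      rw [mul_one]
    · rw [h i hi]
      exact (range_cartan_le (S := {i | wt i = 0}) (fun _ h => h) ⟨_, rfl⟩ i hi).symm
  conv_lhs => rw [hx]
  exact coord_bracket_cartan _ y j

/-- Each root of nonnegative degree can be added to some root of degree -1 to give a weight, which
kills the root components of `x`. What is left lies in the Cartan subalgebra and is annihilated by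
three independent weights. -/
theorem isEffective_gradedPiece (ha0 : a ≠ 0) (ha1 : a ≠ -1) (t : ParabolicType) :
    IsEffective (gradedPiece a (simpleRoots t.rep.1) t.rep.2) := by
  intro k hk x hx hxy
  rw [mem_gradedPiece] at hx
  have hy : ∀ j, deg t.rep.1 t.rep.2 j = -1 → bracket x (bv a j) = 0 := fun j hj => by
    refine hxy _ ?_
    rw [gradedPiece_eq]
    exact bv_mem.2 hj
  have h0 : ∀ i, wt i ≠ 0 → coord a x i = 0 := by
    intro i hi
    by_cases hd : deg t.rep.1 t.rep.2 i = k
    · obtain ⟨j, hj, hj0, hjk⟩ := (by decide : ∀ (t : ParabolicType) (i : Idx), wt i ≠ 0 →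
        0 ≤ deg t.rep.1 t.rep.2 i → ∃ j, deg t.rep.1 t.rep.2 j = -1 ∧ wt j ≠ 0 ∧
          ∃ k, wt k = wt i + wt j) t i hi (hd ▸ hk)
      exact coord_eq_zero_of_bracket ha0 ha1 hi hj0 hjk fun k _ => by
        rw [hy j hj, map_zero, Pi.zero_apply]
    · exact hx i hd
  have h1 : (fun k => coord a x (.inl (k, 0))) = 0 := by
    refine Matrix.eq_zero_of_mulVec_eq_zero (det_indepIdx t) ?_
    ext m
    have := coord_bracket_of_cartan h0 (bv a (indepIdx t m)) (indepIdx t m)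
    rw [hy _ (deg_indepIdx t m), coord_bv, if_pos rfl, mul_one, map_zero, Pi.zero_apply] at this
    exact this.symm
  refine eq_zero_of_coord fun i => ?_
  by_cases hi : wt i = 0
  · obtain ⟨m, rfl⟩ := (by decide : ∀ i : Idx, wt i = 0 → ∃ k, i = .inl (k, 0)) i hi
    exact congrFun h1 m
  · exact h0 i hi

theorem bracket_bv_of_wt (ha0 : a ≠ 0) (ha1 : a ≠ -1) {i j k : Idx} (hi : wt i ≠ 0)
    (hj : wt j ≠ 0) (hk : wt k ≠ 0) (h : wt k = wt i + wt j) :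
    ∃ c : ℂ, c ≠ 0 ∧ bracket (bv a i) (bv a j) = c • bv a k := by
  refine ⟨_, coord_bracket_ne_zero ha0 ha1 hi hj hk h, ?_⟩
  apply (coord a).injective
  ext l
  rw [map_smul, Pi.smul_apply, coord_bv, smul_eq_mul]
  split_ifs with hl
  · rw [hl, mul_one]
  · rw [mul_zero]
    exact coord_bracket_bv_of_ne fun h' =>
      hl (wt_injective_of_ne k l (h.trans h'.symm) hk).symm

/-- Every root of degree below -1 is a root of degree -1 plus a root one degree higher, and the
structure constant is nonzero. Faithfulness uses that each root can be added to some other root to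
give a weight. -/
theorem isFundamental_gradedPiece (ha0 : a ≠ 0) (ha1 : a ≠ -1) (t : ParabolicType) :
    IsFundamental (gradedPiece a (simpleRoots t.rep.1) t.rep.2) := by
  constructor
  · intro n hn z hz
    rw [mem_gradedPiece] at hz
    rw [← sum_coord z]
    refine Submodule.sum_mem _ fun i _ => ?_
    by_cases hd : deg t.rep.1 t.rep.2 i = n
    · obtain ⟨j, l, hj, hl, hi0, hj0, hl0, h⟩ := (by decide : ∀ (t : ParabolicType) (i : Idx),
        deg t.rep.1 t.rep.2 i < -1 → ∃ j l, deg t.rep.1 t.rep.2 j = -1 ∧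
          deg t.rep.1 t.rep.2 l = deg t.rep.1 t.rep.2 i + 1 ∧ wt i ≠ 0 ∧ wt j ≠ 0 ∧ wt l ≠ 0 ∧
          wt i = wt j + wt l) t i (hd ▸ hn)
      obtain ⟨c, hc, hb⟩ := bracket_bv_of_wt ha0 ha1 hj0 hl0 hi0 h
      refine Submodule.smul_mem _ _ ?_
      rw [← inv_smul_smul₀ hc (bv a i), ← hb]
      refine Submodule.smul_mem _ _ (Submodule.subset_span ⟨_, ?_, _, ?_, rfl⟩)
      · rw [gradedPiece_eq]
        exact bv_mem.2 hj
      · rw [gradedPiece_eq]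
        exact bv_mem.2 (hl.trans (by rw [hd]))
    · rw [hz i hd, zero_smul]
      exact Submodule.zero_mem _
  · intro x hx hxy
    have hx' : ∀ i, 0 ≤ deg t.rep.1 t.rep.2 i → coord a x i = 0 := by
      have hle : truncation (gradedPiece a (simpleRoots t.rep.1) t.rep.2) (-1) ≤
          coordSub a {i | deg t.rep.1 t.rep.2 i < 0} := by
        refine iSup₂_le fun n hn => ?_
        rw [gradedPiece_eq]
        exact coordSub_mono fun i (hi : _ = n) => show _ < (0 : ℤ) by omega
      exact fun i hi => hle hx i (not_lt.2 hi)
    refine eq_zero_of_coord fun i => ?_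
    by_cases hd : 0 ≤ deg t.rep.1 t.rep.2 i
    · exact hx' i hd
    · have hi : wt i ≠ 0 := fun h => hd (deg_of_wt_eq_zero _ _ h).ge
      obtain ⟨j, hj, hk⟩ := (by decide : ∀ i : Idx, wt i ≠ 0 →
        ∃ j, wt j ≠ 0 ∧ ∃ k, wt k = wt i + wt j) i hi
      exact coord_eq_zero_of_bracket ha0 ha1 hi hj hk fun k _ => by
        rw [hxy, map_zero, Pi.zero_apply]

end D21

namespace D21

open LieSuperalgebra

variable {a : ℂ}

/-! ### Integer codes of the weights -/

/-- An injective integer encoding of the weights; the weight zero has code `8322`. -/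
def code : Idx → ℕ
  | .inl (i, t) => ![![8322, 8324, 8320], ![8322, 8450, 8194], ![8322, 16514, 130]] i t
  | .inr (p, q, r) => 12483 - 2 * p.val - 128 * q.val - 8192 * r.val

theorem code_eq : ∀ i, (code i : ℤ) = 8322 + wt i 0 + 64 * wt i 1 + 4096 * wt i 2 := by decide

theorem abs_wt_le : ∀ i k, |wt i k| ≤ 2 := by decide

/-- With entries bounded by 16, base 64 admits no carries. The bound leaves room for differences of
sums of several weights. -/
theorem eq_zero_of_code {v : Fin 3 → ℤ} (hv : ∀ k, |v k| ≤ 16)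
    (h : v 0 + 64 * v 1 + 4096 * v 2 = 0) : v = 0 := by
  have h0 := abs_le.1 (hv 0)
  have h1 := abs_le.1 (hv 1)
  have h2 := abs_le.1 (hv 2)
  ext k
  fin_cases k <;> simp <;> omega

theorem wt_add_iff {i j k l : Idx} :
    wt i + wt j = wt k + wt l ↔ code i + code j = code k + code l := by
  have hi := code_eq i
  have hj := code_eq j
  have hk := code_eq k
  have hl := code_eq l
  constructor
  · intro h
    have h0 := congrFun h 0
    have h1 := congrFun h 1
    have h2 := congrFun h 2
    simp only [Pi.add_apply] at h0 h1 h2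
    omega
  · intro h
    refine sub_eq_zero.1 (eq_zero_of_code (fun m => ?_) ?_)
    · have := abs_le.1 (abs_wt_le i m)
      have := abs_le.1 (abs_wt_le j m)
      have := abs_le.1 (abs_wt_le k m)
      have := abs_le.1 (abs_wt_le l m)
      simp only [Pi.add_apply, Pi.sub_apply]
      rw [abs_le]
      omega
    · simp only [Pi.add_apply, Pi.sub_apply]
      omega

/-- Each code contains the offset 8322 once, so the code of the zero weight is added on the side
with fewer summands. -/
theorem wt_add_add_iff {i j k l m : Idx} :
    wt i + wt j = wt k + wt l + wt m ↔ code i + 8322 + code j = code k + code l + code m := by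
  have hi := code_eq i
  have hj := code_eq j
  have hk := code_eq k
  have hl := code_eq l
  have hm := code_eq m
  constructor
  · intro h
    have h0 := congrFun h 0
    have h1 := congrFun h 1
    have h2 := congrFun h 2
    simp only [Pi.add_apply] at h0 h1 h2
    omega
  · intro h
    refine sub_eq_zero.1 (eq_zero_of_code (fun n => ?_) ?_)
    · have := abs_le.1 (abs_wt_le i n)
      have := abs_le.1 (abs_wt_le j n)
      have := abs_le.1 (abs_wt_le k n)
      have := abs_le.1 (abs_wt_le l n)
      have := abs_le.1 (abs_wt_le m n)
      simp only [Pi.add_apply, Pi.sub_apply]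
      rw [abs_le]
      omega
    · simp only [Pi.add_apply, Pi.sub_apply]
      omega

theorem wt_eq_add_iff {i j k : Idx} : wt k = wt i + wt j ↔ code k + 8322 = code i + code j := by
  have := wt_add_iff (i := k) (j := .inl (0, 0)) (k := i) (l := j)
  rwa [(by decide : wt (.inl (0, 0)) = 0), add_zero] at this

/-- The codes of all weights. -/
def codes : List ℕ := [8322, 8324, 8320, 8450, 8194, 16514, 130, 12483, 12481, 12355, 12353, 4291,
  4289, 4163, 4161]

theorem code_mem_codes : ∀ i, code i ∈ codes := by decide

theorem exists_code_eq : ∀ n ∈ codes, ∃ i, code i = n := by decide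

theorem code_mod_two : ∀ i, code i % 2 = 1 → ∃ p, i = .inr p := by decide

/-- The weight with a given code. -/
def decode (n : ℕ) (k : Fin 3) : ℤ := ![n % 64, n / 64 % 64, n / 4096] k - 2

theorem decode_code : ∀ i, decode (code i) = wt i := by decide

/-! ### Propagation of zeros of derivations -/

section Propagation

variable (N : List ℕ) (y₀ c₀ : ℕ)

/-- Whether the component of weight `c₀ - y₀` of a derivation is known to vanish at `y`, given that
it does on `V`. -/
def zeroed (V : List ℕ) (y : ℕ) : Bool :=
  V.any (Nat.beq y) || !codes.any fun c => Nat.beq (c + y₀) (y + c₀)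

/-- Whether the derivation property for `[y, z]` shows that `[D y, z] = 0`. -/
def forces (V : List ℕ) (y z : ℕ) : Bool :=
  -- Unless the target is a weight, the vanishing of [D y, z] carries no information about D y.
  codes.any (fun k => Nat.beq (k + 8322 + y₀) (y + z + c₀)) &&
    (N.all (fun l => !Nat.beq (l + 8322) (y + z) || zeroed y₀ c₀ V l) &&
      -- Odd codes belong to odd vectors. For such a `y` the two Leibniz terms for [y, y] coincide,
      -- so nothing needs to be known at `z = y`.
      (zeroed y₀ c₀ V z || (Nat.beq y z && Nat.beq (y % 2) 1)))

/-- The determinant of three weights. -/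
def detCode (x y z : ℕ) : ℤ :=
  decode x 0 * (decode y 1 * decode z 2 - decode y 2 * decode z 1) -
    decode x 1 * (decode y 0 * decode z 2 - decode y 2 * decode z 0) +
    decode x 2 * (decode y 0 * decode z 1 - decode y 1 * decode z 0)

/-- Whether the list contains three linearly independent weights. -/
def spans (F : List ℕ) : Bool :=
  F.any fun x => F.any fun y => F.any fun z => !decide (detCode x y z = 0)

/-- Propagation of zeros along a list of pairs. -/
def propagate : List (ℕ × ℕ) → List ℕ → List ℕ → List ℕ
  | [], V, _ => V
  | (y, z) :: ps, V, F =>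
    -- If the derivation vanishes at `y` and at `z`, it vanishes at the basis vector of weight `y +
    -- z`.
    bif zeroed y₀ c₀ V y then
      match N.find? (fun l => Nat.beq (l + 8322) (y + z)) with
      | none => propagate ps V F
      | some l => bif zeroed y₀ c₀ V z then propagate ps (l :: V) F else propagate ps V F
    else bif forces N y₀ c₀ V y z then
      -- Here D y lies in the Cartan subalgebra, and [D y, z] = 0 says only that the weight of `z`
      -- annihilates it. Such `z` are collected until they contain three independent weights.
      bif Nat.beq (8322 + y₀) (y + c₀) then
        bif spans (z :: F) then propagate ps (y :: V) (z :: F) else propagate ps V (z :: F)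
      else propagate ps (y :: V) F
    else propagate ps V F

end Propagation

variable {D : D21 a →ₗ[ℂ] D21 a} {μ : Fin 3 → ℤ}

/-- The component of weight `μ` of `D` vanishes at `y`. -/
def Vanishes (D : D21 a →ₗ[ℂ] D21 a) (μ : Fin 3 → ℤ) (y : Idx) : Prop :=
  ∀ c, wt c = wt y + μ → coord a (D (bv a y)) c = 0

theorem coord_bracket_left (x : D21 a) (j k : Idx) : coord a (bracket (bv a j) x) k =
    ∑ i, coord a x i * coord a (bracket (bv a j) (bv a i)) k := by
  conv_lhs => rw [← sum_coord x]
  simp only [map_sum, map_smul, Finset.sum_apply, Pi.smul_apply, smul_eq_mul]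

theorem Vanishes.bracket_right {y z k : Idx} (h : Vanishes D μ y) (hk : wt k = wt y + wt z + μ) :
    coord a (bracket (D (bv a y)) (bv a z)) k = 0 := by
  rw [coord_bracket_right]
  refine Finset.sum_eq_zero fun i _ => ?_
  by_cases hi : wt i = wt y + μ
  · rw [h i hi, zero_mul]
  · rw [coord_bracket_bv_of_ne, mul_zero]
    intro h'
    exact hi (add_right_cancel (h'.symm.trans (hk.trans (add_right_comm _ _ _))))

theorem Vanishes.bracket_left {y z k : Idx} (h : Vanishes D μ z) (hk : wt k = wt y + wt z + μ) :
    coord a (bracket (bv a y) (D (bv a z))) k = 0 := by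
  rw [coord_bracket_left]
  refine Finset.sum_eq_zero fun i _ => ?_
  by_cases hi : wt i = wt z + μ
  · rw [h i hi, zero_mul]
  · rw [coord_bracket_bv_of_ne, mul_zero]
    intro h'
    exact hi (add_left_cancel (h'.symm.trans (hk.trans (add_assoc _ _ _))))

theorem coord_map_bracket_eq_zero {y z k : Idx} (h : ∀ l, wt l = wt y + wt z → Vanishes D μ l)
    (hk : wt k = wt y + wt z + μ) : coord a (D (bracket (bv a y) (bv a z))) k = 0 := by
  rw [← sum_coord (bracket (bv a y) (bv a z)), map_sum, map_sum, Finset.sum_apply]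
  refine Finset.sum_eq_zero fun l _ => ?_
  rw [map_smul, map_smul, Pi.smul_apply, smul_eq_mul]
  by_cases hl : wt l = wt y + wt z
  · rw [h l hl k (by rw [hk, hl]), mul_zero]
  · rw [coord_bracket_bv_of_ne hl, zero_mul]

/-- Root components of `x` shift the weight, so only its Cartan part is seen. -/
theorem coord_bracket_same_weight (x : D21 a) {j : Idx} :
    coord a (bracket x (bv a j)) j = ∑ m, (wt j m : ℂ) * coord a x (.inl (m, 0)) := by
  rw [coord_bracket_right]
  have h : ∀ i, coord a x i * coord a (bracket (bv a i) (bv a j)) j =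
      coord a x i * ∑ m, (wt j m : ℂ) * coord a (bv a i) (.inl (m, 0)) := by
    intro i
    congr 1
    by_cases hi : wt i = 0
    · rw [coord_bracket_of_cartan, coord_bv, if_pos rfl, mul_one]
      intro l hl
      rw [coord_bv, if_neg]
      rintro rfl
      exact hl hi
    · rw [coord_bracket_bv_of_ne, Finset.sum_eq_zero]
      · intro m _
        rw [coord_bv, if_neg, mul_zero]
        rintro rfl
        exact hi ((by decide : ∀ m : Fin 3, wt (.inl (m, 0)) = 0) m)
      · intro h
        exact hi (left_eq_add.1 (h.trans (add_comm _ _)))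
  simp only [h, coord_bv, Finset.mul_sum]
  rw [Finset.sum_comm]
  refine Finset.sum_congr rfl fun m _ => ?_
  rw [Finset.sum_eq_single (.inl (m, 0))]
  · rw [if_pos rfl, mul_one, mul_comm]
  · intro i _ hi
    rw [if_neg (Ne.symm hi), mul_zero, mul_zero]
  · exact fun h => absurd (Finset.mem_univ _) h

section Soundness

variable {N : List ℕ} {y₀ c₀ : Idx}

/-- The derivation property on the basis vectors with codes in `N`. -/
structure IsDerivationOn (D : D21 a →ₗ[ℂ] D21 a) (N : List ℕ) : Prop where
  map_bracket : ∀ y z, code y ∈ N → code z ∈ N → ∃ σ : ℂ, σ ≠ 0 ∧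
    D (bracket (bv a y) (bv a z)) =
      bracket (D (bv a y)) (bv a z) + σ • bracket (bv a y) (D (bv a z))
  map_bracket_self : ∀ p, code (.inr p) ∈ N →
    D (bracket (bv a (.inr p)) (bv a (.inr p))) =
      (2 : ℂ) • bracket (D (bv a (.inr p))) (bv a (.inr p))

theorem wt_add_iff_shift (hμ : wt y₀ + μ = wt c₀) {y c : Idx} :
    wt c = wt y + μ ↔ code c + code y₀ = code y + code c₀ := by
  rw [← wt_add_iff, ← hμ, add_left_comm, add_comm (wt c), add_left_cancel_iff]

theorem wt_add_add_iff_shift (hμ : wt y₀ + μ = wt c₀) {y z k : Idx} :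
    wt k = wt y + wt z + μ ↔ code k + 8322 + code y₀ = code y + code z + code c₀ := by
  rw [← wt_add_add_iff, ← hμ, add_left_comm, add_comm (wt k), add_left_cancel_iff]

theorem vanishes_of_zeroed (hμ : wt y₀ + μ = wt c₀) {V : List ℕ}
    (hV : ∀ y, code y ∈ V → Vanishes D μ y) {y : Idx}
    (h : zeroed (code y₀) (code c₀) V (code y) = true) : Vanishes D μ y := by
  rw [zeroed, Bool.or_eq_true, List.any_eq_true, Bool.not_eq_true', List.any_eq_false] at h
  rcases h with ⟨n, hn, h⟩ | h
  · rw [Nat.beq_eq] at h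
    exact hV y (h ▸ hn)
  · intro c hc
    refine absurd ?_ (h (code c) (code_mem_codes c))
    rw [Nat.beq_eq]
    exact (wt_add_iff_shift hμ).1 hc

theorem bracket_eq_zero_of_forces (hD : IsDerivationOn D N) (hμ : wt y₀ + μ = wt c₀) {V : List ℕ}
    (hV : ∀ y, code y ∈ V → Vanishes D μ y)
    (hN : ∀ y z l, code y ∈ N → code z ∈ N → wt l = wt y + wt z → code l ∈ N)
    {y z : Idx} (hy : code y ∈ N) (hz : code z ∈ N)
    (hyz : ∀ i j, code i = code j → code i ∈ N → i = j)
    (h : forces N (code y₀) (code c₀) V (code y) (code z) = true) :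
    (∃ k, wt k = wt y + wt z + μ) ∧
      ∀ k, wt k = wt y + wt z + μ → coord a (bracket (D (bv a y)) (bv a z)) k = 0 := by
  rw [forces, Bool.and_eq_true, Bool.and_eq_true, List.any_eq_true, List.all_eq_true,
    Bool.or_eq_true, Bool.and_eq_true, Nat.beq_eq, Nat.beq_eq] at h
  obtain ⟨⟨n, hn, hk⟩, h1, h2⟩ := h
  constructor
  · obtain ⟨k, rfl⟩ := exists_code_eq n hn
    rw [Nat.beq_eq] at hk
    exact ⟨k, (wt_add_add_iff_shift hμ).2 hk⟩
  intro k hk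
  have h3 : coord a (D (bracket (bv a y) (bv a z))) k = 0 := by
    refine coord_map_bracket_eq_zero (fun l hl => ?_) hk
    have := h1 (code l) (hN y z l hy hz hl)
    rw [(Nat.beq_eq ▸ wt_eq_add_iff.1 hl : Nat.beq (code l + 8322) (code y + code z) = true),
      Bool.not_true, Bool.false_or] at this
    exact vanishes_of_zeroed hμ hV this
  rcases h2 with h2 | ⟨h2, h4⟩
  · obtain ⟨σ, -, hσ⟩ := hD.map_bracket y z hy hz
    rw [hσ, map_add, Pi.add_apply, map_smul, Pi.smul_apply,
      (vanishes_of_zeroed hμ hV h2).bracket_left hk, smul_zero, add_zero] at h3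
    exact h3
  · obtain rfl := hyz y z h2 hy
    obtain ⟨p, rfl⟩ := code_mod_two y h4
    rw [hD.map_bracket_self p hy, map_smul, Pi.smul_apply, smul_eq_mul] at h3
    exact (mul_eq_zero.1 h3).resolve_left two_ne_zero

theorem detCode_code (x y z : Idx) :
    detCode (code x) (code y) (code z) = (Matrix.of ![wt x, wt y, wt z]).det := by
  simp only [detCode, decode_code, Matrix.det_fin_three, Matrix.of_apply, Matrix.cons_val]
  ring

theorem vanishes_of_spans {F : List ℕ} (hF : ∀ n ∈ F, n ∈ codes) {h : Fin 3 → ℂ}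
    (h0 : ∀ z, code z ∈ F → ∑ m, (wt z m : ℂ) * h m = 0) (hs : spans F = true) : h = 0 := by
  simp only [spans, List.any_eq_true, Bool.not_eq_true', decide_eq_false_iff_not] at hs
  obtain ⟨n1, h1, n2, h2, n3, h3, hdet⟩ := hs
  obtain ⟨x, rfl⟩ := exists_code_eq _ (hF _ h1)
  obtain ⟨y, rfl⟩ := exists_code_eq _ (hF _ h2)
  obtain ⟨z, rfl⟩ := exists_code_eq _ (hF _ h3)
  rw [detCode_code] at hdet
  refine Matrix.eq_zero_of_mulVec_eq_zero
    (M := (Matrix.of ![wt x, wt y, wt z]).map (Int.castRingHom ℂ)) ?_ ?_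
  · rw [← RingHom.mapMatrix_apply, ← RingHom.map_det]
    exact Int.cast_ne_zero.2 hdet
  · ext m
    fin_cases m
    · exact h0 x h1
    · exact h0 y h2
    · exact h0 z h3

/-- Soundness of the search. The invariant is that the derivation vanishes at all of `V`, and that
the weights in `F` annihilate its Cartan value at the vector of weight -μ. That vector is unique
because negative weights are nonzero. -/
theorem vanishes_of_propagate (ha0 : a ≠ 0) (ha1 : a ≠ -1) (hD : IsDerivationOn D N)
    (hμ : wt y₀ + μ = wt c₀)
    (hN : ∀ y z l, code y ∈ N → code z ∈ N → wt l = wt y + wt z → code l ∈ N)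
    (hN0 : ∀ y, code y ∈ N → wt y ≠ 0) (hNc : ∀ n ∈ N, n ∈ codes) :
    ∀ (ps : List (ℕ × ℕ)) (V F : List ℕ), (∀ p ∈ ps, p.1 ∈ N ∧ p.2 ∈ N) →
      (∀ y, code y ∈ V → Vanishes D μ y) → (∀ n ∈ F, n ∈ N) →
      (∀ z, code z ∈ F → ∀ y, wt y + μ = 0 →
        ∑ m, (wt z m : ℂ) * coord a (D (bv a y)) (.inl (m, 0)) = 0) →
      ∀ y, code y ∈ propagate N (code y₀) (code c₀) ps V F → Vanishes D μ y := by
  have hinj : ∀ i j, code i = code j → code i ∈ N → i = j := by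
    intro i j h hi
    refine wt_injective_of_ne i j ?_ (hN0 i hi)
    rw [← decode_code, h, decode_code]
  intro ps
  induction ps with
  | nil => exact fun V F _ hV _ _ => hV
  | cons p ps ih =>
    obtain ⟨n1, n2⟩ := p
    intro V F hps hV hFN hF
    obtain ⟨hy, hz⟩ := hps _ List.mem_cons_self
    have hps' : ∀ p ∈ ps, p.1 ∈ N ∧ p.2 ∈ N := fun p hp => hps p (List.mem_cons_of_mem _ hp)
    dsimp only at hy hz
    obtain ⟨y, rfl⟩ := exists_code_eq _ (hNc _ hy)
    obtain ⟨z, rfl⟩ := exists_code_eq _ (hNc _ hz)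
    have hcons : ∀ i, code i ∈ N → Vanishes D μ i →
        ∀ y, code y ∈ code i :: V → Vanishes D μ y := by
      intro i hi h y' hy'
      rcases List.mem_cons.1 hy' with h' | h'
      · rwa [← hinj i y' h'.symm hi]
      · exact hV y' h'
    rw [propagate]
    cases h1 : zeroed (code y₀) (code c₀) V (code y) with
    | true =>
      rw [cond_true]
      split
      · exact ih V F hps' hV hFN hF
      · rename_i n hn
        cases h2 : zeroed (code y₀) (code c₀) V (code z) with
        | true =>
          rw [cond_true]
          have hnN := List.mem_of_find?_eq_some hn
          have hn' := List.find?_some hn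
          obtain ⟨l, rfl⟩ := exists_code_eq _ (hNc _ hnN)
          rw [Nat.beq_eq] at hn'
          have hl := wt_eq_add_iff.2 hn'
          refine ih _ F hps' (hcons l hnN fun c hc => ?_) hFN hF
          have hc' : wt c = wt y + wt z + μ := by rw [hc, hl]
          -- The bracket of the two basis vectors is a nonzero multiple of the basis vector `l`, so
          -- its image determines the image of `l`.
          obtain ⟨r, hr, hb⟩ := bracket_bv_of_wt (a := a) ha0 ha1 (hN0 y hy) (hN0 z hz)
            (hN0 l hnN) hl
          obtain ⟨σ, -, hσ⟩ := hD.map_bracket y z hy hz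
          have h3 := congrFun (congrArg (coord a) hσ) c
          rw [hb, map_smul, map_smul, Pi.smul_apply, map_add, Pi.add_apply, map_smul,
            Pi.smul_apply, (vanishes_of_zeroed hμ hV h1).bracket_right hc',
            (vanishes_of_zeroed hμ hV h2).bracket_left hc', smul_zero, add_zero,
            smul_eq_mul] at h3
          exact (mul_eq_zero.1 h3).resolve_left hr
        | false => exact ih V F hps' hV hFN hF
    | false =>
      rw [cond_false]
      cases h2 : forces N (code y₀) (code c₀) V (code y) (code z) with
      | false => exact ih V F hps' hV hFN hF
      | true =>
        rw [cond_true]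
        obtain ⟨hk, h3⟩ := bracket_eq_zero_of_forces hD hμ hV hN hy hz hinj h2
        have hiff : wt y + μ = 0 ↔ Nat.beq (8322 + code y₀) (code y + code c₀) = true := by
          have := wt_add_iff_shift hμ (y := y) (c := .inl (0, 0))
          rw [(by decide : wt (.inl (0, 0)) = 0)] at this
          rw [eq_comm, this, Nat.beq_eq]
          rfl
        cases h4 : Nat.beq (8322 + code y₀) (code y + code c₀) with
        | true =>
          rw [cond_true]
          have h5 := hiff.2 h4
          have hF' : ∀ z', code z' ∈ code z :: F → ∀ y', wt y' + μ = 0 →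
              ∑ m, (wt z' m : ℂ) * coord a (D (bv a y')) (.inl (m, 0)) = 0 := by
            intro z' hz' y' hy'
            rcases List.mem_cons.1 hz' with h' | h'
            · obtain rfl := hinj z z' h'.symm hz
              have : wt y = wt y' := add_right_cancel (h5.trans hy'.symm)
              rw [← wt_injective_of_ne y y' this (hN0 y hy), ← coord_bracket_same_weight]
              -- The coordinate of [h, z] at `z` is the weight of `z` evaluated at h.
              exact h3 z (by rw [add_right_comm, h5, zero_add])
            · exact hF z' h' y' hy'
          have hFN' : ∀ n ∈ code z :: F, n ∈ N := by
            intro n hn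
            rcases List.mem_cons.1 hn with rfl | h'
            · exact hz
            · exact hFN n h'
          cases h6 : spans (code z :: F) with
          | true =>
            refine ih _ _ hps' (hcons y hy fun c hc => ?_) hFN' hF'
            rw [h5] at hc
            obtain ⟨m, rfl⟩ := (by decide : ∀ i : Idx, wt i = 0 → ∃ k, i = .inl (k, 0)) c hc
            exact congrFun (vanishes_of_spans (h := fun m => coord a (D (bv a y)) (.inl (m, 0)))
              (fun n hn => hNc n (hFN' n hn)) (fun z' hz' => hF' z' hz' y h5) h6) m
          | false => exact ih _ _ hps' hV hFN' hF'
        | false =>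
          refine ih _ F hps' (hcons y hy fun c hc => ?_) hFN hF
          have hc0 : wt c ≠ 0 := by
            intro h
            rw [h] at hc
            rw [hiff.1 hc.symm] at h4
            exact Bool.noConfusion h4
          have e : wt c + wt z = wt y + wt z + μ := by rw [hc, add_right_comm]
          exact coord_eq_zero_of_bracket ha0 ha1 hc0 (hN0 z hz) (by rwa [e])
            fun k hk' => h3 k (hk'.trans e)

end Soundness

end D21

namespace D21

open LieSuperalgebra

variable {a : ℂ}

/-! ### Derivations of the negative part -/

/-- The codes of the weights of negative degree. -/
def negCodes : ParabolicType → List ℕ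
  | .I1 => [8320, 12481, 4289, 12353, 4161]
  | .I2 => [8320, 8194, 12353, 4161]
  | .I12 => [8320, 8194, 12481, 4289, 12353, 4161]
  | .I23 => [8320, 8194, 130, 4289, 12353, 4161]
  | .I123 => [8320, 8194, 130, 12481, 4289, 12353, 4161]
  | .IV123 => [8320, 8194, 130, 4163, 4289, 12353, 4161]

theorem mem_negCodes : ∀ (t : ParabolicType) (i : Idx),
    code i ∈ negCodes t ↔ deg t.rep.1 t.rep.2 i < 0 := by decide

theorem mem_codes_of_mem_negCodes : ∀ t, ∀ n ∈ negCodes t, n ∈ codes := by decide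

/-- Twice the degree of a weight. -/
def degCode (t : ParabolicType) (n : ℕ) : ℤ :=
  match t with
  | .I1 => 2 * decode n 0
  | .I2 => decode n 0 + decode n 1
  | .I12 => 3 * decode n 0 + decode n 1
  | .I23 => 2 * decode n 0 + decode n 1 + decode n 2
  | .I123 => 4 * decode n 0 + decode n 1 + decode n 2
  | .IV123 => 2 * decode n 0 + 2 * decode n 1 + 2 * decode n 2

theorem degCode_code : ∀ t i, degCode t (code i) = 2 * deg (ParabolicType.rep t).1 t.rep.2 i := by
  decide

/-- The largest degree in which derivations need not be inner. -/
def rigidBound : ParabolicType → ℤ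
  | .I1 | .I12 | .I123 => 1
  | .I2 | .I23 => 0
  | .IV123 => -1

/-- The basis vector at which a derivation of root weight is normalized. -/
def startIdx : Idx → Idx
  | .inl _ => .inr (1, 1, 1)
  | .inr (_, q, _) => .inl (![1, 2] q, 2)

/-- The code of `startIdx`. -/
def startCode (n : ℕ) : ℕ :=
  bif Nat.beq (n % 2) 0 then 4161 else bif Nat.beq (n / 64 % 64) 3 then 8194 else 130

theorem startCode_code : ∀ i, wt i ≠ 0 → startCode (code i) = code (startIdx i) := by decide

/-- Whether propagation proves that the component of weight `c₀ - y₀` vanishes at `y₀`. -/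
def propagates (N : List ℕ) (y₀ c₀ : ℕ) : Bool :=
  let ps := N.flatMap fun y => N.map fun z => (y, z)
  -- Three passes over all pairs suffice for the finite check.
  (propagate N y₀ c₀ (ps ++ ps ++ ps)
    -- If the weight of the component is a weight of the algebra, the component is assumed to vanish
    -- at the normalizing vector; otherwise nothing is assumed.
    (match codes.find? fun i => Nat.beq (i + y₀) (c₀ + 8322) with
    | none => []
    | some i => [startCode i]) []).any (Nat.beq y₀)

/-- The finite core of rigidity, independent of `a`. Components of weight zero are excluded by `y₀ ≠
c₀`, since they are removed by a Cartan element instead. -/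
theorem propagates_negCodes : ∀ t, ∀ y₀ ∈ codes, degCode t y₀ = -2 → ∀ c₀ ∈ codes,
    2 * rigidBound t - 2 < degCode t c₀ → y₀ ≠ c₀ → propagates (negCodes t) y₀ c₀ = true := by
  decide +kernel

theorem coord_eq_zero_of_propagates (ha0 : a ≠ 0) (ha1 : a ≠ -1) (t : ParabolicType)
    {D : D21 a →ₗ[ℂ] D21 a} (hD : IsDerivationOn D (negCodes t)) {y₀ c₀ : Idx}
    (hy : deg t.rep.1 t.rep.2 y₀ = -1) (hc : rigidBound t - 1 < deg t.rep.1 t.rep.2 c₀)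
    (hne : wt y₀ ≠ wt c₀)
    (hst : ∀ i, wt i ≠ 0 → wt i + wt y₀ = wt c₀ → ∀ c, wt c = wt (startIdx i) + wt i →
      coord a (D (bv a (startIdx i))) c = 0) : coord a (D (bv a y₀)) c₀ = 0 := by
  have hcode : code y₀ ≠ code c₀ := fun h => hne (by rw [← decode_code, h, decode_code])
  have h := propagates_negCodes t _ (code_mem_codes y₀) (by rw [degCode_code, hy]; rfl) _
    (code_mem_codes c₀) (by rw [degCode_code]; omega) hcode
  obtain ⟨μ, hμ⟩ : ∃ μ, wt y₀ + μ = wt c₀ := ⟨wt c₀ - wt y₀, add_sub_cancel _ _⟩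
  rw [propagates, List.any_eq_true] at h
  obtain ⟨n, hn, hn'⟩ := h
  rw [Nat.beq_eq] at hn'
  subst hn'
  have hN0 : ∀ y, code y ∈ negCodes t → wt y ≠ 0 := by
    intro y hy h
    rw [mem_negCodes, deg_of_wt_eq_zero _ _ h] at hy
    exact lt_irrefl _ hy
  refine vanishes_of_propagate ha0 ha1 hD hμ ?_ hN0 (mem_codes_of_mem_negCodes t) _ _ _ ?_ ?_
    (fun n hn => absurd hn List.not_mem_nil) (fun z hz => absurd hz List.not_mem_nil) y₀ hn c₀
    hμ.symm
  · intro y z l hy hz hl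
    rw [mem_negCodes] at hy hz ⊢
    rw [isDegree_deg t.rep.1 t.rep.2 y z l hl]
    omega
  · have : ∀ p ∈ (negCodes t).flatMap fun y => (negCodes t).map fun z => (y, z),
        p.1 ∈ negCodes t ∧ p.2 ∈ negCodes t := by
      intro p hp
      simp only [List.mem_flatMap, List.mem_map] at hp
      obtain ⟨y, hy, z, hz, rfl⟩ := hp
      exact ⟨hy, hz⟩
    intro p hp
    rw [List.mem_append, List.mem_append] at hp
    rcases hp with (hp | hp) | hp <;> exact this p hp
  · intro y hy
    split at hy
    · exact absurd hy List.not_mem_nil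
    · rename_i n hn
      have h1 := List.mem_of_find?_eq_some hn
      have h2 := List.find?_some hn
      obtain ⟨i, rfl⟩ := exists_code_eq n h1
      rw [Nat.beq_eq] at h2
      have hi : wt i + wt y₀ = wt c₀ := by
        rw [wt_eq_add_iff.2 h2.symm]
      have hi0 : wt i ≠ 0 := by
        intro h0
        rw [h0, zero_add] at hi
        exact hne hi
      have hiμ : wt i = μ := by
        rw [← hμ, add_comm] at hi
        exact add_left_cancel hi
      rw [startCode_code i hi0, List.mem_singleton] at hy
      have hwt : wt y = wt (startIdx i) := by rw [← decode_code, hy, decode_code]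
      obtain rfl : startIdx i = y :=
        wt_injective_of_ne _ _ hwt.symm ((by decide : ∀ i, wt (startIdx i) ≠ 0) i)
      rw [← hiμ]
      exact hst i hi0 hi

/-- The parity of a basis vector. -/
def idxParity : Idx → ZMod 2 := Sum.elim (fun _ => 0) fun _ => 1

theorem mem_parity_iff {ε : ZMod 2} {x : D21 a} :
    x ∈ parity (L := D21 a) ε ↔ ∀ i, idxParity i ≠ ε → coord a x i = 0 := by
  rcases zmod_two_cases ε with rfl | rfl
  · rw [parity_zero_eq, mem_coordSub]
    refine forall_congr' fun i => ?_
    rcases i with i | i <;> simp [idxParity]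
  · rw [parity_one_eq, mem_coordSub]
    refine forall_congr' fun i => ?_
    rcases i with i | i <;> simp [idxParity]

theorem idxParity_add : ∀ i j k : Idx, wt i ≠ 0 → wt k = wt i + wt j →
    idxParity k = idxParity i + idxParity j := by decide +kernel

/-- The normalizing vector lies in 𝔪, where the derivation satisfies its hypotheses. -/
theorem deg_startIdx : ∀ (t : ParabolicType) (i : Idx), wt i ≠ 0 →
    rigidBound t < deg t.rep.1 t.rep.2 i → deg t.rep.1 t.rep.2 (startIdx i) < 0 := by
  decide

/-- The derivation has one unknown scalar for each root of degree `j` at the chosen starting vector,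
and a multiple of the root vector matches it there. In degree zero a Cartan element matches the
diagonal values at three independent weights. -/
theorem exists_inner_normalization (ha0 : a ≠ 0) (ha1 : a ≠ -1) (t : ParabolicType) {j : ℤ}
    (hj : rigidBound t < j) {ε : ZMod 2} {D : D21 a →ₗ[ℂ] D21 a}
    (hpar : ∀ y c, deg t.rep.1 t.rep.2 y < 0 → idxParity c ≠ ε + idxParity y →
      coord a (D (bv a y)) c = 0) :
    ∃ x ∈ gradedPiece a (simpleRoots t.rep.1) t.rep.2 j, x ∈ parity (L := D21 a) ε ∧
      (∀ i, wt i ≠ 0 → deg t.rep.1 t.rep.2 i = j → ∀ c, wt c = wt (startIdx i) + wt i →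
        coord a (D (bv a (startIdx i))) c = coord a (bracket x (bv a (startIdx i))) c) ∧
      (j = 0 → ∀ m, coord a (D (bv a (indepIdx t m))) (indepIdx t m) =
        coord a (bracket x (bv a (indepIdx t m))) (indepIdx t m)) := by
  have hr : ∀ i, ∃ r : ℂ, wt i ≠ 0 → deg t.rep.1 t.rep.2 i = j → (idxParity i ≠ ε → r = 0) ∧
      ∀ c, wt c = wt (startIdx i) + wt i → coord a (D (bv a (startIdx i))) c =
        r * coord a (bracket (bv a i) (bv a (startIdx i))) c := by
    intro i
    by_cases hc : ∃ c, wt c = wt (startIdx i) + wt i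
    swap
    · exact ⟨0, fun _ _ => ⟨fun _ => rfl, fun c hc' => absurd ⟨c, hc'⟩ hc⟩⟩
    obtain ⟨c, hc⟩ := hc
    refine ⟨coord a (D (bv a (startIdx i))) c /
      coord a (bracket (bv a i) (bv a (startIdx i))) c, fun hi hd => ⟨fun hp => ?_, ?_⟩⟩
    · rw [hpar _ _ (deg_startIdx t i hi (hd ▸ hj)), zero_div]
      intro h
      rw [idxParity_add _ _ _ ((by decide : ∀ i, wt (startIdx i) ≠ 0) i) hc, add_comm] at h
      exact hp (add_right_cancel h)
    · intro c' hc'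
      have hc0 : wt c ≠ 0 := by
        rw [hc]
        exact (by decide : ∀ i, wt i ≠ 0 → wt (startIdx i) + wt i ≠ 0) i hi
      obtain rfl := wt_injective_of_ne c c' (hc.trans hc'.symm) hc0
      rw [div_mul_cancel₀]
      exact coord_bracket_ne_zero ha0 ha1 hi ((by decide : ∀ i, wt (startIdx i) ≠ 0) i) hc0
        (hc.trans (add_comm _ _))
  choose r hr using hr
  -- This Cartan element enters only if `j = 0`.
  obtain ⟨h, hh⟩ : ∃ h : Fin 3 → ℂ, (Matrix.of fun m k => (wt (indepIdx t m) k : ℂ)).mulVec h =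
      fun m => coord a (D (bv a (indepIdx t m))) (indepIdx t m) := by
    refine ⟨(Matrix.of fun m k => (wt (indepIdx t m) k : ℂ))⁻¹.mulVec
      (fun m => coord a (D (bv a (indepIdx t m))) (indepIdx t m)), ?_⟩
    rw [Matrix.mulVec_mulVec, Matrix.mul_nonsing_inv _ (det_indepIdx t).isUnit, Matrix.one_mulVec]
  -- Components of the wrong parity are set to zero; there the scalar `r` vanishes as well, because
  -- the derivation has parity `ε`.
  let g : Idx → ℂ := fun i => if deg t.rep.1 t.rep.2 i = j ∧ idxParity i = ε then
    if wt i = 0 then Sum.elim (fun m => h m.1) (fun _ => 0) i else r i else 0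
  have hg : ∀ i, coord a ((coord a).symm g) i = g i := fun i => by
    rw [LinearEquiv.apply_symm_apply]
  refine ⟨(coord a).symm g, ?_, ?_, ?_, ?_⟩
  · rw [mem_gradedPiece]
    intro i hi
    rw [hg]
    exact if_neg fun h => hi h.1
  · rw [mem_parity_iff]
    intro i hi
    rw [hg]
    exact if_neg fun h => hi h.2
  · intro i hi hd c hc
    rw [coord_bracket_right_of_ne hi (hc.trans (add_comm _ _)), hg, (hr i hi hd).2 c hc]
    congr 1
    by_cases hp : idxParity i = ε
    · simp only [g]
      rw [if_pos ⟨hd, hp⟩, if_neg hi]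
    · simp only [g]
      rw [if_neg fun h => hp h.2]
      exact (hr i hi hd).1 hp
  · rintro rfl m
    rw [coord_bracket_same_weight]
    have h1 : coord a (D (bv a (indepIdx t m))) (indepIdx t m) =
        ∑ k, (wt (indepIdx t m) k : ℂ) * h k := (congrFun hh m).symm
    by_cases hp : ε = 0
    · subst hp
      rw [h1]
      refine Finset.sum_congr rfl fun k _ => ?_
      rw [hg]
      congr 1
      have h0 := (by decide : ∀ m : Fin 3, wt (.inl (m, 0)) = 0) k
      simp only [g]
      rw [if_pos ⟨deg_of_wt_eq_zero _ _ h0, rfl⟩, if_pos h0]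
      rfl
    · rw [hpar _ _ (by rw [deg_indepIdx]; decide), Finset.sum_eq_zero]
      · intro k _
        rw [hg]
        simp only [g]
        rw [if_neg fun h => hp h.2.symm, mul_zero]
      · intro h
        exact hp (right_eq_add.1 h)

/-- After subtraction of the normalizing inner derivation, each component of nonzero weight vanishes
on G₋₁ by propagation, and the component of weight zero by the choice of the Cartan element. -/
theorem innerDerivations_gradedPiece (ha0 : a ≠ 0) (ha1 : a ≠ -1) (t : ParabolicType) {j : ℤ}
    (hj : rigidBound t < j) :
    InnerDerivations (gradedPiece a (simpleRoots t.rep.1) t.rep.2) j := by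
  intro ε D hdeg hpar hder
  have hmem : ∀ i, bv a i ∈ gradedPiece a (simpleRoots t.rep.1) t.rep.2
      (deg t.rep.1 t.rep.2 i) := fun i => by
    rw [gradedPiece_eq]
    exact bv_mem.2 rfl
  have hmemp : ∀ i, bv a i ∈ parity (L := D21 a) (idxParity i) := fun i => by
    rw [mem_parity_iff]
    intro k hk
    rw [coord_bv, if_neg]
    rintro rfl
    exact hk rfl
  obtain ⟨x, hxj, hxε, hx1, hx2⟩ := exists_inner_normalization ha0 ha1 t hj (ε := ε) (D := D)
    fun y c hy hc => mem_parity_iff.1 (hpar _ hy _ _ (hmem y) (hmemp y)) c hc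
  refine ⟨x, hxj, ?_⟩
  have hD : IsDerivationOn (D - bracket x) (negCodes t) := by
    have key : ∀ y z, code y ∈ negCodes t → code z ∈ negCodes t →
        (D - bracket x) (bracket (bv a y) (bv a z)) =
          bracket ((D - bracket x) (bv a y)) (bv a z) +
            koszulSign ε (idxParity y) • bracket (bv a y) ((D - bracket x) (bv a z)) := by
      intro y z hy hz
      rw [mem_negCodes] at hy hz
      simp only [LinearMap.sub_apply, map_sub, smul_sub]
      rw [hder _ hy _ hz _ _ _ (hmem y) (hmemp y) _ (hmem z) (hmemp z), jacobi _ hxε (hmemp y)]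
      abel
    refine ⟨fun y z hy hz => ⟨_, by unfold koszulSign; split_ifs <;> norm_num, key y z hy hz⟩, fun p hp => ?_⟩
    rw [key _ _ hp hp]
    have h1 : (D - bracket x) (bv a (.inr p)) ∈ parity (L := D21 a) (ε + 1) := by
      rw [LinearMap.sub_apply]
      exact Submodule.sub_mem _
        (hpar _ ((mem_negCodes t _).1 hp) _ _ (hmem _) (hmemp (.inr p)))
        (bracket_mem hxε (hmemp (.inr p)))
    -- The image of an odd vector has parity `ε + 1`; with this, skew-symmetry makes the two Leibniz
    -- terms for [y, y] equal.
    rw [skew (hmemp (.inr p)) h1, two_smul]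
    congr 1
    rw [smul_neg, smul_smul]
    rcases zmod_two_cases ε with rfl | rfl
    · simp [koszulSign, idxParity]
    · simp [koszulSign, idxParity, (by decide : (1 : ZMod 2) + 1 = 0)]
  have hmain : ∀ y, deg t.rep.1 t.rep.2 y = -1 → D (bv a y) = bracket x (bv a y) := by
    intro y hy
    rw [← sub_eq_zero, ← LinearMap.sub_apply]
    refine eq_zero_of_coord fun c => ?_
    by_cases hc : deg t.rep.1 t.rep.2 c = j + -1
    · by_cases hne : wt y = wt c
      · have h0 : wt y ≠ 0 := by
          intro h
          rw [deg_of_wt_eq_zero _ _ h] at hy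
          exact absurd hy (by decide)
        obtain rfl := wt_injective_of_ne y c hne h0
        have hj0 : j = 0 := by omega
        -- Degree zero occurs only for the type with bound -1, whose G₋₁ is spanned by the three
        -- chosen vectors.
        obtain ⟨m, rfl⟩ := (by decide : ∀ t, rigidBound t < 0 → ∀ y,
          deg (ParabolicType.rep t).1 t.rep.2 y = -1 → ∃ m, y = indepIdx t m) t (hj0 ▸ hj) y hy
        rw [LinearMap.sub_apply, map_sub, Pi.sub_apply, sub_eq_zero]
        exact hx2 hj0 m
      · refine coord_eq_zero_of_propagates ha0 ha1 t hD hy (by omega) hne fun i hi hi' c' hc' => ?_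
        have := isDegree_deg t.rep.1 t.rep.2 _ _ _ hi'.symm
        rw [LinearMap.sub_apply, map_sub, Pi.sub_apply, sub_eq_zero]
        exact hx1 i hi (by omega) c' hc'
    · have h1 : (D - bracket x) (bv a y) ∈
          gradedPiece a (simpleRoots t.rep.1) t.rep.2 (j + -1) := by
        rw [LinearMap.sub_apply]
        have hy' := hmem y
        rw [hy] at hy'
        exact Submodule.sub_mem _ (hdeg _ (by decide) _ hy')
          ((isGrading_gradedPiece _ _).bracket_mem _ _ _ hxj _ hy')
      exact mem_gradedPiece.1 h1 c hc
  intro y hy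
  rw [mem_gradedPiece] at hy
  rw [← sum_coord y, map_sum, map_sum]
  refine Finset.sum_congr rfl fun i _ => ?_
  rw [map_smul, map_smul]
  by_cases hi : deg t.rep.1 t.rep.2 i = -1
  · rw [hmain i hi]
  · rw [hy i hi, zero_smul, zero_smul]

theorem prolongationIsSelf_gradedPiece (ha0 : a ≠ 0) (ha1 : a ≠ -1) (t : ParabolicType) :
    ProlongationIsSelf.{0, w} (gradedPiece a (simpleRoots t.rep.1) t.rep.2) (rigidBound t) :=
  prolongationIsSelf_of_innerDerivations (isGrading_gradedPiece _ _)
    (isEffective_gradedPiece ha0 ha1 t) (by cases t <;> decide)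
    (isFundamental_gradedPiece ha0 ha1 t) fun _ => innerDerivations_gradedPiece ha0 ha1 t

end D21

namespace LieSuperalgebra

/-! ### Modules over the negative part inside the prolongation -/

section Embedding

variable {L : Type u} [AddCommGroup L] [Module ℂ L] [LieSuperalgebra L]
variable {G : ℤ → Submodule ℂ L} {k : ℤ}
variable {M : Type v} [AddCommGroup M] [Module ℂ M]

/-- A graded module `M` over the negative part together with a map `φ : M → L` that is equivariant
in degrees at most `k` and vanishes in higher degrees. -/
structure IsTruncatedModule (G : ℤ → Submodule ℂ L) (k : ℤ) (σ : M →ₗ[ℂ] M)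
    (act : L →ₗ[ℂ] M →ₗ[ℂ] M) (φ : M →ₗ[ℂ] L) (GM : ℤ → Set M) : Prop where
  isNegativeAction : IsNegativeAction G σ act
  map_sigma : ∀ x, φ (σ x) = sigma L (φ x)
  sigma_mem : ∀ j, ∀ x ∈ GM j, σ x ∈ GM j
  act_mem : ∀ j a, a < 0 → ∀ x ∈ GM j, ∀ y ∈ G a, act y x ∈ GM (j + a)
  map_mem : ∀ j ≤ k, ∀ x ∈ GM j, φ x ∈ G j
  map_eq_zero : ∀ j > k, ∀ x ∈ GM j, φ x = 0
  map_act : ∀ j ≤ k, ∀ a < 0, ∀ x ∈ GM j, ∀ y ∈ G a, φ (act y x) = bracket (φ x) y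

variable {σ : M →ₗ[ℂ] M} {act : L →ₗ[ℂ] M →ₗ[ℂ] M} {φ : M →ₗ[ℂ] L} {GM : ℤ → Set M}

variable (hG : IsGrading G) (hE : IsEffective G) (hk : -1 ≤ k)

/-- The operators on the enveloping algebra given by a truncated module. -/
noncomputable def moduleRep (h : IsTruncatedModule G k σ act φ GM) :
    M →ₗ[ℂ] Module.End ℂ (Env G) :=
  coindRep hG h.isNegativeAction (envι G ∘ₗ φ)

theorem moduleRep_one (h : IsTruncatedModule G k σ act φ GM) (x : M) :
    moduleRep hG h x 1 = envι G (φ x) := by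
  rw [moduleRep, coindRep_one]
  rfl

theorem superBracket_moduleRep_envL (h : IsTruncatedModule G k σ act φ GM) {a : ℤ} (ha : a < 0)
    {y : L} (hy : y ∈ G a) (x : M) :
    superBracket (endSigma hG) (moduleRep hG h x) (envL G y) = moduleRep hG h (act y x) :=
  superBracket_coindRep_envL hG _ (fun x => by simp [h.map_sigma, envSigma_envι]) ha hy x

/-- In degrees at most `k` the map `φ` is equivariant, so both families of operators obey the same
recursion and agree at 1. -/
theorem moduleRep_eq_selfRep (h : IsTruncatedModule G k σ act φ GM) {j : ℤ} (hj : j ≤ k) {x : M}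
    (hx : x ∈ GM j) : moduleRep hG h x = selfRep hG hE hk (φ x) := by
  have hself : ∀ {j : ℤ}, j ≤ k → ∀ x ∈ G j, extMap hG (truncation G k).subtype x = x :=
    fun hj x hx => extMap_apply hG _ hj hx
  have hQ := self_isEffectiveExtension hG hE k
  refine sub_eq_zero.1 (env_operators_eq_zero hG
    (fun x : {x : M // ∃ j ≤ k, x ∈ GM j} => moduleRep hG h x - selfRep hG hE hk (φ x))
    ?_ ?_ ⟨x, j, hj, hx⟩)
  · rintro ⟨x, j, hj, hx⟩
    have h1 := extRetract_extMap hG hQ hj (h.map_mem j hj x hx)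
    rw [hself hj _ (h.map_mem j hj x hx)] at h1
    rw [LinearMap.sub_apply, moduleRep_one, extRep_one, h1, sub_self]
  · rintro ⟨x, j, hj, hx⟩ a q y ha hy hyq
    have ht : ∃ j ≤ k, twist σ q x ∈ GM j := by
      refine ⟨j, hj, ?_⟩
      rcases zmod_two_cases q with rfl | rfl
      · simpa using hx
      · simpa using h.sigma_mem j x hx
    have htw : twist (sigma L) q (φ x) = φ (twist σ q x) := by
      rcases zmod_two_cases q with rfl | rfl
      · simp
      · simp [h.map_sigma]
    refine ⟨_, Submodule.subset_span ⟨⟨act y x, j + a, by omega, h.act_mem j a ha x hx y hy⟩, rfl⟩,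
      _, Submodule.subset_span ⟨⟨_, ht⟩, rfl⟩, fun u => ?_⟩
    simp only [LinearMap.sub_apply, selfRep, extRep_mul hG hQ hk ha hy hyq,
      hself (by omega : a ≤ k) y hy, htw, ← h.map_act j hj a ha x hx y hy, mul_sub]
    rw [moduleRep, coindRep_mul hG _ _ ha hy hyq]
    abel

/-- Above degree `k` the operators kill 1 because `φ` vanishes there, and their commutators with 𝔪
come from the module again; this is the recursion that defines the pieces. -/
theorem moduleRep_mem_piece (h : IsTruncatedModule G k σ act φ GM) {j : ℤ} {x : M}
    (hx : x ∈ GM j) : moduleRep hG h x ∈ piece hG hE hk j := by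
  refine mem_piece_of_graded hG hE hk (moduleRep hG h) GM (fun j hj x hx => ?_)
    (fun j hj x hx => ?_) (fun j hj x hx a ha y hy => ?_) hx
  · rw [moduleRep_eq_selfRep hG hE hk h hj hx, piece_of_le hG hE hk hj]
    exact Submodule.mem_map_of_mem (h.map_mem j hj x hx)
  · rw [moduleRep_one, h.map_eq_zero j hj x hx, map_zero]
  · exact ⟨_, h.act_mem j a ha x hx y hy, superBracket_moduleRep_envL hG h ha hy x⟩

/-- Nonvanishing climbs from `act y x` to `x`, so an infinite chain need only be checked at its
bottom. -/
theorem moduleRep_ne_zero_of_act (h : IsTruncatedModule G k σ act φ GM) {a : ℤ} (ha : a < 0)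
    {y : L} (hy : y ∈ G a) {x : M} (hx : moduleRep hG h (act y x) ≠ 0) : moduleRep hG h x ≠ 0 := by
  intro h0
  apply hx
  rw [← superBracket_moduleRep_envL hG h ha hy, h0, map_zero, LinearMap.zero_apply]

theorem moduleRep_ne_zero (hF : IsFundamental G) (h : IsTruncatedModule G k σ act φ GM) {x : M}
    (hx : φ x ∈ truncation G (-1)) (h0 : φ x ≠ 0) : moduleRep hG h x ≠ 0 := by
  intro h1
  refine h0 (eq_zero_of_envι_eq_zero hG hF hx ?_)
  rw [← moduleRep_one hG h, h1, LinearMap.zero_apply]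

/-- The prolongation is infinite-dimensional if infinitely many of its pieces are nonzero. -/
theorem prolongationIsInfinite_of_ne_bot {L : Type} [AddCommGroup L] [Module ℂ L]
    [LieSuperalgebra L] {G : ℤ → Submodule ℂ L} (hG : IsGrading G) (hE : IsEffective G)
    (hk : -1 ≤ k) (hF : IsFundamental G) {d : ℕ → ℤ} (hd : Function.Injective d)
    (T : ℕ → Module.End ℂ (Env G)) (hT : ∀ n, T n ∈ piece hG hE hk (d n)) (hT0 : ∀ n, T n ≠ 0) :
    ProlongationIsInfinite.{0, w} G k := by
  refine prolongationIsInfinite_of_piece hG hE hk hF fun hfin => ?_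
  have hli : LinearIndependent ℂ T :=
    ((piece_iSupIndep hG hE hk hF).comp hd).linearIndependent _ hT hT0
  set p := ⨆ j, piece hG hE hk j
  have hp : ∀ n, T n ∈ p := fun n => le_iSup (piece hG hE hk) (d n) (hT n)
  have hli' : LinearIndependent ℂ fun n => (⟨T n, hp n⟩ : p) :=
    LinearIndependent.of_comp p.subtype hli
  have := hli'.finite
  exact not_finite ℕ

end Embedding

end LieSuperalgebra

namespace D21

open LieSuperalgebra Polynomial

variable {a : ℂ}

/-! ### The module `ℂ[u] ⊗ Λ(ξ₊, ξ₋)` -/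

/-- The right action of the negative part on `ℂ[u] ⊗ Λ(ξ₊, ξ₋)`; the four components of an element
are the coefficients of `1`, `ξ₊`, `ξ₋` and `ξ₊ξ₋`. -/
noncomputable def prolongAct (a : ℂ) : D21 a →ₗ[ℂ] (Fin 4 → ℂ[X]) →ₗ[ℂ] (Fin 4 → ℂ[X]) :=
  LinearMap.mk₂ ℂ (fun y f => ![
      coord a y (.inl (0, 2)) • derivative (f 0) + (s a 0 * coord a y (.inr (1, 0, 1))) • f 1 -
        (s a 0 * coord a y (.inr (1, 0, 0))) • f 2,
      coord a y (.inl (0, 2)) • derivative (f 1) + coord a y (.inr (1, 1, 0)) • derivative (f 0) +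
        coord a y (.inr (1, 0, 0)) • f 3,
      coord a y (.inl (0, 2)) • derivative (f 2) + coord a y (.inr (1, 1, 1)) • derivative (f 0) +
        coord a y (.inr (1, 0, 1)) • f 3 - coord a y (.inl (2, 2)) • f 1,
      coord a y (.inl (0, 2)) • derivative (f 3) + coord a y (.inl (1, 2)) • derivative (f 0) +
        (s a 0 * coord a y (.inr (1, 1, 0))) • derivative (f 2) -
        (s a 0 * coord a y (.inr (1, 1, 1))) • derivative (f 1)])
    (by intros; ext1 i; fin_cases i <;> simp <;> module)
    (by intros; ext1 i; fin_cases i <;> simp <;> module)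
    (by intros; ext1 i; fin_cases i <;> simp <;> module)
    (by intros; ext1 i; fin_cases i <;> simp <;> module)

/-- The parity involution of `ℂ[u] ⊗ Λ(ξ₊, ξ₋)`. -/
noncomputable def prolongSigma : (Fin 4 → ℂ[X]) →ₗ[ℂ] (Fin 4 → ℂ[X]) where
  toFun f := ![f 0, -f 1, -f 2, f 3]
  map_add' f g := by ext1 i; fin_cases i <;> simp <;> abel
  map_smul' c f := by ext1 i; fin_cases i <;> simp

theorem prolongAct_apply (y : D21 a) (f : Fin 4 → ℂ[X]) : prolongAct a y f = ![
      coord a y (.inl (0, 2)) • derivative (f 0) + (s a 0 * coord a y (.inr (1, 0, 1))) • f 1 -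
        (s a 0 * coord a y (.inr (1, 0, 0))) • f 2,
      coord a y (.inl (0, 2)) • derivative (f 1) + coord a y (.inr (1, 1, 0)) • derivative (f 0) +
        coord a y (.inr (1, 0, 0)) • f 3,
      coord a y (.inl (0, 2)) • derivative (f 2) + coord a y (.inr (1, 1, 1)) • derivative (f 0) +
        coord a y (.inr (1, 0, 1)) • f 3 - coord a y (.inl (2, 2)) • f 1,
      coord a y (.inl (0, 2)) • derivative (f 3) + coord a y (.inl (1, 2)) • derivative (f 0) +
        (s a 0 * coord a y (.inr (1, 1, 0))) • derivative (f 2) -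
        (s a 0 * coord a y (.inr (1, 1, 1))) • derivative (f 1)] := rfl

/-- The indices of the basis vectors that act on `ℂ[u] ⊗ Λ(ξ₊, ξ₋)`. -/
def IsLower (i : Idx) : Prop := i ∈ ({.inl (0, 2), .inl (1, 2), .inl (2, 2), .inr (1, 0, 0),
  .inr (1, 0, 1), .inr (1, 1, 0), .inr (1, 1, 1)} : Finset Idx)

instance (i : Idx) : Decidable (IsLower i) := by unfold IsLower; infer_instance

theorem prolongSigma_act {i : ZMod 2} {y : D21 a} (hy : y ∈ parity (L := D21 a) i)
    (f : Fin 4 → ℂ[X]) :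
    prolongSigma (prolongAct a y f) = koszulSign i 1 • prolongAct a y (prolongSigma f) := by
  rcases zmod_two_cases i with rfl | rfl
  · have h := coord_of_even hy
    ext1 l
    fin_cases l <;> simp [prolongSigma, prolongAct_apply, h, koszulSign]
    module
  · have h := coord_of_odd hy
    ext1 l
    fin_cases l <;> simp [prolongSigma, prolongAct_apply, h, koszulSign] <;> module

/-- The action law is needed only on the seven lower basis vectors; their span contains 𝔪 for the
five types in question. -/
theorem prolongAct_bracket {i j : ZMod 2} {y z : D21 a} (hy : y ∈ parity (L := D21 a) i)
    (hz : z ∈ parity (L := D21 a) j) (hy0 : ∀ l, ¬ IsLower l → coord a y l = 0)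
    (hz0 : ∀ l, ¬ IsLower l → coord a z l = 0) (f : Fin 4 → ℂ[X]) :
    prolongAct a (bracket y z) f = prolongAct a z (prolongAct a y f) -
      koszulSign i j • prolongAct a y (prolongAct a z f) := by
  have key : ∀ l, coord a (bracket y z) l = coordBracket (s a) (coord a y) (coord a z) l :=
    fun l => congrFun (coord_bracket y z) l
  rcases zmod_two_cases i with rfl | rfl <;> rcases zmod_two_cases j with rfl | rfl
  · have h1 := coord_of_even hy
    have h2 := coord_of_even hz
    ext1 l
    fin_cases l <;> simp (disch := decide) [prolongAct_apply, h1, h2, koszulSign, key, hy0, hz0,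
      coordBracket_Y0, coordBracket_Y1, coordBracket_Y2, coordBracket_O100, coordBracket_O101,
      coordBracket_O110, coordBracket_O111] <;> module
  · have h1 := coord_of_even hy
    have h2 := coord_of_odd hz
    ext1 l
    fin_cases l <;> simp (disch := decide) [prolongAct_apply, h1, h2, koszulSign, key, hy0, hz0,
      coordBracket_Y0, coordBracket_Y1, coordBracket_Y2, coordBracket_O100, coordBracket_O101,
      coordBracket_O110, coordBracket_O111] <;> module
  · have h1 := coord_of_odd hy
    have h2 := coord_of_even hz
    ext1 l
    fin_cases l <;> simp (disch := decide) [prolongAct_apply, h1, h2, koszulSign, key, hy0, hz0,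
      coordBracket_Y0, coordBracket_Y1, coordBracket_Y2, coordBracket_O100, coordBracket_O101,
      coordBracket_O110, coordBracket_O111] <;> module
  · have h1 := coord_of_odd hy
    have h2 := coord_of_odd hz
    ext1 l
    fin_cases l <;> simp (disch := decide) [prolongAct_apply, h1, h2, koszulSign, key, hy0, hz0,
      coordBracket_Y0, coordBracket_Y1, coordBracket_Y2, coordBracket_O100, coordBracket_O101,
      coordBracket_O110, coordBracket_O111] <;> module

end D21

/-! ### Infinite-dimensional prolongations from the polynomial module -/

namespace D21

open LieSuperalgebra Polynomial

variable {a : ℂ}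

/-- The map from `ℂ[u] ⊗ Λ(ξ₊, ξ₋)` to `D(2,1;a)` that is equivariant in low degrees. -/
noncomputable def prolongMap (a χ : ℂ) : (Fin 4 → ℂ[X]) →ₗ[ℂ] D21 a :=
  (coord a).symm.toLinearMap ∘ₗ
    { toFun := fun f => Sum.elim
        (fun p => ![![-χ / 2 * (f 0).coeff 1, 0, (f 0).coeff 0],
          ![-χ / 2 * (f 0).coeff 1, 0, (f 3).coeff 0], ![0, 0, 0]] p.1 p.2)
        (fun p => ![![![0, 0], ![0, 0]], ![![0, 0], ![(f 1).coeff 0, (f 2).coeff 0]]] p.1 p.2.1 p.2.2)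
      map_add' := fun f g => by
        ext (⟨i, t⟩ | ⟨p, q, r⟩)
        · fin_cases i <;> fin_cases t <;> simp [mul_add]
        · fin_cases p <;> fin_cases q <;> fin_cases r <;> simp
      map_smul' := fun c f => by
        ext (⟨i, t⟩ | ⟨p, q, r⟩)
        · fin_cases i <;> fin_cases t <;> simp [mul_left_comm]
        · fin_cases p <;> fin_cases q <;> fin_cases r <;> simp }

theorem coord_prolongMap (χ : ℂ) (f : Fin 4 → ℂ[X]) : coord a (prolongMap a χ f) = Sum.elim
    (fun p => ![![-χ / 2 * (f 0).coeff 1, 0, (f 0).coeff 0],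
      ![-χ / 2 * (f 0).coeff 1, 0, (f 3).coeff 0], ![0, 0, 0]] p.1 p.2)
    (fun p => ![![![0, 0], ![0, 0]], ![![0, 0], ![(f 1).coeff 0, (f 2).coeff 0]]]
      p.1 p.2.1 p.2.2) :=
  (coord a).apply_symm_apply _

theorem coord_sigma (x : D21 a) (i : Idx) :
    coord a (sigma (D21 a) x) i = koszulSign (idxParity i) 1 * coord a x i := by
  have h : ∀ i, bv a i ∈ parity (L := D21 a) (idxParity i) := fun i => by
    rw [mem_parity_iff]
    intro k hk
    rw [coord_bv, if_neg]
    rintro rfl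
    exact hk rfl
  conv_lhs => rw [← sum_coord x]
  rw [map_sum, map_sum, Finset.sum_apply, Finset.sum_eq_single i]
  · rw [map_smul, sigma_of_mem (h i), map_smul, map_smul, Pi.smul_apply, Pi.smul_apply, coord_bv,
      if_pos rfl, smul_eq_mul, smul_eq_mul, mul_one, mul_comm]
  · intro k _ hk
    rw [map_smul, sigma_of_mem (h k), map_smul, map_smul, Pi.smul_apply, Pi.smul_apply, coord_bv,
      if_neg hk.symm, smul_zero, smul_zero]
  · exact fun h => absurd (Finset.mem_univ _) h

theorem prolongMap_sigma (χ : ℂ) (f : Fin 4 → ℂ[X]) :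
    prolongMap a χ (prolongSigma f) = sigma (D21 a) (prolongMap a χ f) := by
  apply (coord a).injective
  ext i
  rw [coord_sigma, coord_prolongMap, coord_prolongMap]
  rcases i with ⟨i, t⟩ | ⟨p, q, r⟩
  · simp [idxParity, prolongSigma]
  · fin_cases p <;> fin_cases q <;> fin_cases r <;> simp [idxParity, prolongSigma, koszulSign]

-- In indices from zero, the constants correspond to Y₀, the two odd vectors (1,1,0) and (1,1,1),
-- and Y₁, and for `χ = 1` the element u corresponds to -(H₀ + H₁)/2. Its bracket with each of these
-- four is the vector itself, and with the other three lower vectors it is zero, as differentiation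
-- in u requires. The hypotheses remove coefficients whose image under the action would be seen by
-- the map although they themselves are not.
set_option maxHeartbeats 1000000 in
theorem prolongMap_act {χ : ℂ} {y : D21 a} (hy : ∀ l, ¬ IsLower l → coord a y l = 0)
    {f : Fin 4 → ℂ[X]} (h0 : (f 0).coeff 2 = 0) (h1 : (f 1).coeff 1 = 0) (h2 : (f 2).coeff 1 = 0)
    (h3 : (f 3).coeff 1 = 0) (hχ : χ = 1 ∨ (f 0).coeff 1 = 0) :
    prolongMap a χ (prolongAct a y f) = bracket (prolongMap a χ f) y := by
  apply (coord a).injective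
  rw [coord_bracket, coord_prolongMap, coord_prolongMap]
  ext (⟨i, t⟩ | ⟨p, q, r⟩)
  · rcases hχ with rfl | hχ <;> fin_cases i <;> fin_cases t <;>
      simp (disch := decide) [prolongAct_apply, coeff_derivative, *, coordBracket_H0,
        coordBracket_H1, coordBracket_H2, coordBracket_X0, coordBracket_X1, coordBracket_X2,
        coordBracket_Y0, coordBracket_Y1, coordBracket_Y2] <;> ring
  · rcases hχ with rfl | hχ <;> fin_cases p <;> fin_cases q <;> fin_cases r <;>
      simp (disch := decide) [prolongAct_apply, coeff_derivative, *, coordBracket_O000,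
        coordBracket_O001, coordBracket_O010, coordBracket_O011, coordBracket_O100,
        coordBracket_O101, coordBracket_O110, coordBracket_O111] <;> ring

/-- The lowest basis vector of each component of `ℂ[u] ⊗ Λ(ξ₊, ξ₋)`. -/
def seedIdx : Fin 4 → Idx := ![.inl (0, 2), .inr (1, 1, 0), .inr (1, 1, 1), .inl (1, 2)]

/-- The degree of `uⁿ` times a generator of the exterior algebra. -/
def seedDeg (t : ParabolicType) (i : Fin 4) (n : ℕ) : ℤ :=
  deg t.rep.1 t.rep.2 (seedIdx i) - n * deg t.rep.1 t.rep.2 (.inl (0, 2))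

/-- The homogeneous elements of `ℂ[u] ⊗ Λ(ξ₊, ξ₋)`. -/
def prolongGrading (t : ParabolicType) (j : ℤ) : Set (Fin 4 → ℂ[X]) :=
  {f | ∀ i n, seedDeg t i n ≠ j → (f i).coeff n = 0}

theorem isLower_of_deg_neg : ∀ t : ParabolicType, t ≠ .IV123 → ∀ i, deg t.rep.1 t.rep.2 i < 0 →
    IsLower i := by decide

/-- Additivity of the degree on five weight relations among the lower vectors makes every term of
the action homogeneous. -/
theorem prolongAct_mem (t : ParabolicType) {j b : ℤ} {f : Fin 4 → ℂ[X]}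
    (hf : f ∈ prolongGrading t j) {y : D21 a}
    (hy : y ∈ gradedPiece a (simpleRoots t.rep.1) t.rep.2 b) :
    prolongAct a y f ∈ prolongGrading t (j + b) := by
  rw [mem_gradedPiece] at hy
  have hz : ∀ l i m, deg t.rep.1 t.rep.2 l + seedDeg t i m ≠ j + b →
      coord a y l * (f i).coeff m = 0 := by
    intro l i m h
    by_cases hl : deg t.rep.1 t.rep.2 l = b
    · rw [hf i m fun h' => h (by rw [hl, h', add_comm]), mul_zero]
    · rw [hy l hl, zero_mul]
  have hd : ∀ l i m, deg t.rep.1 t.rep.2 l + seedDeg t i (m + 1) ≠ j + b →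
      coord a y l * ((f i).coeff (m + 1) * ((m : ℂ) + 1)) = 0 := by
    intro l i m h
    rw [← mul_assoc, hz l i _ h, zero_mul]
  have e := isDegree_deg t.rep.1 t.rep.2
  have e1 := e (.inr (1, 0, 1)) (.inr (1, 1, 0)) (.inl (0, 2)) (by decide)
  have e2 := e (.inr (1, 0, 0)) (.inr (1, 1, 1)) (.inl (0, 2)) (by decide)
  have e3 := e (.inr (1, 0, 0)) (.inl (1, 2)) (.inr (1, 1, 0)) (by decide)
  have e4 := e (.inr (1, 0, 1)) (.inl (1, 2)) (.inr (1, 1, 1)) (by decide)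
  have e5 := e (.inl (2, 2)) (.inr (1, 1, 0)) (.inr (1, 1, 1)) (by decide)
  intro i n hn
  have s0 : ∀ n, seedDeg t 0 n = deg t.rep.1 t.rep.2 (.inl (0, 2)) -
      n * deg t.rep.1 t.rep.2 (.inl (0, 2)) := fun _ => rfl
  have s1 : ∀ n, seedDeg t 1 n = deg t.rep.1 t.rep.2 (.inr (1, 1, 0)) -
      n * deg t.rep.1 t.rep.2 (.inl (0, 2)) := fun _ => rfl
  have s2 : ∀ n, seedDeg t 2 n = deg t.rep.1 t.rep.2 (.inr (1, 1, 1)) -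
      n * deg t.rep.1 t.rep.2 (.inl (0, 2)) := fun _ => rfl
  have s3 : ∀ n, seedDeg t 3 n = deg t.rep.1 t.rep.2 (.inl (1, 2)) -
      n * deg t.rep.1 t.rep.2 (.inl (0, 2)) := fun _ => rfl
  have hne : ∀ {x : ℤ}, x = seedDeg t i n → x ≠ j + b := fun h => h ▸ hn
  obtain rfl | rfl | rfl | rfl := (by decide : ∀ i : Fin 4, i = 0 ∨ i = 1 ∨ i = 2 ∨ i = 3) i
  · simp only [prolongAct_apply, Matrix.cons_val, Polynomial.coeff_add, Polynomial.coeff_sub,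
      Polynomial.coeff_smul, smul_eq_mul, coeff_derivative, mul_assoc]
    rw [hd (.inl (0, 2)) 0 n (hne (by
        simp only [s0]; push_cast; ring)),
      hz (.inr (1, 0, 1)) 1 n (hne (by
        simp only [s0, s1]; linear_combination -e1)),
      hz (.inr (1, 0, 0)) 2 n (hne (by
        simp only [s0, s2]; linear_combination -e2))]
    ring
  · simp only [prolongAct_apply, Matrix.cons_val, Polynomial.coeff_add,
      Polynomial.coeff_smul, smul_eq_mul, coeff_derivative]
    rw [hd (.inl (0, 2)) 1 n (hne (by
        simp only [s1]; push_cast; ring)),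
      hd (.inr (1, 1, 0)) 0 n (hne (by
        simp only [s0, s1]; push_cast; ring)),
      hz (.inr (1, 0, 0)) 3 n (hne (by
        simp only [s1, s3]; linear_combination -e3))]
    ring
  · simp only [prolongAct_apply, Matrix.cons_val, Polynomial.coeff_add, Polynomial.coeff_sub,
      Polynomial.coeff_smul, smul_eq_mul, coeff_derivative]
    rw [hd (.inl (0, 2)) 2 n (hne (by
        simp only [s2]; push_cast; ring)),
      hd (.inr (1, 1, 1)) 0 n (hne (by
        simp only [s0, s2]; push_cast; ring)),
      hz (.inr (1, 0, 1)) 3 n (hne (by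
        simp only [s2, s3]; linear_combination -e4)),
      hz (.inl (2, 2)) 1 n (hne (by
        simp only [s1, s2]; linear_combination -e5))]
    ring
  · simp only [prolongAct_apply, Matrix.cons_val, Polynomial.coeff_add, Polynomial.coeff_sub,
      Polynomial.coeff_smul, smul_eq_mul, coeff_derivative, mul_assoc]
    rw [hd (.inl (0, 2)) 3 n (hne (by
        simp only [s3]; push_cast; ring)),
      hd (.inl (1, 2)) 0 n (hne (by
        simp only [s0, s3]; push_cast; ring)),
      hd (.inr (1, 1, 0)) 2 n (hne (by
        simp only [s2, s3]; push_cast; linear_combination e3 - e2)),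
      hd (.inr (1, 1, 1)) 1 n (hne (by
        simp only [s1, s3]; push_cast; linear_combination e3 - e2))]
    ring

/-- Whether the degree zero part is included in the truncation that does not determine the
algebra. -/
noncomputable def prolongSign (t : ParabolicType) : ℂ := if rigidBound t = 1 then 1 else 0

/-- With k = `rigidBound t - 1`, the four constants lie in degrees at most k, u has degree zero, and
the next coefficients lie above k. So k = 0 includes u in the truncation and k = -1 does not. -/
theorem seedDeg_bounds : ∀ t : ParabolicType, t ≠ .IV123 → rigidBound t - 1 < seedDeg t 0 2 ∧
    rigidBound t - 1 < seedDeg t 1 1 ∧ rigidBound t - 1 < seedDeg t 2 1 ∧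
    rigidBound t - 1 < seedDeg t 3 1 ∧ seedDeg t 0 1 = 0 ∧ (rigidBound t = 1 ∨ rigidBound t = 0) ∧
    ∀ i, seedDeg t i 0 ≤ rigidBound t - 1 := by decide

theorem isTruncatedModule_prolong (t : ParabolicType) (ht : t ≠ .IV123) :
    IsTruncatedModule (gradedPiece a (simpleRoots t.rep.1) t.rep.2) (rigidBound t - 1)
      prolongSigma (prolongAct a) (prolongMap a (prolongSign t)) (prolongGrading t) := by
  obtain ⟨b0, b1, b2, b3, b4, b5, b6⟩ := seedDeg_bounds t ht
  have hlow : ∀ {b : ℤ}, b < 0 → ∀ y ∈ gradedPiece a (simpleRoots t.rep.1) t.rep.2 b,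
      ∀ l, ¬ IsLower l → coord a y l = 0 := by
    intro b hb y hy l hl
    refine mem_gradedPiece.1 hy l fun h => hl (isLower_of_deg_neg t ht l (by omega))
  have hseed : ∀ i, seedDeg t i 0 = deg t.rep.1 t.rep.2 (seedIdx i) := fun i => by
    simp [seedDeg]
  refine ⟨⟨fun f => ?_, fun _ _ hyi f => prolongSigma_act hyi f,
    fun ha hb hy hz hyi hzj f => prolongAct_bracket hyi hzj (hlow ha _ hy) (hlow hb _ hz) f⟩,
    prolongMap_sigma _, fun j f hf i n hn => ?_, fun j b _ f hf y hy => prolongAct_mem t hf hy,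
    fun j _ f hf => ?_, fun j hj f hf => ?_, fun j hj b hb f hf y hy => ?_⟩
  · ext1 i
    fin_cases i <;> simp [prolongSigma]
  · have := hf i n hn
    fin_cases i <;> simpa [prolongSigma] using this
  · rw [mem_gradedPiece]
    intro l hl
    have hs : ∀ i, deg t.rep.1 t.rep.2 (seedIdx i) ≠ j → (f i).coeff 0 = 0 := fun i h =>
      hf i 0 (by rwa [hseed])
    have hH : ∀ m, deg t.rep.1 t.rep.2 (.inl (m, 0)) ≠ j → (f 0).coeff 1 = 0 := fun m h =>
      hf 0 1 (by
        rwa [b4, ← deg_of_wt_eq_zero t.rep.1 t.rep.2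
          ((by decide : ∀ m : Fin 3, wt (.inl (m, 0)) = 0) m)])
    rw [coord_prolongMap]
    rcases l with ⟨i, r⟩ | ⟨p, q, r⟩
    · fin_cases i <;> fin_cases r <;> simp
      · exact Or.inr (hH 0 hl)
      · exact hs 0 hl
      · exact Or.inr (hH 1 hl)
      · exact hs 3 hl
    · fin_cases p <;> fin_cases q <;> fin_cases r <;> simp
      · exact hs 1 hl
      · exact hs 2 hl
  · have hs : ∀ i, (f i).coeff 0 = 0 := fun i => hf i 0 (by have := b6 i; omega)
    have hH : prolongSign t = 0 ∨ (f 0).coeff 1 = 0 := by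
      rw [prolongSign]
      split_ifs with h
      · exact Or.inr (hf 0 1 (by omega))
      · exact Or.inl rfl
    refine eq_zero_of_coord fun l => ?_
    rw [coord_prolongMap]
    rcases l with ⟨i, r⟩ | ⟨p, q, r⟩
    · rcases hH with hH | hH <;> fin_cases i <;> fin_cases r <;> simp [hs, hH]
    · fin_cases p <;> fin_cases q <;> fin_cases r <;> simp [hs]
  · refine prolongMap_act (hlow hb y hy) (hf _ _ (by omega)) (hf _ _ (by omega))
      (hf _ _ (by omega)) (hf _ _ (by omega)) ?_
    rw [prolongSign]
    split_ifs with h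
    · exact Or.inl rfl
    · exact Or.inr (hf _ _ (by omega))

/-- The powers of u lie in distinct degrees because Y of the first factor has negative degree. That
Y differentiates them, and the chain ends at the constant 1, which corresponds to Y itself. -/
theorem prolongationIsInfinite_gradedPiece (ha0 : a ≠ 0) (ha1 : a ≠ -1) (t : ParabolicType)
    (ht : t ≠ .IV123) :
    ProlongationIsInfinite.{0, w} (gradedPiece a (simpleRoots t.rep.1) t.rep.2)
      (rigidBound t - 1) := by
  have hG := isGrading_gradedPiece (a := a) t.rep.1 t.rep.2
  have hF := isFundamental_gradedPiece ha0 ha1 t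
  have hk : -1 ≤ rigidBound t - 1 := by
    obtain ⟨-, -, -, -, -, h, -⟩ := seedDeg_bounds t ht
    omega
  have hd : deg t.rep.1 t.rep.2 (.inl (0, 2)) < 0 :=
    (by decide : ∀ t : ParabolicType, deg t.rep.1 t.rep.2 (.inl (0, 2)) < 0) t
  have hM := isTruncatedModule_prolong (a := a) t ht
  have hY : bv a (.inl (0, 2)) ∈ gradedPiece a (simpleRoots t.rep.1) t.rep.2
      (deg t.rep.1 t.rep.2 (.inl (0, 2))) := by
    rw [gradedPiece_eq]
    exact bv_mem.2 rfl
  refine prolongationIsInfinite_of_ne_bot hG (isEffective_gradedPiece ha0 ha1 t) hk hF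
    (d := fun n => seedDeg t 0 n) ?_ (fun n => moduleRep hG hM (Pi.single 0 (X ^ n : ℂ[X])))
    (fun n => moduleRep_mem_piece hG _ hk hM ?_) fun n => ?_
  · intro m n h
    have h' := sub_right_injective h
    exact_mod_cast mul_right_cancel₀ hd.ne h'
  · intro i m hm
    by_cases hi : i = 0
    · subst hi
      rw [Pi.single_eq_same, coeff_X_pow, if_neg]
      rintro rfl
      exact hm rfl
    · rw [Pi.single_eq_of_ne hi, coeff_zero]
  · induction n with
    | zero =>
      have h : prolongMap a (prolongSign t) (Pi.single 0 (X ^ 0 : ℂ[X])) = bv a (.inl (0, 2)) := by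
        apply (coord a).injective
        ext (⟨i, r⟩ | ⟨p, q, r⟩)
        · rw [coord_prolongMap, coord_bv]
          fin_cases i <;> fin_cases r <;> simp [coeff_one]
        · rw [coord_prolongMap, coord_bv]
          fin_cases p <;> fin_cases q <;> fin_cases r <;> simp
      refine moduleRep_ne_zero hG hF hM ?_ ?_
      · rw [h]
        exact mem_truncation (by omega) hY
      · rw [h]
        intro h0
        have := congrFun (congrArg (coord a) h0) (.inl (0, 2))
        rw [coord_bv, if_pos rfl, map_zero] at this
        exact one_ne_zero this
    | succ n ih =>
      refine moduleRep_ne_zero_of_act hG hM hd hY ?_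
      have h : prolongAct a (bv a (.inl (0, 2))) (Pi.single 0 (X ^ (n + 1) : ℂ[X])) =
          ((n : ℂ) + 1) • Pi.single 0 (X ^ n : ℂ[X]) := by
        rw [prolongAct_apply]
        ext1 i
        fin_cases i <;> simp [coord_bv, smul_eq_C_mul]
      rw [h, map_smul]
      exact smul_ne_zero (Nat.cast_add_one_ne_zero n) ih

end D21

/-! ### Transport from the representatives to the whole table -/

namespace D21

open LieSuperalgebra

theorem degreeZeroData_rep {a : ℂ} (ha0 : a ≠ 0) (t : ParabolicType) :
    t.DegreeZeroData (gradedPiece a (simpleRoots t.rep.1) t.rep.2 0) := by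
  cases t with
  | I1 => exact degreeZeroData_I1
  | I2 => exact degreeZeroData_I2 ha0
  | I12 => exact degreeZeroData_I12
  | I23 => exact degreeZeroData_I23
  | I123 => exact subalgebraIso_evenAbelian (by decide)
  | IV123 => exact subalgebraIso_evenAbelian (by decide)

theorem ParabolicType.DegreeZeroData.of_subalgebraIso {a a' : ℂ} {g : Submodule ℂ (D21 a)}
    {g' : Submodule ℂ (D21 a')} {t : ParabolicType} (h : SubalgebraIso g g')
    (h' : t.DegreeZeroData g') : t.DegreeZeroData g := by
  cases t <;> exact h.trans h'

theorem prolongationData_rep {a : ℂ} (ha0 : a ≠ 0) (ha1 : a ≠ -1) (t : ParabolicType) :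
    t.ProlongationData.{w} (gradedPiece a (simpleRoots t.rep.1) t.rep.2) := by
  have hs := prolongationIsSelf_gradedPiece.{w} ha0 ha1 t
  have hi := prolongationIsInfinite_gradedPiece.{w} ha0 ha1 t
  cases t with
  | IV123 => exact hs
  | _ => exact ⟨(hi (by decide)).not_self, hi (by decide), hs⟩

theorem ParabolicType.ProlongationData.of_iso {a a' : ℂ} (e : Iso (D21 a) (D21 a'))
    {G : ℤ → Submodule ℂ (D21 a)} {t : ParabolicType}
    (h : t.ProlongationData.{w} (e.mapGrading G)) : t.ProlongationData.{w} G := by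
  cases t with
  | IV123 => exact ProlongationIsSelf.of_iso e h
  | _ => exact ⟨(ProlongationIsInfinite.of_iso e h.2.1).not_self, .of_iso e h.2.1, .of_iso e h.2.2⟩

end D21

open LieSuperalgebra D21 in
theorem theorem1p1 (a : ℂ) (ha0 : a ≠ 0) (ha1 : a ≠ -1) :
    -- Every parabolic subalgebra is, up to a change of the parameter, one of the six.
    (∀ p : Submodule ℂ (D21 a), IsParabolic a p →
      ∃ t : ParabolicType, ∃ a' ∈ paramOrbit a, ∃ e : Iso (D21 a) (D21 a'),
        p.map e.toLinearEquiv.toLinearMap = parabolic a' (simpleRoots t.rep.1) t.rep.2) ∧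
    -- The six are pairwise non-isomorphic, for all values of the parameter.
    (∀ t t' : ParabolicType, t ≠ t' → ∀ a' a'' : ℂ, a' ≠ 0 → a' ≠ -1 → a'' ≠ 0 → a'' ≠ -1 →
      ¬ SubalgebraIso (parabolic a' (simpleRoots t.rep.1) t.rep.2)
        (parabolic a'' (simpleRoots t'.rep.1) t'.rep.2)) ∧
    -- The marked diagrams give parabolic subalgebras, and each appears exactly once in the table.
    (∀ Ξ, IsSimpleRootSystem a (simpleRoots Ξ)) ∧
    (∀ (Ξ : Diagram) (χ : Finset (Fin 3)), χ.Nonempty →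
      IsParabolic a (parabolic a (simpleRoots Ξ) χ) ∧
        ∃! t : ParabolicType, (Ξ, χ) ∈ t.marked) ∧
    -- Odd reflections in an uncrossed node do not change the grading.
    (∀ Ξj ∈ [(Diagram.I, (0 : Fin 3)), (Diagram.II, 1), (Diagram.III, 2)],
      oddReflection a (simpleRoots Ξj.1) Ξj.2 = simpleRoots Diagram.IV ∧
      ∀ χ : Finset (Fin 3), Ξj.2 ∉ χ → ∀ k : ℤ,
        gradedPiece a (simpleRoots Ξj.1) χ k = gradedPiece a (simpleRoots Diagram.IV) χ k) ∧
    -- The table.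
    ∀ t : ParabolicType, ∀ m ∈ t.marked,
      (∃ a' ∈ paramOrbit a, ∃ e : Iso (D21 a) (D21 a'), ∀ k : ℤ,
        (gradedPiece a (simpleRoots m.1) m.2 k).map e.toLinearEquiv.toLinearMap =
          gradedPiece a' (simpleRoots t.rep.1) t.rep.2 k) ∧
      IsGrading (gradedPiece a (simpleRoots m.1) m.2) ∧
      gradedPiece a (simpleRoots m.1) m.2 (-(t.depth : ℤ)) ≠ ⊥ ∧
      (∀ k : ℤ, (t.depth : ℤ) < |k| → gradedPiece a (simpleRoots m.1) m.2 k = ⊥) ∧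
      (List.range (t.depth + 1)).map (fun k : ℕ =>
        (Module.finrank ℂ ↥(gradedPiece a (simpleRoots m.1) m.2 (-(k : ℤ)) ⊓ parity 0),
          Module.finrank ℂ ↥(gradedPiece a (simpleRoots m.1) m.2 (-(k : ℤ)) ⊓ parity 1))) =
        t.dims ∧
      t.DegreeZeroData (gradedPiece a (simpleRoots m.1) m.2 0) ∧
      t.ProlongationData.{w} (gradedPiece a (simpleRoots m.1) m.2) := by
  refine ⟨fun p hp => hp.exists_type ha0 ha1,
    fun t t' htt' a' a'' _ h1 _ h1' => not_subalgebraIso_parabolic t t' htt' a' a'' h1 h1',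
    isSimpleRootSystem_simpleRoots,
    fun Ξ χ hχ => ⟨isParabolic_parabolic Ξ hχ, existsUnique_marked Ξ χ hχ⟩,
    fun Ξj h => ⟨oddReflection_simpleRoots ha0 ha1 Ξj h, fun χ hχ k => ?_⟩, fun t m hm => ?_⟩
  · simp only [gradedPiece_eq, deg_eq_of_notMem Ξj h χ hχ]
  -- The degree zero part and the prolongations are known for the representative; the new parameter
  -- again differs from 0 and -1, so they can be carried back along `e`. Depth and dimensions are
  -- read off directly from the degrees.
  obtain ⟨a', h1, h2, h3, e, he⟩ := exists_monomialIso_rep ha0 ha1 t m hm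
  obtain ⟨⟨i, hi⟩, hle⟩ := exists_deg_eq_depth t m hm
  refine ⟨⟨a', h1, e, he⟩, isGrading_gradedPiece m.1 m.2, ?_, fun k hk => ?_,
    finrank_gradedPiece t m hm, ?_, ?_⟩
  · rw [gradedPiece_eq, ne_eq, coordSub_eq_bot]
    exact Set.nonempty_iff_ne_empty.1 ⟨i, hi⟩
  · rw [gradedPiece_eq, coordSub_eq_bot]
    refine Set.eq_empty_of_forall_notMem fun i hi => (hle i).not_gt ?_
    rwa [show deg m.1 m.2 i = k from hi]
  · refine .of_subalgebraIso ?_ (degreeZeroData_rep h2 t)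
    rw [← he 0]
    exact subalgebraIso_map (isSubalgebra_gradedPiece_zero _ _) e
  · refine .of_iso e ?_
    rw [show e.mapGrading _ = _ from funext he]
    exact prolongationData_rep h2 h3 t
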